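/- Let $(M,\mathcal F)$ be a compact Finsler manifold: $M$ is a compact smooth manifold of dimension $n$ (without boundary) and $\mathcal F\colon TM\to[0,\infty)$ is continuous, positively $1$-homogeneous, smooth on $TM\setminus\{0\}$, and such that $g_{x,y}(u,v)=\tfrac12\,\partial_s\partial_t|_{s=t=0}\,\mathcal F^2(x,y+su+tv)$ is positive definite for all $y\in T_xM\setminus\{0\}$. In local coordinates let $G^i=\tfrac14 g^{il}\bigl(2\tfrac{\partial g_{jl}}{\partial x^k}-\tfrac{\partial g_{jk}}{\partial x^l}\bigr)y^jy^k$ and $G^i_j=\partial G^i/\partial y^j$. The horizontal lift is given by $(\partial/\partial x^j)^h=\partial/\partial x^j-G^i_j\,\partial/\partial y^i$; let $h\colon TTM\to TTM$ be the corresponding horizontal projector (along the vertical distribution), and let $R=\tfrac12[h,h]$, i.e. $R(A,B)=[hA,hB]+h[A,B]-h[hA,B]-h[A,hB]$ (so that $R(X^h,Y^h)=[X^h,Y^h]-[X,Y]^h$ for vector fields $X,Y$ on $M$). Parallel translation along a curve $c$ in $M$ is $V(0)\mapsto V(1)$, where $V$ is a vector field along $c$ with $\dot V^i+G^i_j(c,V)\,\dot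 c^j=0$. Let $\mathcal I_p=\{y\in T_pM:\mathcal F(y)=1\}$, let $\mathcal IM=\{v\in TM:\mathcal F(v)=1\}$ be the indicatrix bundle, a submanifold of $TM$, and let $\mathfrak X(\mathcal IM)$ be the Lie algebra of smooth vector fields on $\mathcal IM$. Let $\mathrm{Hol}_p(M)$ be the group of transformations of $\mathcal I_p$ generated by the parallel translations along piecewise smooth closed curves at $p$. Let $\mathrm{Hol}_f(M)\subset\mathrm{Diff}^\infty(\mathcal IM)$ be the fibered holonomy group, generated by the fiber preserving diffeomorphisms $\Phi$ of $\mathcal IM$ with $\Phi|_{\mathcal I_p}\in\mathrm{Hol}_p(M)$ for every $p\in M$. A vector field $\xi\in\mathfrak X(\mathcal IM)$ is tangent to a subgroup $\mathcal G\subset\mathrm{Diff}^\infty(\mathcal IM)$ if there are $k\ge1$, $\varepsilon>0$ and a smooth curve $t\mapsto\varphi_t\in\mathcal G$, $|t|<\varepsilon$ (i.e. $(t,v)\mapsto\varphi_t(v)$ is $C^\infty$), with $\varphi_0=\mathrm{id}$, such that for every $v\in\mathcal IM$ one has $\partial_t^i\varphi_t(v)|_{t=0}=0$ for $1\le i<k$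 and $\partial_t^k\varphi_t(v)|_{t=0}=\xi(v)$. Let $\mathfrak{hol}_f(M)$ be the set of all vector fields tangent to $\mathrm{Hol}_f(M)$ (the fibered holonomy algebra). **Proposition.** For all smooth vector fields $X,Y$ on $M$ the field $R(X^h,Y^h)$ is tangent to $\mathcal IM$ and restricts to a unique smooth vector field on $\mathcal IM$; such restrictions are called curvature vector fields. Let $\mathfrak R$ (the curvature algebra) be the Lie subalgebra of $\mathfrak X(\mathcal IM)$ generated by the curvature vector fields. Then: 1. every element of $\mathfrak R$ (in particular every curvature vector field) is tangent to $\mathrm{Hol}_f(M)$; 2. $\mathfrak{hol}_f(M)$ is a Lie subalgebra of $\mathfrak X(\mathcal IM)$, and $\mathfrak R$ is a Lie subalgebra of $\mathfrak{hol}_f(M)$. -/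

import Mathlib

open Set Filter Bundle VectorField
open scoped Manifold ContDiff Topology

section SmoothManifold

variable {E : Type*} [NormedAddCommGroup E] [NormedSpace ℝ E] {H : Type*} [TopologicalSpace H]
  (I : ModelWithCorners ℝ E H) (N : Type*) [TopologicalSpace N] [ChartedSpace H N]

/-- The vector space of smooth vector fields on `N`. -/
abbrev SmoothVectorField [IsManifold I ∞ N] : Type _ :=
  ContMDiffSection I E ∞ (TangentSpace I : N → Type _)

namespace SmoothVectorField

variable {I N} [IsManifold I ∞ N]

theorem mdifferentiableAt (X : SmoothVectorField I N) (p : N) :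
    MDifferentiableAt I I.tangent (fun q => (⟨q, X q⟩ : TangentBundle I N)) p :=
  (X.contMDiff p).mdifferentiableAt (by simp)

theorem minSmoothness_natCast_le (k : ℕ) : minSmoothness ℝ (k : WithTop ℕ∞) ≤ ∞ := by
  rw [minSmoothness_of_isRCLikeNormedField]
  exact WithTop.coe_le_coe.2 (le_top : (k : ℕ∞) ≤ ⊤)

variable [CompleteSpace E]

/-- The Lie bracket of smooth vector fields. -/
noncomputable instance : Bracket (SmoothVectorField I N) (SmoothVectorField I N) where
  bracket X Y := ⟨mlieBracket I X Y, by
    have : IsManifold I (minSmoothness ℝ 2) N := IsManifold.of_le (minSmoothness_natCast_le 2)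
    have : IsManifold I (((⊤ : ℕ∞) : WithTop ℕ∞) + 1) N := inferInstanceAs (IsManifold I ∞ N)
    exact ContDiff.mlieBracket_vectorField (m := ⊤) (n := ⊤) X.contMDiff Y.contMDiff (by simp)⟩

theorem bracket_apply (X Y : SmoothVectorField I N) (p : N) : ⁅X, Y⁆ p = mlieBracket I X Y p := rfl

noncomputable instance : LieRing (SmoothVectorField I N) where
  add_lie X Y Z := by
    ext p
    exact mlieBracket_add_left (X.mdifferentiableAt p) (Y.mdifferentiableAt p)
  lie_add X Y Z := by
    ext p
    exact mlieBracket_add_right (Y.mdifferentiableAt p) (Z.mdifferentiableAt p)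
  lie_self X := by
    ext p
    exact congrFun (mlieBracket_self (I := I) (V := X)) p
  leibniz_lie X Y Z := by
    have : IsManifold I (minSmoothness ℝ 3) N := IsManifold.of_le (minSmoothness_natCast_le 3)
    have h : minSmoothness ℝ 2 ≤ ∞ := minSmoothness_natCast_le 2
    ext p
    exact leibniz_identity_mlieBracket_apply ((X.contMDiff p).of_le h) ((Y.contMDiff p).of_le h)
      ((Z.contMDiff p).of_le h)

noncomputable instance : LieAlgebra ℝ (SmoothVectorField I N) where
  lie_smul c X Y := by
    ext p
    exact mlieBracket_const_smul_right (Y.mdifferentiableAt p)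

end SmoothVectorField

/-- The group of smooth diffeomorphisms of `N`, with `(Φ * Ψ) p = Φ (Ψ p)`. -/
noncomputable instance Diffeomorph.instGroup : Group (N ≃ₘ⟮I, I⟯ N) where
  mul Φ Ψ := Ψ.trans Φ
  one := Diffeomorph.refl I N ∞
  inv Φ := Φ.symm
  mul_assoc _ _ _ := rfl
  one_mul _ := rfl
  mul_one _ := rfl
  inv_mul_cancel Φ := Φ.self_trans_symm

variable {I N}

/-- The curve `c` in `N` is a `k`-th order integral curve of the tangent vector `X` at `p = c 0`: its
derivatives at `0` of orders `1, …, k - 1` vanish and the one of order `k` is `X`. The derivatives are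
taken in the preferred chart at `p`, which is the chart by which Mathlib identifies `T_p N` with the
model vector space. -/
def IsIntegralCurveOfOrder (k : ℕ) (c : ℝ → N) (p : N) (X : TangentSpace I p) : Prop :=
  c 0 = p ∧
  (∀ i : ℕ, 1 ≤ i → i < k → iteratedDeriv i (fun t => extChartAt I p (c t)) 0 = 0) ∧
    iteratedDeriv k (fun t => extChartAt I p (c t)) 0 = X

/-- The vector field `X` is tangent to the subgroup `G` of the diffeomorphism group: there is a smooth
curve `t ↦ φ_t` of diffeomorphisms in `G`, `|t| < ε` (that is, `(t, p) ↦ φ_t(p)` is smooth), with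
`φ_0 = id`, such that for some `k ≥ 1` and every `p` the curve `t ↦ φ_t(p)` is a `k`-th order integral
curve of `X(p)`. -/
def IsTangentToSubgroup [IsManifold I ∞ N] (G : Subgroup (N ≃ₘ⟮I, I⟯ N))
    (X : SmoothVectorField I N) : Prop :=
  ∃ (k : ℕ) (ε : ℝ) (φ : ℝ → N ≃ₘ⟮I, I⟯ N), 1 ≤ k ∧ 0 < ε ∧
    ContMDiffOn (𝓘(ℝ, ℝ).prod I) I ∞ (fun z : ℝ × N => φ z.1 z.2) (Ioo (-ε) ε ×ˢ univ) ∧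
    (∀ t ∈ Ioo (-ε) ε, φ t ∈ G) ∧
    φ 0 = 1 ∧
    ∀ p : N, IsIntegralCurveOfOrder k (fun t => φ t p) p (X p)

end SmoothManifold

/-- The bilinear form `(u, v) ↦ ½ ∂²/∂s∂t f(y + s u + t v)²` at `s = t = 0`. -/
noncomputable def fundamentalForm {V : Type*} [AddCommGroup V] [Module ℝ V]
    (f : V → ℝ) (y u v : V) : ℝ :=
  (1 / 2) * deriv (fun s : ℝ => deriv (fun t : ℝ => f (y + s • u + t • v) ^ 2) 0) 0

/-- A Finsler structure on the `n`-dimensional manifold `M`: a continuous nonnegative function on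
`TM`, positively 1-homogeneous on the fibers, smooth on the slit tangent bundle `TM ∖ {0}`, whose
fundamental form `g_{x,y}(u, v) = ½ ∂²/∂s∂t F(x, y + s u + t v)²` at `s = t = 0` is positive definite
for every `y ≠ 0`. -/
structure FinslerMetric (n : ℕ) (M : Type*) [TopologicalSpace M]
    [ChartedSpace (EuclideanSpace ℝ (Fin n)) M] [IsManifold (𝓡 n) ∞ M] where
  toFun : TangentBundle (𝓡 n) M → ℝ
  nonneg' : ∀ v, 0 ≤ toFun v
  continuous' : Continuous toFun
  homogeneous' : ∀ (x : M) (a : ℝ) (y : TangentSpace (𝓡 n) x), 0 < a →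
    toFun ⟨x, a • y⟩ = a * toFun ⟨x, y⟩
  smooth' : ContMDiffOn (𝓡 n).tangent 𝓘(ℝ, ℝ) ∞ toFun {v | v.2 ≠ 0}
  posDef' : ∀ (x : M) (y u : TangentSpace (𝓡 n) x), y ≠ 0 → u ≠ 0 →
    0 < fundamentalForm (fun w : TangentSpace (𝓡 n) x => toFun ⟨x, w⟩) y u u

namespace FinslerMetric

variable {n : ℕ} {M : Type*} [TopologicalSpace M]
  [ChartedSpace (EuclideanSpace ℝ (Fin n)) M] [IsManifold (𝓡 n) ∞ M]

instance : CoeFun (FinslerMetric n M) (fun _ => TangentBundle (𝓡 n) M → ℝ) := ⟨toFun⟩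

variable (F : FinslerMetric n M)

theorem apply_zero (x : M) : F ⟨x, 0⟩ = 0 := by
  have h := F.homogeneous' x 2 0 (by norm_num)
  rw [smul_zero] at h
  linarith

theorem apply_pos (x : M) (y : TangentSpace (𝓡 n) x) (hy : y ≠ 0) : 0 < F ⟨x, y⟩ := by
  rcases (F.nonneg' ⟨x, y⟩).lt_or_eq with h | h
  · exact h
  exfalso
  have hp := F.posDef' x y y hy hy
  have key : ∀ s t : ℝ, -1 < s + t → F ⟨x, y + s • y + t • y⟩ = 0 := by
    intro s t hst
    have : y + s • y + t • y = (1 + s + t) • y := by module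
    rw [this, F.homogeneous' x _ y (by linarith), ← h, mul_zero]
  have h1 : ∀ s : ℝ, -1 < s →
      deriv (fun t : ℝ => F ⟨x, y + s • y + t • y⟩ ^ 2) 0 = 0 := by
    intro s hs
    have : (fun t : ℝ => F ⟨x, y + s • y + t • y⟩ ^ 2) =ᶠ[𝓝 0] fun _ => 0 := by
      filter_upwards [Ioi_mem_nhds (show -1 - s < 0 by linarith)] with t ht
      rw [key s t (by have : -1 - s < t := ht; linarith)]; simp
    rw [this.deriv_eq]; simp
  have h2 : (fun s : ℝ => deriv (fun t : ℝ => F ⟨x, y + s • y + t • y⟩ ^ 2) 0)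
      =ᶠ[𝓝 0] fun _ => 0 := by
    filter_upwards [Ioi_mem_nhds (show (-1 : ℝ) < 0 by norm_num)] with s hs
    exact h1 s hs
  unfold fundamentalForm at hp
  rw [h2.deriv_eq] at hp
  simp at hp

/-- The total space of the indicatrix bundle, `IM = {v ∈ TM | F v = 1}`. It carries the subspace
topology. -/
structure IndicatrixBundle where
  /-- The inclusion of the indicatrix bundle into the tangent bundle. -/
  incl : TangentBundle (𝓡 n) M
  norm_eq : F incl = 1

noncomputable instance : TopologicalSpace F.IndicatrixBundle := .induced (IndicatrixBundle.incl) inferInstance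

variable {F} in
theorem incl_injective : Function.Injective (IndicatrixBundle.incl : F.IndicatrixBundle → _) := by
  rintro ⟨v, hv⟩ ⟨w, hw⟩ h
  simpa using h

theorem isInducing_incl : Topology.IsInducing (IndicatrixBundle.incl : F.IndicatrixBundle → _) := ⟨rfl⟩

theorem snd_ne_zero (v : F.IndicatrixBundle) : v.incl.2 ≠ 0 := by
  intro h
  have h1 : F ⟨v.incl.1, v.incl.2⟩ = 1 := v.norm_eq
  rw [h, apply_zero] at h1
  exact zero_ne_one h1

theorem exists_coord {n : ℕ} (y : EuclideanSpace ℝ (Fin n)) (hy : y ≠ 0) :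
    ∃ A : EuclideanSpace ℝ (Fin n) ≃L[ℝ] ℝ × EuclideanSpace ℝ (Fin (n - 1)), 0 < (A y).1 := by
  have hn : n ≠ 0 := by
    rintro rfl
    exact hy (Subsingleton.elim _ _)
  have hd : Module.finrank ℝ (EuclideanSpace ℝ (Fin n)) =
      Module.finrank ℝ (ℝ × EuclideanSpace ℝ (Fin (n - 1))) := by
    simp; omega
  let A0 := ContinuousLinearEquiv.ofFinrankEq hd
  have h0 : A0 y ≠ 0 := by simpa using hy
  have h1 : ((1 : ℝ), (0 : EuclideanSpace ℝ (Fin (n - 1)))) ≠ 0 := by simp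
  obtain ⟨B, hB⟩ := SeparatingDual.exists_continuousLinearEquiv_apply_eq (R := ℝ) h0 h1
  exact ⟨A0.trans B, by simp [hB]⟩

/-- A linear change of coordinates `y = (y₀, y')` on `ℝⁿ` for which the point `v` has `y₀ > 0`. -/
noncomputable def coord (v : F.IndicatrixBundle) :
    EuclideanSpace ℝ (Fin n) ≃L[ℝ] ℝ × EuclideanSpace ℝ (Fin (n - 1)) :=
  (exists_coord (n := n) v.incl.2 (F.snd_ne_zero v)).choose

theorem coord_pos (v : F.IndicatrixBundle) :
    0 < (F.coord v v.incl.2).1 :=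
  (exists_coord (n := n) v.incl.2 (F.snd_ne_zero v)).choose_spec

/-- The chart of `TM` induced by the preferred chart of `M` at `c`. -/
noncomputable abbrev tangentChart (c : M) :
    OpenPartialHomeomorph (TangentBundle (𝓡 n) M)
      (ModelProd (EuclideanSpace ℝ (Fin n)) (EuclideanSpace ℝ (Fin n))) :=
  chartAt (ModelProd (EuclideanSpace ℝ (Fin n)) (EuclideanSpace ℝ (Fin n)))
    (⟨c, 0⟩ : TangentBundle (𝓡 n) M)

theorem tangentChart_self (v : TangentBundle (𝓡 n) M) : tangentChart v.1 v = (chartAt _ v.1 v.1, v.2) := by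
  refine Prod.ext rfl ?_
  have := (tangentBundleCore (𝓡 n) M).coordChange_self (achart _ v.1) v.1 (mem_chart_source _ v.1) v.2
  exact this

theorem tangentChart_symm_smul (c : M) (x y : EuclideanSpace ℝ (Fin n)) (a : ℝ) :
    ((tangentChart c).symm (x, a • y) : TangentBundle (𝓡 n) M) =
      ⟨((tangentChart c).symm (x, y)).1, a • ((tangentChart c).symm (x, y)).2⟩ := by
  have h : ∀ z : EuclideanSpace ℝ (Fin n),
      ((tangentChart c).symm (x, z) : TangentBundle (𝓡 n) M) =
      ⟨(chartAt _ c).symm x, (tangentBundleCore (𝓡 n) M).coordChange (achart _ c)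
        (achart _ ((chartAt _ c).symm x)) ((chartAt _ c).symm x) z⟩ := fun z => rfl
  rw [h, h, map_smul]
  rfl

theorem apply_tangentChart_symm_smul (c : M) (x y : EuclideanSpace ℝ (Fin n)) {a : ℝ}
    (ha : 0 < a) :
    F ((tangentChart c).symm (x, a • y)) = a * F ((tangentChart c).symm (x, y)) := by
  rw [tangentChart_symm_smul, F.homogeneous' _ _ _ ha]

theorem tangentChart_smul (c : M) (x : M) (y : TangentSpace (𝓡 n) x) (a : ℝ) :
    (tangentChart c ⟨x, a • y⟩).2 = a • (tangentChart c ⟨x, y⟩).2 := by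
  have h : ∀ z : TangentSpace (𝓡 n) x, (tangentChart c ⟨x, z⟩).2 =
      (tangentBundleCore (𝓡 n) M).coordChange (achart _ x) (achart _ c) x z := fun z => rfl
  rw [h, h]
  exact map_smul ((tangentBundleCore (𝓡 n) M).coordChange (achart _ x) (achart _ c) x) a y

theorem tangentChart_symm_snd_ne_zero (c : M) {x y : EuclideanSpace ℝ (Fin n)}
    (hx : x ∈ (chartAt (EuclideanSpace ℝ (Fin n)) c).target) (hy : y ≠ 0) :
    ((tangentChart c).symm (x, y) : TangentBundle (𝓡 n) M).2 ≠ 0 := by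
  intro h
  have hm : ((x, y) : ModelProd _ _) ∈ (tangentChart (M := M) c).target :=
    (TangentBundle.mem_chart_target_iff (I := 𝓡 n) (M := M) (x, y) ⟨c, 0⟩).2 hx
  have h1 := (tangentChart c).right_inv hm
  have h2 := tangentChart_smul c ((tangentChart c).symm (x, y)).1 ((tangentChart c).symm (x, y)).2 0
  rw [zero_smul, zero_smul] at h2
  rw [← h] at h2
  have h3 : (tangentChart c ((tangentChart c).symm (x, y))).2 = 0 := h2
  rw [h1] at h3
  exact hy h3

theorem coord_symm_ne_zero (v : F.IndicatrixBundle) (z : EuclideanSpace ℝ (Fin (n - 1))) :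
    (F.coord v).symm (1, z) ≠ 0 := by
  intro h
  have := congrArg (F.coord v) h
  simp at this

/-- The vector of `TM` with base point `x` and direction `z` in the coordinates centred at `v`,
rescaled so that its norm is one. -/
noncomputable def unitVector (v : F.IndicatrixBundle)
    (p : EuclideanSpace ℝ (Fin n) × EuclideanSpace ℝ (Fin (n - 1))) : TangentBundle (𝓡 n) M :=
  (tangentChart v.incl.1).symm (p.1,
    (F ((tangentChart v.incl.1).symm (p.1, (F.coord v).symm (1, p.2))))⁻¹ •
      (F.coord v).symm (1, p.2))

theorem scale_pos (v : F.IndicatrixBundle)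
    {p : EuclideanSpace ℝ (Fin n) × EuclideanSpace ℝ (Fin (n - 1))}
    (hp : p.1 ∈ (chartAt (EuclideanSpace ℝ (Fin n)) v.incl.1).target) :
    0 < F ((tangentChart v.incl.1).symm (p.1, (F.coord v).symm (1, p.2))) :=
  F.apply_pos _ _ (tangentChart_symm_snd_ne_zero _ hp (F.coord_symm_ne_zero v p.2))

theorem apply_unitVector (v : F.IndicatrixBundle)
    {p : EuclideanSpace ℝ (Fin n) × EuclideanSpace ℝ (Fin (n - 1))}
    (hp : p.1 ∈ (chartAt (EuclideanSpace ℝ (Fin n)) v.incl.1).target) :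
    F (F.unitVector v p) = 1 := by
  have h := F.scale_pos v hp
  rw [unitVector, apply_tangentChart_symm_smul _ _ _ _ (inv_pos.2 h), inv_mul_cancel₀ h.ne']

theorem mem_tangentChart_source (c : M) (w : TangentBundle (𝓡 n) M) :
    w ∈ (tangentChart (M := M) c).source ↔ w.1 ∈ (chartAt (EuclideanSpace ℝ (Fin n)) c).source :=
  TangentBundle.mem_chart_source_iff w ⟨c, 0⟩

theorem mem_tangentChart_target (c : M) (p : EuclideanSpace ℝ (Fin n) × EuclideanSpace ℝ (Fin n)) :
    p ∈ (tangentChart (M := M) c).target ↔ p.1 ∈ (chartAt (EuclideanSpace ℝ (Fin n)) c).target :=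
  TangentBundle.mem_chart_target_iff p ⟨c, 0⟩

open Classical in
/-- `unitVector` as a point of the indicatrix bundle. -/
noncomputable def unitPoint (v : F.IndicatrixBundle)
    (p : EuclideanSpace ℝ (Fin n) × EuclideanSpace ℝ (Fin (n - 1))) : F.IndicatrixBundle :=
  if h : F (F.unitVector v p) = 1 then ⟨F.unitVector v p, h⟩ else v

theorem incl_unitPoint (v : F.IndicatrixBundle)
    {p : EuclideanSpace ℝ (Fin n) × EuclideanSpace ℝ (Fin (n - 1))}
    (hp : p.1 ∈ (chartAt (EuclideanSpace ℝ (Fin n)) v.incl.1).target) :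
    (F.unitPoint v p).incl = F.unitVector v p := by
  rw [unitPoint, dif_pos (F.apply_unitVector v hp)]

/-- The coordinates `(x, y' / y₀)` centred at `v` of a tangent vector. -/
noncomputable def direction (v : F.IndicatrixBundle) (w : TangentBundle (𝓡 n) M) :
    EuclideanSpace ℝ (Fin n) × EuclideanSpace ℝ (Fin (n - 1)) :=
  ((tangentChart v.incl.1 w).1,
    (F.coord v (tangentChart v.incl.1 w).2).1⁻¹ •
      (F.coord v (tangentChart v.incl.1 w).2).2)

theorem tangentChart_unitVector (v : F.IndicatrixBundle)
    {p : EuclideanSpace ℝ (Fin n) × EuclideanSpace ℝ (Fin (n - 1))}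
    (hp : p.1 ∈ (chartAt (EuclideanSpace ℝ (Fin n)) v.incl.1).target) :
    tangentChart v.incl.1 (F.unitVector v p) = (p.1,
      (F ((tangentChart v.incl.1).symm (p.1, (F.coord v).symm (1, p.2))))⁻¹ •
        (F.coord v).symm (1, p.2)) :=
  (tangentChart v.incl.1).right_inv ((mem_tangentChart_target _ _).2 hp)

theorem direction_unitVector (v : F.IndicatrixBundle)
    {p : EuclideanSpace ℝ (Fin n) × EuclideanSpace ℝ (Fin (n - 1))}
    (hp : p.1 ∈ (chartAt (EuclideanSpace ℝ (Fin n)) v.incl.1).target) :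
    F.direction v (F.unitVector v p) = p := by
  have h := F.scale_pos v hp
  rw [direction, tangentChart_unitVector F v hp]
  refine Prod.ext rfl ?_
  simp [smul_smul, h.ne']

theorem unitVector_direction (v w : F.IndicatrixBundle)
    (hs : w.incl ∈ (tangentChart v.incl.1).source)
    (hw : 0 < (F.coord v (tangentChart v.incl.1 w.incl).2).1) :
    F.unitVector v (F.direction v w.incl) = w.incl := by
  obtain ⟨x, y, hxy⟩ : ∃ x y : EuclideanSpace ℝ (Fin n),
    tangentChart v.incl.1 w.incl = (x, y) := ⟨_, _, rfl⟩
  have hl := (tangentChart v.incl.1).left_inv hs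
  have h1 : F w.incl = 1 := w.norm_eq
  rw [hxy] at hl hw
  rw [unitVector, direction, hxy]
  simp only at hw ⊢
  set a := (F.coord v y).1 with ha
  have e1 : (F.coord v).symm (1, a⁻¹ • (F.coord v y).2) = a⁻¹ • y := by
    rw [ContinuousLinearEquiv.symm_apply_eq, map_smul]
    refine Prod.ext ?_ rfl
    simp [← ha, hw.ne']
  rw [e1, apply_tangentChart_symm_smul _ _ _ _ (inv_pos.2 hw), hl, h1, mul_one, inv_inv, smul_smul,
    mul_inv_cancel₀ hw.ne', one_smul, hl]

/-- The chart of the indicatrix bundle at `v`: with `(x, y)` the coordinates on `TM` induced by the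
chart of `M` at the base point of `v` and `y = (y₀, y')` after a linear change of coordinates for
which `v` has `y₀ > 0`, it is `(x, y) ↦ (x, y' / y₀)` on the part of `IM` where `y₀ > 0`. -/
noncomputable def indicatrixChart (v : F.IndicatrixBundle) :
    OpenPartialHomeomorph F.IndicatrixBundle
      (EuclideanSpace ℝ (Fin n) × EuclideanSpace ℝ (Fin (n - 1))) where
  toFun w := F.direction v w.incl
  invFun p := F.unitPoint v p
  source := {w | w.incl ∈ (tangentChart v.incl.1).source ∧
    0 < (F.coord v (tangentChart v.incl.1 w.incl).2).1}
  target := {p | p.1 ∈ (chartAt (EuclideanSpace ℝ (Fin n)) v.incl.1).target}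
  map_source' w hw := by
    have h1 := (tangentChart v.incl.1).map_source hw.1
    exact (mem_tangentChart_target _ _).1 h1
  map_target' p hp := by
    have hp' : p.1 ∈ (chartAt (EuclideanSpace ℝ (Fin n)) v.incl.1).target := hp
    change IndicatrixBundle.incl _ ∈ _ ∧
      0 < (F.coord v (tangentChart v.incl.1 (IndicatrixBundle.incl _)).2).1
    rw [F.incl_unitPoint v hp', tangentChart_unitVector F v hp']
    refine ⟨(tangentChart v.incl.1).map_target ((mem_tangentChart_target _ _).2 hp'), ?_⟩
    simpa using F.scale_pos v hp'
  left_inv' w hw := by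
    apply incl_injective
    have h1 := (tangentChart v.incl.1).map_source hw.1
    rw [F.incl_unitPoint v ((mem_tangentChart_target _ _).1 h1)]
    exact F.unitVector_direction v w hw.1 hw.2
  right_inv' p hp := by
    rw [F.incl_unitPoint v hp, F.direction_unitVector v hp]
  open_source := by
    have h := (tangentChart v.incl.1).continuousOn.isOpen_inter_preimage
      (tangentChart v.incl.1).open_source
      (t := {q : EuclideanSpace ℝ (Fin n) × EuclideanSpace ℝ (Fin n) | 0 < (F.coord v q.2).1})
      (isOpen_lt continuous_const (((F.coord v).continuous.comp continuous_snd).fst :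
        Continuous fun q : EuclideanSpace ℝ (Fin n) × EuclideanSpace ℝ (Fin n) => (F.coord v q.2).1))
    exact h.preimage F.isInducing_incl.continuous
  open_target := (chartAt _ v.incl.1).open_target.preimage continuous_fst
  continuousOn_toFun := by
    have h1 : ContinuousOn (fun w : F.IndicatrixBundle => tangentChart v.incl.1 w.incl)
        {w : F.IndicatrixBundle | w.incl ∈ (tangentChart v.incl.1).source ∧
          0 < (F.coord v (tangentChart v.incl.1 w.incl).2).1} :=
      (tangentChart v.incl.1).continuousOn.comp F.isInducing_incl.continuous.continuousOn
        fun w hw => hw.1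
    have h2 := (F.coord v).continuous.comp_continuousOn h1.snd
    exact h1.fst.prodMk ((h2.fst.inv₀ fun w hw => hw.2.ne').smul h2.snd)
  continuousOn_invFun := by
    rw [F.isInducing_incl.continuousOn_iff]
    have h0 : Continuous fun p : EuclideanSpace ℝ (Fin n) × EuclideanSpace ℝ (Fin (n - 1)) =>
        (F.coord v).symm (1, p.2) :=
      (F.coord v).symm.continuous.comp (continuous_const.prodMk continuous_snd)
    have h1 : ContinuousOn (fun p : EuclideanSpace ℝ (Fin n) × EuclideanSpace ℝ (Fin (n - 1)) =>
        F ((tangentChart v.incl.1).symm (p.1, (F.coord v).symm (1, p.2))))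
        {p | p.1 ∈ (chartAt (EuclideanSpace ℝ (Fin n)) v.incl.1).target} :=
      F.continuous'.comp_continuousOn ((tangentChart v.incl.1).continuousOn_symm.comp
        (continuous_fst.prodMk h0).continuousOn fun p hp => (mem_tangentChart_target _ _).2 hp)
    have h2 : ContinuousOn (F.unitVector v)
        {p | p.1 ∈ (chartAt (EuclideanSpace ℝ (Fin n)) v.incl.1).target} :=
      (tangentChart v.incl.1).continuousOn_symm.comp
        (continuous_fst.continuousOn.prodMk
          ((h1.inv₀ fun p hp => (F.scale_pos v hp).ne').smul h0.continuousOn))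
        fun p hp => (mem_tangentChart_target _ _).2 hp
    exact h2.congr fun p hp => F.incl_unitPoint v hp

theorem mem_indicatrixChart_source (v : F.IndicatrixBundle) :
    v ∈ (F.indicatrixChart v).source := by
  refine ⟨(mem_tangentChart_source _ _).2 (mem_chart_source _ _), ?_⟩
  rw [tangentChart_self]
  exact F.coord_pos v

/-- The smooth structure of the indicatrix bundle. -/
noncomputable instance : ChartedSpace
    (EuclideanSpace ℝ (Fin n) × EuclideanSpace ℝ (Fin (n - 1))) F.IndicatrixBundle where
  atlas := range F.indicatrixChart
  chartAt := F.indicatrixChart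
  mem_chart_source := F.mem_indicatrixChart_source
  chart_mem_atlas := mem_range_self

theorem contDiffOn_tangentChart_change (c d : M) : ContDiffOn ℝ ∞
    (fun q : EuclideanSpace ℝ (Fin n) × EuclideanSpace ℝ (Fin n) =>
      (((tangentChart d ((tangentChart c).symm q)).1, (tangentChart d ((tangentChart c).symm q)).2) :
        EuclideanSpace ℝ (Fin n) × EuclideanSpace ℝ (Fin n)))
    {q | q.1 ∈ (chartAt (EuclideanSpace ℝ (Fin n)) c).target ∧
      ((tangentChart c).symm q).1 ∈ (chartAt (EuclideanSpace ℝ (Fin n)) d).source} := by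
  have h := (contDiffGroupoid ∞ (𝓡 n).tangent).compatible
    (chart_mem_atlas (ModelProd _ _) (⟨c, 0⟩ : TangentBundle (𝓡 n) M))
    (chart_mem_atlas (ModelProd _ _) (⟨d, 0⟩ : TangentBundle (𝓡 n) M))
  rw [contDiffGroupoid, mem_groupoid_of_pregroupoid] at h
  refine ContDiffOn.mono h.1 fun q hq => ⟨⟨?_, ?_⟩, ?_⟩
  · exact (mem_tangentChart_target c q).2 hq.1
  · exact (mem_tangentChart_source d _).2 hq.2
  · simp

instance : IsManifold 𝓘(ℝ, EuclideanSpace ℝ (Fin n) × EuclideanSpace ℝ (Fin (n - 1))) ∞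
    F.IndicatrixBundle := by
  apply isManifold_of_contDiffOn
  rintro _ _ ⟨v, rfl⟩ ⟨w, rfl⟩
  have h0 : ContDiff ℝ ∞ fun p : EuclideanSpace ℝ (Fin n) × EuclideanSpace ℝ (Fin (n - 1)) =>
      (p.1, (F.coord v).symm (1, p.2)) :=
    contDiff_fst.prodMk ((F.coord v).symm.contDiff.comp (contDiff_const.prodMk contDiff_snd))
  set S := ((F.indicatrixChart v).symm ≫ₕ F.indicatrixChart w).source with hS
  have hmem : ∀ p ∈ S, p.1 ∈ (chartAt (EuclideanSpace ℝ (Fin n)) v.incl.1).target ∧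
      F.unitVector v p ∈ (tangentChart (M := M) w.incl.1).source ∧
      0 < (F.coord w (tangentChart w.incl.1 (F.unitVector v p)).2).1 := by
    intro p hp
    have h1 : p.1 ∈ (chartAt (EuclideanSpace ℝ (Fin n)) v.incl.1).target := hp.1
    have h2 : (F.unitPoint v p).incl ∈ (tangentChart (M := M) w.incl.1).source ∧
      0 < (F.coord w (tangentChart w.incl.1 (F.unitPoint v p).incl).2).1 := hp.2
    rw [F.incl_unitPoint v h1] at h2
    exact ⟨h1, h2⟩
  have hchange : ∀ p ∈ S, (tangentChart w.incl.1 (F.unitVector v p)).1 =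
        (tangentChart w.incl.1 ((tangentChart v.incl.1).symm
          (p.1, (F.coord v).symm (1, p.2)))).1 ∧
      ∃ a : ℝ, 0 < a ∧ (tangentChart w.incl.1 (F.unitVector v p)).2 =
        a • (tangentChart w.incl.1 ((tangentChart v.incl.1).symm
          (p.1, (F.coord v).symm (1, p.2)))).2 := by
    intro p hp
    have h1 := F.scale_pos v (hmem p hp).1
    rw [unitVector, tangentChart_symm_smul]
    exact ⟨rfl, _, inv_pos.2 h1, tangentChart_smul _ _ _ _⟩
  have h1 : ContDiffOn ℝ ∞ (fun p : EuclideanSpace ℝ (Fin n) × EuclideanSpace ℝ (Fin (n - 1)) =>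
      (((tangentChart w.incl.1 ((tangentChart v.incl.1).symm
          (p.1, (F.coord v).symm (1, p.2)))).1,
        (tangentChart w.incl.1 ((tangentChart v.incl.1).symm
          (p.1, (F.coord v).symm (1, p.2)))).2) :
        EuclideanSpace ℝ (Fin n) × EuclideanSpace ℝ (Fin n))) S :=
    (contDiffOn_tangentChart_change v.incl.1 w.incl.1).comp (h0.contDiffOn (s := S))
      (fun p hp => ⟨(hmem p hp).1, (mem_tangentChart_source _ _).1 (hmem p hp).2.1⟩)
  have key : ∀ Q : EuclideanSpace ℝ (Fin n) × EuclideanSpace ℝ (Fin (n - 1)) →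
        EuclideanSpace ℝ (Fin n) × EuclideanSpace ℝ (Fin n),
      ContDiffOn ℝ ∞ Q S →
      (∀ p ∈ S, (tangentChart w.incl.1 (F.unitVector v p)).1 = (Q p).1 ∧
        ∃ a : ℝ, 0 < a ∧ (tangentChart w.incl.1 (F.unitVector v p)).2 = a • (Q p).2) →
      ContDiffOn ℝ ∞ (fun p => F.direction w (F.unitVector v p)) S := by
    intro Q hQ hchange
    have h2 := (F.coord w).contDiff.comp_contDiffOn hQ.snd
    have hpos : ∀ p ∈ S, (F.coord w (Q p).2).1 ≠ 0 := by
      intro p hp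
      obtain ⟨-, a, ha, h⟩ := hchange p hp
      have := (hmem p hp).2.2
      rw [h, map_smul] at this
      intro h0
      simp [h0] at this
    have h3 : ContDiffOn ℝ ∞ (fun p => ((Q p).1, (F.coord w (Q p).2).1⁻¹ • (F.coord w (Q p).2).2))
      S := hQ.fst.prodMk ((h2.fst.inv hpos).smul h2.snd)
    refine h3.congr fun p hp => ?_
    obtain ⟨e1, a, ha, e2⟩ := hchange p hp
    rw [direction, e2, e1, map_smul]
    simp only [Prod.smul_fst, Prod.smul_snd, smul_eq_mul, mul_inv, smul_smul]
    rw [mul_right_comm, inv_mul_cancel₀ ha.ne', one_mul]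
  have h4 : ContDiffOn ℝ ∞ (fun p => F.direction w (F.unitVector v p)) S := key _ h1 hchange
  have h5 : ContDiffOn ℝ ∞ ((F.indicatrixChart v).symm ≫ₕ F.indicatrixChart w) S := by
    refine h4.congr fun p hp => ?_
    change F.direction w (F.unitPoint v p).incl = _
    rw [F.incl_unitPoint v (hmem p hp).1]
  simpa only [modelWithCornersSelf_coe, modelWithCornersSelf_coe_symm, Function.id_comp,
    Function.comp_id, preimage_id, range_id, inter_univ, CompTriple.comp_eq] using h5

/-- The charts above make the indicatrix bundle a submanifold of `TM`: the inclusion is smooth (and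
it is a topological embedding by construction). -/
theorem contMDiff_incl : ContMDiff
    𝓘(ℝ, EuclideanSpace ℝ (Fin n) × EuclideanSpace ℝ (Fin (n - 1))) (𝓡 n).tangent ∞
    (fun w : F.IndicatrixBundle => w.incl) := by
  intro v
  set T : Set (EuclideanSpace ℝ (Fin n) × EuclideanSpace ℝ (Fin (n - 1))) :=
    {p | p.1 ∈ (chartAt (EuclideanSpace ℝ (Fin n)) v.incl.1).target} with hT
  have hsymm : ContMDiffOn (𝓘(ℝ, EuclideanSpace ℝ (Fin n)).prod 𝓘(ℝ, EuclideanSpace ℝ (Fin n)))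
      (𝓡 n).tangent ∞ (tangentChart v.incl.1).symm (tangentChart v.incl.1).target :=
    contMDiffOn_chart_symm (I := (𝓡 n).tangent) (x := (⟨v.incl.1, 0⟩ : TangentBundle (𝓡 n) M))
  have h0 : ContMDiff 𝓘(ℝ, EuclideanSpace ℝ (Fin n) × EuclideanSpace ℝ (Fin (n - 1)))
      𝓘(ℝ, EuclideanSpace ℝ (Fin n)) ∞
      fun p : EuclideanSpace ℝ (Fin n) × EuclideanSpace ℝ (Fin (n - 1)) =>
        (F.coord v).symm (1, p.2) :=
    ((F.coord v).symm.contDiff.comp (contDiff_const.prodMk contDiff_snd)).contMDiff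
  have hfst : ContMDiff 𝓘(ℝ, EuclideanSpace ℝ (Fin n) × EuclideanSpace ℝ (Fin (n - 1)))
      𝓘(ℝ, EuclideanSpace ℝ (Fin n)) ∞
      fun p : EuclideanSpace ℝ (Fin n) × EuclideanSpace ℝ (Fin (n - 1)) => p.1 :=
    contDiff_fst.contMDiff
  have hpair : ∀ g : EuclideanSpace ℝ (Fin n) × EuclideanSpace ℝ (Fin (n - 1)) →
      EuclideanSpace ℝ (Fin n), ContMDiffOn 𝓘(ℝ, EuclideanSpace ℝ (Fin n) ×
        EuclideanSpace ℝ (Fin (n - 1))) 𝓘(ℝ, EuclideanSpace ℝ (Fin n)) ∞ g T →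
      ContMDiffOn 𝓘(ℝ, EuclideanSpace ℝ (Fin n) × EuclideanSpace ℝ (Fin (n - 1))) (𝓡 n).tangent ∞
        (fun p => (tangentChart v.incl.1).symm (p.1, g p)) T := by
    intro g hg
    have h := hfst.contMDiffOn.prodMk hg
    rw [chartedSpaceSelf_prod] at h
    exact hsymm.comp h fun p hp => (mem_tangentChart_target _ _).2 hp
  have h1 : ContMDiffOn 𝓘(ℝ, EuclideanSpace ℝ (Fin n) × EuclideanSpace ℝ (Fin (n - 1)))
      𝓘(ℝ, ℝ) ∞
      (fun p => F ((tangentChart v.incl.1).symm (p.1, (F.coord v).symm (1, p.2)))) T :=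
    F.smooth'.comp (hpair _ h0.contMDiffOn)
      fun p hp => tangentChart_symm_snd_ne_zero _ hp (F.coord_symm_ne_zero v p.2)
  have h1' : ContMDiffOn 𝓘(ℝ, EuclideanSpace ℝ (Fin n) × EuclideanSpace ℝ (Fin (n - 1)))
      𝓘(ℝ, ℝ) ∞
      (fun p => (F ((tangentChart v.incl.1).symm (p.1, (F.coord v).symm (1, p.2))))⁻¹) T :=
    (h1.contDiffOn.inv fun p hp => (F.scale_pos v hp).ne').contMDiffOn
  have h2 : ContMDiffOn 𝓘(ℝ, EuclideanSpace ℝ (Fin n) × EuclideanSpace ℝ (Fin (n - 1)))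
      (𝓡 n).tangent ∞ (F.unitVector v) T :=
    hpair _ (h1'.smul h0.contMDiffOn)
  have h3 := contMDiffOn_chart (I := 𝓘(ℝ, EuclideanSpace ℝ (Fin n) × EuclideanSpace ℝ (Fin (n - 1))))
    (n := ∞) (x := v)
  have h4 : ContMDiffOn 𝓘(ℝ, EuclideanSpace ℝ (Fin n) × EuclideanSpace ℝ (Fin (n - 1)))
      (𝓡 n).tangent ∞ (fun w : F.IndicatrixBundle => F.unitVector v (F.direction v w.incl))
      (F.indicatrixChart v).source :=
    h2.comp h3 fun w hw => (F.indicatrixChart v).map_source hw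
  refine (h4.congr fun w hw => (F.unitVector_direction v w hw.1 hw.2).symm).contMDiffAt
    ((F.indicatrixChart v).open_source.mem_nhds (F.mem_indicatrixChart_source v))

end FinslerMetric

namespace FinslerMetric

variable {n : ℕ} {M : Type*} [TopologicalSpace M]
  [ChartedSpace (EuclideanSpace ℝ (Fin n)) M] [IsManifold (𝓡 n) ∞ M] (F : FinslerMetric n M)

/-- The matrix `g_ij(x, y)` of the fundamental form in the coordinates `(x, y)` on `TM` induced by
the preferred chart of `M` at `c`. -/
noncomputable def metricMatrix (c : M) (x y : EuclideanSpace ℝ (Fin n)) :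
    Matrix (Fin n) (Fin n) ℝ :=
  Matrix.of fun i j => fundamentalForm
    (fun w : EuclideanSpace ℝ (Fin n) => F ((tangentChart c).symm (x, w))) y
    (EuclideanSpace.single i 1) (EuclideanSpace.single j 1)

/-- The geodesic coefficients
`G^i(x, y) = ¼ g^{il} (2 ∂g_{jl}/∂x^k - ∂g_{jk}/∂x^l) y^j y^k` in the chart at `c`. -/
noncomputable def geodesicCoeff (c : M) (x y : EuclideanSpace ℝ (Fin n)) (i : Fin n) : ℝ :=
  (1 / 4) * ∑ l, ∑ j, ∑ k, (F.metricMatrix c x y)⁻¹ i l *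
    (2 * lineDeriv ℝ (fun x' => F.metricMatrix c x' y j l) x (EuclideanSpace.single k 1) -
      lineDeriv ℝ (fun x' => F.metricMatrix c x' y j k) x (EuclideanSpace.single l 1)) *
    y j * y k

/-- The connection coefficients `G^i_j = ∂G^i/∂y^j` in the chart at `c`. -/
noncomputable def connectionCoeff (c : M) (x y : EuclideanSpace ℝ (Fin n)) (i j : Fin n) : ℝ :=
  lineDeriv ℝ (fun y' => F.geodesicCoeff c x y' i) y (EuclideanSpace.single j 1)

/-- The horizontal lift `T_x M → T_v TM`, `v = (x, y)`, sending `u^j ∂/∂x^j` to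
`u^j (∂/∂x^j - G^i_j(x, y) ∂/∂y^i)`. Both sides are written in the chart of `M` at `x` and the chart
of `TM` it induces, which is how Mathlib identifies `T_x M` with `ℝⁿ` and `T_v TM` with
`ℝⁿ × ℝⁿ`. -/
noncomputable def horizontalLift (v : TangentBundle (𝓡 n) M) (u : TangentSpace (𝓡 n) v.1) :
    TangentSpace (𝓡 n).tangent v :=
  let u' : EuclideanSpace ℝ (Fin n) := u
  ((u', -WithLp.toLp 2 fun i =>
      ∑ j, F.connectionCoeff v.1 (chartAt (EuclideanSpace ℝ (Fin n)) v.1 v.1) v.2 i j * u' j) :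
    EuclideanSpace ℝ (Fin n) × EuclideanSpace ℝ (Fin n))

/-- The horizontal projector `h : TTM → TTM`. -/
noncomputable def horizontalProj (v : TangentBundle (𝓡 n) M)
    (A : TangentSpace (𝓡 n).tangent v) : TangentSpace (𝓡 n).tangent v :=
  F.horizontalLift v (mfderiv (𝓡 n).tangent (𝓡 n)
    (fun w : TangentBundle (𝓡 n) M => w.1) v A)

/-- The horizontal lift `X^h` of a vector field `X` on `M`. -/
noncomputable def horizontalField (X : SmoothVectorField (𝓡 n) M) (v : TangentBundle (𝓡 n) M) :
    TangentSpace (𝓡 n).tangent v :=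
  F.horizontalLift v (X v.1)

/-- The curvature `R = ½ [h, h]`, that is, the Nijenhuis torsion
`R(A, B) = [hA, hB] + h[A, B] - h[hA, B] - h[A, hB]` of the horizontal projector. -/
noncomputable def curvature (A B : ∀ v : TangentBundle (𝓡 n) M, TangentSpace (𝓡 n).tangent v)
    (v : TangentBundle (𝓡 n) M) : TangentSpace (𝓡 n).tangent v :=
  mlieBracket (𝓡 n).tangent (fun w => F.horizontalProj w (A w))
      (fun w => F.horizontalProj w (B w)) v
    + F.horizontalProj v (mlieBracket (𝓡 n).tangent A B v)
    - F.horizontalProj v (mlieBracket (𝓡 n).tangent (fun w => F.horizontalProj w (A w)) B v)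
    - F.horizontalProj v (mlieBracket (𝓡 n).tangent A (fun w => F.horizontalProj w (B w)) v)

/-- Smooth vector fields on the indicatrix bundle. -/
abbrev IndicatrixVectorField : Type _ :=
  SmoothVectorField 𝓘(ℝ, EuclideanSpace ℝ (Fin n) × EuclideanSpace ℝ (Fin (n - 1)))
    F.IndicatrixBundle

/-- Smooth diffeomorphisms of the indicatrix bundle. -/
abbrev IndicatrixDiffeo : Type _ :=
  Diffeomorph 𝓘(ℝ, EuclideanSpace ℝ (Fin n) × EuclideanSpace ℝ (Fin (n - 1)))
    𝓘(ℝ, EuclideanSpace ℝ (Fin n) × EuclideanSpace ℝ (Fin (n - 1)))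
    F.IndicatrixBundle F.IndicatrixBundle ∞

/-- `ξ` is the curvature vector field `R(X^h, Y^h)` on the indicatrix bundle: the inclusion
`IM → TM` carries `ξ` to `R(X^h, Y^h)`. -/
def IsCurvatureField (X Y : SmoothVectorField (𝓡 n) M) (ξ : F.IndicatrixVectorField) : Prop :=
  ∀ v : F.IndicatrixBundle,
    mfderiv 𝓘(ℝ, EuclideanSpace ℝ (Fin n) × EuclideanSpace ℝ (Fin (n - 1))) (𝓡 n).tangent
        (fun w : F.IndicatrixBundle => w.incl) v (ξ v) =
      F.curvature (F.horizontalField X) (F.horizontalField Y) v.incl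

/-- The curvature algebra: the Lie subalgebra of the Lie algebra of smooth vector fields on the
indicatrix bundle that is generated by the curvature vector fields. -/
noncomputable def curvatureAlgebra : LieSubalgebra ℝ F.IndicatrixVectorField :=
  LieSubalgebra.lieSpan ℝ F.IndicatrixVectorField {ξ | ∃ X Y, F.IsCurvatureField X Y ξ}

/-- The vector field `V` along the smooth curve `c : s → M` is parallel: the curve `(c, V)` in `TM`
is the horizontal lift of `c`, that is, its velocity is the horizontal lift of the velocity of `c`.
In coordinates, `dV^i/dt + G^i_j(c, V) dc^j/dt = 0`. -/
def IsParallelOn (c : ℝ → M) (V : ∀ t, TangentSpace (𝓡 n) (c t)) (s : Set ℝ) : Prop :=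
  ∀ t ∈ s, HasMFDerivWithinAt 𝓘(ℝ, ℝ) (𝓡 n).tangent
    (fun r => (⟨c r, V r⟩ : TangentBundle (𝓡 n) M)) s t
    (ContinuousLinearMap.toSpanSingleton ℝ
      (F.horizontalLift ⟨c t, V t⟩ (mfderivWithin 𝓘(ℝ, ℝ) (𝓡 n) c s t (1 : ℝ))))

/-- The indicatrix at `p`. -/
def Indicatrix (p : M) : Type := {y : TangentSpace (𝓡 n) p // F ⟨p, y⟩ = 1}

/-- `σ` is the parallel translation of the indicatrix at `p` along some closed curve
`c : [0, 1] → M` at `p` which is smooth on each interval of a subdivision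
`0 = τ 0 < τ 1 < ⋯ < τ m = 1`. -/
def IsLoopTranslation (p : M) (σ : Equiv.Perm (F.Indicatrix p)) : Prop :=
  ∃ (c : ℝ → M) (m : ℕ) (τ : ℕ → ℝ), τ 0 = 0 ∧ τ m = 1 ∧ (∀ i < m, τ i < τ (i + 1)) ∧
    (∀ i < m, ContMDiffOn 𝓘(ℝ, ℝ) (𝓡 n) ∞ c (Icc (τ i) (τ (i + 1)))) ∧ c 0 = p ∧ c 1 = p ∧
    ∀ y : F.Indicatrix p, ∃ V : ∀ t, TangentSpace (𝓡 n) (c t),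
      (∀ i < m, F.IsParallelOn c V (Icc (τ i) (τ (i + 1)))) ∧
      (⟨c 0, V 0⟩ : TangentBundle (𝓡 n) M) = ⟨p, y.1⟩ ∧
      (⟨c 1, V 1⟩ : TangentBundle (𝓡 n) M) = ⟨p, (σ y).1⟩

/-- The holonomy group at `p`, as a group of transformations of the indicatrix at `p`. -/
def holonomyGroup (p : M) : Subgroup (Equiv.Perm (F.Indicatrix p)) :=
  Subgroup.closure {σ | F.IsLoopTranslation p σ}

/-- The fibered holonomy group: it is generated by the fiber preserving diffeomorphisms of the
indicatrix bundle whose restriction to each indicatrix belongs to the holonomy group there. -/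
noncomputable def fiberedHolonomyGroup : Subgroup F.IndicatrixDiffeo :=
  Subgroup.closure {Φ | ∀ p : M, ∃ σ ∈ F.holonomyGroup p, ∀ y : F.Indicatrix p,
    (Φ ⟨⟨p, y.1⟩, y.2⟩).incl = ⟨p, (σ y).1⟩}

/-- The fibered holonomy algebra: the set of smooth vector fields on the indicatrix bundle which are
tangent to the fibered holonomy group. -/
def fiberedHolonomyAlgebra : Set F.IndicatrixVectorField :=
  {ξ | IsTangentToSubgroup F.fiberedHolonomyGroup ξ}

end FinslerMetric

/-! Two facts carry the theorem. The first holds for every subgroup `G` of the diffeomorphism group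
of a manifold. Let φ_t and ψ_t be smooth curves in `G` through the identity with leading terms
(t^k/k!) X and (t^l/l!) Y. Then φ_t⁻¹ has leading term -(t^k/k!) X; the product of φ at t^l and ψ at
t^k has, after rescaling, leading term X + Y of order kl; and the group commutator of φ_t and ψ_t
has leading term a nonzero multiple of [X, Y], of order k + l. Hence the fields tangent to `G` form
a Lie algebra (`tangentLieSubalgebra`). Applied to the fibered holonomy group, this leaves only the
generators of the curvature algebra to be treated: every curvature vector field has to be shown
tangent.

The second fact is the infinitesimal meaning of curvature: parallel translation around a loop of
size t is the identity up to first order in t, and its second order term is the curvature times the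
enclosed area. To obtain diffeomorphisms of the whole indicatrix bundle, the loops are chosen at all
points of a chart at once: x is the base point of s ↦ x + t (a(s) u(x) + b(s) w(x)), where u and w
are the components of X and Y multiplied by a cutoff function and the polynomials a, b vanish at s =
0 and s = 1. The translations along these loops form a smooth family φ_t of fiber preserving
diffeomorphisms, which are the identity away from the support of the cutoff. Each restriction to a
fiber is a parallel translation along a closed curve, so φ_t lies in the fibered holonomy group, and
its second order term is (1/30) R(X^h, Y^h) (`LoopData.IsTransport.isLittleO`,
`IsLoopTransport.isTangentOfOrder`). This requires X to have compact support in a chart domain. In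
general X is cut into pieces by a partition of unity: the curvature is tensorial in X, so R(X^h,
Y^h) is a finite sum of fields already known to be tangent, and closure under sums finishes the
proof (`curvatureField_mem`).

The Finsler geometry enters through the energy e = F²/2. The geodesic coefficients are characterized
by the Euler-Lagrange equation of e, which is coordinate free. It follows that horizontal vectors
annihilate de, that vertical parts of brackets of horizontal fields do so too, and that the
horizontal distribution and its curvature do not depend on the chart. So parallel translation
preserves F and the curvature is tangent to the indicatrix bundle.

The smooth dependence of parallel translation on all parameters is obtained from a fixed point
equation in the Banach space of curves C([0, 1], E). -/

set_option linter.unusedSectionVars false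

/-! ### Superposition operators on spaces of continuous curves. -/

namespace ContinuousMap

universe u

variable {K : Type*} [TopologicalSpace K] [CompactSpace K]
  {E F : Type u} [NormedAddCommGroup E] [NormedSpace ℝ E] [NormedAddCommGroup F] [NormedSpace ℝ F]

noncomputable instance : NormedAddCommGroup C(K, E →L[ℝ] F) :=
  ContinuousMap.instNormedAddCommGroup

noncomputable instance : SeminormedAddCommGroup C(K, E →L[ℝ] F) :=
  NormedAddCommGroup.toSeminormedAddCommGroup

/-- Pointwise application of a continuous family of continuous linear maps. -/
noncomputable def pointwiseApply : C(K, E →L[ℝ] F) →L[ℝ] C(K, E) →L[ℝ] C(K, F) :=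
  LinearMap.mkContinuous₂
    (LinearMap.mk₂ ℝ (fun (A : C(K, E →L[ℝ] F)) (γ : C(K, E)) =>
        (⟨fun s => A s (γ s), A.continuous.clm_apply γ.continuous⟩ : C(K, F)))
      (fun A A' γ => by ext; simp) (fun c A γ => by ext; simp)
      (fun A γ γ' => by ext; simp) (fun c A γ => by ext; simp)) 1 fun A γ => by
    rw [one_mul]
    refine (norm_le _ (by positivity)).2 fun s => ?_
    exact ((A s).le_opNorm (γ s)).trans (by gcongr <;> exact norm_coe_le_norm _ _)

@[simp]
theorem pointwiseApply_apply (A : C(K, E →L[ℝ] F)) (γ : C(K, E)) (s : K) :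
    pointwiseApply A γ s = A s (γ s) := rfl

/-- The superposition operator `γ ↦ f ∘ γ`. -/
def superpose (f : E → F) (hf : Continuous f) (γ : C(K, E)) : C(K, F) := ⟨fun s => f (γ s), by fun_prop⟩

@[simp]
theorem superpose_apply (f : E → F) (hf : Continuous f) (γ : C(K, E)) (s : K) :
    superpose f hf γ s = f (γ s) := rfl

theorem continuous_superpose (f : E → F) (hf : Continuous f) :
    Continuous (superpose (K := K) f hf) :=
  continuous_postcomp (⟨f, hf⟩ : C(E, F))

/-- The points of the segment from `γ s` to `γ s + η s` are the values at `s` of the curves `γ + b •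
η` with b in [0, 1]. So continuity of the superposition operator of `fderiv ℝ f` bounds the
variation of the derivative uniformly in `s`, and the mean value inequality gives a remainder that
is small in the sup norm. -/
theorem hasFDerivAt_superpose {f : E → F} (hf : ContDiff ℝ 1 f) (γ : C(K, E)) :
    HasFDerivAt (superpose f hf.continuous)
      (pointwiseApply (superpose (fderiv ℝ f) (hf.continuous_fderiv one_ne_zero) γ)) γ := by
  rw [hasFDerivAt_iff_isLittleO_nhds_zero, Asymptotics.isLittleO_iff]
  intro ε hε
  have hc := (continuous_superpose (K := K) (fderiv ℝ f) (hf.continuous_fderiv one_ne_zero)).continuousAt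
    (x := γ)
  obtain ⟨δ, hδ, h⟩ := Metric.continuousAt_iff.1 hc ε hε
  filter_upwards [Metric.ball_mem_nhds (0 : C(K, E)) hδ] with η hη
  refine (norm_le _ (by positivity)).2 fun s => ?_
  simp only [sub_apply, superpose_apply, add_apply, pointwiseApply_apply]
  have key : ∀ z ∈ segment ℝ (γ s) (γ s + η s), ‖fderiv ℝ f z - fderiv ℝ f (γ s)‖ ≤ ε := by
    rintro z ⟨a, b, ha, hb, hab, rfl⟩
    have hz : a • γ s + b • (γ s + η s) = (γ + b • η) s := by
      have : a = 1 - b := by linarith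
      subst this
      simp only [add_apply, smul_apply]
      module
    rw [hz]
    have h1 : dist (γ + b • η) γ < δ := by
      rw [dist_eq_norm, add_sub_cancel_left, norm_smul, Real.norm_of_nonneg hb]
      have : ‖η‖ < δ := by simpa using hη
      calc b * ‖η‖ ≤ 1 * ‖η‖ := by gcongr; linarith
        _ < δ := by linarith
    have h2 := (h h1).le
    rw [dist_eq_norm] at h2
    exact (norm_coe_le_norm _ s).trans h2
  have h3 := (convex_segment (γ s) (γ s + η s)).norm_image_sub_le_of_norm_hasFDerivWithin_le'
    (f := f) (f' := fderiv ℝ f) (φ := fderiv ℝ f (γ s))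
    (fun z _ => (hf.differentiable one_ne_zero z).hasFDerivAt.hasFDerivWithinAt) key
    (left_mem_segment _ _ _) (right_mem_segment _ _ _)
  rw [add_sub_cancel_left] at h3
  exact h3.trans (by gcongr; exact norm_coe_le_norm _ _)

/-- The derivative is again a superposition operator, that of `fderiv ℝ f`, followed by the
continuous linear map `pointwiseApply`. The induction therefore runs over all target spaces; `E` and
`F` share a universe so that `F` may be replaced by `E →L[ℝ] F`. -/
theorem contDiff_superpose {f : E → F} (hf : ContDiff ℝ ∞ f) :
    ContDiff ℝ ∞ (superpose (K := K) f hf.continuous) := by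
  rw [contDiff_infty]
  intro n
  induction n generalizing F with
  | zero => exact contDiff_zero.2 (continuous_superpose f hf.continuous)
  | succ n ih =>
    refine contDiff_succ_iff_hasFDerivAt.2 ⟨_, ?_, fun γ => hasFDerivAt_superpose
      (hf.of_le (by exact_mod_cast le_top)) γ⟩
    exact pointwiseApply.contDiff.comp (ih (hf.fderiv_right (m := ∞) (by simp)))

variable {P : Type u} [NormedAddCommGroup P] [NormedSpace ℝ P]

/-- The linear map taking a parameter `p` and a curve `γ` to the curve `s ↦ (p, γ s)`. -/
noncomputable def parametrize : P × C(K, E) →L[ℝ] C(K, P × E) :=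
  LinearMap.mkContinuous
    { toFun := fun q => ⟨fun s => (q.1, q.2 s), by fun_prop⟩
      map_add' := fun q q' => by ext <;> simp
      map_smul' := fun c q => by ext <;> simp } 1 fun q => by
    rw [one_mul]
    refine (norm_le _ (by positivity)).2 fun s => ?_
    exact max_le_max le_rfl (norm_coe_le_norm _ _)

@[simp]
theorem parametrize_apply (q : P × C(K, E)) (s : K) : parametrize q s = (q.1, q.2 s) := rfl

end ContinuousMap

/-! ### The integral operator on curves. -/

section Volterra

open unitInterval ContinuousMap

universe u

variable {E : Type u} [NormedAddCommGroup E] [NormedSpace ℝ E]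

/-- The integral operator `γ ↦ (s ↦ ∫₀ˢ γ)`. -/
noncomputable def volterra [CompleteSpace E] : C(I, E) →L[ℝ] C(I, E) :=
  LinearMap.mkContinuous
    { toFun := fun γ => ⟨fun s => ∫ r in (0 : ℝ)..s, Set.IccExtend zero_le_one γ r, by
        have hc : Continuous (Set.IccExtend (zero_le_one' ℝ) γ) := γ.continuous.Icc_extend'
        exact (intervalIntegral.continuous_primitive (fun a b => hc.intervalIntegrable a b) 0).comp
          continuous_subtype_val⟩
      map_add' := fun γ η => by
        ext s
        have hγ : Continuous (Set.IccExtend (zero_le_one' ℝ) γ) := γ.continuous.Icc_extend'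
        have hη : Continuous (Set.IccExtend (zero_le_one' ℝ) η) := η.continuous.Icc_extend'
        exact intervalIntegral.integral_add (hγ.intervalIntegrable _ _) (hη.intervalIntegrable _ _)
      map_smul' := fun c γ => by
        ext s
        exact intervalIntegral.integral_smul c _ } 1 fun γ => by
    rw [one_mul]
    refine (norm_le _ (by positivity)).2 fun s => ?_
    have := intervalIntegral.norm_integral_le_of_norm_le_const (a := 0) (b := (s : ℝ)) (C := ‖γ‖)
      (f := Set.IccExtend (zero_le_one' ℝ) γ) fun r _ => norm_coe_le_norm γ _
    refine this.trans ?_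
    rw [sub_zero, abs_of_nonneg s.2.1]
    exact mul_le_of_le_one_right (norm_nonneg _) s.2.2

variable [CompleteSpace E]

theorem volterra_apply (γ : C(I, E)) (s : I) :
    volterra γ s = ∫ r in (0 : ℝ)..s, Set.IccExtend zero_le_one γ r := rfl

theorem norm_volterra_le (γ : C(I, E)) : ‖volterra γ‖ ≤ ‖γ‖ := by
  simpa using (volterra (E := E)).le_of_opNorm_le (LinearMap.mkContinuous_norm_le _ zero_le_one _) γ

theorem hasDerivWithinAt_volterra (γ : C(I, E)) (s : ℝ) (hs : s ∈ I) :
    HasDerivWithinAt (Set.IccExtend zero_le_one (volterra γ)) (γ ⟨s, hs⟩) I s := by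
  have hc : Continuous (Set.IccExtend (zero_le_one' ℝ) γ) := γ.continuous.Icc_extend'
  have h := (intervalIntegral.integral_hasDerivAt_right (hc.intervalIntegrable 0 s)
    (hc.stronglyMeasurableAtFilter _ _) hc.continuousAt).hasDerivWithinAt (s := I)
  rw [IccExtend_of_mem zero_le_one _ hs] at h
  refine h.congr_of_mem (fun r hr => ?_) hs
  rw [IccExtend_of_mem zero_le_one _ hr]
  rfl

end Volterra

/-! ### Smooth dependence of fixed points on parameters. -/

section Contraction

variable {P Γ : Type*} [NormedAddCommGroup P] [NormedSpace ℝ P] [CompleteSpace P]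
  [NormedAddCommGroup Γ] [NormedSpace ℝ Γ] [CompleteSpace Γ]

/-- The fixed points of a smooth family of contractions depend smoothly on the parameter. -/
theorem exists_contDiffOn_fixedPoint {T : P × Γ → Γ} (hT : ContDiff ℝ ∞ T) {U : Set P} (hU : IsOpen U)
    (hc : ∀ p ∈ U, ∀ γ γ', ‖T (p, γ) - T (p, γ')‖ ≤ 1 / 2 * ‖γ - γ'‖) :
    ∃ Z : P → Γ, ContDiffOn ℝ ∞ Z U ∧ (∀ p ∈ U, T (p, Z p) = Z p) ∧
      ∀ p ∈ U, ∀ γ, T (p, γ) = γ → γ = Z p := by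
  have hu : ∀ p ∈ U, ∀ γ γ', T (p, γ) = γ → T (p, γ') = γ' → γ = γ' := by
    intro p hp γ γ' h h'
    have := hc p hp γ γ'
    rw [h, h'] at this
    have h0 : ‖γ - γ'‖ = 0 := le_antisymm (by linarith) (norm_nonneg _)
    exact sub_eq_zero.1 (norm_eq_zero.1 h0)
  have hex : ∀ p, ∃ γ, p ∈ U → T (p, γ) = γ := by
    intro p
    by_cases hp : p ∈ U
    · have hC : ContractingWith (1 / 2) fun γ => T (p, γ) := by
        refine ⟨by rw [← NNReal.coe_lt_coe]; norm_num, LipschitzWith.of_dist_le_mul fun γ γ' => ?_⟩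
        rw [dist_eq_norm, dist_eq_norm]
        simpa using hc p hp γ γ'
      exact ⟨_, fun _ => hC.fixedPoint_isFixedPt⟩
    · exact ⟨0, fun h => absurd h hp⟩
  choose Z hZ using hex
  refine ⟨Z, fun p hp => ContDiffAt.contDiffWithinAt ?_, hZ, fun p hp γ h => hu p hp _ _ h (hZ p hp)⟩
  set DT := fderiv ℝ T (p, Z p) with hDT
  have hTd : HasFDerivAt T DT (p, Z p) := (hT.differentiable (by simp) _).hasFDerivAt
  -- The partial derivative in `γ` inherits the contraction constant 1/2, so `1 - A` is invertible
  -- by the Neumann series.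
  set A : Γ →L[ℝ] Γ := DT.comp (ContinuousLinearMap.inr ℝ P Γ) with hA
  have hAn : ‖A‖ < 1 := by
    have h1 : HasFDerivAt (fun γ => T (p, γ)) A (Z p) :=
      hTd.comp (Z p) (hasFDerivAt_prodMk_right p (Z p))
    have h2 : LipschitzWith (1 / 2) fun γ => T (p, γ) :=
      LipschitzWith.of_dist_le_mul fun γ γ' => by
        rw [dist_eq_norm, dist_eq_norm]
        simpa using hc p hp γ γ'
    have := h1.le_of_lipschitz h2
    exact lt_of_le_of_lt this (by norm_num)
  let e : Γ ≃L[ℝ] Γ := ContinuousLinearEquiv.unitsEquiv ℝ Γ (Units.oneSub A hAn)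
  have he : ∀ γ, e γ = γ - A γ := fun γ => rfl
  -- Fixed points are the solutions of `Φ (p, γ) = (p, 0)`. The inverse function theorem yields a
  -- smooth solution near `p`, and uniqueness of the fixed point identifies it with `Z`.
  let Φ : P × Γ → P × Γ := fun q => (q.1, q.2 - T q)
  have hΦ : ContDiff ℝ ∞ Φ := contDiff_fst.prodMk (contDiff_snd.sub hT)
  let B : P →L[ℝ] Γ := DT.comp (ContinuousLinearMap.inl ℝ P Γ)
  let L : (P × Γ) ≃L[ℝ] (P × Γ) := ContinuousLinearEquiv.equivOfInverse
    ((ContinuousLinearMap.fst ℝ P Γ).prod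
      ((e : Γ →L[ℝ] Γ).comp (ContinuousLinearMap.snd ℝ P Γ) - B.comp (ContinuousLinearMap.fst ℝ P Γ)))
    ((ContinuousLinearMap.fst ℝ P Γ).prod ((e.symm : Γ →L[ℝ] Γ).comp
      (ContinuousLinearMap.snd ℝ P Γ + B.comp (ContinuousLinearMap.fst ℝ P Γ))))
    (fun q => by simp) (fun q => by simp)
  have hL : HasFDerivAt Φ (L : P × Γ →L[ℝ] P × Γ) (p, Z p) := by
    have := hasFDerivAt_fst.prodMk ((hasFDerivAt_snd (𝕜 := ℝ) (p := (p, Z p))).sub hTd)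
    refine this.congr_fderiv ?_
    ext q
    · rfl
    · simp [L, B]
    · rfl
    · have h0 : DT (0, 0) = 0 := map_zero DT
      simp [L, B, he, hA, h0]
  have hn : (∞ : WithTop ℕ∞) ≠ 0 := by simp
  have hΦp : Φ (p, Z p) = (p, 0) := by simp [Φ, hZ p hp]
  let ψ := hΦ.contDiffAt.localInverse hL hn
  have hψ : ContDiffAt ℝ ∞ ψ (p, 0) := by
    have := hΦ.contDiffAt.to_localInverse hL hn
    rwa [hΦp] at this
  have hs : HasStrictFDerivAt Φ (L : P × Γ →L[ℝ] P × Γ) (p, Z p) :=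
    hΦ.contDiffAt.hasStrictFDerivAt' hL hn
  have hr : ∀ᶠ q in 𝓝 ((p, 0) : P × Γ), Φ (ψ q) = q := by
    have := hs.eventually_right_inverse
    rwa [hΦp] at this
  have hin : ContDiffAt ℝ ∞ (fun p' : P => ((p', 0) : P × Γ)) p :=
    contDiffAt_id.prodMk contDiffAt_const
  have h1 : ∀ᶠ p' in 𝓝 p, Φ (ψ (p', 0)) = (p', 0) := hin.continuousAt.eventually hr
  have h2 : (fun p' => (ψ (p', 0)).2) =ᶠ[𝓝 p] Z := by
    filter_upwards [h1, hU.mem_nhds hp] with p' h3 hp'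
    have e1 : (ψ (p', 0)).1 = p' := congrArg Prod.fst h3
    have e2 : (ψ (p', 0)).2 - T (ψ (p', 0)) = 0 := congrArg Prod.snd h3
    refine hu p' hp' _ _ ?_ (hZ p' hp')
    have e3 : ψ (p', 0) = (p', (ψ (p', 0)).2) := Prod.ext e1 rfl
    rw [← e3]
    exact (sub_eq_zero.1 e2).symm
  exact ((contDiffAt_snd.comp p (hψ.comp p hin)).congr_of_eventuallyEq h2.symm)

end Contraction

/-! ### Differential equations as fixed point problems in C([0, 1], E). -/

section IntegralCurves

open unitInterval ContinuousMap

universe u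

variable {P E : Type u} [NormedAddCommGroup P] [NormedSpace ℝ P]
  [NormedAddCommGroup E] [NormedSpace ℝ E]

/-- The graph `s ↦ (s, p, γ s)`. -/
def timeGraph (q : P × C(I, E)) : C(I, ℝ × P × E) := ⟨fun s => (s, q.1, q.2 s), by fun_prop⟩

/-- As a constant plus a continuous linear map, the graph map is smooth with known derivative. -/
theorem timeGraph_eq (q : P × C(I, E)) : timeGraph q =
    (⟨fun s => (s, 0), by fun_prop⟩ : C(I, ℝ × P × E)) +
      (ContinuousLinearMap.inr ℝ ℝ (P × E)).compLeftContinuous ℝ I (parametrize q) := by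
  ext s <;> simp [timeGraph]

theorem contDiff_timeGraph : ContDiff ℝ ∞ (timeGraph : P × C(I, E) → _) := by
  simp_rw [funext timeGraph_eq]
  exact contDiff_const.add (ContinuousLinearMap.contDiff
    (((ContinuousLinearMap.inr ℝ ℝ (P × E)).compLeftContinuous ℝ I).comp parametrize))

/-- The velocity `s ↦ B (s, p, γ s)` prescribed along the curve `γ`. -/
def velocity (B : ℝ × P × E → E) (hB : Continuous B) (q : P × C(I, E)) : C(I, E) :=
  superpose B hB (timeGraph q)

theorem velocity_apply (B : ℝ × P × E → E) (hB : Continuous B) (q : P × C(I, E)) (s : I) :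
    velocity B hB q s = B (s, q.1, q.2 s) := rfl

theorem contDiff_velocity {B : ℝ × P × E → E} (hB : ContDiff ℝ ∞ B) :
    ContDiff ℝ ∞ (velocity B hB.continuous) :=
  (contDiff_superpose hB).comp contDiff_timeGraph

/-- First variation of the velocity along a family of curves; it yields the second order term of
parallel translation. -/
theorem hasDerivAt_velocity {B : ℝ × P × E → E} (hB : ContDiff ℝ ∞ B) {p : ℝ → P} {γ : ℝ → C(I, E)}
    {p' : P} {γ' : C(I, E)} {t : ℝ} (hp : HasDerivAt p p' t) (hγ : HasDerivAt γ γ' t) :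
    ∃ b' : C(I, E), HasDerivAt (fun t => velocity B hB.continuous (p t, γ t)) b' t ∧
      ∀ s : I, b' s = fderiv ℝ B (s, p t, γ t s) (0, p', γ' s) := by
  have h1 : HasDerivAt (fun t => timeGraph (p t, γ t))
      ((ContinuousLinearMap.inr ℝ ℝ (P × E)).compLeftContinuous ℝ I (parametrize (p', γ'))) t := by
    simp_rw [timeGraph_eq]
    exact (HasFDerivAt.comp_hasDerivAt t (ContinuousLinearMap.hasFDerivAt
      (((ContinuousLinearMap.inr ℝ ℝ (P × E)).compLeftContinuous ℝ I).comp parametrize))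
      (hp.prodMk hγ)).const_add _
  exact ⟨_, (hasFDerivAt_superpose (hB.of_le (by simp)) _).comp_hasDerivAt t h1, fun s => rfl⟩

variable [CompleteSpace E]

/-- The bridge between the initial value problem and the integral equation. In the nontrivial
direction, the curve minus its integral has zero derivative and is constant. -/
theorem eq_const_add_volterra_iff (γ b : C(I, E)) (y : E) :
    γ = const I y + volterra b ↔ γ 0 = y ∧ ∀ (s : ℝ) (hs : s ∈ I),
      HasDerivWithinAt (Set.IccExtend zero_le_one γ) (b ⟨s, hs⟩) I s := by
  constructor
  · rintro rfl
    refine ⟨by simp [volterra_apply], fun s hs => ?_⟩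
    exact ((hasDerivWithinAt_volterra b s hs).const_add y)
  · rintro ⟨h0, h⟩
    have hd : ∀ s ∈ I, HasDerivWithinAt (Set.IccExtend zero_le_one γ -
        Set.IccExtend zero_le_one (volterra b)) 0 I s := fun s hs => by
      simpa using (h s hs).sub (hasDerivWithinAt_volterra b s hs)
    have hc := constant_of_has_deriv_right_zero (a := (0 : ℝ)) (b := 1)
      (fun s hs => (hd s hs).continuousWithinAt)
      (fun s hs => (hd s ⟨hs.1, hs.2.le⟩).mono_of_mem_nhdsWithin (by
        exact mem_of_superset (Icc_mem_nhdsGE hs.2) (Icc_subset_Icc hs.1 le_rfl)))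
    ext s
    have h1 := hc s s.2
    rw [Pi.sub_apply, Pi.sub_apply, IccExtend_of_mem _ _ s.2, IccExtend_of_mem _ _ s.2, IccExtend_left, IccExtend_left] at h1
    have h2 : γ ⟨0, left_mem_Icc.2 zero_le_one⟩ = y := h0
    have h3 : volterra b ⟨0, left_mem_Icc.2 zero_le_one⟩ = 0 := by simp [volterra_apply]
    rw [h2, h3, sub_zero] at h1
    exact sub_eq_iff_eq_add.1 h1

variable [CompleteSpace P]

/-- Existence, uniqueness and smooth dependence on parameters of the solutions on `[0, 1]` of a
differential equation whose right hand side has a small Lipschitz constant. -/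
theorem exists_contDiffOn_integralCurve {B : ℝ × P × E → E} (hB : ContDiff ℝ ∞ B) {y : P → E}
    (hy : ContDiff ℝ ∞ y) {U : Set P} (hU : IsOpen U)
    (hc : ∀ p ∈ U, ∀ s ∈ I, ∀ z z', ‖B (s, p, z) - B (s, p, z')‖ ≤ 1 / 2 * ‖z - z'‖) :
    ∃ Z : P → C(I, E), ContDiffOn ℝ ∞ Z U ∧
      (∀ p ∈ U, Z p = const I (y p) + volterra (velocity B hB.continuous (p, Z p))) ∧
      ∀ p ∈ U, ∀ γ : C(I, E), γ 0 = y p → (∀ (s : ℝ) (hs : s ∈ I), HasDerivWithinAt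
        (Set.IccExtend zero_le_one γ) (B (s, p, γ ⟨s, hs⟩)) I s) → γ = Z p := by
  have hconst : ContDiff ℝ ∞ fun p : P => const I (y p) := by
    let C : E →L[ℝ] C(I, E) := LinearMap.mkContinuous
      { toFun := fun e => const I e, map_add' := fun _ _ => rfl, map_smul' := fun _ _ => rfl } 1
      fun e => by
        rw [one_mul]
        exact (norm_le _ (by positivity)).2 fun s => le_rfl
    exact C.contDiff.comp hy
  have hT : ContDiff ℝ ∞ fun q : P × C(I, E) =>
      const I (y q.1) + volterra (velocity B hB.continuous q) :=
    (hconst.comp contDiff_fst).add ((volterra (E := E)).contDiff.comp (contDiff_velocity hB))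
  -- Integration over [0, 1] does not increase the sup norm, so the Lipschitz constant 1/2 of `B` is
  -- also one of the fixed point operator.
  obtain ⟨Z, h1, h2, h3⟩ := exists_contDiffOn_fixedPoint hT hU fun p hp γ γ' => by
    rw [add_sub_add_left_eq_sub, ← map_sub]
    refine (norm_volterra_le _).trans ((norm_le _ (by positivity)).2 fun s => ?_)
    refine (hc p hp s s.2 _ _).trans ?_
    gcongr
    exact norm_coe_le_norm (γ - γ') s
  refine ⟨Z, h1, fun p hp => (h2 p hp).symm, fun p hp γ h0 h => h3 p hp γ ?_⟩
  exact ((eq_const_add_volterra_iff γ (velocity B hB.continuous (p, γ)) (y p)).2 ⟨h0, h⟩).symm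

end IntegralCurves

/-- Only germs matter in the local arguments below, while the superposition operators need functions
smooth everywhere; a bump function makes up the difference. -/
theorem exists_contDiff_eventuallyEq {E F : Type*} [NormedAddCommGroup E] [NormedSpace ℝ E]
    [FiniteDimensional ℝ E] [NormedAddCommGroup F] [NormedSpace ℝ F] {G : E → F} {x : E} (hG : ∀ᶠ y in 𝓝 x, ContDiffAt ℝ ∞ G y) :
    ∃ G' : E → F, ContDiff ℝ ∞ G' ∧ G' =ᶠ[𝓝 x] G := by
  obtain ⟨r, hr, h⟩ := Metric.eventually_nhds_iff_ball.1 hG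
  let f : ContDiffBump x := ⟨r / 3, r / 2, by positivity, by linarith⟩
  refine ⟨fun y => f y • G y, contDiff_iff_contDiffAt.2 fun y => ?_, ?_⟩
  · by_cases hy : y ∈ Metric.ball x r
    · exact f.contDiff.contDiffAt.smul (h y hy)
    · have : y ∉ tsupport f := by
        rw [f.tsupport_eq]
        intro h'
        have h1 : dist y x ≤ r / 2 := h'
        exact hy (lt_of_le_of_lt h1 (by linarith))
      have h0 : (fun y => f y • G y) =ᶠ[𝓝 y] fun _ => 0 := by
        filter_upwards [notMem_tsupport_iff_eventuallyEq.1 this] with z hz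
        simp [hz]
      exact contDiffAt_const.congr_of_eventuallyEq h0
  · filter_upwards [f.eventuallyEq_one] with z hz
    simp [hz]

/-! ### Smooth division by powers of the time variable. -/

section Hadamard

open unitInterval ContinuousMap

universe u

variable {E F : Type u} [NormedAddCommGroup E] [NormedSpace ℝ E] [FiniteDimensional ℝ E]
  [NormedAddCommGroup F] [NormedSpace ℝ F]

variable [CompleteSpace F]

/-- Hadamard's formula: G(t, z) = t ∫₀¹ ∂_t G(st, z) ds. The integral is smooth in (t, z) because it
is composed of a linear map into curves, a superposition operator, `volterra` and evaluation at 1.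
-/
theorem exists_eq_smul_of_zero {G : ℝ × E → F} {z₀ : E}
    (hG : ∀ᶠ q in 𝓝 ((0 : ℝ), z₀), ContDiffAt ℝ ∞ G q) (h0 : ∀ᶠ z in 𝓝 z₀, G (0, z) = 0) :
    ∃ A : ℝ × E → F, ContDiff ℝ ∞ A ∧ ∀ᶠ q in 𝓝 ((0 : ℝ), z₀), G q = q.1 • A q := by
  obtain ⟨G', hG', he⟩ := exists_contDiff_eventuallyEq hG
  have hD : ContDiff ℝ ∞ fun q => fderiv ℝ G' q (1, 0) :=
    (hG'.fderiv_right (m := ∞) (by simp)).clm_apply contDiff_const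
  let Λ : ℝ × E →L[ℝ] C(I, ℝ × E) := LinearMap.mkContinuous
    { toFun := fun q => ⟨fun s => ((s : ℝ) * q.1, q.2), by fun_prop⟩
      map_add' := fun q q' => by ext <;> simp [mul_add]
      map_smul' := fun c q => by ext <;> simp [mul_left_comm] } 1 fun q => by
    rw [one_mul]
    refine (norm_le _ (by positivity)).2 fun s => max_le_max ?_ le_rfl
    refine (norm_mul _ _).trans_le ?_
    exact mul_le_of_le_one_left (norm_nonneg _) (by rw [Real.norm_of_nonneg s.2.1]; exact s.2.2)
  refine ⟨fun q => volterra (superpose _ hD.continuous (Λ q)) 1, ?_, ?_⟩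
  · exact (evalCLM ℝ (1 : I)).contDiff.comp
      (volterra.contDiff.comp ((contDiff_superpose hD).comp Λ.contDiff))
  · have hfst : Tendsto (fun q : ℝ × E => ((0 : ℝ), q.2)) (𝓝 (0, z₀)) (𝓝 (0, z₀)) := by
      have : Continuous fun q : ℝ × E => ((0 : ℝ), q.2) := by fun_prop
      exact this.tendsto _
    have hsnd : Tendsto (fun q : ℝ × E => q.2) (𝓝 (0, z₀)) (𝓝 z₀) := continuous_snd.tendsto _
    filter_upwards [he, hfst.eventually he, hsnd.eventually h0] with q h1 h2 h3
    obtain ⟨t, z⟩ := q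
    simp only at h1 h2 h3
    have h4 : ∀ s : ℝ, HasDerivAt (fun s => G' (s * t, z)) (t • fderiv ℝ G' (s * t, z) (1, 0)) s := by
      intro s
      have e1 : HasDerivAt (fun s : ℝ => (s * t, z)) ((t, 0) : ℝ × E) s :=
        (by simpa using (hasDerivAt_id s).mul_const t : HasDerivAt (fun s => s * t) t s).prodMk
          (hasDerivAt_const s z)
      have e2 := ((hG'.differentiable (by simp)) (s * t, z)).hasFDerivAt.comp_hasDerivAt s e1
      refine e2.congr_deriv ?_
      rw [← map_smul]
      simp
    have hcont : Continuous fun s : ℝ => t • fderiv ℝ G' (s * t, z) (1, 0) :=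
      continuous_const.smul (hD.continuous.comp (by fun_prop))
    have h5 := intervalIntegral.integral_eq_sub_of_hasDerivAt (a := 0) (b := 1)
      (fun s _ => h4 s) (hcont.intervalIntegrable _ _)
    rw [intervalIntegral.integral_smul, one_mul, zero_mul, h1, h2, h3, sub_zero] at h5
    rw [← h5, volterra_apply]
    congr 1
    refine intervalIntegral.integral_congr fun s hs => ?_
    rw [uIcc_of_le zero_le_one] at hs
    have hs1 : s ∈ Icc ((0 : ℝ)) ((1 : I) : ℝ) := hs
    rw [IccExtend_of_mem _ _ hs]
    rfl

/-- One factor t is split off at a time. If G = t^k A and G = O(t^(k+1)), then A(t, z) = O(t) for t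
≠ 0, so A(0, z) = 0 by continuity and Hadamard's formula applies to A. -/
theorem exists_eq_pow_smul {k : ℕ} {G : ℝ × E → F} {z₀ : E}
    (hG : ∀ᶠ q in 𝓝 ((0 : ℝ), z₀), ContDiffAt ℝ ∞ G q)
    (h0 : ∀ᶠ z in 𝓝 z₀, (fun t => G (t, z)) =O[𝓝 0] fun t : ℝ => t ^ k) :
    ∃ A : ℝ × E → F, ContDiff ℝ ∞ A ∧ ∀ᶠ q in 𝓝 ((0 : ℝ), z₀), G q = q.1 ^ k • A q := by
  induction k with
  | zero =>
    obtain ⟨G', hG', he⟩ := exists_contDiff_eventuallyEq hG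
    exact ⟨G', hG', he.mono fun q hq => by simp [hq]⟩
  | succ k ih =>
    obtain ⟨A, hA, hGA⟩ := ih <| h0.mono fun z hz =>
      hz.trans (Asymptotics.IsBigO.of_bound 1 (by
        filter_upwards [Metric.ball_mem_nhds (0 : ℝ) one_pos] with t ht
        have : ‖t‖ ≤ 1 := by simpa using (mem_ball_zero_iff.1 ht).le
        rw [pow_succ, norm_mul, one_mul]
        exact mul_le_of_le_one_right (norm_nonneg _) this))
    have hA0 : ∀ᶠ z in 𝓝 z₀, A (0, z) = 0 := by
      obtain ⟨U, hU, V, hV, hUV⟩ := mem_nhds_prod_iff.1 hGA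
      filter_upwards [h0, hV] with z hz hzV
      have h1 : (fun t => A (t, z)) =O[𝓝[≠] 0] fun t : ℝ => t := by
        obtain ⟨C, hC⟩ := hz.bound
        refine Asymptotics.IsBigO.of_bound C ?_
        filter_upwards [nhdsWithin_le_nhds hC, self_mem_nhdsWithin, nhdsWithin_le_nhds hU]
          with t ht ht0 htU
        have e1 : G (t, z) = t ^ k • A (t, z) := hUV (mk_mem_prod htU hzV)
        rw [e1, norm_smul, pow_succ, norm_mul] at ht
        have : 0 < ‖t ^ k‖ := norm_pos_iff.2 (pow_ne_zero _ ht0)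
        rw [← mul_le_mul_iff_right₀ this]
        linarith
      have h2 : Tendsto (fun t => A (t, z)) (𝓝[≠] 0) (𝓝 0) :=
        h1.trans_tendsto (tendsto_id.mono_left nhdsWithin_le_nhds)
      have h3 : Tendsto (fun t : ℝ => A (t, z)) (𝓝[≠] 0) (𝓝 (A (0, z))) :=
        ((hA.continuous.comp (by fun_prop : Continuous fun t : ℝ => (t, z))).tendsto 0).mono_left
          nhdsWithin_le_nhds
      exact tendsto_nhds_unique h3 h2
    obtain ⟨A', hA', he⟩ := exists_eq_smul_of_zero (Eventually.of_forall fun q => hA.contDiffAt) hA0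
    refine ⟨A', hA', ?_⟩
    filter_upwards [hGA, he] with q h1 h2
    rw [h1, h2, smul_smul, pow_succ]

end Hadamard

/-! ### Vanishing derivatives as asymptotic expansions. -/

section Taylor

variable {E : Type*} [NormedAddCommGroup E] [NormedSpace ℝ E]

theorem eq_zero_of_pow_smul_isLittleO {k : ℕ} {v : E}
    (h : (fun t : ℝ => t ^ k • v) =o[𝓝 0] fun t : ℝ => t ^ k) : v = 0 := by
  by_contra hv
  have h1 := (Asymptotics.isLittleO_iff.1 h) (half_pos (norm_pos_iff.2 hv))
  obtain ⟨t, ht, ht0⟩ := ((h1.filter_mono nhdsWithin_le_nhds).and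
    (self_mem_nhdsWithin : ∀ᶠ t in 𝓝[≠] (0 : ℝ), t ≠ 0)).exists
  simp only [norm_smul] at ht
  have h2 : 0 < ‖t ^ k‖ := norm_pos_iff.2 (pow_ne_zero _ ht0)
  have h3 : 0 < ‖v‖ := norm_pos_iff.2 hv
  nlinarith

/-- A smooth curve has vanishing derivatives of orders `1, …, k - 1` and `k`-th derivative `w` at `0`
if and only if it is `c 0 + t ^ k / k! • w + o(t ^ k)`. -/
theorem iteratedDeriv_eq_iff_isLittleO {k : ℕ} (hk : 1 ≤ k) {c : ℝ → E}
    (hc : ∀ᶠ t in 𝓝 0, ContDiffAt ℝ ∞ c t) (w : E) :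
    ((∀ i : ℕ, 1 ≤ i → i < k → iteratedDeriv i c 0 = 0) ∧ iteratedDeriv k c 0 = w) ↔
      (fun t => c t - c 0 - ((k.factorial : ℝ)⁻¹ * t ^ k) • w) =o[𝓝 0] fun t : ℝ => t ^ k := by
  obtain ⟨c', hc', he⟩ := exists_contDiff_eventuallyEq hc
  have key : ∀ j : ℕ, 1 ≤ j → (∀ i : ℕ, 1 ≤ i → i < j → iteratedDeriv i c 0 = 0) →
      (fun t => c t - c 0 - ((j.factorial : ℝ)⁻¹ * t ^ j) • iteratedDeriv j c 0) =o[𝓝 0]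
        fun t : ℝ => t ^ j := by
    intro j hj h
    have h1 := taylor_isLittleO_univ (x₀ := 0) (hc'.of_le (n := ∞) (m := j) (by exact_mod_cast le_top))
    simp only [sub_zero] at h1
    refine h1.congr' ?_ EventuallyEq.rfl
    filter_upwards [he] with t ht
    rw [taylor_within_apply, ht, sub_sub]
    congr 1
    have e : ∀ i, iteratedDerivWithin i c' univ 0 = iteratedDeriv i c 0 := fun i => by
      rw [iteratedDerivWithin_univ]
      exact he.iteratedDeriv_eq i
    obtain ⟨m, rfl⟩ : ∃ m, j = m + 1 := ⟨j - 1, by omega⟩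
    rw [Finset.sum_range_succ, Finset.sum_range_succ']
    simp only [e, sub_zero]
    rw [Finset.sum_eq_zero fun i hi => by
      rw [h (i + 1) (by omega) (by simpa using hi), smul_zero]]
    simp
  constructor
  · rintro ⟨h1, rfl⟩
    exact key k hk h1
  · intro h
    -- When the derivatives of orders below i vanish, the increment of c is (t^i/i!) times the i-th
    -- derivative, up to o(t^i). As i < k, the increment is itself o(t^i), and the i-th derivative
    -- vanishes as well.
    have h1 : ∀ j : ℕ, j ≤ k → ∀ i : ℕ, 1 ≤ i → i < j → iteratedDeriv i c 0 = 0 := by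
      intro j
      induction j with
      | zero => intro _ i _ hi; omega
      | succ j ih =>
        intro hj i hi hij
        rcases Nat.lt_succ_iff_lt_or_eq.1 hij with h' | rfl
        · exact ih (by omega) i hi h'
        have h2 := key i hi (ih (by omega))
        have h3 : (fun t : ℝ => t ^ k) =o[𝓝 0] fun t : ℝ => t ^ i := by
          exact Asymptotics.isLittleO_pow_pow hj
        have h4 : (fun t => c t - c 0) =o[𝓝 0] fun t : ℝ => t ^ i := by
          have h5 : (fun t : ℝ => ((k.factorial : ℝ)⁻¹ * t ^ k) • w) =o[𝓝 0] fun t : ℝ => t ^ i := by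
            have := ((h3.const_mul_left (k.factorial : ℝ)⁻¹).smul_isBigO
              (Asymptotics.isBigO_refl (fun _ => w) (𝓝 (0 : ℝ))))
            refine (this.congr (fun t => rfl) fun t => rfl).trans_isBigO ?_
            exact Asymptotics.IsBigO.of_bound ‖w‖ (Eventually.of_forall fun t => by
              rw [norm_smul, mul_comm])
          exact ((h.trans h3).add h5).congr_left fun t => by abel
        have h6 := (h4.sub h2).const_smul_left (i.factorial : ℝ)
        refine eq_zero_of_pow_smul_isLittleO (h6.congr_left fun t => ?_)
        rw [Pi.smul_apply, sub_sub_cancel, smul_smul, ← mul_assoc, mul_inv_cancel₀, one_mul]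
        exact_mod_cast i.factorial_ne_zero
    refine ⟨h1 k le_rfl, ?_⟩
    have h2 := key k hk (h1 k le_rfl)
    have h3 := (h.sub h2).const_smul_left (k.factorial : ℝ)
    refine sub_eq_zero.1 (eq_zero_of_pow_smul_isLittleO (h3.congr_left fun t => ?_))
    rw [Pi.smul_apply, sub_sub_sub_cancel_left, ← smul_sub, smul_smul, ← mul_assoc, mul_inv_cancel₀, one_mul]
    exact_mod_cast k.factorial_ne_zero

end Taylor

/-! ### Calculus of leading terms for local families of maps. -/

section LocalFamilies

open Asymptotics

universe u

variable {E : Type u} [NormedAddCommGroup E] [NormedSpace ℝ E]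

/-- `f (t, z)` is smooth near `(0, z₀)` and the identity for `t = 0`. -/
structure IsLocalFamily (f : ℝ × E → E) (z₀ : E) : Prop where
  smooth : ∀ᶠ q in 𝓝 ((0 : ℝ), z₀), ContDiffAt ℝ ∞ f q
  zero : ∀ᶠ z in 𝓝 z₀, f (0, z) = z

/-- `f (t, z) = z + t ^ k / k! • w + o(t ^ k)`. -/
def HasJet (k : ℕ) (f : ℝ × E → E) (w z : E) : Prop :=
  (fun t : ℝ => f (t, z) - z - ((k.factorial : ℝ)⁻¹ * t ^ k) • w) =o[𝓝 0] fun t : ℝ => t ^ k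

theorem pow_smul_isBigO {k : ℕ} {v : ℝ → E} {l : Filter ℝ} (hv : v =O[l] fun _ => (1 : ℝ)) :
    (fun t => t ^ k • v t) =O[l] fun t : ℝ => t ^ k := by
  simpa using (isBigO_refl (fun t : ℝ => t ^ k) l).smul hv

theorem pow_smul_isLittleO {k : ℕ} {v : ℝ → E} {l : Filter ℝ} (hv : v =o[l] fun _ => (1 : ℝ)) :
    (fun t => t ^ k • v t) =o[l] fun t : ℝ => t ^ k := by
  simpa using (isBigO_refl (fun t : ℝ => t ^ k) l).smul_isLittleO hv

theorem HasJet.isBigO {k : ℕ} {f : ℝ × E → E} {w z : E} (h : HasJet k f w z) :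
    (fun t : ℝ => f (t, z) - z) =O[𝓝 0] fun t : ℝ => t ^ k := by
  have h1 : (fun t : ℝ => ((k.factorial : ℝ)⁻¹ * t ^ k) • w) =O[𝓝 0] fun t : ℝ => t ^ k := by
    refine (pow_smul_isBigO (k := k) (isBigO_const_const ((k.factorial : ℝ)⁻¹ • w) one_ne_zero _)).congr_left
      fun t => ?_
    rw [smul_smul, mul_comm]
  exact (IsLittleO.isBigO h).add h1 |>.congr_left fun t => by abel

theorem tendsto_of_sub_isBigO_pow {k : ℕ} (hk : 1 ≤ k) {u : ℝ → E} {z : E}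
    (h : (fun t : ℝ => u t - z) =O[𝓝 0] fun t : ℝ => t ^ k) : Tendsto u (𝓝 0) (𝓝 z) := by
  have h1 : Tendsto (fun t : ℝ => t ^ k) (𝓝 0) (𝓝 0) := by
    have := (continuous_pow k).tendsto (0 : ℝ)
    rwa [zero_pow (by omega)] at this
  simpa using (h.trans_tendsto h1).add_const z

namespace IsLocalFamily

variable {f g : ℝ × E → E} {z₀ : E}

theorem contDiffAt (hf : IsLocalFamily f z₀) : ContDiffAt ℝ ∞ f (0, z₀) := hf.smooth.self_of_nhds

/-- Strict differentiability at `(0, z₀)`, combined with the fact that the derivative in z is the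
identity there. This one estimate replaces any expansion of compositions: up to relatively small
errors, a local family acts on differences as the identity. -/
theorem sub_isLittleO (hf : IsLocalFamily f z₀) {u v : ℝ → E} (hu : Tendsto u (𝓝 0) (𝓝 z₀))
    (hv : Tendsto v (𝓝 0) (𝓝 z₀)) :
    (fun t => f (t, u t) - f (t, v t) - (u t - v t)) =o[𝓝 0] fun t => u t - v t := by
  have hs := hf.contDiffAt.hasStrictFDerivAt (by simp)
  have hid : ∀ h, fderiv ℝ f (0, z₀) (0, h) = h := by
    have h1 : HasFDerivAt (fun z => f (0, z)) ((fderiv ℝ f (0, z₀)).comp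
        (ContinuousLinearMap.inr ℝ ℝ E)) z₀ :=
      hs.hasFDerivAt.comp z₀ (hasFDerivAt_prodMk_right 0 z₀)
    have h2 : HasFDerivAt (fun z => f (0, z)) (ContinuousLinearMap.id ℝ E) z₀ :=
      (hasFDerivAt_id z₀).congr_of_eventuallyEq hf.zero
    intro h
    exact congrArg (fun L : E →L[ℝ] E => L h) (h1.unique h2)
  have hT : Tendsto (fun t : ℝ => (((t, u t), (t, v t)) : (ℝ × E) × (ℝ × E))) (𝓝 0)
      (𝓝 ((0, z₀), (0, z₀))) := by
    have h0 : Tendsto (fun t : ℝ => t) (𝓝 0) (𝓝 0) := tendsto_id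
    exact (h0.prodMk_nhds hu).prodMk_nhds (h0.prodMk_nhds hv)
  have h3 := hs.isLittleO.comp_tendsto hT
  refine (h3.congr_left (f₂ := fun t => f (t, u t) - f (t, v t) - (u t - v t)) fun t => ?_).trans_isBigO ?_
  · have e : ((t, u t) : ℝ × E) - (t, v t) = (0, u t - v t) := by simp
    simp only [Function.comp_apply, e, hid]
  · refine IsBigO.of_bound 1 (Eventually.of_forall fun t => ?_)
    simp [Prod.norm_def]

/-- Leading terms of equal order add up: f(t, u) - z₀ is the sum of f(t, z₀) - z₀ and u - z₀, up to
an error controlled by `sub_isLittleO`. -/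
theorem hasJet_comp (hf : IsLocalFamily f z₀) {m : ℕ} (hm : 1 ≤ m) {w w' : E} {u : ℝ → E}
    (hf' : HasJet m f w z₀)
    (hu : (fun t : ℝ => u t - z₀ - ((m.factorial : ℝ)⁻¹ * t ^ m) • w') =o[𝓝 0] fun t : ℝ => t ^ m) :
    (fun t : ℝ => f (t, u t) - z₀ - ((m.factorial : ℝ)⁻¹ * t ^ m) • (w + w')) =o[𝓝 0]
      fun t : ℝ => t ^ m := by
  have h1 : (fun t : ℝ => u t - z₀) =O[𝓝 0] fun t : ℝ => t ^ m :=
    HasJet.isBigO (f := fun q => u q.1) hu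
  have h2 := (hf.sub_isLittleO (tendsto_of_sub_isBigO_pow hm h1) tendsto_const_nhds).trans_isBigO h1
  exact ((h2.add hf').add hu).congr_left fun t => by rw [smul_add]; abel

theorem hasJet_inverse (hg : IsLocalFamily g z₀) {k : ℕ} (hk : 1 ≤ k) {w : E} (hf : HasJet k f w z₀)
    (hfg : ∀ᶠ t in 𝓝 (0 : ℝ), g (t, f (t, z₀)) = z₀) : HasJet k g (-w) z₀ := by
  have h2 := (hg.sub_isLittleO (tendsto_of_sub_isBigO_pow hk hf.isBigO)
    tendsto_const_nhds).trans_isBigO hf.isBigO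
  refine ((h2.add hf).neg_left).congr' ?_ EventuallyEq.rfl
  filter_upwards [hfg] with t ht
  simp only [ht, smul_neg]
  abel

/-- No regularity of `a` is assumed: smoothness near `z₀` comes from a = k! A(0, ·), where A is the
quotient of f(t, z) - z by t^k. -/
theorem exists_eq_pow_smul [FiniteDimensional ℝ E] (hf : IsLocalFamily f z₀) {k : ℕ} {a : E → E}
    (ha : ∀ᶠ z in 𝓝 z₀, HasJet k f (a z) z) :
    ∃ A : ℝ × E → E, ContDiff ℝ ∞ A ∧ (∀ᶠ q in 𝓝 ((0 : ℝ), z₀), f q = q.2 + q.1 ^ k • A q) ∧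
      ∀ᶠ z in 𝓝 z₀, a z = (k.factorial : ℝ) • A (0, z) := by
  have : CompleteSpace E := FiniteDimensional.complete ℝ E
  obtain ⟨A, hA, he⟩ := _root_.exists_eq_pow_smul (k := k) (G := fun q => f q - q.2) (z₀ := z₀)
    (hf.smooth.mono fun q hq => hq.sub contDiffAt_snd) (ha.mono fun z hz => hz.isBigO)
  refine ⟨A, hA, he.mono fun q hq => by rw [← hq]; abel, ?_⟩
  obtain ⟨U, hU, V, hV, hUV⟩ := mem_nhds_prod_iff.1 he
  filter_upwards [ha, hV] with z hz hzV
  have h1 : (fun t : ℝ => t ^ k • (A (t, z) - A (0, z))) =o[𝓝 0] fun t : ℝ => t ^ k := by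
    refine pow_smul_isLittleO ((isLittleO_one_iff ℝ).2 ?_)
    have : Continuous fun t : ℝ => A (t, z) - A (0, z) :=
      (hA.continuous.comp (by fun_prop)).sub continuous_const
    simpa using this.tendsto 0
  have h2 : (fun t : ℝ => t ^ k • (A (t, z) - (k.factorial : ℝ)⁻¹ • a z)) =o[𝓝 0]
      fun t : ℝ => t ^ k := by
    refine IsLittleO.congr' hz ?_ EventuallyEq.rfl
    filter_upwards [hU] with t ht
    have e : f (t, z) - z = t ^ k • A (t, z) := hUV (mk_mem_prod ht hzV)
    rw [e, smul_sub, smul_smul, mul_comm]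
  have h3 := eq_zero_of_pow_smul_isLittleO ((h2.sub h1).congr_left fun t => by
    rw [← smul_sub, sub_sub_sub_cancel_left])
  rw [sub_eq_zero.1 h3, smul_smul, mul_inv_cancel₀, one_smul]
  exact_mod_cast k.factorial_ne_zero

/-- The effect of the inner map z + t^l B on the leading part t^k A of the outer one. It accounts
for one of the two halves of a commutator. -/
theorem pow_smul_sub_isLittleO {A B : ℝ × E → E} (hA : ContDiff ℝ ∞ A) (hB : ContDiff ℝ ∞ B) (z₀ : E)
    (k : ℕ) {l : ℕ} (hl : 1 ≤ l) :
    (fun t : ℝ => t ^ k • (A (t, z₀ + t ^ l • B (t, z₀)) - A (t, z₀)) -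
      t ^ (k + l) • fderiv ℝ A (0, z₀) (0, B (0, z₀))) =o[𝓝 0] fun t : ℝ => t ^ (k + l) := by
  have hs := hA.contDiffAt.hasStrictFDerivAt (x := (0, z₀)) (by simp)
  have hBt : Tendsto (fun t : ℝ => B (t, z₀)) (𝓝 0) (𝓝 (B (0, z₀))) :=
    (hB.continuous.comp (by fun_prop : Continuous fun t : ℝ => (t, z₀))).tendsto 0
  have hO : (fun t : ℝ => t ^ l • B (t, z₀)) =O[𝓝 0] fun t : ℝ => t ^ l :=
    pow_smul_isBigO (hBt.isBigO_one ℝ)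
  have hu : Tendsto (fun t : ℝ => z₀ + t ^ l • B (t, z₀)) (𝓝 0) (𝓝 z₀) :=
    tendsto_of_sub_isBigO_pow hl (hO.congr_left fun t => by abel)
  have hT : Tendsto (fun t : ℝ => (((t, z₀ + t ^ l • B (t, z₀)), (t, z₀)) : (ℝ × E) × (ℝ × E))) (𝓝 0)
      (𝓝 ((0, z₀), (0, z₀))) := by
    have h0 : Tendsto (fun t : ℝ => t) (𝓝 0) (𝓝 0) := tendsto_id
    exact (h0.prodMk_nhds hu).prodMk_nhds (h0.prodMk_nhds tendsto_const_nhds)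
  have e : ∀ t : ℝ, ((t, z₀ + t ^ l • B (t, z₀)) : ℝ × E) - (t, z₀) = (0, t ^ l • B (t, z₀)) := by
    intro t; simp
  have h1 : (fun t : ℝ => A (t, z₀ + t ^ l • B (t, z₀)) - A (t, z₀) -
      fderiv ℝ A (0, z₀) (0, t ^ l • B (t, z₀))) =o[𝓝 0] fun t : ℝ => t ^ l := by
    refine ((hs.isLittleO.comp_tendsto hT).congr_left fun t => ?_).trans_isBigO (IsBigO.trans ?_ hO)
    · simp only [Function.comp_apply, e]
    · refine IsBigO.of_bound 1 (Eventually.of_forall fun t => ?_)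
      simp [Prod.norm_def]
  have h2 : (fun t : ℝ => t ^ l • fderiv ℝ A (0, z₀) (0, B (t, z₀) - B (0, z₀))) =o[𝓝 0]
      fun t : ℝ => t ^ l := by
    refine pow_smul_isLittleO ((isLittleO_one_iff ℝ).2 ?_)
    have h3 : Tendsto (fun t : ℝ => ((0 : ℝ), B (t, z₀) - B (0, z₀))) (𝓝 0) (𝓝 (0, 0)) :=
      tendsto_const_nhds.prodMk_nhds (by simpa using hBt.sub_const (B (0, z₀)))
    have h4 := ((fderiv ℝ A (0, z₀)).continuous.tendsto (0, 0)).comp h3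
    rwa [show ((0 : ℝ), (0 : E)) = 0 from rfl, map_zero] at h4
  have h5 := ((isBigO_refl (fun t : ℝ => t ^ k) (𝓝 0)).smul_isLittleO (h1.add h2))
  refine (h5.congr (fun t => ?_) fun t => ?_)
  · have e1 : ((0 : ℝ), t ^ l • B (t, z₀)) = t ^ l • (0, B (t, z₀)) := by simp
    have e2 : ((0 : ℝ), B (t, z₀) - B (0, z₀)) = (0, B (t, z₀)) - (0, B (0, z₀)) := by simp
    rw [e1, e2, map_smul, map_sub, pow_add, mul_smul]
    module
  · rw [pow_add, smul_eq_mul]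

/-- The leading term of `f_t ∘ g_t - g_t ∘ f_t`. -/
theorem comp_sub_comp_isLittleO [FiniteDimensional ℝ E] (hf : IsLocalFamily f z₀)
    (hg : IsLocalFamily g z₀) {k l : ℕ} (hk : 1 ≤ k) (hl : 1 ≤ l) {a b : E → E}
    (ha : ∀ᶠ z in 𝓝 z₀, HasJet k f (a z) z) (hb : ∀ᶠ z in 𝓝 z₀, HasJet l g (b z) z) :
    (fun t : ℝ => f (t, g (t, z₀)) - g (t, f (t, z₀)) -
      (((k.factorial * l.factorial : ℝ))⁻¹ * t ^ (k + l)) •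
        (fderiv ℝ a z₀ (b z₀) - fderiv ℝ b z₀ (a z₀))) =o[𝓝 0] fun t : ℝ => t ^ (k + l) := by
  obtain ⟨A, hA, hfA, haA⟩ := hf.exists_eq_pow_smul ha
  obtain ⟨B, hB, hgB, hbB⟩ := hg.exists_eq_pow_smul hb
  -- Since a = k! A(0, ·) near `z₀`, the derivative of a is k! times the spatial derivative of A at
  -- t = 0.
  have hD : ∀ (A : ℝ × E → E) (a : E → E) (k : ℕ), ContDiff ℝ ∞ A →
      (∀ᶠ z in 𝓝 z₀, a z = (k.factorial : ℝ) • A (0, z)) →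
      ∀ h, fderiv ℝ a z₀ h = (k.factorial : ℝ) • fderiv ℝ A (0, z₀) (0, h) := by
    intro A a k hA haA h
    have h1 : HasFDerivAt (fun z => (k.factorial : ℝ) • A (0, z)) ((k.factorial : ℝ) •
        (fderiv ℝ A (0, z₀)).comp (ContinuousLinearMap.inr ℝ ℝ E)) z₀ :=
      (((hA.differentiable (by simp)) (0, z₀)).hasFDerivAt.comp z₀
        (hasFDerivAt_prodMk_right 0 z₀)).const_smul _
    rw [(h1.congr_of_eventuallyEq haA).fderiv]
    rfl
  have hk0 : (k.factorial : ℝ) ≠ 0 := by exact_mod_cast k.factorial_ne_zero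
  have hl0 : (l.factorial : ℝ) ≠ 0 := by exact_mod_cast l.factorial_ne_zero
  have h1 := pow_smul_sub_isLittleO hA hB z₀ k hl
  have h2 := pow_smul_sub_isLittleO hB hA z₀ l hk
  rw [add_comm l k] at h2
  have h0 : Tendsto (fun t : ℝ => t) (𝓝 0) (𝓝 0) := tendsto_id
  have ht0 : Tendsto (fun t : ℝ => (t, z₀)) (𝓝 0) (𝓝 (0, z₀)) := h0.prodMk_nhds tendsto_const_nhds
  have htg : Tendsto (fun t : ℝ => (t, g (t, z₀))) (𝓝 0) (𝓝 (0, z₀)) :=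
    h0.prodMk_nhds (tendsto_of_sub_isBigO_pow hl hb.self_of_nhds.isBigO)
  have htf : Tendsto (fun t : ℝ => (t, f (t, z₀))) (𝓝 0) (𝓝 (0, z₀)) :=
    h0.prodMk_nhds (tendsto_of_sub_isBigO_pow hk ha.self_of_nhds.isBigO)
  -- With f = z + t^k A and g = z + t^l B, the terms z + t^k A + t^l B cancel in f ∘ g - g ∘ f. What
  -- remains is the difference of the two increments in `h1` and `h2`.
  refine (h1.sub h2).congr' ?_ EventuallyEq.rfl
  filter_upwards [ht0.eventually hfA, ht0.eventually hgB, htg.eventually hfA, htf.eventually hgB]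
    with t e1 e2 e3 e4
  have c1 : (((k.factorial * l.factorial : ℝ))⁻¹ * t ^ (k + l)) •
        (fderiv ℝ a z₀ (b z₀) - fderiv ℝ b z₀ (a z₀)) =
      t ^ (k + l) • fderiv ℝ A (0, z₀) (0, B (0, z₀)) -
        t ^ (k + l) • fderiv ℝ B (0, z₀) (0, A (0, z₀)) := by
    have s1 : ∀ (c : ℝ) (v : E), ((0 : ℝ), c • v) = c • ((0 : ℝ), v) := by simp
    rw [hD A a k hA haA, hD B b l hB hbB, haA.self_of_nhds, hbB.self_of_nhds, s1, s1, map_smul,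
      map_smul, smul_sub, smul_smul, smul_smul, smul_smul, smul_smul]
    congr 2 <;> field_simp
  rw [c1, e3, e4, ← e1, ← e2]
  rw [e1, e2]
  module

end IsLocalFamily

/-- Used with l = 1 to multiply leading terms by positive constants, and with α = 1 to bring two
families to the common order kl. -/
theorem HasJet.reparametrize {k l : ℕ} (hl : 1 ≤ l) {f : ℝ × E → E} {w z : E}
    (h : HasJet k f w z) (α : ℝ) : HasJet (k * l) (fun q => f (α * q.1 ^ l, q.2))
      (((k * l).factorial * (k.factorial : ℝ)⁻¹ * α ^ k) • w) z := by
  have hT : Tendsto (fun t : ℝ => α * t ^ l) (𝓝 0) (𝓝 0) := by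
    have : Continuous fun t : ℝ => α * t ^ l := by fun_prop
    simpa [show l ≠ 0 by omega] using this.tendsto 0
  have h1 := IsLittleO.comp_tendsto h hT
  refine IsLittleO.trans_isBigO (h1.congr_left fun t => ?_) ?_ (g := fun t : ℝ => (α * t ^ l) ^ k)
  · simp only [Function.comp_apply]
    rw [smul_smul]
    congr 2
    have : ((k * l).factorial : ℝ) ≠ 0 := by exact_mod_cast (k * l).factorial_ne_zero
    rw [mul_pow, ← pow_mul, mul_comm l k]
    field_simp
  · refine IsBigO.of_bound ‖α ^ k‖ (Eventually.of_forall fun t => ?_)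
    rw [mul_pow, ← pow_mul, mul_comm l k, norm_mul]

end LocalFamilies

/-! ### Families of maps of a manifold and their leading terms in charts. -/

section TangentAlgebra

open Asymptotics

universe u

variable {E : Type u} [NormedAddCommGroup E] [NormedSpace ℝ E]
  {N : Type*} [TopologicalSpace N] [ChartedSpace E N]

/-- The expression of a family of maps of `N` in the preferred chart at `p`. -/
noncomputable def localRep (p : N) (φ : ℝ → N → N) (q : ℝ × E) : E :=
  extChartAt 𝓘(ℝ, E) p (φ q.1 ((extChartAt 𝓘(ℝ, E) p).symm q.2))

/-- `φ_t(p)` is smooth in `(t, p)` for `|t| < ε`. -/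
abbrev SmoothOnIoo (ε : ℝ) (φ : ℝ → N → N) : Prop :=
  ContMDiffOn (𝓘(ℝ, ℝ).prod 𝓘(ℝ, E)) 𝓘(ℝ, E) ∞ (fun z : ℝ × N => φ z.1 z.2) (Ioo (-ε) ε ×ˢ univ)

namespace SmoothOnIoo

variable {ε δ : ℝ} {φ ψ : ℝ → N → N}

theorem contMDiffAt (h : SmoothOnIoo (E := E) ε φ) {t : ℝ} (ht : t ∈ Ioo (-ε) ε) (q : N) :
    ContMDiffAt (𝓘(ℝ, ℝ).prod 𝓘(ℝ, E)) 𝓘(ℝ, E) ∞ (fun z : ℝ × N => φ z.1 z.2) (t, q) :=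
  ContMDiffOn.contMDiffAt h ((isOpen_Ioo.prod isOpen_univ).mem_nhds ⟨ht, mem_univ q⟩)

theorem mono (h : SmoothOnIoo (E := E) ε φ) (hδ : δ ≤ ε) : SmoothOnIoo (E := E) δ φ :=
  ContMDiffOn.mono h (prod_mono (Ioo_subset_Ioo (by linarith) hδ) subset_rfl)

theorem comp (hφ : SmoothOnIoo (E := E) ε φ) (hψ : SmoothOnIoo (E := E) ε ψ) :
    SmoothOnIoo (E := E) ε fun t q => φ t (ψ t q) :=
  ContMDiffOn.comp hφ (contMDiff_fst.contMDiffOn.prodMk hψ) fun _ hz => ⟨hz.1, mem_univ _⟩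

theorem reparametrize (hφ : SmoothOnIoo (E := E) ε φ) {r : ℝ → ℝ} (hr : ContDiff ℝ ∞ r)
    (hm : MapsTo r (Ioo (-δ) δ) (Ioo (-ε) ε)) : SmoothOnIoo (E := E) δ fun t q => φ (r t) q :=
  ContMDiffOn.comp hφ ((hr.contMDiff.comp contMDiff_fst).prodMk contMDiff_snd).contMDiffOn
    fun _ hz => ⟨hm hz.1, mem_univ _⟩

variable [IsManifold 𝓘(ℝ, E) ∞ N]

theorem contDiffAt_chart (hφ : SmoothOnIoo (E := E) ε φ) {t : ℝ} (ht : t ∈ Ioo (-ε) ε) {q p : N} {z : E}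
    (hz : z ∈ (extChartAt 𝓘(ℝ, E) q).target)
    (hs : φ t ((extChartAt 𝓘(ℝ, E) q).symm z) ∈ (extChartAt 𝓘(ℝ, E) p).source) :
    ContDiffAt ℝ ∞ (fun x : ℝ × E =>
      extChartAt 𝓘(ℝ, E) p (φ x.1 ((extChartAt 𝓘(ℝ, E) q).symm x.2))) (t, z) := by
  have h1 : ContMDiffAt 𝓘(ℝ, E) 𝓘(ℝ, E) ∞ (extChartAt 𝓘(ℝ, E) q).symm z :=
    (contMDiffOn_extChartAt_symm q).contMDiffAt (extChartAt_target_mem_nhds' hz)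
  have h2 : ContMDiffAt (𝓘(ℝ, ℝ).prod 𝓘(ℝ, E)) 𝓘(ℝ, E) ∞
      (fun x : ℝ × E => φ x.1 ((extChartAt 𝓘(ℝ, E) q).symm x.2)) (t, z) :=
    (hφ.contMDiffAt ht _).comp (t, z) (contMDiffAt_fst.prodMk (h1.comp (t, z) contMDiffAt_snd))
  have h3 : ContMDiffAt 𝓘(ℝ, E) 𝓘(ℝ, E) ∞ (extChartAt 𝓘(ℝ, E) p)
      (φ t ((extChartAt 𝓘(ℝ, E) q).symm z)) :=
    contMDiffAt_extChartAt' (by rwa [extChartAt_source] at hs)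
  have h4 := h3.comp (t, z) h2
  rw [← modelWithCornersSelf_prod, chartedSpaceSelf_prod] at h4
  exact h4.contDiffAt

theorem tendsto_symm (hφ : SmoothOnIoo (E := E) ε φ) {t : ℝ} (ht : t ∈ Ioo (-ε) ε) {q : N} {z : E}
    (hz : z ∈ (extChartAt 𝓘(ℝ, E) q).target) :
    ContinuousAt (fun x : ℝ × E => φ x.1 ((extChartAt 𝓘(ℝ, E) q).symm x.2)) (t, z) := by
  have h1 : ContinuousAt (fun x : ℝ × E => (extChartAt 𝓘(ℝ, E) q).symm x.2) (t, z) :=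
    ContinuousAt.comp (f := Prod.snd) (continuousAt_extChartAt_symm'' hz) continuousAt_snd
  exact ContinuousAt.comp (x := (t, z)) (g := fun z : ℝ × N => φ z.1 z.2)
    (hφ.contMDiffAt ht _).continuousAt (continuousAt_fst.prodMk h1)

theorem eventually_localRep_mem (hφ : SmoothOnIoo (E := E) ε φ) (hε : 0 < ε) (h0 : φ 0 = id) (p : N) :
    ∀ᶠ x in 𝓝 ((0 : ℝ), extChartAt 𝓘(ℝ, E) p p), x.1 ∈ Ioo (-ε) ε ∧
      x.2 ∈ (extChartAt 𝓘(ℝ, E) p).target ∧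
      φ x.1 ((extChartAt 𝓘(ℝ, E) p).symm x.2) ∈ (extChartAt 𝓘(ℝ, E) p).source := by
  have hI : (0 : ℝ) ∈ Ioo (-ε) ε := ⟨by linarith, hε⟩
  have h1 := hφ.tendsto_symm hI (mem_extChartAt_target (I := 𝓘(ℝ, E)) p)
  have h2 : φ 0 ((extChartAt 𝓘(ℝ, E) p).symm (extChartAt 𝓘(ℝ, E) p p)) ∈
      (extChartAt 𝓘(ℝ, E) p).source := by
    rw [extChartAt_to_inv, h0]; exact mem_extChartAt_source p
  have h3 : Tendsto (fun x : ℝ × E => x.2) (𝓝 ((0 : ℝ), extChartAt 𝓘(ℝ, E) p p))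
      (𝓝 (extChartAt 𝓘(ℝ, E) p p)) := continuous_snd.tendsto _
  exact (continuousAt_fst.eventually (isOpen_Ioo.mem_nhds hI)).and
    ((h3.eventually (extChartAt_target_mem_nhds (I := 𝓘(ℝ, E)) p)).and
      (h1.eventually ((isOpen_extChartAt_source p).mem_nhds h2)))

theorem isLocalFamily (hφ : SmoothOnIoo (E := E) ε φ) (hε : 0 < ε) (h0 : φ 0 = id) (p : N) :
    IsLocalFamily (localRep p φ) (extChartAt 𝓘(ℝ, E) p p) where
  smooth := (hφ.eventually_localRep_mem hε h0 p).mono fun x hx => hφ.contDiffAt_chart hx.1 hx.2.1 hx.2.2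
  zero := by
    filter_upwards [extChartAt_target_mem_nhds (I := 𝓘(ℝ, E)) p] with z hz
    simp only [localRep, h0, id]
    exact (extChartAt 𝓘(ℝ, E) p).right_inv hz

theorem localRep_comp (hψ : SmoothOnIoo (E := E) ε ψ) (hε : 0 < ε) (h0 : ψ 0 = id) (p : N) :
    ∀ᶠ x in 𝓝 ((0 : ℝ), extChartAt 𝓘(ℝ, E) p p),
      localRep p (fun t q => φ t (ψ t q)) x = localRep p φ (x.1, localRep p ψ x) := by
  filter_upwards [hψ.eventually_localRep_mem hε h0 p] with x hx
  simp only [localRep]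
  rw [(extChartAt 𝓘(ℝ, E) p).left_inv hx.2.2]

/-- Trades the defining conditions on iterated derivatives for an asymptotic expansion, which is
easy to compose, invert and reparametrize. -/
theorem isIntegralCurveOfOrder_iff (hφ : SmoothOnIoo (E := E) ε φ) (hε : 0 < ε) (h0 : φ 0 = id) (p : N)
    {k : ℕ} (hk : 1 ≤ k) (X : E) :
    IsIntegralCurveOfOrder (I := 𝓘(ℝ, E)) k (fun t => φ t p) p (X : TangentSpace 𝓘(ℝ, E) p) ↔
      HasJet k (localRep p φ) X (extChartAt 𝓘(ℝ, E) p p) := by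
  have ht : Tendsto (fun t : ℝ => (t, extChartAt 𝓘(ℝ, E) p p)) (𝓝 0) (𝓝 (0, extChartAt 𝓘(ℝ, E) p p)) :=
    tendsto_id.prodMk_nhds tendsto_const_nhds
  have e : ∀ t, extChartAt 𝓘(ℝ, E) p (φ t p) = localRep p φ (t, extChartAt 𝓘(ℝ, E) p p) := by
    intro t
    simp only [localRep, extChartAt_to_inv]
  have hc : ∀ᶠ t in 𝓝 (0 : ℝ), ContDiffAt ℝ ∞ (fun t => extChartAt 𝓘(ℝ, E) p (φ t p)) t := by
    filter_upwards [ht.eventually (hφ.isLocalFamily hε h0 p).smooth] with t ht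
    simp_rw [e]
    exact ContDiffAt.comp (f := fun t : ℝ => (t, extChartAt 𝓘(ℝ, E) p p)) t ht
      (contDiffAt_id.prodMk contDiffAt_const)
  have h := iteratedDeriv_eq_iff_isLittleO hk hc X
  have h00 : φ 0 p = p := by rw [h0]; rfl
  refine Iff.trans (and_iff_right h00) (h.trans ?_)
  rw [h00]
  simp_rw [e]
  exact Iff.rfl

theorem eventually_contMDiffAt_curve (hφ : SmoothOnIoo (E := E) ε φ) (hε : 0 < ε) (q : N) :
    ContMDiffAt 𝓘(ℝ, ℝ) 𝓘(ℝ, E) ∞ (fun t => φ t q) 0 :=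
  (hφ.contMDiffAt (t := 0) ⟨by linarith, hε⟩ q).comp (0 : ℝ) (contMDiffAt_id.prodMk contMDiffAt_const)

end SmoothOnIoo

variable [IsManifold 𝓘(ℝ, E) ∞ N]

theorem hasFDerivAt_of_range_modelWithCornersSelf {F : Type*} [NormedAddCommGroup F] [NormedSpace ℝ F]
    {g : E → F} {L : E →L[ℝ] F} {z : E} (h : HasFDerivWithinAt g L (range 𝓘(ℝ, E)) z) :
    HasFDerivAt g L z := by
  rwa [modelWithCornersSelf_coe, range_id, hasFDerivWithinAt_univ] at h

/-- The leading term of a curve read through a differentiable map. -/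
theorem isLittleO_of_hasFDerivAt {F : Type*} [NormedAddCommGroup F] [NormedSpace ℝ F] {g : E → F}
    {g' : E →L[ℝ] F} {z w : E} {k : ℕ} (hk : 1 ≤ k) (hg : HasFDerivAt g g' z) {c : ℝ → E}
    (hc : (fun t : ℝ => c t - z - ((k.factorial : ℝ)⁻¹ * t ^ k) • w) =o[𝓝 0] fun t : ℝ => t ^ k) :
    (fun t : ℝ => g (c t) - g z - ((k.factorial : ℝ)⁻¹ * t ^ k) • g' w) =o[𝓝 0] fun t : ℝ => t ^ k := by
  have h1 : (fun t : ℝ => c t - z) =O[𝓝 0] fun t : ℝ => t ^ k :=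
    HasJet.isBigO (f := fun q => c q.1) hc
  have h2 := (hg.isLittleO.comp_tendsto (tendsto_of_sub_isBigO_pow hk h1)).trans_isBigO h1
  have h3 := (g'.isBigO_comp (fun t : ℝ => c t - z - ((k.factorial : ℝ)⁻¹ * t ^ k) • w)
    (𝓝 0)).trans_isLittleO hc
  refine (h2.add h3).congr_left fun t => ?_
  simp only [Function.comp_apply, map_sub, map_smul]
  abel

/-- The components of a vector field in the preferred chart at `p`. -/
noncomputable def chartField (p : N) (X : ∀ q : N, TangentSpace 𝓘(ℝ, E) q) : E → E :=
  mpullbackWithin 𝓘(ℝ, E) 𝓘(ℝ, E) (extChartAt 𝓘(ℝ, E) p).symm X (range 𝓘(ℝ, E))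

theorem chartField_apply (p : N) (X : ∀ q : N, TangentSpace 𝓘(ℝ, E) q) {z : E}
    (hz : z ∈ (extChartAt 𝓘(ℝ, E) p).target) :
    chartField p X z = mfderiv 𝓘(ℝ, E) 𝓘(ℝ, E) (extChartAt 𝓘(ℝ, E) p)
      ((extChartAt 𝓘(ℝ, E) p).symm z) (X ((extChartAt 𝓘(ℝ, E) p).symm z)) := by
  have : IsManifold 𝓘(ℝ, E) 1 N := IsManifold.of_le (n := ∞) (by simp)
  rw [chartField, mpullbackWithin_apply]
  exact (isInvertible_mfderivWithin_extChartAt_symm hz).inverse_apply_eq.2 (congrArg (fun L : TangentSpace 𝓘(ℝ, E) ((extChartAt 𝓘(ℝ, E) p).symm z) →L[ℝ]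
    TangentSpace 𝓘(ℝ, E) ((extChartAt 𝓘(ℝ, E) p).symm z) => L (X ((extChartAt 𝓘(ℝ, E) p).symm z)))
    (mfderivWithin_extChartAt_symm_comp_mfderiv_extChartAt hz)).symm

theorem chartField_self (p : N) (X : ∀ q : N, TangentSpace 𝓘(ℝ, E) q) :
    chartField p X (extChartAt 𝓘(ℝ, E) p p) = X p := by
  have : IsManifold 𝓘(ℝ, E) 1 N := IsManifold.of_le (n := ∞) (by simp)
  rw [chartField_apply p X (mem_extChartAt_target p), extChartAt_to_inv, mfderiv_extChartAt_self]
  rfl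

variable [CompleteSpace E]

/-- The derivative of the preferred chart at its own center is the identity, so no change of frame
appears when the bracket is computed there. -/
theorem mlieBracket_eq_fderiv_chartField (X Y : ∀ q : N, TangentSpace 𝓘(ℝ, E) q) (p : N) :
    mlieBracket 𝓘(ℝ, E) X Y p =
      fderiv ℝ (chartField p Y) (extChartAt 𝓘(ℝ, E) p p) (X p) -
        fderiv ℝ (chartField p X) (extChartAt 𝓘(ℝ, E) p p) (Y p) := by
  have : IsManifold 𝓘(ℝ, E) 1 N := IsManifold.of_le (n := ∞) (by simp)
  rw [← mlieBracketWithin_univ, mlieBracketWithin_apply, mfderiv_extChartAt_self]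
  simp only [preimage_univ, univ_inter]
  change (ContinuousLinearMap.id ℝ E).inverse (lieBracketWithin ℝ (chartField p X) (chartField p Y)
    (range 𝓘(ℝ, E)) (extChartAt 𝓘(ℝ, E) p p)) = _
  rw [ContinuousLinearMap.inverse_id, modelWithCornersSelf_coe, range_id, lieBracketWithin_univ,
    lieBracket, chartField_self, chartField_self]
  rfl

/-- The commutator formula differentiates the leading term in the base point, so the expansions at
all points near `p` are needed in the single chart at `p`. The hypothesis gives each one in the
chart at its own point; the change of charts carries the leading term by its derivative. -/
theorem SmoothOnIoo.eventually_hasJet {ε : ℝ} {φ : ℝ → N → N} (hφ : SmoothOnIoo (E := E) ε φ)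
    (hε : 0 < ε) (h0 : φ 0 = id) {k : ℕ} (hk : 1 ≤ k) {X : ∀ q : N, TangentSpace 𝓘(ℝ, E) q}
    (hX : ∀ q, IsIntegralCurveOfOrder (I := 𝓘(ℝ, E)) k (fun t => φ t q) q (X q)) (p : N) :
    ∀ᶠ z in 𝓝 (extChartAt 𝓘(ℝ, E) p p), HasJet k (localRep p φ) (chartField p X z) z := by
  have : IsManifold 𝓘(ℝ, E) 1 N := IsManifold.of_le (n := ∞) (by simp)
  filter_upwards [extChartAt_target_mem_nhds (I := 𝓘(ℝ, E)) p] with z hz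
  set q := (extChartAt 𝓘(ℝ, E) p).symm z with hq
  have hqs : q ∈ (extChartAt 𝓘(ℝ, E) p).source := (extChartAt 𝓘(ℝ, E) p).map_target hz
  have h1 := (hφ.isIntegralCurveOfOrder_iff hε h0 q hk (X q)).1 (hX q)
  have hd : MDifferentiableAt 𝓘(ℝ, E) 𝓘(ℝ, E) (extChartAt 𝓘(ℝ, E) p) q :=
    mdifferentiableAt_extChartAt (by rwa [extChartAt_source] at hqs)
  have h2 : HasFDerivAt (fun x => extChartAt 𝓘(ℝ, E) p ((extChartAt 𝓘(ℝ, E) q).symm x))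
      (mfderiv 𝓘(ℝ, E) 𝓘(ℝ, E) (extChartAt 𝓘(ℝ, E) p) q : E →L[ℝ] E) (extChartAt 𝓘(ℝ, E) q q) := by
    exact hasFDerivAt_of_range_modelWithCornersSelf hd.hasMFDerivAt.2
  have h3 := isLittleO_of_hasFDerivAt hk h2 h1
  rw [HasJet, chartField_apply p X hz]
  refine IsLittleO.congr' h3 ?_ EventuallyEq.rfl
  have hc := (hφ.eventually_contMDiffAt_curve hε q).continuousAt
  have h00 : φ 0 q = q := by rw [h0]; rfl
  have hs : (extChartAt 𝓘(ℝ, E) q).source ∈ 𝓝 (φ 0 q) := by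
    rw [h00]; exact extChartAt_source_mem_nhds q
  filter_upwards [hc.eventually hs] with t ht
  simp only [localRep, extChartAt_to_inv, ← hq]
  rw [(extChartAt 𝓘(ℝ, E) q).left_inv ht]
  congr 2
  exact (extChartAt 𝓘(ℝ, E) p).right_inv hz

end TangentAlgebra

/-! ### The Lie algebra of vector fields tangent to a group of diffeomorphisms. -/

section TangentSubgroup

open Asymptotics

universe u

variable {E : Type u} [NormedAddCommGroup E] [NormedSpace ℝ E]
  {N : Type*} [TopologicalSpace N] [ChartedSpace E N] [IsManifold 𝓘(ℝ, E) ∞ N]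

/-- The inverses of a smooth family of diffeomorphisms form a smooth family. -/
theorem SmoothOnIoo.symm [CompleteSpace E] {ε : ℝ} {φ : ℝ → N ≃ₘ⟮𝓘(ℝ, E), 𝓘(ℝ, E)⟯ N}
    (hφ : SmoothOnIoo (E := E) ε fun t => φ t) : SmoothOnIoo (E := E) ε fun t => (φ t).symm := by
  rintro ⟨t₀, p₀⟩ ⟨ht₀, -⟩
  refine ContMDiffAt.contMDiffWithinAt ?_
  simp only at ht₀
  set q₀ := (φ t₀).symm p₀ with hq₀
  have hφq : φ t₀ q₀ = p₀ := (φ t₀).apply_symm_apply p₀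
  set cp := extChartAt 𝓘(ℝ, E) p₀ with hcp
  set cq := extChartAt 𝓘(ℝ, E) q₀ with hcq
  let f : ℝ × E → E := fun x => cp (φ x.1 (cq.symm x.2))
  have hz : cq q₀ ∈ cq.target := mem_extChartAt_target q₀
  have hw : cp p₀ ∈ cp.target := mem_extChartAt_target p₀
  have hφz : φ t₀ (cq.symm (cq q₀)) = p₀ := by rw [extChartAt_to_inv, hφq]
  have hf : ContDiffAt ℝ ∞ f (t₀, cq q₀) := hφ.contDiffAt_chart ht₀ hz (by
    rw [hφz]; exact mem_extChartAt_source p₀)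
  -- A single diffeomorphism viewed as a constant family, so that the chart smoothness of families
  -- applies to `φ t₀` and its inverse.
  have hconst : ∀ Ψ : N ≃ₘ⟮𝓘(ℝ, E), 𝓘(ℝ, E)⟯ N, SmoothOnIoo (E := E) 1 fun _ : ℝ => Ψ := fun Ψ =>
    (Ψ.contMDiff.comp contMDiff_snd).contMDiffOn
  have h01 : (0 : ℝ) ∈ Ioo (-1 : ℝ) 1 := by norm_num
  have hin : ∀ z : E, ContDiffAt ℝ ∞ (fun z : E => ((0 : ℝ), z)) z := fun z =>
    contDiffAt_const.prodMk contDiffAt_id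
  have hf0 : ContDiffAt ℝ ∞ (fun z => cp (φ t₀ (cq.symm z))) (cq q₀) :=
    ContDiffAt.comp (f := fun z : E => ((0 : ℝ), z)) (cq q₀)
      ((hconst (φ t₀)).contDiffAt_chart h01 hz (by rw [hφz]; exact mem_extChartAt_source p₀))
      (hin _)
  have hφw : (φ t₀).symm (cp.symm (cp p₀)) = q₀ := by rw [extChartAt_to_inv]
  have hg0 : ContDiffAt ℝ ∞ (fun w => cq ((φ t₀).symm (cp.symm w))) (cp p₀) :=
    ContDiffAt.comp (f := fun z : E => ((0 : ℝ), z)) (cp p₀)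
      ((hconst (φ t₀).symm).contDiffAt_chart h01 hw (by rw [hφw]; exact mem_extChartAt_source q₀))
      (hin _)
  have hgf : ∀ᶠ z in 𝓝 (cq q₀), cq ((φ t₀).symm (cp.symm (cp (φ t₀ (cq.symm z))))) = z := by
    have h1 : ContinuousAt (fun z => φ t₀ (cq.symm z)) (cq q₀) :=
      (φ t₀).continuous.continuousAt.comp (continuousAt_extChartAt_symm q₀)
    have h2 : cp.source ∈ 𝓝 (φ t₀ (cq.symm (cq q₀))) := by
      rw [hφz]; exact extChartAt_source_mem_nhds p₀
    filter_upwards [h1.eventually h2, extChartAt_target_mem_nhds (I := 𝓘(ℝ, E)) q₀] with z h3 h4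
    rw [cp.left_inv h3, (φ t₀).symm_apply_apply, cq.right_inv h4]
  have hfg : ∀ᶠ w in 𝓝 (cp p₀), cp (φ t₀ (cq.symm (cq ((φ t₀).symm (cp.symm w))))) = w := by
    have h1 : ContinuousAt (fun w => (φ t₀).symm (cp.symm w)) (cp p₀) :=
      (φ t₀).symm.continuous.continuousAt.comp (continuousAt_extChartAt_symm p₀)
    have h2 : cq.source ∈ 𝓝 ((φ t₀).symm (cp.symm (cp p₀))) := by
      rw [hφw]; exact extChartAt_source_mem_nhds q₀
    filter_upwards [h1.eventually h2, extChartAt_target_mem_nhds (I := 𝓘(ℝ, E)) p₀] with z h3 h4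
    rw [cq.left_inv h3, (φ t₀).apply_symm_apply, cp.right_inv h4]
  have e1 : cp (φ t₀ (cq.symm (cq q₀))) = cp p₀ := by rw [hφz]
  have e2 : cq ((φ t₀).symm (cp.symm (cp p₀))) = cq q₀ := by rw [hφw]
  have hf' := (hf0.differentiableAt (by simp)).hasFDerivAt
  have hg' := (hg0.differentiableAt (by simp)).hasFDerivAt
  set A := fderiv ℝ (fun z => cp (φ t₀ (cq.symm z))) (cq q₀)
  set A' := fderiv ℝ (fun w => cq ((φ t₀).symm (cp.symm w))) (cp p₀)
  -- The spatial derivative of `φ t₀` is invertible because `φ t₀` has a smooth inverse.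
  have hA1 : A'.comp A = ContinuousLinearMap.id ℝ E := by
    rw [← e1] at hg'
    exact ((hg'.comp (cq q₀) hf').congr_of_eventuallyEq (hgf.mono fun z hz => hz.symm)).unique
      (hasFDerivAt_id _)
  have hA2 : A.comp A' = ContinuousLinearMap.id ℝ E := by
    rw [← e2] at hf'
    exact ((hf'.comp (cp p₀) hg').congr_of_eventuallyEq (hfg.mono fun z hz => hz.symm)).unique
      (hasFDerivAt_id _)
  have hA1' : ∀ v, A' (A v) = v := fun v => congrArg (fun L : E →L[ℝ] E => L v) hA1
  have hA2' : ∀ v, A (A' v) = v := fun v => congrArg (fun L : E →L[ℝ] E => L v) hA2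
  have hdf := (hf.differentiableAt (by simp)).hasFDerivAt
  set D := fderiv ℝ f (t₀, cq q₀)
  have hDA : ∀ v, D (0, v) = A v := fun v =>
    congrArg (fun L : E →L[ℝ] E => L v) ((hdf.comp (cq q₀) (hasFDerivAt_prodMk_right t₀ (cq q₀))).unique hf')
  let b : ℝ →L[ℝ] E := D.comp (ContinuousLinearMap.inl ℝ ℝ E)
  have hD : ∀ x : ℝ × E, D x = b x.1 + A x.2 := fun x => by
    rw [← hDA]
    simp only [b, ContinuousLinearMap.comp_apply, ContinuousLinearMap.inl_apply, ← map_add]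
    simp
  let L : (ℝ × E) ≃L[ℝ] (ℝ × E) := ContinuousLinearEquiv.equivOfInverse
    ((ContinuousLinearMap.fst ℝ ℝ E).prod D)
    ((ContinuousLinearMap.fst ℝ ℝ E).prod (A'.comp
      (ContinuousLinearMap.snd ℝ ℝ E - b.comp (ContinuousLinearMap.fst ℝ ℝ E))))
    (fun x => by simp [hD, hA1']) (fun x => by simp [hD, hA2'])
  -- The derivative of this map is block triangular with invertible diagonal blocks. The second
  -- component of its local inverse is the family of inverses in charts.
  let Φ : ℝ × E → ℝ × E := fun x => (x.1, f x)
  have hΦ : ContDiffAt ℝ ∞ Φ (t₀, cq q₀) := contDiffAt_fst.prodMk hf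
  have hL : HasFDerivAt Φ (L : ℝ × E →L[ℝ] ℝ × E) (t₀, cq q₀) := hasFDerivAt_fst.prodMk hdf
  have hn : (∞ : WithTop ℕ∞) ≠ 0 := by simp
  have hΦp : Φ (t₀, cq q₀) = (t₀, cp p₀) := by simp only [Φ, f, hφz]
  let ψ := hΦ.localInverse hL hn
  have hψ : ContDiffAt ℝ ∞ ψ (t₀, cp p₀) := by
    have := hΦ.to_localInverse hL hn
    rwa [hΦp] at this
  have hs : HasStrictFDerivAt Φ (L : ℝ × E →L[ℝ] ℝ × E) (t₀, cq q₀) := hΦ.hasStrictFDerivAt' hL hn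
  have hr : ∀ᶠ x in 𝓝 (t₀, cp p₀), Φ (ψ x) = x := by
    have := hs.eventually_right_inverse
    rwa [hΦp] at this
  have hψ0 : ψ (t₀, cp p₀) = (t₀, cq q₀) := by
    have := hs.localInverse_apply_image
    rwa [hΦp] at this
  have hψq : (ψ (t₀, cp p₀)).2 = cq q₀ := by rw [hψ0]
  have hψ2 : ContDiffAt ℝ ∞ (fun x => (ψ x).2) (t₀, cp p₀) := contDiffAt_snd.comp _ hψ
  have hψm : ContMDiffAt (𝓘(ℝ, ℝ).prod 𝓘(ℝ, E)) 𝓘(ℝ, E) ∞ (fun x => (ψ x).2) (t₀, cp p₀) := by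
    rw [← modelWithCornersSelf_prod, chartedSpaceSelf_prod]
    exact hψ2.contMDiffAt
  have hin2 : ContMDiffAt (𝓘(ℝ, ℝ).prod 𝓘(ℝ, E)) (𝓘(ℝ, ℝ).prod 𝓘(ℝ, E)) ∞
      (fun x : ℝ × N => (x.1, cp x.2)) (t₀, p₀) :=
    contMDiffAt_fst.prodMk (contMDiffAt_extChartAt.comp (t₀, p₀) contMDiffAt_snd)
  have hcs : ContMDiffAt 𝓘(ℝ, E) 𝓘(ℝ, E) ∞ cq.symm (ψ (t₀, cp p₀)).2 := by
    rw [hψq]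
    exact (contMDiffOn_extChartAt_symm q₀).contMDiffAt (extChartAt_target_mem_nhds q₀)
  have hψN : ContMDiffAt (𝓘(ℝ, ℝ).prod 𝓘(ℝ, E)) 𝓘(ℝ, E) ∞ (fun x : ℝ × N => (ψ (x.1, cp x.2)).2)
      (t₀, p₀) :=
    ContMDiffAt.comp (g := fun x => (ψ x).2) (t₀, p₀) hψm hin2
  have hfin : ContMDiffAt (𝓘(ℝ, ℝ).prod 𝓘(ℝ, E)) 𝓘(ℝ, E) ∞
      (fun x : ℝ × N => cq.symm (ψ (x.1, cp x.2)).2) (t₀, p₀) := hcs.comp (t₀, p₀) hψN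
  refine hfin.congr_of_eventuallyEq ?_
  have hc1 : ∀ᶠ x : ℝ × N in 𝓝 (t₀, p₀), Φ (ψ (x.1, cp x.2)) = (x.1, cp x.2) :=
    hin2.continuousAt.eventually hr
  have hc2 : ContinuousAt (fun x : ℝ × N => φ x.1 (cq.symm (ψ (x.1, cp x.2)).2)) (t₀, p₀) :=
    ContinuousAt.comp (x := (t₀, p₀)) (g := fun z : ℝ × N => φ z.1 z.2)
      (hφ.contMDiffAt ht₀ _).continuousAt (continuousAt_fst.prodMk hfin.continuousAt)
  have hc3 : cp.source ∈ 𝓝 (φ t₀ (cq.symm (ψ (t₀, cp p₀)).2)) := by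
    rw [hψq, hφz]; exact extChartAt_source_mem_nhds p₀
  have hc4 : ∀ᶠ x : ℝ × N in 𝓝 (t₀, p₀), x.2 ∈ cp.source :=
    continuousAt_snd.eventually ((extChartAt_source_mem_nhds (I := 𝓘(ℝ, E)) p₀))
  filter_upwards [hc1, hc2.eventually hc3, hc4] with x h1 h2 h3
  have h4 : (ψ (x.1, cp x.2)).1 = x.1 := congrArg Prod.fst h1
  have h5 : f (ψ (x.1, cp x.2)) = cp x.2 := congrArg Prod.snd h1
  simp only [f, h4] at h5
  have h6 := congrArg (φ x.1).symm (cp.injOn h2 h3 h5)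
  rw [(φ x.1).symm_apply_apply] at h6
  exact h6.symm

/-- `X` is tangent to `G` along a smooth curve of diffeomorphisms with leading term of order `k`. -/
def IsTangentOfOrder (G : Subgroup (N ≃ₘ⟮𝓘(ℝ, E), 𝓘(ℝ, E)⟯ N)) (k : ℕ)
    (X : ∀ p : N, TangentSpace 𝓘(ℝ, E) p) : Prop :=
  ∃ (ε : ℝ) (φ : ℝ → N ≃ₘ⟮𝓘(ℝ, E), 𝓘(ℝ, E)⟯ N), 0 < ε ∧ (SmoothOnIoo (E := E) ε fun t => φ t) ∧
    (∀ t ∈ Ioo (-ε) ε, φ t ∈ G) ∧ φ 0 = 1 ∧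
    ∀ p, HasJet (E := E) k (localRep p fun t => φ t) (X p) (extChartAt 𝓘(ℝ, E) p p)

theorem coe_zero_eq_id {φ : ℝ → N ≃ₘ⟮𝓘(ℝ, E), 𝓘(ℝ, E)⟯ N} (h0 : φ 0 = 1) :
    (fun t => ⇑(φ t)) 0 = id := by
  simp only [h0]
  rfl

theorem isTangentToSubgroup_iff {G : Subgroup (N ≃ₘ⟮𝓘(ℝ, E), 𝓘(ℝ, E)⟯ N)}
    {X : SmoothVectorField 𝓘(ℝ, E) N} :
    IsTangentToSubgroup G X ↔ ∃ k, 1 ≤ k ∧ IsTangentOfOrder G k X := by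
  constructor
  · rintro ⟨k, ε, φ, hk, hε, hφ, hG, h0, hX⟩
    exact ⟨k, hk, ε, φ, hε, hφ, hG, h0, fun p => (SmoothOnIoo.isIntegralCurveOfOrder_iff (E := E)
      (φ := fun t => φ t) hφ hε (coe_zero_eq_id h0) p hk (X p)).1 (hX p)⟩
  · rintro ⟨k, hk, ε, φ, hε, hφ, hG, h0, hX⟩
    exact ⟨k, ε, φ, hk, hε, hφ, hG, h0, fun p => (SmoothOnIoo.isIntegralCurveOfOrder_iff (E := E)
      (φ := fun t => φ t) hφ hε (coe_zero_eq_id h0) p hk (X p)).2 (hX p)⟩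

theorem exists_mapsTo_Ioo {r : ℝ → ℝ} (hr : Continuous r) (h0 : r 0 = 0) {ε : ℝ} (hε : 0 < ε) :
    ∃ δ > 0, MapsTo r (Ioo (-δ) δ) (Ioo (-ε) ε) := by
  have h : Ioo (-ε) ε ∈ 𝓝 (r 0) := by rw [h0]; exact Ioo_mem_nhds (by linarith) hε
  obtain ⟨δ, hδ, hb⟩ := Metric.mem_nhds_iff.1 (hr.continuousAt h)
  refine ⟨δ, hδ, fun t ht => hb ?_⟩
  rw [mem_ball_zero_iff]
  exact abs_lt.2 ht

theorem tendsto_prodMk_const (z : E) : Tendsto (fun t : ℝ => (t, z)) (𝓝 0) (𝓝 (0, z)) :=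
  tendsto_id.prodMk_nhds tendsto_const_nhds

namespace IsTangentOfOrder

variable {G : Subgroup (N ≃ₘ⟮𝓘(ℝ, E), 𝓘(ℝ, E)⟯ N)} {k l : ℕ} {X Y : ∀ p : N, TangentSpace 𝓘(ℝ, E) p}

theorem zero : IsTangentOfOrder G k (0 : ∀ p : N, TangentSpace 𝓘(ℝ, E) p) := by
  refine ⟨1, fun _ => 1, one_pos, contMDiff_snd.contMDiffOn, fun t _ => G.one_mem, rfl, fun p => ?_⟩
  have h : ∀ t, localRep p (fun _ => ((1 : N ≃ₘ⟮𝓘(ℝ, E), 𝓘(ℝ, E)⟯ N) : N → N))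
      (t, extChartAt 𝓘(ℝ, E) p p) = extChartAt 𝓘(ℝ, E) p p := fun t =>
    congrArg _ (extChartAt_to_inv p)
  have h1 : ∀ t : ℝ, (0 : E) = localRep p (fun _ => ((1 : N ≃ₘ⟮𝓘(ℝ, E), 𝓘(ℝ, E)⟯ N) : N → N))
      (t, extChartAt 𝓘(ℝ, E) p p) - extChartAt 𝓘(ℝ, E) p p -
        ((k.factorial : ℝ)⁻¹ * t ^ k) • (0 : E) := fun t => by rw [h, smul_zero, sub_self, sub_self]
  exact (isLittleO_zero (E' := E) (fun t : ℝ => t ^ k) (𝓝 0)).congr_left h1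

theorem congr (hX : IsTangentOfOrder G k X) (h : X = Y) : IsTangentOfOrder G k Y := h ▸ hX

variable [CompleteSpace E]

/-- Uses the inverse diffeomorphisms. Replacing t by -t would change the sign only for odd k. -/
theorem neg (hk : 1 ≤ k) (hX : IsTangentOfOrder G k X) : IsTangentOfOrder G k (-X) := by
  obtain ⟨ε, φ, hε, hφ, hG, h0, hX⟩ := hX
  have h0s : (fun t => ⇑(φ t).symm) 0 = id := by simp only [h0]; rfl
  refine ⟨ε, fun t => (φ t)⁻¹, hε, SmoothOnIoo.symm hφ, fun t ht => G.inv_mem (hG t ht),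
    by simp only [h0, inv_one], fun p => ?_⟩
  refine (SmoothOnIoo.isLocalFamily (SmoothOnIoo.symm hφ) hε h0s p).hasJet_inverse hk (hX p) ?_
  filter_upwards [(tendsto_prodMk_const _).eventually
    (SmoothOnIoo.localRep_comp (φ := fun t => ⇑(φ t).symm) hφ hε (coe_zero_eq_id h0) p)] with t h
  rw [← h]
  simp only [localRep, extChartAt_to_inv]
  rw [(φ t).symm_apply_apply]

theorem smul_pos (hk : 1 ≤ k) (hX : IsTangentOfOrder G k X) {c : ℝ} (hc : 0 < c) :
    IsTangentOfOrder G k (c • X) := by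
  obtain ⟨ε, φ, hε, hφ, hG, h0, hX⟩ := hX
  set α : ℝ := c ^ (k : ℝ)⁻¹ with hα
  have hαk : α ^ k = c := Real.rpow_inv_natCast_pow hc.le (by omega)
  obtain ⟨δ, hδ, hm⟩ := exists_mapsTo_Ioo (r := fun t => α * t) (by fun_prop) (by simp) hε
  refine ⟨δ, fun t => φ (α * t), hδ, SmoothOnIoo.reparametrize (φ := fun t => φ t) hφ
    (contDiff_const.mul contDiff_id) hm, fun t ht => hG _ (hm ht), by simp only [mul_zero, h0], fun p => ?_⟩
  have h := (hX p).reparametrize le_rfl α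
  have hk0 : (k.factorial : ℝ) ≠ 0 := by exact_mod_cast k.factorial_ne_zero
  simp only [mul_one, pow_one] at h
  rw [hαk, mul_inv_cancel₀ hk0, one_mul] at h
  exact h

theorem smul (hk : 1 ≤ k) (hX : IsTangentOfOrder G k X) (c : ℝ) : IsTangentOfOrder G k (c • X) := by
  rcases lt_trichotomy c 0 with h | rfl | h
  · exact ((hX.smul_pos hk (neg_pos.2 h)).neg hk).congr (by rw [neg_smul, neg_neg])
  · exact zero.congr (by rw [zero_smul])
  · exact hX.smul_pos hk h

/-- The substitutions t ↦ t^l and t ↦ t^k bring both families to order kl, where the leading terms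
of a product add. -/
theorem add (hk : 1 ≤ k) (hl : 1 ≤ l) (hX : IsTangentOfOrder G k X) (hY : IsTangentOfOrder G l Y) :
    IsTangentOfOrder G (k * l) (X + Y) := by
  have key : ∀ k l : ℕ, ((k * l).factorial : ℝ) * (k.factorial : ℝ)⁻¹ ≠ 0 := by
    intro k l
    have h1 : ((k * l).factorial : ℝ) ≠ 0 := by exact_mod_cast (k * l).factorial_ne_zero
    have h2 : (k.factorial : ℝ) ≠ 0 := by exact_mod_cast k.factorial_ne_zero
    exact mul_ne_zero h1 (inv_ne_zero h2)
  -- The factors that the substitutions t ↦ t^l and t ↦ t^k put on the leading terms; dividing X and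
  -- Y by them beforehand cancels them.
  set c₁ : ℝ := ((k * l).factorial : ℝ) * (k.factorial : ℝ)⁻¹ with hc₁
  set c₂ : ℝ := ((l * k).factorial : ℝ) * (l.factorial : ℝ)⁻¹ with hc₂
  obtain ⟨ε, φ, hε, hφ, hG, h0, hX⟩ := hX.smul hk c₁⁻¹
  obtain ⟨ε', ψ, hε', hψ, hG', h0', hY⟩ := hY.smul hl c₂⁻¹
  obtain ⟨δ, hδ, hm⟩ := exists_mapsTo_Ioo (r := fun t => 1 * t ^ l) (by fun_prop)
    (by simp [show l ≠ 0 by omega]) hε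
  obtain ⟨δ', hδ', hm'⟩ := exists_mapsTo_Ioo (r := fun t => 1 * t ^ k) (by fun_prop)
    (by simp [show k ≠ 0 by omega]) hε'
  have hd : 0 < min δ δ' := lt_min hδ hδ'
  have s1 : SmoothOnIoo (E := E) (min δ δ') fun t => φ (1 * t ^ l) :=
    SmoothOnIoo.mono (SmoothOnIoo.reparametrize (φ := fun t => φ t) hφ
      (contDiff_const.mul (contDiff_id.pow l)) hm) (min_le_left _ _)
  have s2 : SmoothOnIoo (E := E) (min δ δ') fun t => ψ (1 * t ^ k) :=
    SmoothOnIoo.mono (SmoothOnIoo.reparametrize (φ := fun t => ψ t) hψ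
      (contDiff_const.mul (contDiff_id.pow k)) hm') (min_le_right _ _)
  have z1 : φ (1 * 0 ^ l) = 1 := by rw [zero_pow (by omega), mul_zero, h0]
  have z2 : ψ (1 * 0 ^ k) = 1 := by rw [zero_pow (by omega), mul_zero, h0']
  have hkl : 1 ≤ k * l := Nat.mul_pos hk hl
  refine ⟨min δ δ', fun t => φ (1 * t ^ l) * ψ (1 * t ^ k), hd, s1.comp s2, fun t ht => G.mul_mem
        (hG _ (hm (Ioo_subset_Ioo (neg_le_neg (min_le_left _ _)) (min_le_left _ _) ht)))
        (hG' _ (hm' (Ioo_subset_Ioo (neg_le_neg (min_le_right _ _)) (min_le_right _ _) ht))),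
      by beta_reduce; rw [z1, z2, one_mul], fun p => ?_⟩
  have j1 := (hX p).reparametrize hl 1
  have j2 := (hY p).reparametrize hk 1
  rw [one_pow, mul_one] at j1 j2
  have e1 : ((k * l).factorial * (k.factorial : ℝ)⁻¹) • (c₁⁻¹ • X) p = X p :=
    smul_inv_smul₀ (key k l) (X p)
  have e2 : ((l * k).factorial * (l.factorial : ℝ)⁻¹) • (c₂⁻¹ • Y) p = Y p :=
    smul_inv_smul₀ (key l k) (Y p)
  have j1' : HasJet (E := E) (k * l) (fun q => localRep p (fun t => φ t) (1 * q.1 ^ l, q.2)) (X p)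
      (extChartAt 𝓘(ℝ, E) p p) := e1 ▸ j1
  have j2' : HasJet (E := E) (k * l) (fun q => localRep p (fun t => ψ t) (1 * q.1 ^ k, q.2)) (Y p)
      (extChartAt 𝓘(ℝ, E) p p) := mul_comm l k ▸ (e2 ▸ j2)
  have h := (s1.isLocalFamily hd (coe_zero_eq_id (φ := fun t => φ (1 * t ^ l)) z1) p).hasJet_comp hkl
    (w := (X p : E)) (w' := (Y p : E))
    (u := fun t => localRep p (fun t => ψ t) (1 * t ^ k, extChartAt 𝓘(ℝ, E) p p)) j1' j2'
  refine IsLittleO.congr' h ?_ EventuallyEq.rfl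
  filter_upwards [(tendsto_prodMk_const _).eventually (SmoothOnIoo.localRep_comp
    (φ := fun t => ⇑(φ (1 * t ^ l))) s2 hd (coe_zero_eq_id (φ := fun t => ψ (1 * t ^ k)) z2) p)] with t h
  have sub_congr : ∀ {a b : E} (w : E), a = b → a - w = b - w := fun w hab => by rw [hab]
  exact sub_congr _ (sub_congr _ h.symm)

/-- The group commutator (ψφ)⁻¹(φψ), where ψ belongs to X and φ to Y, has leading term [X, Y]
t^(k+l)/(k! l!). -/
theorem mlieBracket [FiniteDimensional ℝ E] (hk : 1 ≤ k) (hl : 1 ≤ l) (hX : IsTangentOfOrder G k X)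
    (hY : IsTangentOfOrder G l Y) : IsTangentOfOrder G (k + l) (mlieBracket 𝓘(ℝ, E) X Y) := by
  -- Converts the coefficient 1/(k! l!) of the commutator into the normalization 1/(k+l)! of a jet
  -- of order k + l.
  set c : ℝ := ((k + l).factorial : ℝ)⁻¹ * (k.factorial * l.factorial) with hc
  have hc0 : c ≠ 0 := by
    have h1 : ((k + l).factorial : ℝ) ≠ 0 := by exact_mod_cast (k + l).factorial_ne_zero
    have h2 : (k.factorial : ℝ) ≠ 0 := by exact_mod_cast k.factorial_ne_zero
    have h3 : (l.factorial : ℝ) ≠ 0 := by exact_mod_cast l.factorial_ne_zero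
    positivity
  suffices h : IsTangentOfOrder G (k + l) (c⁻¹ • VectorField.mlieBracket 𝓘(ℝ, E) X Y) from
    (h.smul (by omega) c).congr (smul_inv_smul₀ hc0 _)
  obtain ⟨ε₁, ψ, hε₁, hψ, hG', h0', hX⟩ := hX
  obtain ⟨ε₂, φ, hε₂, hφ, hG, h0, hY⟩ := hY
  set ε := min ε₁ ε₂ with hεd
  have hε : 0 < ε := lt_min hε₁ hε₂
  replace hψ : SmoothOnIoo (E := E) ε fun t => ψ t := SmoothOnIoo.mono hψ (min_le_left _ _)
  replace hφ : SmoothOnIoo (E := E) ε fun t => φ t := SmoothOnIoo.mono hφ (min_le_right _ _)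
  have hφψ : SmoothOnIoo (E := E) ε fun t => φ t * ψ t := hφ.comp hψ
  have hψφ : SmoothOnIoo (E := E) ε fun t => ψ t * φ t := hψ.comp hφ
  have hinv : SmoothOnIoo (E := E) ε fun t => ⇑((ψ t * φ t)⁻¹ : N ≃ₘ⟮𝓘(ℝ, E), 𝓘(ℝ, E)⟯ N) := SmoothOnIoo.symm hψφ
  have zφψ : φ 0 * ψ 0 = 1 := by rw [h0, h0', one_mul]
  have zψφ : ψ 0 * φ 0 = 1 := by rw [h0, h0', one_mul]
  have zinv : (ψ 0 * φ 0)⁻¹ = 1 := by rw [zψφ, inv_one]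
  refine ⟨ε, fun t => (ψ t * φ t)⁻¹ * (φ t * ψ t), hε, hinv.comp hφψ, fun t ht => ?_, ?_, fun p => ?_⟩
  · have h1 := hG t (Ioo_subset_Ioo (neg_le_neg (min_le_right _ _)) (min_le_right _ _) ht)
    have h2 := hG' t (Ioo_subset_Ioo (neg_le_neg (min_le_left _ _)) (min_le_left _ _) ht)
    exact G.mul_mem (G.inv_mem (G.mul_mem h2 h1)) (G.mul_mem h1 h2)
  · simp only [zinv, zφψ, one_mul]
  set z := extChartAt 𝓘(ℝ, E) p p with hz
  have lφ := hφ.isLocalFamily hε (coe_zero_eq_id h0) p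
  have lψ := hψ.isLocalFamily hε (coe_zero_eq_id h0') p
  have linv := hinv.isLocalFamily hε (coe_zero_eq_id (φ := fun t => (ψ t * φ t)⁻¹) zinv) p
  have jφ := hφ.eventually_hasJet hε (coe_zero_eq_id h0) hl (X := Y) (fun q =>
    (SmoothOnIoo.isIntegralCurveOfOrder_iff (E := E) (φ := fun t => φ t) hφ hε (coe_zero_eq_id h0) q hl
      (Y q)).2 (hY q)) p
  have jψ := hψ.eventually_hasJet hε (coe_zero_eq_id h0') hk (X := X) (fun q =>
    (SmoothOnIoo.isIntegralCurveOfOrder_iff (E := E) (φ := fun t => ψ t) hψ hε (coe_zero_eq_id h0') q hk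
      (X q)).2 (hX q)) p
  have hcomm := lφ.comp_sub_comp_isLittleO lψ hl hk jφ jψ
  have hbr := mlieBracket_eq_fderiv_chartField X Y p
  rw [← hz] at hbr
  rw [chartField_self, chartField_self, ← hz] at hcomm
  set W : E := fderiv ℝ (chartField p Y) z (X p) - fderiv ℝ (chartField p X) z (Y p) with hW
  set u : ℝ → E := fun t => localRep p (fun t => φ t) (t, localRep p (fun t => ψ t) (t, z)) with hu
  set v : ℝ → E := fun t => localRep p (fun t => ψ t) (t, localRep p (fun t => φ t) (t, z)) with hv
  have ht := tendsto_prodMk_const z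
  have eu : ∀ᶠ t in 𝓝 (0 : ℝ), localRep p (fun t => ⇑(φ t * ψ t)) (t, z) = u t :=
    ht.eventually (SmoothOnIoo.localRep_comp (φ := fun t => φ t) hψ hε (coe_zero_eq_id h0') p)
  have ev : ∀ᶠ t in 𝓝 (0 : ℝ), localRep p (fun t => ⇑(ψ t * φ t)) (t, z) = v t :=
    ht.eventually (SmoothOnIoo.localRep_comp (φ := fun t => ψ t) hφ hε (coe_zero_eq_id h0) p)
  have tend : ∀ {f : ℝ × E → E}, IsLocalFamily f z → ∀ {w : ℝ → E}, Tendsto w (𝓝 0) (𝓝 z) →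
      Tendsto (fun t => f (t, w t)) (𝓝 0) (𝓝 z) := by
    intro f hf w hw
    have h1 := hf.contDiffAt.continuousAt.tendsto.comp
      ((tendsto_id (α := ℝ) (x := 𝓝 0)).prodMk_nhds hw)
    rwa [hf.zero.self_of_nhds] at h1
  have tu : Tendsto u (𝓝 0) (𝓝 z) := tend lφ (tend lψ tendsto_const_nhds)
  have tv : Tendsto v (𝓝 0) (𝓝 z) := tend lψ (tend lφ tendsto_const_nhds)
  have huv : (fun t => u t - v t) =O[𝓝 0] fun t : ℝ => t ^ (k + l) := by
    have h1 : (fun t : ℝ => ((l.factorial * k.factorial : ℝ)⁻¹ * t ^ (l + k)) • W) =O[𝓝 0]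
        fun t : ℝ => t ^ (l + k) := by
      refine (pow_smul_isBigO (k := l + k) (isBigO_const_const
        ((l.factorial * k.factorial : ℝ)⁻¹ • W) one_ne_zero _)).congr_left fun t => ?_
      rw [smul_smul, mul_comm]
    rw [add_comm l k] at hcomm h1
    exact (hcomm.isBigO.add h1).congr_left fun t => by rw [sub_add_cancel]
  -- Let g be the inverse of ψφ, u = φψ and v = ψφ at the point z. Then g(v) = z, so g(u) - z = g(u)
  -- - g(v) equals u - v up to o(t^(k+l)). No expansion of the inverse itself is needed.
  have hmain := (linv.sub_isLittleO tu tv).trans_isBigO huv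
  rw [add_comm l k] at hcomm
  refine IsLittleO.congr' (hmain.add hcomm) ?_ EventuallyEq.rfl
  filter_upwards [eu, ev, ht.eventually (SmoothOnIoo.localRep_comp
      (φ := fun t => ⇑((ψ t * φ t)⁻¹ : N ≃ₘ⟮𝓘(ℝ, E), 𝓘(ℝ, E)⟯ N)) hφψ hε
      (coe_zero_eq_id (φ := fun t => φ t * ψ t) zφψ) p),
    ht.eventually (SmoothOnIoo.localRep_comp
      (φ := fun t => ⇑((ψ t * φ t)⁻¹ : N ≃ₘ⟮𝓘(ℝ, E), 𝓘(ℝ, E)⟯ N)) hψφ hε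
      (coe_zero_eq_id (φ := fun t => ψ t * φ t) zψφ) p)] with t h1 h2 h3 h4
  have h5 : localRep p (fun t => ⇑((ψ t * φ t)⁻¹ : N ≃ₘ⟮𝓘(ℝ, E), 𝓘(ℝ, E)⟯ N)) (t, v t) = z := by
    simp only [h2] at h4
    rw [← h4]
    simp only [localRep, hz, extChartAt_to_inv]
    congr 1
    exact (ψ t * φ t).symm_apply_apply p
  simp only [h1] at h3
  have h6 : localRep p (fun t => ⇑((ψ t * φ t)⁻¹ * (φ t * ψ t))) (t, z) =
      localRep p (fun t => ⇑((ψ t * φ t)⁻¹ : N ≃ₘ⟮𝓘(ℝ, E), 𝓘(ℝ, E)⟯ N)) (t, u t) := h3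
  have h7 : (c⁻¹ • VectorField.mlieBracket 𝓘(ℝ, E) X Y) p = (c⁻¹ • W : E) := by
    exact congrArg (fun w : E => c⁻¹ • w) hbr
  rw [h5, h6, h7]
  have h8 : (((k + l).factorial : ℝ)⁻¹ * t ^ (k + l)) • (c⁻¹ • W) =
      ((l.factorial * k.factorial : ℝ)⁻¹ * t ^ (k + l)) • W := by
    rw [smul_smul, hc]
    congr 1
    have h1 : ((k + l).factorial : ℝ) ≠ 0 := by exact_mod_cast (k + l).factorial_ne_zero
    rw [mul_inv, inv_inv]
    field_simp
  rw [h8]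
  abel

end IsTangentOfOrder

variable [CompleteSpace E] [FiniteDimensional ℝ E]

/-- The vector fields tangent to a subgroup of the diffeomorphism group form a Lie algebra. -/
noncomputable def tangentLieSubalgebra (G : Subgroup (N ≃ₘ⟮𝓘(ℝ, E), 𝓘(ℝ, E)⟯ N)) :
    LieSubalgebra ℝ (SmoothVectorField 𝓘(ℝ, E) N) where
  carrier := {X | IsTangentToSubgroup G X}
  add_mem' {X Y} hX hY := by
    obtain ⟨k, hk, h⟩ := isTangentToSubgroup_iff.1 hX
    obtain ⟨l, hl, h'⟩ := isTangentToSubgroup_iff.1 hY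
    exact isTangentToSubgroup_iff.2 ⟨k * l, Nat.mul_pos hk hl,
      (h.add hk hl h').congr (ContMDiffSection.coe_add X Y).symm⟩
  zero_mem' := isTangentToSubgroup_iff.2 ⟨1, le_rfl,
    IsTangentOfOrder.zero.congr ContMDiffSection.coe_zero.symm⟩
  smul_mem' c X hX := by
    obtain ⟨k, hk, h⟩ := isTangentToSubgroup_iff.1 hX
    exact isTangentToSubgroup_iff.2 ⟨k, hk, (h.smul hk c).congr (ContMDiffSection.coe_smul c X).symm⟩
  lie_mem' {X Y} hX hY := by
    obtain ⟨k, hk, h⟩ := isTangentToSubgroup_iff.1 hX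
    obtain ⟨l, hl, h'⟩ := isTangentToSubgroup_iff.1 hY
    exact isTangentToSubgroup_iff.2 ⟨k + l, by omega, h.mlieBracket hk hl h'⟩

theorem mem_tangentLieSubalgebra {G : Subgroup (N ≃ₘ⟮𝓘(ℝ, E), 𝓘(ℝ, E)⟯ N)}
    {X : SmoothVectorField 𝓘(ℝ, E) N} : X ∈ tangentLieSubalgebra G ↔ IsTangentToSubgroup G X := Iff.rfl

end TangentSubgroup

/-! ### Spray, nonlinear connection and curvature of a Finsler energy in coordinates. -/

section FinslerCalculus

variable {E : Type*} [NormedAddCommGroup E] [NormedSpace ℝ E]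

/-- The points `(x, y)` with `x ∈ Ω` and `y ≠ 0`. -/
def slitSet (Ω : Set E) : Set (E × E) := {q | q.1 ∈ Ω ∧ q.2 ≠ 0}

theorem isOpen_slitSet {Ω : Set E} (hΩ : IsOpen Ω) : IsOpen (slitSet Ω) :=
  (hΩ.preimage continuous_fst).inter (isOpen_ne_fun continuous_snd continuous_const)

/-- `e` is the energy `½ F²` of a Finsler metric in local coordinates. -/
structure IsFinslerEnergy (e : E × E → ℝ) (Ω : Set E) : Prop where
  isOpen : IsOpen Ω
  contDiffOn : ContDiffOn ℝ ∞ e (slitSet Ω)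
  homogeneous : ∀ x y : E, ∀ a : ℝ, 0 < a → e (x, a • y) = a ^ 2 * e (x, y)
  pos : ∀ q ∈ slitSet Ω, ∀ u : E, u ≠ 0 → 0 < fderiv ℝ (fderiv ℝ e) q (0, u) (0, u)

/-- `(y, -2 G)` is the geodesic spray of the energy `e`. -/
def IsSpray (e : E × E → ℝ) (Ω : Set E) (G : E × E → E) : Prop :=
  ∀ q ∈ slitSet Ω, ∀ v : E, fderiv ℝ (fderiv ℝ e) q (q.2, -(2 : ℝ) • G q) (0, v) = fderiv ℝ e q (v, 0)

/-- The vertical derivative of the spray coefficients. -/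
noncomputable def sprayConnection (G : E × E → E) (q : E × E) : E →L[ℝ] E :=
  (fderiv ℝ G q).comp (ContinuousLinearMap.inr ℝ E E)

/-- The horizontal vector over `u` at `q`. -/
noncomputable def sprayHorizontal (G : E × E → E) (q : E × E) (u : E) : E × E :=
  (u, -sprayConnection G q u)

/-- The curvature of the nonlinear connection defined by the spray coefficients. -/
noncomputable def sprayCurvature (G : E × E → E) (q : E × E) (u w : E) : E :=
  fderiv ℝ (sprayConnection G) q (sprayHorizontal G q w) u -
    fderiv ℝ (sprayConnection G) q (sprayHorizontal G q u) w

theorem sprayConnection_apply (G : E × E → E) (q : E × E) (u : E) :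
    sprayConnection G q u = fderiv ℝ G q (0, u) := rfl

theorem fundamentalForm_comp_linearMap {V W : Type*} [AddCommGroup V] [Module ℝ V] [AddCommGroup W]
    [Module ℝ W] (A : V →ₗ[ℝ] W) (f : W → ℝ) (y u v : V) :
    fundamentalForm (fun z => f (A z)) y u v = fundamentalForm f (A y) (A u) (A v) := by
  simp only [fundamentalForm, map_add, map_smul]

/-- The factor 1/2 in the fundamental form is absorbed by L² = 2e, so g is the vertical Hessian of
the energy. -/
theorem fundamentalForm_eq_fderiv {Ω : Set E} (hΩ : IsOpen Ω) {L e : E × E → ℝ}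
    (hL : ∀ q, L q ^ 2 = 2 * e q) (he : ContDiffOn ℝ ∞ e (slitSet Ω)) {q : E × E} (hq : q ∈ slitSet Ω)
    (u v : E) : fundamentalForm (fun w => L (q.1, w)) q.2 u v =
      fderiv ℝ (fderiv ℝ e) q (0, u) (0, v) := by
  have ho := isOpen_slitSet hΩ
  have hc : ∀ y w : E, HasDerivAt (fun t : ℝ => (q.1, y + t • w)) ((0 : E), w) 0 := by
    intro y w
    have := (hasDerivAt_const (0 : ℝ) q.1).prodMk
      (((hasDerivAt_id (0 : ℝ)).smul_const w).const_add y)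
    simpa using this
  have h1 : ∀ s : ℝ, (q.1, q.2 + s • u) ∈ slitSet Ω →
      deriv (fun t : ℝ => L (q.1, q.2 + s • u + t • v) ^ 2) 0 =
        2 * fderiv ℝ e (q.1, q.2 + s • u) (0, v) := by
    intro s hs
    have hd : HasFDerivAt e (fderiv ℝ e (q.1, q.2 + s • u))
        (q.1, q.2 + s • u + (0 : ℝ) • v) := by
      rw [zero_smul, add_zero]
      exact ((he.contDiffAt (ho.mem_nhds hs)).differentiableAt (by simp)).hasFDerivAt
    simp_rw [hL]
    exact ((hd.comp_hasDerivAt (0 : ℝ) (hc (q.2 + s • u) v)).const_mul 2).deriv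
  have h3 : (fun s : ℝ => deriv (fun t : ℝ => L (q.1, q.2 + s • u + t • v) ^ 2) 0) =ᶠ[𝓝 0]
      fun s => 2 * fderiv ℝ e (q.1, q.2 + s • u) (0, v) := by
    have := (hc q.2 u).continuousAt.eventually (ho.mem_nhds (by simpa using hq))
    filter_upwards [this] with s hs using h1 s hs
  have hd : HasFDerivAt (fun r => fderiv ℝ e r (0, v)) ((fderiv ℝ (fderiv ℝ e) q).flip (0, v))
      (q.1, q.2 + (0 : ℝ) • u) := by
    rw [zero_smul, add_zero]
    exact ((((he.contDiffAt (ho.mem_nhds hq)).fderiv_right (m := ∞) (by simp)).differentiableAt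
      (by simp)).hasFDerivAt.clm_apply (hasFDerivAt_const _ _)).congr_fderiv (by ext <;> simp)
  have h4 : HasDerivAt (fun s : ℝ => 2 * fderiv ℝ e (q.1, q.2 + s • u) (0, v))
      (2 * fderiv ℝ (fderiv ℝ e) q (0, u) (0, v)) 0 :=
    (hd.comp_hasDerivAt (0 : ℝ) (hc q.2 u)).const_mul 2
  rw [fundamentalForm, h3.deriv_eq, h4.deriv]
  ring

theorem clm_apply_sum_sum {ι : Type*} (s : Finset ι) (T : E →L[ℝ] E →L[ℝ] ℝ) (a b : ι → ℝ)
    (f g : ι → E) : T (∑ i ∈ s, a i • f i) (∑ j ∈ s, b j • g j) =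
      ∑ i ∈ s, ∑ j ∈ s, a i * b j * T (f i) (g j) := by
  rw [map_sum T, sum_apply]
  refine Finset.sum_congr rfl fun i _ => ?_
  rw [map_smul, smul_apply, map_sum, smul_eq_mul, Finset.mul_sum]
  refine Finset.sum_congr rfl fun j _ => ?_
  rw [map_smul, smul_eq_mul, mul_assoc]

set_option synthInstance.maxHeartbeats 200000 in
theorem clm_apply_sum_sum_left {ι : Type*} (s : Finset ι) (T : E →L[ℝ] E →L[ℝ] E →L[ℝ] ℝ) (a b : ι → ℝ)
    (f g : ι → E) (v : E) : T (∑ i ∈ s, a i • f i) (∑ j ∈ s, b j • g j) v =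
      ∑ j ∈ s, ∑ i ∈ s, b j * a i * T (f i) (g j) v := by
  rw [map_sum T, sum_apply, sum_apply, Finset.sum_comm]
  refine Finset.sum_congr rfl fun i _ => ?_
  rw [map_smul T, smul_apply, smul_apply, map_sum, sum_apply, smul_eq_mul, Finset.mul_sum]
  refine Finset.sum_congr rfl fun j _ => ?_
  rw [map_smul, smul_apply, smul_eq_mul, mul_left_comm, mul_assoc]

set_option synthInstance.maxHeartbeats 200000 in
theorem hasFDerivAt_clm_apply_apply {f : E → E →L[ℝ] E →L[ℝ] ℝ} {f' : E →L[ℝ] E →L[ℝ] E →L[ℝ] ℝ} {q : E}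
    (hf : HasFDerivAt f f' q) (a b : E) :
    HasFDerivAt (fun r => f r a b) ((f'.flip a).flip b) q := by
  have h1 : HasFDerivAt (fun r => f r a) (f'.flip a) q :=
    (hf.clm_apply (hasFDerivAt_const a q)).congr_fderiv (by ext; simp)
  exact (h1.clm_apply (hasFDerivAt_const b q)).congr_fderiv (by ext; simp)

namespace IsFinslerEnergy

variable {e : E × E → ℝ} {Ω : Set E} {G : E × E → E}

theorem mem_nhds (he : IsFinslerEnergy e Ω) {q : E × E} (hq : q ∈ slitSet Ω) : slitSet Ω ∈ 𝓝 q :=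
  (isOpen_slitSet he.isOpen).mem_nhds hq

theorem contDiffAt (he : IsFinslerEnergy e Ω) {q : E × E} (hq : q ∈ slitSet Ω) : ContDiffAt ℝ ∞ e q :=
  he.contDiffOn.contDiffAt (he.mem_nhds hq)

theorem contDiffAt_fderiv (he : IsFinslerEnergy e Ω) {q : E × E} (hq : q ∈ slitSet Ω) :
    ContDiffAt ℝ ∞ (fderiv ℝ e) q :=
  (he.contDiffAt hq).fderiv_right (m := ∞) (by simp)

theorem contDiffAt_fderiv_fderiv (he : IsFinslerEnergy e Ω) {q : E × E} (hq : q ∈ slitSet Ω) :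
    ContDiffAt ℝ ∞ (fderiv ℝ (fderiv ℝ e)) q :=
  (he.contDiffAt_fderiv hq).fderiv_right (m := ∞) (by simp)

theorem hasFDerivAt (he : IsFinslerEnergy e Ω) {q : E × E} (hq : q ∈ slitSet Ω) :
    HasFDerivAt e (fderiv ℝ e q) q :=
  ((he.contDiffAt hq).differentiableAt (by simp)).hasFDerivAt

theorem hasFDerivAt_fderiv (he : IsFinslerEnergy e Ω) {q : E × E} (hq : q ∈ slitSet Ω) :
    HasFDerivAt (fderiv ℝ e) (fderiv ℝ (fderiv ℝ e) q) q :=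
  ((he.contDiffAt_fderiv hq).differentiableAt (by simp)).hasFDerivAt

theorem symm (he : IsFinslerEnergy e Ω) {q : E × E} (hq : q ∈ slitSet Ω) (a b : E × E) :
    fderiv ℝ (fderiv ℝ e) q a b = fderiv ℝ (fderiv ℝ e) q b a :=
  (he.contDiffAt hq).isSymmSndFDerivAt (by
    rw [minSmoothness_of_isRCLikeNormedField]; exact WithTop.coe_le_coe.2 le_top) a b

/-- Euler's identity for 2-homogeneous functions: differentiate e(x, ay) = a² e(x, y) at a = 1. -/
theorem euler (he : IsFinslerEnergy e Ω) {q : E × E} (hq : q ∈ slitSet Ω) :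
    fderiv ℝ e q (0, q.2) = 2 * e q := by
  have h1 : HasDerivAt (fun a : ℝ => e (q.1, a • q.2)) (fderiv ℝ e q (0, q.2)) 1 := by
    have hc : HasDerivAt (fun a : ℝ => (q.1, a • q.2)) (0, (1 : ℝ) • q.2) 1 :=
      (hasDerivAt_const _ _).prodMk ((hasDerivAt_id _).smul_const _)
    have hq1 : (q.1, (1 : ℝ) • q.2) = q := by simp
    have := he.hasFDerivAt hq
    rw [← hq1] at this
    have h := this.comp_hasDerivAt (1 : ℝ) hc
    rw [hq1, one_smul] at h
    exact h
  have h2 : HasDerivAt (fun a : ℝ => a ^ 2 * e q) (2 * e q) 1 := by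
    simpa using ((hasDerivAt_id (1 : ℝ)).pow 2).mul_const (e q)
  refine h1.unique (h2.congr_of_eventuallyEq ?_)
  filter_upwards [Ioi_mem_nhds (show (0 : ℝ) < 1 by norm_num)] with a ha
  exact he.homogeneous _ _ _ ha

theorem fderiv_euler (he : IsFinslerEnergy e Ω) {q : E × E} (hq : q ∈ slitSet Ω) (a : E × E) :
    fderiv ℝ (fderiv ℝ e) q a (0, q.2) + fderiv ℝ e q (0, a.2) = 2 * fderiv ℝ e q a := by
  have hc : HasFDerivAt (fun q : E × E => ((0 : E), q.2))
      ((ContinuousLinearMap.inr ℝ E E).comp (ContinuousLinearMap.snd ℝ E E)) q :=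
    ((ContinuousLinearMap.inr ℝ E E).comp (ContinuousLinearMap.snd ℝ E E)).hasFDerivAt
  have h1 := (he.hasFDerivAt_fderiv hq).clm_apply hc
  have h2 := ((he.hasFDerivAt hq).const_mul 2).congr_of_eventuallyEq
    (f₁ := fun q => fderiv ℝ e q (0, q.2)) (by
      filter_upwards [he.mem_nhds hq] with q hq
      exact he.euler hq)
  have h3 := congrArg (fun L : E × E →L[ℝ] ℝ => L a) (h1.unique h2)
  simpa [add_comm] using h3

set_option synthInstance.maxHeartbeats 200000 in
theorem hasFDerivAt_fderiv_fderiv (he : IsFinslerEnergy e Ω) {q : E × E} (hq : q ∈ slitSet Ω) :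
    HasFDerivAt (fderiv ℝ (fderiv ℝ e)) (fderiv ℝ (fderiv ℝ (fderiv ℝ e)) q) q :=
  ((he.contDiffAt_fderiv_fderiv hq).differentiableAt (by simp)).hasFDerivAt

theorem fderiv_fderiv_snd (he : IsFinslerEnergy e Ω) {q : E × E} (hq : q ∈ slitSet Ω) (v : E) :
    fderiv ℝ (fderiv ℝ e) q (0, q.2) (0, v) = fderiv ℝ e q (0, v) := by
  have h := he.fderiv_euler hq (0, v)
  rw [he.symm hq] at h
  simp only at h
  linarith

-- The x-derivative of the identity e_yy(y, v) = e_y(v). It contracts the x-derivatives of the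
-- fundamental tensor with y, which is what occurs in the formula for the geodesic coefficients.
set_option synthInstance.maxHeartbeats 200000 in
theorem fderiv_fderiv_fderiv_snd (he : IsFinslerEnergy e Ω) {q : E × E} (hq : q ∈ slitSet Ω)
    (w v : E) : fderiv ℝ (fderiv ℝ (fderiv ℝ e)) q (w, 0) (0, q.2) (0, v) =
      fderiv ℝ (fderiv ℝ e) q (w, 0) (0, v) := by
  have hc : HasFDerivAt (fun q : E × E => ((0 : E), q.2))
      ((ContinuousLinearMap.inr ℝ E E).comp (ContinuousLinearMap.snd ℝ E E)) q :=
    ((ContinuousLinearMap.inr ℝ E E).comp (ContinuousLinearMap.snd ℝ E E)).hasFDerivAt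
  have h1 := ((he.hasFDerivAt_fderiv_fderiv hq).clm_apply
    hc).clm_apply (hasFDerivAt_const ((0 : E), v) q)
  have h2 := ((he.hasFDerivAt_fderiv hq).clm_apply (hasFDerivAt_const ((0 : E), v) q)).congr_of_eventuallyEq
    (f₁ := fun q => fderiv ℝ (fderiv ℝ e) q (0, q.2) (0, v)) (by
      filter_upwards [he.mem_nhds hq] with q hq
      exact he.fderiv_fderiv_snd hq v)
  have h3 := congrArg (fun L : E × E →L[ℝ] ℝ => L (w, 0)) (h1.unique h2)
  have h0 : ((0 : E), (0 : E)) = 0 := rfl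
  simpa [h0] using h3

set_option synthInstance.maxHeartbeats 200000 in
theorem lineDeriv_eq (he : IsFinslerEnergy e Ω) {q : E × E} (hq : q ∈ slitSet Ω) {a b : E × E}
    {m : E → ℝ} (hm : ∀ x ∈ Ω, m x = fderiv ℝ (fderiv ℝ e) (x, q.2) a b) (w : E) :
    lineDeriv ℝ m q.1 w = fderiv ℝ (fderiv ℝ (fderiv ℝ e)) q (w, 0) a b := by
  have hc : HasDerivAt (fun t : ℝ => (q.1 + t • w, q.2)) (w, (0 : E)) 0 := by
    have := (((hasDerivAt_id (0 : ℝ)).smul_const w).const_add q.1).prodMk (hasDerivAt_const (0 : ℝ) q.2)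
    simpa using this
  have h0 : (q.1 + (0 : ℝ) • w, q.2) = q := by simp
  have hd := hasFDerivAt_clm_apply_apply (he.hasFDerivAt_fderiv_fderiv hq) a b
  rw [← h0] at hd
  have h := hd.comp_hasDerivAt (0 : ℝ) hc
  rw [h0] at h
  have h2 : HasDerivAt (fun t : ℝ => m (q.1 + t • w))
      (fderiv ℝ (fderiv ℝ (fderiv ℝ e)) q (w, 0) a b) 0 := by
    refine h.congr_of_eventuallyEq ?_
    have h3 : ContinuousAt (fun t : ℝ => q.1 + t • w) 0 := by fun_prop
    filter_upwards [h3.eventually (he.isOpen.mem_nhds (by simpa using hq.1))] with t ht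
    exact hm _ ht
  exact h2.deriv

/-- The spray equation determines the vertical component because the vertical Hessian is positive
definite. -/
theorem spray_unique (he : IsFinslerEnergy e Ω) {q : E × E} (hq : q ∈ slitSet Ω) {b b' : E}
    (h : ∀ v, fderiv ℝ (fderiv ℝ e) q (q.2, b) (0, v) = fderiv ℝ (fderiv ℝ e) q (q.2, b') (0, v)) :
    b = b' := by
  by_contra hne
  have h1 := he.pos q hq (b - b') (sub_ne_zero.2 hne)
  have h2 : ((0 : E), b - b') = (q.2, b) - (q.2, b') := by simp
  have h3 : fderiv ℝ (fderiv ℝ e) q (0, b - b') (0, b - b') = 0 := by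
    nth_rewrite 1 [h2]
    rw [map_sub, sub_apply, h, sub_self]
  exact h1.ne' h3

/-- The fundamental tensor as an operator into the dual space. -/
noncomputable def _root_.fundamentalOperator (e : E × E → ℝ) (q : E × E) : E →L[ℝ] E →L[ℝ] ℝ :=
  ((ContinuousLinearMap.compL ℝ E (E × E) ℝ).flip (ContinuousLinearMap.inr ℝ E E)).comp
    ((fderiv ℝ (fderiv ℝ e) q).comp (ContinuousLinearMap.inr ℝ E E))

theorem _root_.fundamentalOperator_apply (e : E × E → ℝ) (q : E × E) (u v : E) :
    fundamentalOperator e q u v = fderiv ℝ (fderiv ℝ e) q (0, u) (0, v) := rfl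

theorem isInvertible_fundamentalOperator [FiniteDimensional ℝ E] (he : IsFinslerEnergy e Ω)
    {q : E × E} (hq : q ∈ slitSet Ω) : (fundamentalOperator e q).IsInvertible := by
  have hinj : Function.Injective (fundamentalOperator e q) := by
    rw [injective_iff_map_eq_zero]
    intro u hu
    by_contra hne
    have := he.pos q hq u hne
    rw [← fundamentalOperator_apply, hu] at this
    simp at this
  have hdim : Module.finrank ℝ E = Module.finrank ℝ (E →L[ℝ] ℝ) := by
    rw [← LinearEquiv.finrank_eq (LinearMap.toContinuousLinearMap (𝕜 := ℝ) (E := E) (F' := ℝ)),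
      Module.finrank_linearMap, Module.finrank_self, mul_one]
  let L := LinearEquiv.ofInjectiveOfFinrankEq (fundamentalOperator e q : E →ₗ[ℝ] E →L[ℝ] ℝ) hinj hdim
  exact ⟨L.toContinuousLinearEquiv, by ext; rfl⟩

/-- The spray equation expresses G as the inverse of the fundamental tensor applied to derivatives
of e, and inversion of operators is smooth. -/
theorem contDiffOn_spray [FiniteDimensional ℝ E] (he : IsFinslerEnergy e Ω) (hG : IsSpray e Ω G) :
    ContDiffOn ℝ ∞ G (slitSet Ω) := by
  have : CompleteSpace E := FiniteDimensional.complete ℝ E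
  let ρ : E × E → E →L[ℝ] ℝ := fun q => (2 : ℝ)⁻¹ •
    ((fderiv ℝ (fderiv ℝ e) q (q.2, 0)).comp (ContinuousLinearMap.inr ℝ E E) -
      (fderiv ℝ e q).comp (ContinuousLinearMap.inl ℝ E E))
  have hρ : ∀ q ∈ slitSet Ω, fundamentalOperator e q (G q) = ρ q := by
    intro q hq
    ext v
    have h := hG q hq v
    have h1 : (q.2, -(2 : ℝ) • G q) = (q.2, (0 : E)) - (2 : ℝ) • ((0 : E), G q) := by simp
    rw [h1, map_sub, map_smul, sub_apply, smul_apply] at h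
    simp only [ρ, fundamentalOperator_apply, smul_apply,
      sub_apply, ContinuousLinearMap.comp_apply, ContinuousLinearMap.inr_apply,
      ContinuousLinearMap.inl_apply, smul_eq_mul] at h ⊢
    linarith
  have heq : ∀ q ∈ slitSet Ω, G q = (fundamentalOperator e q).inverse (ρ q) := by
    intro q hq
    rw [← hρ q hq]
    exact ((he.isInvertible_fundamentalOperator hq).inverse_apply_eq.2 rfl).symm
  refine ContDiffOn.congr (fun q hq => ContDiffAt.contDiffWithinAt ?_) heq
  have h2 := he.contDiffAt_fderiv_fderiv hq
  have h1 := he.contDiffAt_fderiv hq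
  have hg : ContDiffAt ℝ ∞ (fundamentalOperator e) q :=
    contDiffAt_const.clm_comp (h2.clm_comp contDiffAt_const)
  have hρ' : ContDiffAt ℝ ∞ ρ q := ContDiffAt.const_smul (2 : ℝ)⁻¹
    (((h2.clm_apply (contDiffAt_snd.prodMk contDiffAt_const)).clm_comp contDiffAt_const).sub
      (h1.clm_comp contDiffAt_const))
  obtain ⟨L, hL⟩ := he.isInvertible_fundamentalOperator hq
  have hinv : ContDiffAt ℝ ∞ (fun q => (fundamentalOperator e q).inverse) q := by
    have := contDiffAt_map_inverse (n := ∞) L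
    rw [hL] at this
    exact this.comp q hg
  exact hinv.clm_apply hρ'

variable [FiniteDimensional ℝ E]

theorem contDiffAt_spray (he : IsFinslerEnergy e Ω) (hG : IsSpray e Ω G) {q : E × E}
    (hq : q ∈ slitSet Ω) : ContDiffAt ℝ ∞ G q :=
  (he.contDiffOn_spray hG).contDiffAt (he.mem_nhds hq)

theorem hasFDerivAt_spray (he : IsFinslerEnergy e Ω) (hG : IsSpray e Ω G) {q : E × E}
    (hq : q ∈ slitSet Ω) : HasFDerivAt G (fderiv ℝ G q) q :=
  ((he.contDiffAt_spray hG hq).differentiableAt (by simp)).hasFDerivAt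

theorem contDiffAt_sprayConnection (he : IsFinslerEnergy e Ω) (hG : IsSpray e Ω G) {q : E × E}
    (hq : q ∈ slitSet Ω) : ContDiffAt ℝ ∞ (sprayConnection G) q :=
  ((he.contDiffAt_spray hG hq).fderiv_right (m := ∞) (by simp)).clm_comp contDiffAt_const

theorem contDiffOn_sprayConnection (he : IsFinslerEnergy e Ω) (hG : IsSpray e Ω G) :
    ContDiffOn ℝ ∞ (sprayConnection G) (slitSet Ω) :=
  fun _ hq => (he.contDiffAt_sprayConnection hG hq).contDiffWithinAt

theorem hasFDerivAt_sprayConnection (he : IsFinslerEnergy e Ω) (hG : IsSpray e Ω G) {q : E × E}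
    (hq : q ∈ slitSet Ω) :
    HasFDerivAt (sprayConnection G) (fderiv ℝ (sprayConnection G) q) q :=
  ((he.contDiffAt_sprayConnection hG hq).differentiableAt (by simp)).hasFDerivAt

/-- Conservation of energy along geodesics: the spray equation tested on v = y, combined with
Euler's identity. -/
theorem fderiv_spray (he : IsFinslerEnergy e Ω) (hG : IsSpray e Ω G) {q : E × E}
    (hq : q ∈ slitSet Ω) : fderiv ℝ e q (q.2, -(2 : ℝ) • G q) = 0 := by
  have h1 := hG q hq q.2
  have h2 := he.fderiv_euler hq (q.2, -(2 : ℝ) • G q)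
  have h3 : (q.2, -(2 : ℝ) • G q) = (q.2, (0 : E)) + ((0 : E), -(2 : ℝ) • G q) := by simp
  rw [h1] at h2
  simp only at h2
  have h4 : fderiv ℝ e q (q.2, -(2 : ℝ) • G q) =
      fderiv ℝ e q (q.2, 0) + fderiv ℝ e q (0, -(2 : ℝ) • G q) := by rw [← map_add, ← h3]
  linarith

/-- Differentiating de(y, -2G) = 0 in the direction (0, v) gives e_yx-type terms that the spray
equation turns into de(v, 0), plus de(v, -2Nv) with N the connection. Their sum is twice de(v, -Nv).
This is why parallel translation preserves F. -/
theorem fderiv_sprayHorizontal (he : IsFinslerEnergy e Ω) (hG : IsSpray e Ω G) {q : E × E}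
    (hq : q ∈ slitSet Ω) (v : E) : fderiv ℝ e q (sprayHorizontal G q v) = 0 := by
  have hc : HasFDerivAt (fun q : E × E => (q.2, -(2 : ℝ) • G q))
      ((ContinuousLinearMap.snd ℝ E E).prod (-(2 : ℝ) • fderiv ℝ G q)) q :=
    hasFDerivAt_snd.prodMk ((he.hasFDerivAt_spray hG hq).const_smul (-2 : ℝ))
  have h1 := (he.hasFDerivAt_fderiv hq).clm_apply hc
  have h2 := (hasFDerivAt_const (𝕜 := ℝ) (0 : ℝ) q).congr_of_eventuallyEq
    (f₁ := fun q => fderiv ℝ e q (q.2, -(2 : ℝ) • G q)) (by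
      filter_upwards [he.mem_nhds hq] with q hq
      exact he.fderiv_spray hG hq)
  have h3 := congrArg (fun L : E × E →L[ℝ] ℝ => L (0, v)) (h1.unique h2)
  simp only [add_apply, ContinuousLinearMap.comp_apply,
    ContinuousLinearMap.prod_apply, ContinuousLinearMap.flip_apply,
    zero_apply, ContinuousLinearMap.coe_snd', smul_apply] at h3
  rw [he.symm hq, hG q hq] at h3
  rw [sprayHorizontal, sprayConnection_apply]
  have e1 : (v, -(2 : ℝ) • fderiv ℝ G q (0, v)) =
      -(v, (0 : E)) + (2 : ℝ) • (v, -fderiv ℝ G q (0, v)) := by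
    ext <;> simp [two_smul]
  rw [e1, map_add, map_neg, map_smul, smul_eq_mul] at h3
  linarith

/-- Differentiating de = 0 on horizontal vectors along a second horizontal vector expresses the
Hessian of e on the pair as de of a vertical derivative of the connection. The Hessian is symmetric,
so the antisymmetric part, the curvature, is annihilated by de: curvature vectors are tangent to the
indicatrix. -/
theorem fderiv_sprayCurvature (he : IsFinslerEnergy e Ω) (hG : IsSpray e Ω G) {q : E × E}
    (hq : q ∈ slitSet Ω) (u w : E) : fderiv ℝ e q (0, sprayCurvature G q u w) = 0 := by
  have key : ∀ a w : E, fderiv ℝ (fderiv ℝ e) q (sprayHorizontal G q a) (sprayHorizontal G q w) =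
      fderiv ℝ e q (0, fderiv ℝ (sprayConnection G) q (sprayHorizontal G q a) w) := by
    intro a w
    have hc : HasFDerivAt (fun q : E × E => sprayHorizontal G q w)
        ((0 : E × E →L[ℝ] E).prod (-((fderiv ℝ (sprayConnection G) q).flip w))) q :=
      (hasFDerivAt_const w q).prodMk
        (((he.hasFDerivAt_sprayConnection hG hq).clm_apply (hasFDerivAt_const w q)).congr_fderiv
          (by ext <;> simp)).neg
    have h1 := (he.hasFDerivAt_fderiv hq).clm_apply hc
    have h2 := (hasFDerivAt_const (𝕜 := ℝ) (0 : ℝ) q).congr_of_eventuallyEq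
      (f₁ := fun q => fderiv ℝ e q (sprayHorizontal G q w)) (by
        filter_upwards [he.mem_nhds hq] with q hq
        exact he.fderiv_sprayHorizontal hG hq w)
    have h3 := congrArg (fun L : E × E →L[ℝ] ℝ => L (sprayHorizontal G q a)) (h1.unique h2)
    simp only [add_apply, ContinuousLinearMap.comp_apply,
      ContinuousLinearMap.prod_apply, ContinuousLinearMap.flip_apply,
      zero_apply, neg_apply] at h3
    have h4 : ((0 : E), -(fderiv ℝ (sprayConnection G) q (sprayHorizontal G q a)) w) =
      -((0 : E), (fderiv ℝ (sprayConnection G) q (sprayHorizontal G q a)) w) := by simp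
    rw [h4, map_neg] at h3
    linarith
  have h5 : ((0 : E), sprayCurvature G q u w) =
      ((0 : E), fderiv ℝ (sprayConnection G) q (sprayHorizontal G q w) u) -
        (0, fderiv ℝ (sprayConnection G) q (sprayHorizontal G q u) w) := by simp [sprayCurvature]
  rw [h5, map_sub, ← key, ← key, he.symm hq, sub_self]

/-- The horizontal distribution does not depend on the coordinates. -/
theorem sprayHorizontal_change (he : IsFinslerEnergy e Ω) (hG : IsSpray e Ω G) {e' : E × E → ℝ}
    {Ω' : Set E} {G' : E × E → E} (he' : IsFinslerEnergy e' Ω') (hG' : IsSpray e' Ω' G')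
    {U : Set E} (hU : IsOpen U) (hUΩ : U ⊆ Ω) {φ : E → E} (hφ : ContDiffOn ℝ ∞ φ U)
    (hm : MapsTo φ U Ω') (hinj : ∀ x ∈ U, Function.Bijective (fderiv ℝ φ x))
    (hee : ∀ x ∈ U, ∀ y ≠ 0, e (x, y) = e' (φ x, fderiv ℝ φ x y)) {q : E × E} (hqU : q.1 ∈ U)
    (hq0 : q.2 ≠ 0) (a : E) :
    fderiv ℝ (fun q : E × E => (φ q.1, fderiv ℝ φ q.1 q.2)) q (sprayHorizontal G q a) =
      sprayHorizontal G' (φ q.1, fderiv ℝ φ q.1 q.2) (fderiv ℝ φ q.1 a) := by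
  set Θ : E × E → E × E := fun q => (φ q.1, fderiv ℝ φ q.1 q.2) with hΘ
  have cφ : ∀ x ∈ U, ContDiffAt ℝ ∞ φ x := fun x hx => hφ.contDiffAt (hU.mem_nhds hx)
  have cφ' : ∀ x ∈ U, ContDiffAt ℝ ∞ (fderiv ℝ φ) x := fun x hx =>
    (cφ x hx).fderiv_right (m := ∞) (by simp)
  have dφ : ∀ x ∈ U, HasFDerivAt φ (fderiv ℝ φ x) x := fun x hx =>
    ((cφ x hx).differentiableAt (by simp)).hasFDerivAt
  have dφ' : ∀ x ∈ U, HasFDerivAt (fderiv ℝ φ) (fderiv ℝ (fderiv ℝ φ) x) x := fun x hx =>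
    ((cφ' x hx).differentiableAt (by simp)).hasFDerivAt
  have sφ : ∀ x ∈ U, ∀ a b, fderiv ℝ (fderiv ℝ φ) x a b = fderiv ℝ (fderiv ℝ φ) x b a :=
    fun x hx => (cφ x hx).isSymmSndFDerivAt (by
      rw [minSmoothness_of_isRCLikeNormedField]; exact WithTop.coe_le_coe.2 le_top)
  have hsl : ∀ q ∈ slitSet U, q ∈ slitSet Ω := fun q hq => ⟨hUΩ hq.1, hq.2⟩
  have hsl' : ∀ q ∈ slitSet U, Θ q ∈ slitSet Ω' := fun q hq =>
    ⟨hm hq.1, fun h0 => hq.2 ((hinj q.1 hq.1).1 (h0.trans (map_zero _).symm))⟩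
  have hnhds : ∀ q ∈ slitSet U, slitSet U ∈ 𝓝 q := fun q hq => (isOpen_slitSet hU).mem_nhds hq
  have hee' : ∀ q ∈ slitSet U, e q = e' (Θ q) := fun q hq => hee q.1 hq.1 q.2 hq.2
  -- the derivative of the coordinate change
  let DΘ : E × E → (E × E →L[ℝ] E × E) := fun q =>
    ((fderiv ℝ φ q.1).comp (ContinuousLinearMap.fst ℝ E E)).prod
      ((fderiv ℝ φ q.1).comp (ContinuousLinearMap.snd ℝ E E) +
        ((fderiv ℝ (fderiv ℝ φ) q.1).flip q.2).comp (ContinuousLinearMap.fst ℝ E E))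
  have hDΘ : ∀ q ∈ slitSet U, HasFDerivAt Θ (DΘ q) q := by
    intro q hq
    refine ((dφ q.1 hq.1).comp q hasFDerivAt_fst).prodMk ?_
    exact (((dφ' q.1 hq.1).comp q hasFDerivAt_fst).clm_apply hasFDerivAt_snd).congr_fderiv (by
      ext <;> simp)
  have hDΘ_apply : ∀ q v w, DΘ q (v, w) =
      (fderiv ℝ φ q.1 v, fderiv ℝ φ q.1 w + fderiv ℝ (fderiv ℝ φ) q.1 v q.2) := fun _ _ _ => rfl
  have hde : ∀ q ∈ slitSet U, ∀ v w, fderiv ℝ e q (v, w) = fderiv ℝ e' (Θ q) (DΘ q (v, w)) := by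
    intro q hq v w
    have h1 := ((he'.hasFDerivAt (hsl' q hq)).comp q (hDΘ q hq)).congr_of_eventuallyEq
      (f₁ := e) (by filter_upwards [hnhds q hq] with r hr using hee' r hr)
    exact congrArg (fun L : E × E →L[ℝ] ℝ => L (v, w)) ((he.hasFDerivAt (hsl q hq)).unique h1)
  -- The coordinate change carries spray to spray: the transported vector satisfies the equation
  -- that determines the spray of `e'` uniquely. Test vectors are taken of the form Dφ v, which is
  -- no restriction as Dφ is surjective.
  have hspray : ∀ q ∈ slitSet U, DΘ q (q.2, -(2 : ℝ) • G q) = ((Θ q).2, -(2 : ℝ) • G' (Θ q)) := by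
    intro q hq
    refine Prod.ext rfl ?_
    refine he'.spray_unique (hsl' q hq) fun v' => ?_
    rw [hG' _ (hsl' q hq)]
    obtain ⟨v, rfl⟩ := (hinj q.1 hq.1).2 v'
    have hlin : HasFDerivAt (fun q : E × E => ((0 : E), fderiv ℝ φ q.1 v))
        ((ContinuousLinearMap.inr ℝ E E).comp (((fderiv ℝ (fderiv ℝ φ) q.1).flip v).comp
          (ContinuousLinearMap.fst ℝ E E))) q := by
      have := (((dφ' q.1 hq.1).comp q hasFDerivAt_fst).clm_apply
        (hasFDerivAt_const v q)).congr_fderiv (g' := ((fderiv ℝ (fderiv ℝ φ) q.1).flip v).comp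
          (ContinuousLinearMap.fst ℝ E E)) (by ext <;> simp)
      exact ((ContinuousLinearMap.inr ℝ E E).hasFDerivAt (x := fderiv ℝ φ q.1 v)).comp q this
    have h1 := ((he'.hasFDerivAt_fderiv (hsl' q hq)).comp q (hDΘ q hq)).clm_apply hlin
    have h2 := ((he.hasFDerivAt_fderiv (hsl q hq)).clm_apply
      (hasFDerivAt_const ((0 : E), v) q)).congr_of_eventuallyEq
        (f₁ := fun q => fderiv ℝ e' (Θ q) (0, fderiv ℝ φ q.1 v)) (by
          filter_upwards [hnhds q hq] with r hr
          rw [hde r hr, hDΘ_apply]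
          simp)
    have h3 := congrArg (fun L : E × E →L[ℝ] ℝ => L (q.2, -(2 : ℝ) • G q)) (h1.unique h2)
    simp only [add_apply, ContinuousLinearMap.comp_apply,
      ContinuousLinearMap.flip_apply, ContinuousLinearMap.inr_apply, ContinuousLinearMap.coe_fst',
      zero_apply, map_zero, zero_add, Function.comp_apply] at h3
    rw [hG q (hsl q hq), hde q hq, sφ q.1 hq.1 q.2 v] at h3
    have h4 : DΘ q (v, 0) =
        (fderiv ℝ φ q.1 v, (0 : E)) + (0, fderiv ℝ (fderiv ℝ φ) q.1 v q.2) := by simp [hDΘ_apply]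
    rw [h4, map_add] at h3
    have h5 := (add_left_cancel_iff (a := fderiv ℝ e' (Θ q) (0, fderiv ℝ (fderiv ℝ φ) q.1 v q.2))).1
      (h3.trans (add_comm _ _))
    exact h5
  have hq : q ∈ slitSet U := ⟨hqU, hq0⟩
  rw [(hDΘ q hq).fderiv]
  -- The vertical derivative of the transformation law Dφ(-2G) + D²φ(y, y) = -2G' is twice the
  -- transformation law of the connection.
  have h1 : HasFDerivAt (fun q : E × E => fderiv ℝ φ q.1 (-(2 : ℝ) • G q) +
      fderiv ℝ (fderiv ℝ φ) q.1 q.2 q.2) _ q :=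
    (((dφ' q.1 hq.1).comp q hasFDerivAt_fst).clm_apply
      ((he.hasFDerivAt_spray hG (hsl q hq)).const_smul (-2 : ℝ))).add
      (((((((cφ' q.1 hq.1).fderiv_right (m := ∞) (by simp)).differentiableAt
        (by simp)).hasFDerivAt).comp q hasFDerivAt_fst).clm_apply hasFDerivAt_snd).clm_apply
        hasFDerivAt_snd)
  have h2 := (((he'.hasFDerivAt_spray hG' (hsl' q hq)).comp q (hDΘ q hq)).const_smul
    (-2 : ℝ)).congr_of_eventuallyEq (f₁ := fun q : E × E => fderiv ℝ φ q.1 (-(2 : ℝ) • G q) +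
      fderiv ℝ (fderiv ℝ φ) q.1 q.2 q.2) (by
        filter_upwards [hnhds q hq] with r hr
        exact congrArg Prod.snd (hspray r hr))
  have h3 := congrArg (fun L : E × E →L[ℝ] E => L (0, a)) (h1.unique h2)
  simp only [add_apply, ContinuousLinearMap.comp_apply,
      ContinuousLinearMap.flip_apply, ContinuousLinearMap.coe_fst', ContinuousLinearMap.coe_snd',
      zero_apply, smul_apply, map_zero, add_zero, Function.comp_apply, hDΘ_apply] at h3
  rw [sφ q.1 hq.1 q.2 a, map_smul, ← two_smul ℝ (fderiv ℝ (fderiv ℝ φ) q.1 a q.2), neg_smul,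
    neg_smul, neg_add_eq_sub, ← smul_sub, ← smul_neg] at h3
  have h4 := smul_right_injective E (two_ne_zero (α := ℝ)) h3
  refine Prod.ext rfl ?_
  change fderiv ℝ φ q.1 (-sprayConnection G q a) + fderiv ℝ (fderiv ℝ φ) q.1 a q.2 =
    -sprayConnection G' (Θ q) (fderiv ℝ φ q.1 a)
  rw [map_neg, neg_add_eq_sub]
  exact h4

/-- The curvature does not depend on the coordinates. -/
theorem sprayCurvature_change (he : IsFinslerEnergy e Ω) (hG : IsSpray e Ω G) {e' : E × E → ℝ}
    {Ω' : Set E} {G' : E × E → E} (he' : IsFinslerEnergy e' Ω') (hG' : IsSpray e' Ω' G')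
    {U : Set E} (hU : IsOpen U) (hUΩ : U ⊆ Ω) {φ : E → E} (hφ : ContDiffOn ℝ ∞ φ U)
    (hm : MapsTo φ U Ω') (hinj : ∀ x ∈ U, Function.Bijective (fderiv ℝ φ x))
    (hee : ∀ x ∈ U, ∀ y ≠ 0, e (x, y) = e' (φ x, fderiv ℝ φ x y)) {q : E × E} (hqU : q.1 ∈ U)
    (hq0 : q.2 ≠ 0) (u w : E) :
    fderiv ℝ φ q.1 (sprayCurvature G q u w) =
      sprayCurvature G' (φ q.1, fderiv ℝ φ q.1 q.2) (fderiv ℝ φ q.1 u) (fderiv ℝ φ q.1 w) := by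
  set Θ : E × E → E × E := fun q => (φ q.1, fderiv ℝ φ q.1 q.2) with hΘ
  have hq : q ∈ slitSet U := ⟨hqU, hq0⟩
  have hsl : q ∈ slitSet Ω := ⟨hUΩ hqU, hq0⟩
  have hsl' : Θ q ∈ slitSet Ω' :=
    ⟨hm hqU, fun h0 => hq0 ((hinj q.1 hqU).1 (h0.trans (map_zero _).symm))⟩
  have hnhds : ∀ q ∈ slitSet U, slitSet U ∈ 𝓝 q := fun q hq => (isOpen_slitSet hU).mem_nhds hq
  have cφ : ∀ x ∈ U, ContDiffAt ℝ ∞ φ x := fun x hx => hφ.contDiffAt (hU.mem_nhds hx)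
  have cφ' : ∀ x ∈ U, ContDiffAt ℝ ∞ (fderiv ℝ φ) x := fun x hx =>
    (cφ x hx).fderiv_right (m := ∞) (by simp)
  have cφ'' : ∀ x ∈ U, ContDiffAt ℝ ∞ (fderiv ℝ (fderiv ℝ φ)) x := fun x hx =>
    (cφ' x hx).fderiv_right (m := ∞) (by simp)
  have dφ : ∀ x ∈ U, HasFDerivAt φ (fderiv ℝ φ x) x := fun x hx =>
    ((cφ x hx).differentiableAt (by simp)).hasFDerivAt
  have dφ' : ∀ x ∈ U, HasFDerivAt (fderiv ℝ φ) (fderiv ℝ (fderiv ℝ φ) x) x := fun x hx =>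
    ((cφ' x hx).differentiableAt (by simp)).hasFDerivAt
  have dφ'' : ∀ x ∈ U, HasFDerivAt (fderiv ℝ (fderiv ℝ φ)) (fderiv ℝ (fderiv ℝ (fderiv ℝ φ)) x) x :=
    fun x hx => ((cφ'' x hx).differentiableAt (by simp)).hasFDerivAt
  have sφ : ∀ x ∈ U, ∀ a b, fderiv ℝ (fderiv ℝ (fderiv ℝ φ)) x a b =
      fderiv ℝ (fderiv ℝ (fderiv ℝ φ)) x b a :=
    fun x hx => (cφ' x hx).isSymmSndFDerivAt (by
      rw [minSmoothness_of_isRCLikeNormedField]; exact WithTop.coe_le_coe.2 le_top)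
  have hDΘ : ∀ q ∈ slitSet U, ∀ v, fderiv ℝ Θ q v =
      (fderiv ℝ φ q.1 v.1, fderiv ℝ φ q.1 v.2 + fderiv ℝ (fderiv ℝ φ) q.1 v.1 q.2) := by
    intro q hq v
    have h := ((dφ q.1 hq.1).comp q hasFDerivAt_fst).prodMk
      (((dφ' q.1 hq.1).comp q hasFDerivAt_fst).clm_apply hasFDerivAt_snd)
    have h' : HasFDerivAt Θ _ q := h
    rw [h'.fderiv]
    simp
  have hhor : ∀ q ∈ slitSet U, ∀ a, fderiv ℝ Θ q (sprayHorizontal G q a) =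
      sprayHorizontal G' (Θ q) (fderiv ℝ φ q.1 a) := fun q hq a =>
    he.sprayHorizontal_change hG he' hG' hU hUΩ hφ hm hinj hee hq.1 hq.2 a
  -- The transformation law of the connection applied to u, differentiated along the horizontal
  -- vector over w.
  have key : ∀ u w, fderiv ℝ (fderiv ℝ (fderiv ℝ φ)) q.1 w u q.2 -
      fderiv ℝ (fderiv ℝ φ) q.1 u (sprayConnection G q w) -
      fderiv ℝ (fderiv ℝ φ) q.1 w (sprayConnection G q u) -
      fderiv ℝ φ q.1 (fderiv ℝ (sprayConnection G) q (sprayHorizontal G q w) u) =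
      -fderiv ℝ (sprayConnection G') (Θ q) (sprayHorizontal G' (Θ q) (fderiv ℝ φ q.1 w))
        (fderiv ℝ φ q.1 u) - sprayConnection G' (Θ q) (fderiv ℝ (fderiv ℝ φ) q.1 w u) := by
    intro u w
    have e1 : HasFDerivAt (fun q : E × E => fderiv ℝ φ q.1 u)
        (((fderiv ℝ (fderiv ℝ φ) q.1).flip u).comp (ContinuousLinearMap.fst ℝ E E)) q :=
      (((dφ' q.1 hqU).comp q hasFDerivAt_fst).clm_apply
        (hasFDerivAt_const u q)).congr_fderiv (by ext <;> simp)
    have e2 : HasFDerivAt (fun q : E × E => sprayConnection G q u)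
        ((fderiv ℝ (sprayConnection G) q).flip u) q :=
      ((he.hasFDerivAt_sprayConnection hG hsl).clm_apply (hasFDerivAt_const u q)).congr_fderiv
        (by ext <;> simp)
    have e3 : HasFDerivAt (fun q : E × E => fderiv ℝ (fderiv ℝ φ) q.1 u)
        (((fderiv ℝ (fderiv ℝ (fderiv ℝ φ)) q.1).flip u).comp (ContinuousLinearMap.fst ℝ E E)) q :=
      (((dφ'' q.1 hqU).comp q hasFDerivAt_fst).clm_apply
        (hasFDerivAt_const u q)).congr_fderiv (by ext <;> simp)
    have e4 : HasFDerivAt Θ (fderiv ℝ Θ q) q := by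
      have h := ((dφ q.1 hq.1).comp q hasFDerivAt_fst).prodMk
        (((dφ' q.1 hq.1).comp q hasFDerivAt_fst).clm_apply hasFDerivAt_snd)
      exact (show DifferentiableAt ℝ Θ q from h.differentiableAt).hasFDerivAt
    have h1 := (((dφ' q.1 hqU).comp q hasFDerivAt_fst).clm_apply e2.neg).add
      (e3.clm_apply hasFDerivAt_snd)
    have h2 := (((he'.hasFDerivAt_sprayConnection hG' hsl').comp q e4).clm_apply
      e1).neg.congr_of_eventuallyEq
      (f₁ := fun q : E × E => fderiv ℝ φ q.1 (-sprayConnection G q u) +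
        fderiv ℝ (fderiv ℝ φ) q.1 u q.2) (by
          filter_upwards [hnhds q hq] with r hr
          have h := congrArg Prod.snd (hhor r hr u)
          rw [hDΘ r hr] at h
          exact h)
    have h3 := congrArg (fun L : E × E →L[ℝ] E => L (sprayHorizontal G q w)) (h1.unique h2)
    simp only [add_apply, ContinuousLinearMap.comp_apply, neg_apply, hhor q hq,
      ContinuousLinearMap.flip_apply, ContinuousLinearMap.coe_fst', ContinuousLinearMap.coe_snd',
      Function.comp_apply, Pi.neg_apply, map_neg] at h3
    simp only [sprayHorizontal, map_neg] at h3 ⊢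
    rw [neg_add] at h3
    rw [sub_eq_add_neg _ (sprayConnection G' (Θ q) _), add_comm _ (-(sprayConnection G' (Θ q) _)),
      ← h3]
    abel
  have k1 := key u w
  have k2 := key w u
  have s2 := (cφ q.1 hqU).isSymmSndFDerivAt (by
      rw [minSmoothness_of_isRCLikeNormedField]; exact WithTop.coe_le_coe.2 le_top) w u
  rw [sφ q.1 hqU w u, s2] at k1
  change _ = sprayCurvature G' (Θ q) _ _
  simp only [sprayCurvature, map_sub]
  rw [← sub_eq_zero] at k1 k2 ⊢
  -- Antisymmetrization in u and w: everything containing second or third derivatives of φ is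
  -- symmetric and cancels, leaving the two curvatures.
  have k3 := k1.trans k2.symm
  rw [← sub_eq_zero] at k3
  rw [← neg_eq_zero]
  refine Eq.trans ?_ k3
  abel

/-- The vertical part of the bracket of horizontal fields is the curvature. -/
theorem lieBracket_sprayHorizontal (he : IsFinslerEnergy e Ω) (hG : IsSpray e Ω G) {q : E × E}
    (hq : q ∈ slitSet Ω) {X Y : E → E} (hX : DifferentiableAt ℝ X q.1) (hY : DifferentiableAt ℝ Y q.1) :
    lieBracket ℝ (fun q => sprayHorizontal G q (X q.1)) (fun q => sprayHorizontal G q (Y q.1)) q =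
      sprayHorizontal G q (lieBracket ℝ X Y q.1) + (0, sprayCurvature G q (X q.1) (Y q.1)) := by
  have key : ∀ {Z : E → E}, DifferentiableAt ℝ Z q.1 →
      ∀ v : E × E, fderiv ℝ (fun q => sprayHorizontal G q (Z q.1)) q v =
        (fderiv ℝ Z q.1 v.1, -(fderiv ℝ (sprayConnection G) q v (Z q.1) +
          sprayConnection G q (fderiv ℝ Z q.1 v.1))) := by
    intro Z hZ v
    have h1 : HasFDerivAt (fun q : E × E => Z q.1) ((fderiv ℝ Z q.1).comp
      (ContinuousLinearMap.fst ℝ E E)) q := hZ.hasFDerivAt.comp q hasFDerivAt_fst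
    have h2 : HasFDerivAt (fun q => sprayHorizontal G q (Z q.1)) _ q :=
      h1.prodMk ((he.hasFDerivAt_sprayConnection hG hq).clm_apply h1).neg
    rw [h2.fderiv]
    refine Prod.ext rfl ?_
    simp [add_comm]
  rw [lieBracket, key hX, key hY]
  simp only [lieBracket, sprayHorizontal, sprayCurvature]
  refine Prod.ext (by simp) ?_
  simp only [Prod.snd_sub, Prod.snd_add, map_sub]
  abel

end IsFinslerEnergy

end FinslerCalculus

/-! ### Changes of charts of the manifold and of its tangent bundle. -/

section ChartChange

variable {n : ℕ} {M : Type*} [TopologicalSpace M]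
  [ChartedSpace (EuclideanSpace ℝ (Fin n)) M] [IsManifold (𝓡 n) ∞ M]

local notation "𝔼" => EuclideanSpace ℝ (Fin n)

open FinslerMetric

/-- The change from the preferred chart at `c` to the preferred chart at `d`. -/
noncomputable def chartChange (c d : M) (x : 𝔼) : 𝔼 := chartAt 𝔼 d ((chartAt 𝔼 c).symm x)

/-- The domain of the change of charts. -/
def chartChangeSource (c d : M) : Set 𝔼 :=
  {x | x ∈ (chartAt 𝔼 c).target ∧ (chartAt 𝔼 c).symm x ∈ (chartAt 𝔼 d).source}

theorem isOpen_chartChangeSource (c d : M) : IsOpen (chartChangeSource (n := n) c d) :=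
  (chartAt 𝔼 c).isOpen_inter_preimage_symm (chartAt 𝔼 d).open_source

theorem isManifold_one (n : ℕ) (M : Type*) [TopologicalSpace M]
    [ChartedSpace (EuclideanSpace ℝ (Fin n)) M] [IsManifold (𝓡 n) ∞ M] : IsManifold (𝓡 n) 1 M := IsManifold.of_le (n := ∞) (by simp)

theorem hasFDerivAt_chartChange {c d : M} {x : 𝔼} (hx : x ∈ chartChangeSource c d) :
    HasFDerivAt (chartChange c d)
      ((tangentBundleCore (𝓡 n) M).coordChange (achart 𝔼 c) (achart 𝔼 d) ((chartAt 𝔼 c).symm x)) x := by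
  have : IsManifold (𝓡 n) 1 M := isManifold_one n M
  have hs : (chartAt 𝔼 c).symm x ∈ (extChartAt (𝓡 n) c).source ∩ (extChartAt (𝓡 n) d).source := by
    rw [extChartAt_source, extChartAt_source]
    exact ⟨(chartAt 𝔼 c).map_target hx.1, hx.2⟩
  have h := hasFDerivWithinAt_tangentCoordChange hs
  have e : extChartAt (𝓡 n) c ((chartAt 𝔼 c).symm x) = x := (chartAt 𝔼 c).right_inv hx.1
  rw [e] at h
  exact hasFDerivAt_of_range_modelWithCornersSelf h

theorem tangentChart_symm_apply (c : M) (q : 𝔼 × 𝔼) :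
    ((tangentChart c).symm q : TangentBundle (𝓡 n) M) =
      ⟨(chartAt 𝔼 c).symm q.1, (tangentBundleCore (𝓡 n) M).coordChange (achart 𝔼 c)
        (achart 𝔼 ((chartAt 𝔼 c).symm q.1)) ((chartAt 𝔼 c).symm q.1) q.2⟩ := rfl

theorem tangentChart_apply (c : M) (w : TangentBundle (𝓡 n) M) :
    tangentChart c w = (chartAt 𝔼 c w.1, (tangentBundleCore (𝓡 n) M).coordChange (achart 𝔼 w.1)
        (achart 𝔼 c) w.1 w.2) := rfl

/-- The cocycle of the tangent bundle is the derivative of the chart change, so the invariance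
results of the flat calculus, stated for (φ, Dφ), apply to charts of M. -/
theorem tangentChart_tangentChart_symm {c d : M} {q : 𝔼 × 𝔼} (hq : q.1 ∈ chartChangeSource c d) :
    tangentChart d ((tangentChart c).symm q : TangentBundle (𝓡 n) M) =
      (chartChange c d q.1, fderiv ℝ (chartChange c d) q.1 q.2) := by
  rw [(hasFDerivAt_chartChange hq).fderiv, tangentChart_symm_apply, tangentChart_apply]
  refine Prod.ext rfl ?_
  exact (tangentBundleCore (𝓡 n) M).coordChange_comp _ _ _ _
    ⟨⟨(chartAt 𝔼 c).map_target hq.1, mem_chart_source _ _⟩, hq.2⟩ _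

theorem contDiffOn_chartChange (c d : M) :
    ContDiffOn ℝ ∞ (chartChange (n := n) c d) (chartChangeSource c d) := by
  have hc : ContDiff ℝ ∞ fun x : 𝔼 => (x, (0 : 𝔼)) := contDiff_id.prodMk contDiff_const
  have h := (contDiffOn_tangentChart_change c d).fst.comp
    (hc.contDiffOn (s := chartChangeSource c d)) fun x hx => ⟨hx.1, hx.2⟩
  exact h

theorem bijective_fderiv_chartChange {c d : M} {x : 𝔼} (hx : x ∈ chartChangeSource c d) :
    Function.Bijective (fderiv ℝ (chartChange c d) x) := by
  rw [(hasFDerivAt_chartChange hx).fderiv]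
  have h1 := (chartAt 𝔼 c).map_target hx.1
  have hcomp : ∀ i j : atlas 𝔼 M, (chartAt 𝔼 c).symm x ∈ i.1.source → (chartAt 𝔼 c).symm x ∈ j.1.source →
      ∀ v, (tangentBundleCore (𝓡 n) M).coordChange j i ((chartAt 𝔼 c).symm x)
        ((tangentBundleCore (𝓡 n) M).coordChange i j ((chartAt 𝔼 c).symm x) v) = v := by
    intro i j hi hj v
    rw [(tangentBundleCore (𝓡 n) M).coordChange_comp _ _ _ _ ⟨⟨hi, hj⟩, hi⟩,
      (tangentBundleCore (𝓡 n) M).coordChange_self _ _ hi]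
  exact Function.bijective_iff_has_inverse.2 ⟨_, fun v => hcomp _ _ h1 hx.2 v,
    fun v => hcomp _ _ hx.2 h1 v⟩

theorem tangentChart_symm_tangentChart {c d : M} {q : 𝔼 × 𝔼} (hq : q.1 ∈ chartChangeSource c d) :
    (tangentChart d).symm (chartChange c d q.1, fderiv ℝ (chartChange c d) q.1 q.2) = (tangentChart c).symm q := by
  rw [← tangentChart_tangentChart_symm hq]
  exact (tangentChart d).left_inv ((mem_tangentChart_source _ _).2 hq.2)

end ChartChange

/-! ### The energy of a Finsler metric in a chart and its geodesic coefficients. -/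

namespace FinslerMetric

variable {n : ℕ} {M : Type*} [TopologicalSpace M]
  [ChartedSpace (EuclideanSpace ℝ (Fin n)) M] [IsManifold (𝓡 n) ∞ M] (F : FinslerMetric n M)

local notation "𝔼" => EuclideanSpace ℝ (Fin n)

/-- The Finsler function in the coordinates induced by the preferred chart at `c`. -/
noncomputable def chartNorm (c : M) (q : 𝔼 × 𝔼) : ℝ := F ((tangentChart c).symm q)

/-- The energy `½ F²` in the coordinates induced by the preferred chart at `c`. -/
noncomputable def energy (c : M) (q : 𝔼 × 𝔼) : ℝ := (1 / 2) * F.chartNorm c q ^ 2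

/-- The geodesic coefficients as a vector. -/
noncomputable def geodesicVector (c : M) (q : 𝔼 × 𝔼) : 𝔼 :=
  WithLp.toLp 2 fun i => F.geodesicCoeff c q.1 q.2 i

theorem contDiffOn_chartNorm (c : M) :
    ContDiffOn ℝ ∞ (F.chartNorm c) (slitSet (chartAt 𝔼 c).target) := by
  have hsymm : ContMDiffOn (𝓘(ℝ, 𝔼).prod 𝓘(ℝ, 𝔼))
      (𝓡 n).tangent ∞ (tangentChart c).symm (tangentChart (M := M) c).target :=
    contMDiffOn_chart_symm (I := (𝓡 n).tangent) (x := (⟨c, 0⟩ : TangentBundle (𝓡 n) M))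
  have h := F.smooth'.comp
    (hsymm.mono fun (q : 𝔼 × 𝔼) (hq : q ∈ slitSet _) => (mem_tangentChart_target c q).2 hq.1)
    fun q hq => tangentChart_symm_snd_ne_zero c hq.1 hq.2
  exact contMDiffOn_iff_contDiffOn.1 h

theorem chartNorm_smul (c : M) (x y : 𝔼) {a : ℝ} (ha : 0 < a) :
    F.chartNorm c (x, a • y) = a * F.chartNorm c (x, y) :=
  F.apply_tangentChart_symm_smul c x y ha

theorem chartNorm_pos (c : M) {q : 𝔼 × 𝔼} (hq : q ∈ slitSet (chartAt 𝔼 c).target) :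
    0 < F.chartNorm c q :=
  F.apply_pos _ _ (tangentChart_symm_snd_ne_zero c hq.1 hq.2)

theorem contDiffOn_energy (c : M) : ContDiffOn ℝ ∞ (F.energy c) (slitSet (chartAt 𝔼 c).target) :=
  contDiffOn_const.mul ((F.contDiffOn_chartNorm c).pow 2)

theorem fundamentalForm_eq (c : M) {q : 𝔼 × 𝔼} (hq : q ∈ slitSet (chartAt 𝔼 c).target) (u v : 𝔼) :
    fundamentalForm (fun w : 𝔼 => F ((tangentChart c).symm (q.1, w))) q.2 u v =
      fderiv ℝ (fderiv ℝ (F.energy c)) q (0, u) (0, v) :=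
  fundamentalForm_eq_fderiv (chartAt 𝔼 c).open_target (L := F.chartNorm c)
    (fun q => by rw [energy]; ring) (F.contDiffOn_energy c) hq u v

theorem isFinslerEnergy_energy (c : M) : IsFinslerEnergy (F.energy c) (chartAt 𝔼 c).target where
  isOpen := (chartAt 𝔼 c).open_target
  contDiffOn := F.contDiffOn_energy c
  homogeneous x y a ha := by
    rw [energy, F.chartNorm_smul c x y ha, energy]
    ring
  pos q hq u hu := by
    rw [← F.fundamentalForm_eq c hq]
    -- Fiber coordinates are linear, so the fundamental form in the chart is the intrinsic one
    -- evaluated on the images of y and u.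
    have h := F.posDef' ((tangentChart c).symm q).1 ((tangentChart c).symm q).2
      ((tangentChart c).symm (q.1, u)).2 (tangentChart_symm_snd_ne_zero c hq.1 hq.2)
      (tangentChart_symm_snd_ne_zero c hq.1 hu)
    refine h.trans_eq ?_
    exact (fundamentalForm_comp_linearMap ((tangentBundleCore (𝓡 n) M).coordChange (achart 𝔼 c)
      (achart 𝔼 ((chartAt 𝔼 c).symm q.1)) ((chartAt 𝔼 c).symm q.1) : 𝔼 →ₗ[ℝ] 𝔼)
      (fun w : 𝔼 => F ⟨(chartAt 𝔼 c).symm q.1, w⟩) q.2 u u).symm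

theorem metricMatrix_apply (c : M) {q : 𝔼 × 𝔼} (hq : q ∈ slitSet (chartAt 𝔼 c).target) (i j : Fin n) :
    F.metricMatrix c q.1 q.2 i j = fderiv ℝ (fderiv ℝ (F.energy c)) q
      (0, EuclideanSpace.single i 1) (0, EuclideanSpace.single j 1) :=
  F.fundamentalForm_eq c hq _ _

theorem _root_.EuclideanSpace.sum_smul_single (y : 𝔼) :
    ∑ i, y i • (EuclideanSpace.single i (1 : ℝ) : 𝔼) = y := by
  ext j
  simp [Finset.sum_apply, Pi.single_apply]

end FinslerMetric

namespace FinslerMetric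

variable {n : ℕ} {M : Type*} [TopologicalSpace M]
  [ChartedSpace (EuclideanSpace ℝ (Fin n)) M] [IsManifold (𝓡 n) ∞ M] (F : FinslerMetric n M)

local notation "𝔼" => EuclideanSpace ℝ (Fin n)

theorem lineDeriv_metricMatrix (c : M) {q : 𝔼 × 𝔼} (hq : q ∈ slitSet (chartAt 𝔼 c).target) (i j : Fin n)
    (w : 𝔼) : lineDeriv ℝ (fun x => F.metricMatrix c x q.2 i j) q.1 w =
      fderiv ℝ (fderiv ℝ (fderiv ℝ (F.energy c))) q (w, 0)
        (0, EuclideanSpace.single i 1) (0, EuclideanSpace.single j 1) :=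
  (F.isFinslerEnergy_energy c).lineDeriv_eq hq
    (fun x hx => F.metricMatrix_apply c (q := (x, q.2)) ⟨hx, hq.2⟩ i j) w

theorem sum_metricMatrix_mulVec (c : M) {q : 𝔼 × 𝔼} (hq : q ∈ slitSet (chartAt 𝔼 c).target) (u : 𝔼)
    (j : Fin n) : ∑ i, F.metricMatrix c q.1 q.2 j i * u i =
      fderiv ℝ (fderiv ℝ (F.energy c)) q (0, u) (0, EuclideanSpace.single j 1) := by
  have he := F.isFinslerEnergy_energy c
  rw [he.symm hq]
  have h : (0, u) = ∑ i, u i • ((0 : 𝔼), (EuclideanSpace.single i (1 : ℝ) : 𝔼)) := by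
    refine Prod.ext ?_ ?_
    · simp [Prod.fst_sum]
    · rw [Prod.snd_sum]
      exact (EuclideanSpace.sum_smul_single u).symm
  rw [h, map_sum]
  refine Finset.sum_congr rfl fun i _ => ?_
  rw [map_smul, F.metricMatrix_apply c hq, smul_eq_mul, mul_comm]

theorem isUnit_det_metricMatrix (c : M) {q : 𝔼 × 𝔼} (hq : q ∈ slitSet (chartAt 𝔼 c).target) :
    IsUnit (F.metricMatrix c q.1 q.2).det := by
  have he := F.isFinslerEnergy_energy c
  rw [← Matrix.isUnit_iff_isUnit_det, ← Matrix.mulVec_injective_iff_isUnit]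
  rw [← Matrix.coe_mulVecLin, injective_iff_map_eq_zero]
  intro u hu
  by_contra hne
  have hpos := he.pos q hq (WithLp.toLp 2 u) (by simpa using hne)
  have h1 : ∀ j, fderiv ℝ (fderiv ℝ (F.energy c)) q (0, WithLp.toLp 2 u)
        (0, EuclideanSpace.single j 1) = 0 := by
    intro j
    rw [← F.sum_metricMatrix_mulVec c hq]
    exact congrFun hu j
  have h : (0, WithLp.toLp 2 u) = ∑ i, u i • ((0 : 𝔼), (EuclideanSpace.single i (1 : ℝ) : 𝔼)) := by
    refine Prod.ext ?_ ?_
    · simp [Prod.fst_sum]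
    · rw [Prod.snd_sum]
      exact (EuclideanSpace.sum_smul_single (WithLp.toLp 2 u)).symm
  refine hpos.ne' ?_
  nth_rewrite 2 [h]
  rw [map_sum]
  exact Finset.sum_eq_zero fun i _ => by rw [map_smul, h1, smul_zero]

-- Identifies the classical index formula with the invariant characterization: multiplied by the
-- matrix g, it becomes the spray equation tested on basis vectors.
set_option synthInstance.maxHeartbeats 200000 in
set_option maxHeartbeats 800000 in
theorem isSpray_geodesicVector (c : M) :
    IsSpray (F.energy c) (chartAt 𝔼 c).target (F.geodesicVector c) := by
  intro q hq
  have he := F.isFinslerEnergy_energy c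
  have hsum : ∀ y : 𝔼, (0, y) = ∑ i, y i • ((0 : 𝔼), (EuclideanSpace.single i (1 : ℝ) : 𝔼)) := by
    intro y
    refine Prod.ext ?_ ?_
    · simp [Prod.fst_sum]
    · rw [Prod.snd_sum]
      exact (EuclideanSpace.sum_smul_single y).symm
  have hsum' : ∀ y : 𝔼, (y, 0) = ∑ i, y i • ((EuclideanSpace.single i (1 : ℝ) : 𝔼), (0 : 𝔼)) := by
    intro y
    refine Prod.ext ?_ ?_
    · rw [Prod.fst_sum]
      exact (EuclideanSpace.sum_smul_single y).symm
    · simp [Prod.snd_sum]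
  set D2 := fderiv ℝ (fderiv ℝ (F.energy c)) q with hD2
  set D3 := fderiv ℝ (fderiv ℝ (fderiv ℝ (F.energy c))) q with hD3
  -- Homogeneity lowers the order of the derivatives: contracting ∂_k g_jl with y^j y^k leaves
  -- e_xy(y, e_l), and contracting ∂_l g_jk leaves e_xy(e_l, y), which is 2 e_x(e_l).
  have hb : ∀ l, ∑ j, ∑ k, (2 * lineDeriv ℝ (fun x => F.metricMatrix c x q.2 j l) q.1
        (EuclideanSpace.single k 1) - lineDeriv ℝ (fun x => F.metricMatrix c x q.2 j k) q.1
        (EuclideanSpace.single l 1)) * q.2 j * q.2 k =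
      2 * D2 (q.2, 0) (0, EuclideanSpace.single l 1) -
        2 * fderiv ℝ (F.energy c) q (EuclideanSpace.single l 1, 0) := by
    intro l
    have e1 : D2 (q.2, 0) (0, EuclideanSpace.single l 1) =
        ∑ j, ∑ k, q.2 j * q.2 k * D3 (EuclideanSpace.single k 1, 0)
          (0, EuclideanSpace.single j 1) (0, EuclideanSpace.single l 1) := by
      rw [← he.fderiv_fderiv_fderiv_snd hq]
      conv_lhs => rw [hsum q.2, hsum' q.2]
      exact clm_apply_sum_sum_left _ _ _ _ _ _ _
    have e2 : 2 * fderiv ℝ (F.energy c) q (EuclideanSpace.single l 1, 0) =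
        ∑ j, ∑ k, q.2 j * q.2 k * D3 (EuclideanSpace.single l 1, 0)
          (0, EuclideanSpace.single j 1) (0, EuclideanSpace.single k 1) := by
      have h := he.fderiv_euler hq (EuclideanSpace.single l 1, 0)
      rw [← h, Prod.mk_zero_zero, map_zero, add_zero, ← he.fderiv_fderiv_fderiv_snd hq]
      conv_lhs => rw [hsum q.2]
      exact clm_apply_sum_sum _ _ _ _ _ _
    rw [e1, e2, Finset.mul_sum, ← Finset.sum_sub_distrib]
    refine Finset.sum_congr rfl fun j _ => ?_
    rw [Finset.mul_sum, ← Finset.sum_sub_distrib]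
    refine Finset.sum_congr rfl fun k _ => ?_
    rw [F.lineDeriv_metricMatrix c hq, F.lineDeriv_metricMatrix c hq]
    ring
  have hG : ∀ l, D2 (0, F.geodesicVector c q) (0, EuclideanSpace.single l 1) =
      (1 / 4) * (2 * D2 (q.2, 0) (0, EuclideanSpace.single l 1) -
        2 * fderiv ℝ (F.energy c) q (EuclideanSpace.single l 1, 0)) := by
    intro l
    rw [← F.sum_metricMatrix_mulVec c hq]
    set b : Fin n → ℝ := fun l => 2 * D2 (q.2, 0) (0, EuclideanSpace.single l 1) -
        2 * fderiv ℝ (F.energy c) q (EuclideanSpace.single l 1, 0) with hbd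
    have h1 : (fun i => F.geodesicVector c q i) =
        ((F.metricMatrix c q.1 q.2)⁻¹).mulVec ((1 / 4 : ℝ) • b) := by
      ext i
      change F.geodesicCoeff c q.1 q.2 i = ∑ l, (F.metricMatrix c q.1 q.2)⁻¹ i l * ((1 / 4 : ℝ) * b l)
      rw [geodesicCoeff, Finset.mul_sum]
      refine Finset.sum_congr rfl fun l _ => ?_
      have h2 := hb l
      change _ = b l at h2
      rw [← h2, Finset.mul_sum, Finset.mul_sum, Finset.mul_sum]
      refine Finset.sum_congr rfl fun j _ => ?_
      rw [Finset.mul_sum, Finset.mul_sum, Finset.mul_sum]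
      refine Finset.sum_congr rfl fun k _ => ?_
      ring
    have h2 := congrArg (fun x => (F.metricMatrix c q.1 q.2).mulVec x l) h1
    simp only [Matrix.mulVec_mulVec, Matrix.mul_nonsing_inv _ (F.isUnit_det_metricMatrix c hq),
      Matrix.one_mulVec] at h2
    exact h2
  have hl : ∀ l, D2 (q.2, -(2 : ℝ) • F.geodesicVector c q) (0, EuclideanSpace.single l 1) =
      fderiv ℝ (F.energy c) q (EuclideanSpace.single l 1, 0) := by
    intro l
    have e : (q.2, -(2 : ℝ) • F.geodesicVector c q) =
        (q.2, (0 : 𝔼)) - (2 : ℝ) • ((0 : 𝔼), F.geodesicVector c q) := by simp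
    rw [e, map_sub, map_smul, sub_apply, smul_apply, hG, smul_eq_mul]
    ring
  intro v
  rw [hsum v, hsum' v, map_sum, map_sum]
  refine Finset.sum_congr rfl fun l _ => ?_
  rw [map_smul, map_smul, hl]

theorem sprayConnection_geodesicVector (c : M) {q : 𝔼 × 𝔼} (hq : q ∈ slitSet (chartAt 𝔼 c).target)
    (u : 𝔼) : sprayConnection (F.geodesicVector c) q u =
      WithLp.toLp 2 fun i => ∑ j, F.connectionCoeff c q.1 q.2 i j * u j := by
  have he := F.isFinslerEnergy_energy c
  have hd := he.hasFDerivAt_spray (F.isSpray_geodesicVector c) hq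
  have hcoeff : ∀ i j, F.connectionCoeff c q.1 q.2 i j =
      sprayConnection (F.geodesicVector c) q (EuclideanSpace.single j 1) i := by
    intro i j
    have hc : HasDerivAt (fun t : ℝ => (q.1, q.2 + t • (EuclideanSpace.single j 1 : 𝔼)))
        ((0 : 𝔼), (EuclideanSpace.single j 1 : 𝔼)) 0 := by
      have := (hasDerivAt_const (0 : ℝ) q.1).prodMk
        (((hasDerivAt_id (0 : ℝ)).smul_const (EuclideanSpace.single j 1 : 𝔼)).const_add q.2)
      simpa using this
    have hd' : HasFDerivAt (F.geodesicVector c) (fderiv ℝ (F.geodesicVector c) q)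
        (q.1, q.2 + (0 : ℝ) • (EuclideanSpace.single j 1 : 𝔼)) := by
      rw [zero_smul, add_zero]; exact hd
    have h := (EuclideanSpace.proj (𝕜 := ℝ) i : 𝔼 →L[ℝ] ℝ).hasFDerivAt.comp_hasDerivAt (0 : ℝ)
      (hd'.comp_hasDerivAt (0 : ℝ) hc)
    exact HasLineDerivAt.lineDeriv h
  ext i
  nth_rewrite 1 [← EuclideanSpace.sum_smul_single u]
  rw [map_sum]
  change (EuclideanSpace.proj (𝕜 := ℝ) i : 𝔼 →L[ℝ] ℝ) (∑ j, sprayConnection (F.geodesicVector c) q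
    (u j • (EuclideanSpace.single j 1 : 𝔼))) = ∑ j, F.connectionCoeff c q.1 q.2 i j * u j
  rw [map_sum]
  refine Finset.sum_congr rfl fun j _ => ?_
  rw [map_smul, map_smul, hcoeff, smul_eq_mul, mul_comm]
  rfl

theorem horizontalLift_eq (v : TangentBundle (𝓡 n) M) (hv : v.2 ≠ 0) (u : 𝔼) :
    F.horizontalLift v u =
      sprayHorizontal (F.geodesicVector v.1) (chartAt 𝔼 v.1 v.1, (v.2 : 𝔼)) u := by
  rw [sprayHorizontal, F.sprayConnection_geodesicVector v.1
    (q := (chartAt 𝔼 v.1 v.1, (v.2 : 𝔼))) ⟨mem_chart_target _ _, hv⟩]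
  rfl

end FinslerMetric

/-! ### Derivatives in charts of the tangent bundle. -/

section TangentChart

variable {n : ℕ} {M : Type*} [TopologicalSpace M]
  [ChartedSpace (EuclideanSpace ℝ (Fin n)) M] [IsManifold (𝓡 n) ∞ M]

local notation "𝔼" => EuclideanSpace ℝ (Fin n)

open FinslerMetric

/-- The change between the charts of the tangent bundle. -/
noncomputable def tangentChartChange (c d : M) (q : 𝔼 × 𝔼) : 𝔼 × 𝔼 :=
  (chartChange c d q.1, fderiv ℝ (chartChange c d) q.1 q.2)

theorem contDiffOn_tangentChartChange (c d : M) :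
    ContDiffOn ℝ ∞ (tangentChartChange (n := n) c d) {q | q.1 ∈ chartChangeSource c d} := by
  have h : ContDiffOn ℝ ∞ (fun q : 𝔼 × 𝔼 => fderiv ℝ (chartChange c d) q.1)
      {q | q.1 ∈ chartChangeSource c d} :=
    ((contDiffOn_chartChange c d).fderiv_of_isOpen (m := ∞) (isOpen_chartChangeSource c d)
      (by simp)).comp contDiffOn_fst fun q hq => hq
  exact ((contDiffOn_chartChange c d).comp contDiffOn_fst fun q hq => hq).prodMk
    (h.clm_apply contDiffOn_snd)

theorem mem_chartChangeSource {c : M} {x : 𝔼} (hx : x ∈ (chartAt 𝔼 c).target) :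
    x ∈ chartChangeSource c ((chartAt 𝔼 c).symm x) := ⟨hx, mem_chart_source _ _⟩

theorem hasFDerivAt_tangentChartChange {c d : M} {q : 𝔼 × 𝔼} (hq : q.1 ∈ chartChangeSource c d) :
    HasFDerivAt (tangentChartChange c d) (fderiv ℝ (tangentChartChange c d) q) q :=
  (((contDiffOn_tangentChartChange c d).contDiffAt
    (((isOpen_chartChangeSource c d).preimage continuous_fst).mem_nhds hq)).differentiableAt
      (by simp)).hasFDerivAt

theorem fderiv_tangentChartChange_apply {c d : M} {q : 𝔼 × 𝔼} (hq : q.1 ∈ chartChangeSource c d)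
    (v : 𝔼 × 𝔼) : fderiv ℝ (tangentChartChange c d) q v = (fderiv ℝ (chartChange c d) q.1 v.1,
      fderiv ℝ (chartChange c d) q.1 v.2 + fderiv ℝ (fderiv ℝ (chartChange c d)) q.1 v.1 q.2) := by
  have h1 := (contDiffOn_chartChange c d).contDiffAt ((isOpen_chartChangeSource c d).mem_nhds hq)
  have h2 := (h1.differentiableAt (by simp)).hasFDerivAt
  have h3 := ((h1.fderiv_right (m := ∞) (by simp)).differentiableAt (by simp)).hasFDerivAt
  have h4 : HasFDerivAt (tangentChartChange c d) _ q := (h2.comp q hasFDerivAt_fst).prodMk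
    ((h3.comp q hasFDerivAt_fst).clm_apply hasFDerivAt_snd)
  rw [h4.fderiv]
  simp

theorem bijective_fderiv_tangentChartChange {c d : M} {q : 𝔼 × 𝔼} (hq : q.1 ∈ chartChangeSource c d) :
    Function.Bijective (fderiv ℝ (tangentChartChange c d) q) := by
  obtain ⟨h1, h2⟩ := bijective_fderiv_chartChange hq
  constructor
  · rw [injective_iff_map_eq_zero]
    intro v hv
    rw [fderiv_tangentChartChange_apply hq] at hv
    have e1 : v.1 = 0 := h1 ((congrArg Prod.fst hv).trans (map_zero _).symm)
    have e2 := congrArg Prod.snd hv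
    simp only [e1, map_zero, zero_apply, add_zero] at e2
    exact Prod.ext e1 (h1 (e2.trans (map_zero _).symm))
  · intro w
    obtain ⟨a, ha⟩ := h2 w.1
    obtain ⟨b, hb⟩ := h2 (w.2 - fderiv ℝ (fderiv ℝ (chartChange c d)) q.1 a q.2)
    refine ⟨(a, b), ?_⟩
    rw [fderiv_tangentChartChange_apply hq]
    exact Prod.ext ha (by simp [hb])

theorem eventually_tangentChart_tangentChart_symm {c d : M} {q : 𝔼 × 𝔼}
    (hq : q.1 ∈ chartChangeSource c d) : ∀ᶠ r in 𝓝 q,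
      tangentChart d ((tangentChart c).symm r : TangentBundle (𝓡 n) M) = tangentChartChange c d r := by
  filter_upwards [((isOpen_chartChangeSource c d).preimage continuous_fst).mem_nhds hq] with r hr
  exact tangentChart_tangentChart_symm hr

theorem continuousAt_tangentChart_symm {c : M} {q : 𝔼 × 𝔼} (hq : q.1 ∈ (chartAt 𝔼 c).target) :
    ContinuousAt (fun q : 𝔼 × 𝔼 => ((tangentChart c).symm q : TangentBundle (𝓡 n) M)) q :=
  (tangentChart c).continuousAt_symm ((mem_tangentChart_target c q).2 hq)

/-- Tangent vectors of TM are written in the chart at their own base point, so the derivative of the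
inverse chart at `c` is that of the change to the chart at the moving base point. -/
theorem hasMFDerivAt_tangentChart_symm {c : M} {q : 𝔼 × 𝔼} (hq : q.1 ∈ (chartAt 𝔼 c).target) :
    HasMFDerivAt 𝓘(ℝ, 𝔼 × 𝔼) (𝓡 n).tangent
      (fun q : 𝔼 × 𝔼 => ((tangentChart c).symm q : TangentBundle (𝓡 n) M)) q
      (fderiv ℝ (tangentChartChange c ((chartAt 𝔼 c).symm q.1)) q) := by
  refine ⟨continuousAt_tangentChart_symm hq, ?_⟩
  refine HasFDerivAt.hasFDerivWithinAt ?_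
  exact (hasFDerivAt_tangentChartChange (mem_chartChangeSource hq)).congr_of_eventuallyEq
    (eventually_tangentChart_tangentChart_symm (mem_chartChangeSource hq))

theorem hasMFDerivWithinAt_chartAt_symm_comp {c : M} {ℓ : ℝ → 𝔼} {ℓ' : 𝔼} {s : Set ℝ} {t : ℝ}
    (ht : ℓ t ∈ (chartAt 𝔼 c).target) (hℓ : HasDerivWithinAt ℓ ℓ' s t) :
    HasMFDerivWithinAt 𝓘(ℝ, ℝ) (𝓡 n) (fun r => (chartAt 𝔼 c).symm (ℓ r)) s t
      (ContinuousLinearMap.toSpanSingleton ℝ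
        (fderiv ℝ (chartChange c ((chartAt 𝔼 c).symm (ℓ t))) (ℓ t) ℓ')) := by
  have hm := mem_chartChangeSource ht
  refine ⟨((chartAt 𝔼 c).continuousAt_symm ht).comp_continuousWithinAt hℓ.continuousWithinAt, ?_⟩
  have h := (hasFDerivAt_chartChange hm).differentiableAt.hasFDerivAt.comp_hasDerivWithinAt t hℓ
  refine HasFDerivWithinAt.mono ?_ (inter_subset_left : _ ⊆ s)
  exact h.hasFDerivWithinAt

theorem hasMFDerivWithinAt_tangentChart_symm_comp {c : M} {γ : ℝ → 𝔼 × 𝔼} {γ' : 𝔼 × 𝔼} {s : Set ℝ} {t : ℝ}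
    (ht : (γ t).1 ∈ (chartAt 𝔼 c).target) (hγ : HasDerivWithinAt γ γ' s t) :
    HasMFDerivWithinAt 𝓘(ℝ, ℝ) (𝓡 n).tangent
      (fun r => ((tangentChart c).symm (γ r) : TangentBundle (𝓡 n) M)) s t
      (ContinuousLinearMap.toSpanSingleton ℝ
        (fderiv ℝ (tangentChartChange c ((chartAt 𝔼 c).symm (γ t).1)) (γ t) γ')) := by
  have hm := mem_chartChangeSource ht
  refine ⟨ContinuousAt.comp_continuousWithinAt (f := γ) (continuousAt_tangentChart_symm ht)
    hγ.continuousWithinAt, ?_⟩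
  have h := (hasFDerivAt_tangentChartChange hm).comp_hasDerivWithinAt t hγ
  refine HasFDerivWithinAt.mono ?_ (inter_subset_left : _ ⊆ s)
  exact h.hasFDerivWithinAt.congr_of_eventuallyEq
    (hγ.continuousWithinAt.eventually (eventually_tangentChart_tangentChart_symm hm))
    (eventually_tangentChart_tangentChart_symm hm).self_of_nhds

end TangentChart

/-! ### Horizontal lifts and parallel fields in an arbitrary chart. -/

namespace FinslerMetric

variable {n : ℕ} {M : Type*} [TopologicalSpace M]
  [ChartedSpace (EuclideanSpace ℝ (Fin n)) M] [IsManifold (𝓡 n) ∞ M] (F : FinslerMetric n M)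

local notation "𝔼" => EuclideanSpace ℝ (Fin n)

theorem energy_chartChange {c d : M} {x : 𝔼} (hx : x ∈ chartChangeSource c d) (y : 𝔼) :
    F.energy c (x, y) = F.energy d (chartChange c d x, fderiv ℝ (chartChange c d) x y) := by
  rw [energy, energy, chartNorm, chartNorm, ← tangentChart_symm_tangentChart (q := (x, y)) hx]

theorem fderiv_tangentChartChange_sprayHorizontal {c d : M} {q : 𝔼 × 𝔼}
    (hq : q.1 ∈ chartChangeSource c d) (hq0 : q.2 ≠ 0) (a : 𝔼) :
    fderiv ℝ (tangentChartChange c d) q (sprayHorizontal (F.geodesicVector c) q a) =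
      sprayHorizontal (F.geodesicVector d) (tangentChartChange c d q)
        (fderiv ℝ (chartChange c d) q.1 a) :=
  (F.isFinslerEnergy_energy c).sprayHorizontal_change (F.isSpray_geodesicVector c)
    (F.isFinslerEnergy_energy d) (F.isSpray_geodesicVector d) (isOpen_chartChangeSource c d)
    (fun _ hx => hx.1) (contDiffOn_chartChange c d) (fun _ hx => (chartAt 𝔼 d).map_source hx.2)
    (fun _ hx => bijective_fderiv_chartChange hx) (fun _ hx y _ => F.energy_chartChange hx y) hq hq0 a

theorem fderiv_tangentChartChange_sprayCurvature {c d : M} {q : 𝔼 × 𝔼}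
    (hq : q.1 ∈ chartChangeSource c d) (hq0 : q.2 ≠ 0) (u w : 𝔼) :
    fderiv ℝ (tangentChartChange c d) q (0, sprayCurvature (F.geodesicVector c) q u w) =
      (0, sprayCurvature (F.geodesicVector d) (tangentChartChange c d q)
        (fderiv ℝ (chartChange c d) q.1 u) (fderiv ℝ (chartChange c d) q.1 w)) := by
  have h := (F.isFinslerEnergy_energy c).sprayCurvature_change (F.isSpray_geodesicVector c)
    (F.isFinslerEnergy_energy d) (F.isSpray_geodesicVector d) (isOpen_chartChangeSource c d)
    (fun _ hx => hx.1) (contDiffOn_chartChange c d) (fun _ hx => (chartAt 𝔼 d).map_source hx.2)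
    (fun _ hx => bijective_fderiv_chartChange hx) (fun _ hx y _ => F.energy_chartChange hx y) hq hq0 u w
  rw [fderiv_tangentChartChange_apply hq]
  refine Prod.ext (map_zero _) ?_
  simp only [map_zero, zero_apply, add_zero]
  exact h

theorem tangentChartChange_self {c : M} {q : 𝔼 × 𝔼} (hq : q.1 ∈ (chartAt 𝔼 c).target) :
    (chartAt 𝔼 ((tangentChart c).symm q : TangentBundle (𝓡 n) M).1
      ((tangentChart c).symm q : TangentBundle (𝓡 n) M).1,
      (((tangentChart c).symm q : TangentBundle (𝓡 n) M).2 : 𝔼)) =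
    tangentChartChange c ((chartAt 𝔼 c).symm q.1) q := by
  rw [← tangentChart_self]
  exact tangentChart_tangentChart_symm (mem_chartChangeSource hq)

/-- The horizontal lift in the chart at `c`. -/
theorem horizontalLift_tangentChart_symm {c : M} {q : 𝔼 × 𝔼} (hq : q ∈ slitSet (chartAt 𝔼 c).target)
    (a : 𝔼) :
    F.horizontalLift ((tangentChart c).symm q)
      (fderiv ℝ (chartChange c ((chartAt 𝔼 c).symm q.1)) q.1 a) =
    fderiv ℝ (tangentChartChange c ((chartAt 𝔼 c).symm q.1)) q
      (sprayHorizontal (F.geodesicVector c) q a) := by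
  rw [F.fderiv_tangentChartChange_sprayHorizontal (mem_chartChangeSource hq.1) hq.2]
  refine (F.horizontalLift_eq _ (tangentChart_symm_snd_ne_zero c hq.1 hq.2) _).trans ?_
  exact congrArg (fun z => sprayHorizontal (F.geodesicVector ((chartAt 𝔼 c).symm q.1)) z
    (fderiv ℝ (chartChange c ((chartAt 𝔼 c).symm q.1)) q.1 a)) (tangentChartChange_self hq.1)

/-- A solution of the parallel transport equation in a chart is parallel. -/
theorem isParallelOn_of_chart {c : M} {ℓ γ ℓ' : ℝ → 𝔼} {s : Set ℝ} (hs : UniqueDiffOn ℝ s)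
    (hℓs : ∀ t ∈ s, ℓ t ∈ (chartAt 𝔼 c).target) (hγs : ∀ t ∈ s, γ t ≠ 0)
    (hℓ : ∀ t ∈ s, HasDerivWithinAt ℓ (ℓ' t) s t)
    (hγ : ∀ t ∈ s, HasDerivWithinAt γ
      (-sprayConnection (F.geodesicVector c) (ℓ t, γ t) (ℓ' t)) s t) :
    F.IsParallelOn (fun t => (chartAt 𝔼 c).symm (ℓ t))
      (fun t => ((tangentChart c).symm (ℓ t, γ t) : TangentBundle (𝓡 n) M).2) s := by
  intro t ht
  have h1 := hasMFDerivWithinAt_chartAt_symm_comp (hℓs t ht) (hℓ t ht)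
  have h2 := hasMFDerivWithinAt_tangentChart_symm_comp (γ := fun t => (ℓ t, γ t)) (hℓs t ht)
    ((hℓ t ht).prodMk (hγ t ht))
  have h3 := F.horizontalLift_tangentChart_symm (q := (ℓ t, γ t)) ⟨hℓs t ht, hγs t ht⟩ (ℓ' t)
  rw [h1.mfderivWithin (hs.uniqueMDiffOn t ht)]
  have e : ContinuousLinearMap.toSpanSingleton ℝ (fderiv ℝ (chartChange c ((chartAt 𝔼 c).symm (ℓ t)))
      (ℓ t) (ℓ' t)) (1 : ℝ) = fderiv ℝ (chartChange c ((chartAt 𝔼 c).symm (ℓ t))) (ℓ t) (ℓ' t) := by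
    simp
  have h4 : F.horizontalLift ((tangentChart c).symm (ℓ t, γ t))
      (ContinuousLinearMap.toSpanSingleton ℝ (fderiv ℝ (chartChange c ((chartAt 𝔼 c).symm (ℓ t)))
      (ℓ t) (ℓ' t)) (1 : ℝ)) = _ := (congrArg (fun u : 𝔼 =>
        F.horizontalLift ((tangentChart c).symm (ℓ t, γ t)) u) e).trans h3
  refine HasMFDerivWithinAt.congr_mfderiv h2 ?_
  exact congrArg (fun u : 𝔼 × 𝔼 => ContinuousLinearMap.toSpanSingleton ℝ u) h4.symm

end FinslerMetric

/-! ### Components of vector fields in charts. -/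

section LocalField

variable {n : ℕ} {M : Type*} [TopologicalSpace M]
  [ChartedSpace (EuclideanSpace ℝ (Fin n)) M] [IsManifold (𝓡 n) ∞ M]

local notation "𝔼" => EuclideanSpace ℝ (Fin n)

open FinslerMetric

/-- The components of a vector field in the preferred chart at `c`. -/
noncomputable def SmoothVectorField.inChart (c : M) (X : SmoothVectorField (𝓡 n) M) (x : 𝔼) : 𝔼 :=
  (tangentChart c (⟨(chartAt 𝔼 c).symm x, X ((chartAt 𝔼 c).symm x)⟩ : TangentBundle (𝓡 n) M)).2

theorem SmoothVectorField.contDiffOn_inChart (c : M) (X : SmoothVectorField (𝓡 n) M) :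
    ContDiffOn ℝ ∞ (X.inChart c) (chartAt 𝔼 c).target := by
  have h1 : ContMDiffOn 𝓘(ℝ, 𝔼) (𝓡 n) ∞ (chartAt 𝔼 c).symm (chartAt 𝔼 c).target :=
    contMDiffOn_chart_symm
  have h2 : ContMDiffOn (𝓡 n).tangent (𝓡 n).tangent ∞ (tangentChart (M := M) c)
      (tangentChart (M := M) c).source :=
    contMDiffOn_chart (I := (𝓡 n).tangent) (x := (⟨c, 0⟩ : TangentBundle (𝓡 n) M))
  have h3 := h2.comp (X.contMDiff.comp_contMDiffOn h1)
    fun x hx => (mem_tangentChart_source c _).2 ((chartAt 𝔼 c).map_target hx)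
  have h4 : ContDiffOn ℝ ∞ (fun x : 𝔼 => (show 𝔼 × 𝔼 from tangentChart c
      (⟨(chartAt 𝔼 c).symm x, X ((chartAt 𝔼 c).symm x)⟩ : TangentBundle (𝓡 n) M)))
      (chartAt 𝔼 c).target := contMDiffOn_iff_contDiffOn.1 h3
  exact h4.snd

theorem SmoothVectorField.fderiv_chartChange_inChart {c d : M} (X : SmoothVectorField (𝓡 n) M) {x : 𝔼}
    (hx : x ∈ chartChangeSource c d) :
    fderiv ℝ (chartChange c d) x (X.inChart c x) = X.inChart d (chartChange c d x) := by
  have e : (chartAt 𝔼 d).symm (chartChange c d x) = (chartAt 𝔼 c).symm x :=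
    (chartAt 𝔼 d).left_inv hx.2
  rw [(hasFDerivAt_chartChange hx).fderiv]
  simp only [inChart, tangentChart_apply]
  rw [e]
  exact (tangentBundleCore (𝓡 n) M).coordChange_comp _ _ _ _
    ⟨⟨mem_chart_source _ _, (chartAt 𝔼 c).map_target hx.1⟩, hx.2⟩ _

theorem SmoothVectorField.inChart_self (X : SmoothVectorField (𝓡 n) M) (p : M) :
    X.inChart p (chartAt 𝔼 p p) = X p := by
  have e : (chartAt 𝔼 p).symm (chartAt 𝔼 p p) = p := (chartAt 𝔼 p).left_inv (mem_chart_source _ _)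
  exact (congrArg (fun p' => (tangentChart p (⟨p', X p'⟩ : TangentBundle (𝓡 n) M)).2) e).trans
    (congrArg Prod.snd (tangentChart_self (⟨p, X p⟩ : TangentBundle (𝓡 n) M)))

theorem SmoothVectorField.fderiv_chartChange_inChart_self {c : M} (X : SmoothVectorField (𝓡 n) M) {x : 𝔼}
    (hx : x ∈ (chartAt 𝔼 c).target) :
    fderiv ℝ (chartChange c ((chartAt 𝔼 c).symm x)) x (X.inChart c x) = X ((chartAt 𝔼 c).symm x) := by
  rw [X.fderiv_chartChange_inChart (mem_chartChangeSource hx)]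
  exact X.inChart_self _

/-- The coordinates of a tangent vector in the preferred chart at its base point. -/
noncomputable def selfCoord (v : TangentBundle (𝓡 n) M) : 𝔼 × 𝔼 := tangentChart v.1 v

theorem selfCoord_eq (v : TangentBundle (𝓡 n) M) : selfCoord v = (chartAt 𝔼 v.1 v.1, v.2) :=
  tangentChart_self v

theorem selfCoord_mem {v : TangentBundle (𝓡 n) M} (hv : v.2 ≠ 0) :
    selfCoord v ∈ slitSet (chartAt 𝔼 v.1).target := by
  rw [selfCoord_eq]
  exact ⟨mem_chart_target _ _, hv⟩

theorem tangentChart_symm_selfCoord (v : TangentBundle (𝓡 n) M) :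
    (tangentChart v.1).symm (selfCoord v) = v :=
  (tangentChart v.1).left_inv ((mem_tangentChart_source _ _).2 (mem_chart_source _ _))

theorem mfderiv_tangentBundle_proj (v : TangentBundle (𝓡 n) M) (A : 𝔼 × 𝔼) :
    mfderiv (𝓡 n).tangent (𝓡 n) (fun w : TangentBundle (𝓡 n) M => w.1) v A = A.1 := by
  have h : HasMFDerivAt (𝓡 n).tangent (𝓡 n) (fun w : TangentBundle (𝓡 n) M => w.1) v
      (ContinuousLinearMap.fst ℝ 𝔼 𝔼) := by
    refine ⟨(FiberBundle.continuous_proj 𝔼 _).continuousAt, ?_⟩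
    refine HasFDerivAt.hasFDerivWithinAt ?_
    have h1 : (selfCoord v).1 ∈ (chartAt 𝔼 v.1).target := mem_chart_target _ _
    have h2 : HasFDerivAt (fun q : 𝔼 × 𝔼 => q.1) (ContinuousLinearMap.fst ℝ 𝔼 𝔼) (selfCoord v) :=
      hasFDerivAt_fst
    refine h2.congr_of_eventuallyEq ?_
    filter_upwards [((chartAt 𝔼 v.1).open_target.preimage continuous_fst).mem_nhds h1] with q hq
    exact (chartAt 𝔼 v.1).right_inv hq
  rw [h.mfderiv]
  rfl

end LocalField

/-! ### The curvature of two horizontal lifts in a chart. -/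

namespace FinslerMetric

variable {n : ℕ} {M : Type*} [TopologicalSpace M]
  [ChartedSpace (EuclideanSpace ℝ (Fin n)) M] [IsManifold (𝓡 n) ∞ M] (F : FinslerMetric n M)

local notation "𝔼" => EuclideanSpace ℝ (Fin n)

theorem horizontalProj_apply (v : TangentBundle (𝓡 n) M) (A : TangentSpace (𝓡 n).tangent v) :
    F.horizontalProj v A = F.horizontalLift v (show 𝔼 × 𝔼 from A).1 := by
  rw [horizontalProj]
  exact congrArg (fun u : 𝔼 => F.horizontalLift v u) (mfderiv_tangentBundle_proj v A)

theorem horizontalProj_horizontalField (X : SmoothVectorField (𝓡 n) M) :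
    (fun w => F.horizontalProj w (F.horizontalField X w)) = F.horizontalField X := by
  ext1 w
  exact F.horizontalProj_apply w _

/-- Horizontal lifts are fixed by the projector, so three of the four terms involve the same bracket
and its vertical part remains. -/
theorem curvature_horizontalField (X Y : SmoothVectorField (𝓡 n) M) (v : TangentBundle (𝓡 n) M) :
    F.curvature (F.horizontalField X) (F.horizontalField Y) v =
      mlieBracket (𝓡 n).tangent (F.horizontalField X) (F.horizontalField Y) v -
        F.horizontalProj v
          (mlieBracket (𝓡 n).tangent (F.horizontalField X) (F.horizontalField Y) v) := by
  rw [curvature, horizontalProj_horizontalField, horizontalProj_horizontalField]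
  abel

theorem mpullbackWithin_horizontalField (X : SmoothVectorField (𝓡 n) M) {c : M} {q : 𝔼 × 𝔼}
    (hq : q ∈ slitSet (chartAt 𝔼 c).target) :
    mpullbackWithin 𝓘(ℝ, 𝔼 × 𝔼) (𝓡 n).tangent
      (fun q : 𝔼 × 𝔼 => ((tangentChart c).symm q : TangentBundle (𝓡 n) M)) (F.horizontalField X)
      univ q = sprayHorizontal (F.geodesicVector c) q (X.inChart c q.1) := by
  rw [mpullbackWithin_apply, mfderivWithin_univ, (hasMFDerivAt_tangentChart_symm hq.1).mfderiv]
  obtain ⟨L, hL⟩ : ∃ L : (𝔼 × 𝔼) ≃L[ℝ] 𝔼 × 𝔼, (L : 𝔼 × 𝔼 →L[ℝ] 𝔼 × 𝔼) =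
      fderiv ℝ (tangentChartChange c ((chartAt 𝔼 c).symm q.1)) q := by
    let L := LinearEquiv.ofBijective
      (fderiv ℝ (tangentChartChange c ((chartAt 𝔼 c).symm q.1)) q : 𝔼 × 𝔼 →ₗ[ℝ] 𝔼 × 𝔼)
      (bijective_fderiv_tangentChartChange (mem_chartChangeSource hq.1))
    exact ⟨L.toContinuousLinearEquiv, ContinuousLinearMap.ext fun _ => rfl⟩
  have hinv : (fderiv ℝ (tangentChartChange c ((chartAt 𝔼 c).symm q.1)) q).IsInvertible := ⟨L, hL⟩
  refine hinv.inverse_apply_eq.2 ?_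
  refine Eq.trans ?_ (F.horizontalLift_tangentChart_symm hq _)
  exact congrArg (fun u : 𝔼 => F.horizontalLift ((tangentChart c).symm q) u)
    (X.fderiv_chartChange_inChart_self hq.1).symm

/-- Near a nonzero vector the horizontal lifts pull back to flat horizontal fields, and the
derivative of the chart at its center is the identity, so the bracket reduces to one in a vector
space. -/
theorem mlieBracket_horizontalField (X Y : SmoothVectorField (𝓡 n) M) (v : TangentBundle (𝓡 n) M)
    (hv : v.2 ≠ 0) : mlieBracket (𝓡 n).tangent (F.horizontalField X) (F.horizontalField Y) v =
      lieBracket ℝ (fun q => sprayHorizontal (F.geodesicVector v.1) q (X.inChart v.1 q.1))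
        (fun q => sprayHorizontal (F.geodesicVector v.1) q (Y.inChart v.1 q.1)) (selfCoord v) := by
  have hM : IsManifold (𝓡 n).tangent 1 (TangentBundle (𝓡 n) M) :=
    IsManifold.of_le (n := ∞) (by simp)
  rw [← mlieBracketWithin_univ, mlieBracketWithin_apply, mfderiv_extChartAt_self]
  simp only [preimage_univ, univ_inter]
  have e1 : range (𝓡 n).tangent = univ := ModelWithCorners.range_eq_univ _
  rw [e1]
  have key : ∀ X : SmoothVectorField (𝓡 n) M, mpullbackWithin 𝓘(ℝ, 𝔼 × 𝔼) (𝓡 n).tangent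
      (fun q : 𝔼 × 𝔼 => ((tangentChart v.1).symm q : TangentBundle (𝓡 n) M)) (F.horizontalField X)
      univ =ᶠ[𝓝 (selfCoord v)]
        fun q => sprayHorizontal (F.geodesicVector v.1) q (X.inChart v.1 q.1) := by
    intro X
    filter_upwards [(isOpen_slitSet (chartAt 𝔼 v.1).open_target).mem_nhds (selfCoord_mem hv)] with q hq
    exact F.mpullbackWithin_horizontalField X hq
  have h := Filter.EventuallyEq.lieBracket_vectorField_eq (𝕜 := ℝ) (key X) (key Y)
  refine Eq.trans ?_ h
  change (ContinuousLinearMap.id ℝ (𝔼 × 𝔼)).inverse (lieBracketWithin ℝ _ _ univ _) = _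
  rw [ContinuousLinearMap.inverse_id]
  exact congrFun (lieBracketWithin_univ (𝕜 := ℝ)) (selfCoord v)

theorem horizontalLift_eq_selfCoord (v : TangentBundle (𝓡 n) M) (hv : v.2 ≠ 0) (u : 𝔼) :
    F.horizontalLift v u = sprayHorizontal (F.geodesicVector v.1) (selfCoord v) u :=
  (F.horizontalLift_eq v hv u).trans
    (congrArg (fun q => sprayHorizontal (F.geodesicVector v.1) q u) (selfCoord_eq v).symm)

/-- The curvature in the preferred chart. -/
theorem curvature_eq (X Y : SmoothVectorField (𝓡 n) M) (v : TangentBundle (𝓡 n) M) (hv : v.2 ≠ 0) :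
    F.curvature (F.horizontalField X) (F.horizontalField Y) v =
      ((0, sprayCurvature (F.geodesicVector v.1) (selfCoord v) (X v.1) (Y v.1)) : 𝔼 × 𝔼) := by
  have hq := selfCoord_mem hv
  have hdiff : ∀ X : SmoothVectorField (𝓡 n) M, DifferentiableAt ℝ (X.inChart v.1) (selfCoord v).1 :=
    fun X => ((X.contDiffOn_inChart v.1).contDiffAt
      ((chartAt 𝔼 v.1).open_target.mem_nhds hq.1)).differentiableAt (by simp)
  have h1 := F.mlieBracket_horizontalField X Y v hv
  have h2 := (F.isFinslerEnergy_energy v.1).lieBracket_sprayHorizontal (F.isSpray_geodesicVector v.1) hq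
      (hdiff X) (hdiff Y)
  have h3 := h1.trans h2
  have h4 := ((F.horizontalProj_apply v _).trans
    (congrArg (fun A : 𝔼 × 𝔼 => F.horizontalLift v A.1) h3)).trans
      (F.horizontalLift_eq_selfCoord v hv _)
  refine ((F.curvature_horizontalField X Y v).trans
    (congrArg₂ (fun a b : 𝔼 × 𝔼 => a - b) h3 h4)).trans ?_
  have e1 : X.inChart v.1 (selfCoord v).1 = X v.1 := X.inChart_self v.1
  have e2 : Y.inChart v.1 (selfCoord v).1 = Y v.1 := Y.inChart_self v.1
  have e3 : ∀ a r : 𝔼, sprayHorizontal (F.geodesicVector v.1) (selfCoord v) a + ((0 : 𝔼), r) -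
      sprayHorizontal (F.geodesicVector v.1) (selfCoord v)
        (sprayHorizontal (F.geodesicVector v.1) (selfCoord v) a + ((0 : 𝔼), r)).1 = (0, r) := by
    intro a r
    simp [sprayHorizontal]
  refine (e3 _ _).trans ?_
  rw [e1, e2]

end FinslerMetric

/-! ### Coordinates on the indicatrix bundle and tangency of the curvature. -/

namespace FinslerMetric

variable {n : ℕ} {M : Type*} [TopologicalSpace M]
  [ChartedSpace (EuclideanSpace ℝ (Fin n)) M] [IsManifold (𝓡 n) ∞ M] (F : FinslerMetric n M)

local notation "𝔼" => EuclideanSpace ℝ (Fin n)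
local notation "𝔹" => EuclideanSpace ℝ (Fin n) × EuclideanSpace ℝ (Fin (n - 1))

theorem fderiv_energy (c : M) {q : 𝔼 × 𝔼} (hq : q ∈ slitSet (chartAt 𝔼 c).target) :
    fderiv ℝ (F.energy c) q = F.chartNorm c q • fderiv ℝ (F.chartNorm c) q := by
  have h := (((F.contDiffOn_chartNorm c).contDiffAt
    ((isOpen_slitSet (chartAt 𝔼 c).open_target).mem_nhds hq)).differentiableAt (by simp)).hasFDerivAt
  have h2 := ((h.pow 2).const_mul (1 / 2)).fderiv
  refine Eq.trans h2 ?_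
  refine ContinuousLinearMap.ext fun v => ?_
  simp [smul_apply]
  ring

/-- `direction` in the coordinates of the tangent bundle. -/
noncomputable def directionCoord (v : F.IndicatrixBundle) (q : 𝔼 × 𝔼) : 𝔹 :=
  (q.1, (F.coord v q.2).1⁻¹ • (F.coord v q.2).2)

/-- `unitVector` in the coordinates of the tangent bundle. -/
noncomputable def unitCoord (v : F.IndicatrixBundle) (p : 𝔹) : 𝔼 × 𝔼 :=
  (p.1, (F.chartNorm v.incl.1 (p.1, (F.coord v).symm (1, p.2)))⁻¹ • (F.coord v).symm (1, p.2))

theorem contDiffAt_directionCoord (v : F.IndicatrixBundle) {q : 𝔼 × 𝔼} (hq : 0 < (F.coord v q.2).1) :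
    ContDiffAt ℝ ∞ (F.directionCoord v) q := by
  have h : ContDiffAt ℝ ∞ (fun q : 𝔼 × 𝔼 => F.coord v q.2) q :=
    (F.coord v).contDiff.contDiffAt.comp q contDiffAt_snd
  exact contDiffAt_fst.prodMk ((h.fst.inv hq.ne').smul h.snd)

theorem contDiffAt_unitCoord (v : F.IndicatrixBundle) {p : 𝔹} (hp : p.1 ∈ (chartAt 𝔼 v.incl.1).target) :
    ContDiffAt ℝ ∞ (F.unitCoord v) p := by
  have h : ContDiffAt ℝ ∞ (fun p : 𝔹 => (F.coord v).symm (1, p.2)) p :=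
    (F.coord v).symm.contDiff.contDiffAt.comp p (contDiffAt_const.prodMk contDiffAt_snd)
  have hs : (p.1, (F.coord v).symm (1, p.2)) ∈ slitSet (chartAt 𝔼 v.incl.1).target :=
    ⟨hp, F.coord_symm_ne_zero v p.2⟩
  have h2 : ContDiffAt ℝ ∞ (fun p : 𝔹 => F.chartNorm v.incl.1 (p.1, (F.coord v).symm (1, p.2))) p :=
    ContDiffAt.comp (f := fun p : 𝔹 => (p.1, (F.coord v).symm (1, p.2))) p
      ((F.contDiffOn_chartNorm v.incl.1).contDiffAt
        ((isOpen_slitSet (chartAt 𝔼 v.incl.1).open_target).mem_nhds hs)) (contDiffAt_fst.prodMk h)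
  exact contDiffAt_fst.prodMk ((h2.inv (F.chartNorm_pos _ hs).ne').smul h)

theorem directionCoord_unitCoord (v : F.IndicatrixBundle) {p : 𝔹}
    (hp : p.1 ∈ (chartAt 𝔼 v.incl.1).target) : F.directionCoord v (F.unitCoord v p) = p := by
  have h := F.scale_pos v hp
  refine Prod.ext rfl ?_
  simp [directionCoord, unitCoord, smul_smul, h.ne', chartNorm]

theorem unitCoord_directionCoord (v : F.IndicatrixBundle) {q : 𝔼 × 𝔼}
    (hq : 0 < (F.coord v q.2).1) :
    F.unitCoord v (F.directionCoord v q) = (q.1, (F.chartNorm v.incl.1 q)⁻¹ • q.2) := by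
  set a := (F.coord v q.2).1 with ha
  have e1 : (F.coord v).symm (1, a⁻¹ • (F.coord v q.2).2) = a⁻¹ • q.2 := by
    rw [ContinuousLinearEquiv.symm_apply_eq, map_smul]
    refine Prod.ext ?_ rfl
    simp [← ha, hq.ne']
  simp only [unitCoord, directionCoord]
  rw [← ha, e1, F.chartNorm_smul _ _ _ (inv_pos.2 hq), smul_smul, mul_inv, inv_inv, mul_comm a,
    mul_assoc, mul_inv_cancel₀ hq.ne', mul_one]

theorem coord_selfCoord_pos (v : F.IndicatrixBundle) : 0 < (F.coord v (selfCoord v.incl).2).1 := by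
  rw [selfCoord_eq]
  exact F.coord_pos v

theorem chartNorm_selfCoord (v : F.IndicatrixBundle) :
    F.chartNorm v.incl.1 (selfCoord v.incl) = 1 := by
  rw [chartNorm, tangentChart_symm_selfCoord]
  exact v.norm_eq

theorem selfCoord_incl_mem (v : F.IndicatrixBundle) :
    selfCoord v.incl ∈ slitSet (chartAt 𝔼 v.incl.1).target := selfCoord_mem (F.snd_ne_zero v)

theorem fderiv_chartNorm_sprayCurvature (c : M) {q : 𝔼 × 𝔼} (hq : q ∈ slitSet (chartAt 𝔼 c).target)
    (u w : 𝔼) : fderiv ℝ (F.chartNorm c) q (0, sprayCurvature (F.geodesicVector c) q u w) = 0 := by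
  have h := (F.isFinslerEnergy_energy c).fderiv_sprayCurvature (F.isSpray_geodesicVector c) hq u w
  rw [F.fderiv_energy c hq, smul_apply, smul_eq_mul] at h
  exact (mul_eq_zero.1 h).resolve_left (F.chartNorm_pos c hq).ne'

theorem unitCoord_directionCoord_selfCoord (v : F.IndicatrixBundle) :
    F.unitCoord v (F.directionCoord v (selfCoord v.incl)) = selfCoord v.incl := by
  rw [F.unitCoord_directionCoord v (F.coord_selfCoord_pos v), chartNorm_selfCoord, inv_one, one_smul]

theorem hasFDerivAt_unitCoord (v : F.IndicatrixBundle) {p : 𝔹}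
    (hp : p.1 ∈ (chartAt 𝔼 v.incl.1).target) :
    HasFDerivAt (F.unitCoord v) (fderiv ℝ (F.unitCoord v) p) p :=
  ((F.contDiffAt_unitCoord v hp).differentiableAt (by simp)).hasFDerivAt

theorem hasFDerivAt_directionCoord (v : F.IndicatrixBundle) {q : 𝔼 × 𝔼}
    (hq : 0 < (F.coord v q.2).1) :
    HasFDerivAt (F.directionCoord v) (fderiv ℝ (F.directionCoord v) q) q :=
  ((F.contDiffAt_directionCoord v hq).differentiableAt (by simp)).hasFDerivAt

/-- The composite of the two maps is the radial projection (x, y) ↦ (x, y/F). At a unit vector its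
derivative fixes the vertical vectors annihilated by dF. -/
theorem fderiv_unitCoord_fderiv_directionCoord (v : F.IndicatrixBundle) {b : 𝔼}
    (hb : fderiv ℝ (F.chartNorm v.incl.1) (selfCoord v.incl) (0, b) = 0) :
    fderiv ℝ (F.unitCoord v) (F.directionCoord v (selfCoord v.incl))
      (fderiv ℝ (F.directionCoord v) (selfCoord v.incl) (0, b)) = (0, b) := by
  have hpos := F.coord_selfCoord_pos v
  have hq := F.selfCoord_incl_mem v
  set q := selfCoord v.incl with hqd
  have h1 := (F.hasFDerivAt_unitCoord v (p := F.directionCoord v q) hq.1).comp q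
    (F.hasFDerivAt_directionCoord v hpos)
  have hL := (((F.contDiffOn_chartNorm v.incl.1).contDiffAt
    ((isOpen_slitSet (chartAt 𝔼 v.incl.1).open_target).mem_nhds hq)).differentiableAt
      (by simp)).hasFDerivAt
  have h2 := (hasFDerivAt_fst (𝕜 := ℝ) (p := q)).prodMk
    (((hasDerivAt_inv (F.chartNorm_pos _ hq).ne').comp_hasFDerivAt q hL).smul (hasFDerivAt_snd (𝕜 := ℝ) (p := q)))
  have hev : (F.unitCoord v ∘ F.directionCoord v) =ᶠ[𝓝 q]
      fun q => (q.1, (F.chartNorm v.incl.1 q)⁻¹ • q.2) := by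
    have hc : Continuous fun q : 𝔼 × 𝔼 => (F.coord v q.2).1 :=
      ((F.coord v).continuous.comp continuous_snd).fst
    filter_upwards [(isOpen_lt continuous_const hc).mem_nhds hpos] with r hr
    exact F.unitCoord_directionCoord v hr
  have h3 := congrArg (fun L : 𝔼 × 𝔼 →L[ℝ] 𝔼 × 𝔼 => L (0, b))
    ((h1.congr_of_eventuallyEq hev.symm).unique h2)
  refine h3.trans ?_
  have hN : F.chartNorm v.incl.1 q = 1 := F.chartNorm_selfCoord v
  simp [hb, hN]

theorem fderiv_directionCoord_fderiv_unitCoord (v : F.IndicatrixBundle) (b : 𝔹) :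
    fderiv ℝ (F.directionCoord v) (selfCoord v.incl)
      (fderiv ℝ (F.unitCoord v) (F.directionCoord v (selfCoord v.incl)) b) = b := by
  have hpos := F.coord_selfCoord_pos v
  have hq := F.selfCoord_incl_mem v
  have e := F.unitCoord_directionCoord_selfCoord v
  set q := selfCoord v.incl with hqd
  have h1 := F.hasFDerivAt_directionCoord v hpos
  rw [← e] at h1
  have h2 := h1.comp (F.directionCoord v q)
    (F.hasFDerivAt_unitCoord v (p := F.directionCoord v q) hq.1)
  rw [e] at h2
  have hev : (F.directionCoord v ∘ F.unitCoord v) =ᶠ[𝓝 (F.directionCoord v q)] id := by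
    have h0 : (F.directionCoord v q).1 ∈ (chartAt 𝔼 v.incl.1).target := hq.1
    filter_upwards [((chartAt 𝔼 v.incl.1).open_target.preimage continuous_fst).mem_nhds h0] with r hr
    exact F.directionCoord_unitCoord v hr
  exact congrArg (fun L : 𝔹 →L[ℝ] 𝔹 => L b)
    ((h2.congr_of_eventuallyEq hev.symm).unique (hasFDerivAt_id _))

theorem extChartAt_indicatrix (v w : F.IndicatrixBundle) :
    extChartAt 𝓘(ℝ, 𝔹) v w = F.directionCoord v (tangentChart v.incl.1 w.incl) := rfl

theorem extChartAt_indicatrix_self (v : F.IndicatrixBundle) :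
    extChartAt 𝓘(ℝ, 𝔹) v v = F.directionCoord v (selfCoord v.incl) := rfl

theorem incl_extChartAt_indicatrix_symm (v : F.IndicatrixBundle) {p : 𝔹}
    (hp : p.1 ∈ (chartAt 𝔼 v.incl.1).target) :
    ((extChartAt 𝓘(ℝ, 𝔹) v).symm p).incl = (tangentChart v.incl.1).symm (F.unitCoord v p) :=
  F.incl_unitPoint v hp

/-- In the preferred charts at `v` and at its image in TM, the inclusion is `unitCoord`. -/
theorem hasMFDerivAt_incl (v : F.IndicatrixBundle) :
    HasMFDerivAt 𝓘(ℝ, 𝔹) (𝓡 n).tangent (fun w : F.IndicatrixBundle => w.incl) v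
      (fderiv ℝ (F.unitCoord v) (F.directionCoord v (selfCoord v.incl))) := by
  refine ⟨F.isInducing_incl.continuous.continuousAt, HasFDerivAt.hasFDerivWithinAt ?_⟩
  have hq := F.selfCoord_incl_mem v
  have h0 : (F.directionCoord v (selfCoord v.incl)).1 ∈ (chartAt 𝔼 v.incl.1).target := hq.1
  refine (F.hasFDerivAt_unitCoord v (p := F.directionCoord v (selfCoord v.incl))
    h0).congr_of_eventuallyEq ?_
  filter_upwards [((chartAt 𝔼 v.incl.1).open_target.preimage continuous_fst).mem_nhds h0] with r hr
  have h1 : tangentChart v.incl.1 ((extChartAt 𝓘(ℝ, 𝔹) v).symm r).incl = F.unitCoord v r :=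
    (congrArg (tangentChart v.incl.1) (F.incl_extChartAt_indicatrix_symm v hr)).trans
      (F.tangentChart_unitVector v hr)
  exact h1

/-- The curvature vector at a point of the indicatrix bundle, in the preferred chart. -/
noncomputable def curvatureVector (X Y : SmoothVectorField (𝓡 n) M) (v : F.IndicatrixBundle) : 𝔹 :=
  fderiv ℝ (F.directionCoord v) (selfCoord v.incl)
    (0, sprayCurvature (F.geodesicVector v.incl.1) (selfCoord v.incl) (X v.incl.1) (Y v.incl.1))

/-- The derivative of the inclusion has the derivative of `directionCoord` as a left inverse, and
also as a right inverse on vertical vectors tangent to the indicatrix, such as curvature vectors.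
The condition thus prescribes ξ at every point, which gives uniqueness, and existence once
smoothness is known. -/
theorem isCurvatureField_iff (X Y : SmoothVectorField (𝓡 n) M) (ξ : F.IndicatrixVectorField) :
    F.IsCurvatureField X Y ξ ↔ ∀ v, ξ v = F.curvatureVector X Y v := by
  refine forall_congr' fun v => ?_
  have h1 : ∀ b : 𝔹, mfderiv 𝓘(ℝ, 𝔹) (𝓡 n).tangent (fun w : F.IndicatrixBundle => w.incl) v b =
      fderiv ℝ (F.unitCoord v) (F.directionCoord v (selfCoord v.incl)) b := fun b => by
    rw [(F.hasMFDerivAt_incl v).mfderiv]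
    rfl
  have h2 := F.curvature_eq X Y v.incl (F.snd_ne_zero v)
  have h3 := F.fderiv_unitCoord_fderiv_directionCoord v
    (F.fderiv_chartNorm_sprayCurvature v.incl.1 (F.selfCoord_incl_mem v) (X v.incl.1) (Y v.incl.1))
  constructor
  · intro h
    have h4 : fderiv ℝ (F.unitCoord v) (F.directionCoord v (selfCoord v.incl)) (ξ v : 𝔹) = _ :=
      ((h1 (ξ v)).symm.trans h).trans h2
    have h5 := congrArg (fderiv ℝ (F.directionCoord v) (selfCoord v.incl)) h4
    exact (F.fderiv_directionCoord_fderiv_unitCoord v (ξ v : 𝔹)).symm.trans h5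
  · intro h
    have h4 : (ξ v : 𝔹) = _ := h
    exact ((h1 (ξ v)).trans ((congrArg _ h4).trans h3)).trans h2.symm

theorem contMDiffAt_direction (v : F.IndicatrixBundle) {w : TangentBundle (𝓡 n) M}
    (hs : w ∈ (tangentChart (M := M) v.incl.1).source)
    (hw : 0 < (F.coord v (tangentChart v.incl.1 w).2).1) :
    ContMDiffAt (𝓡 n).tangent 𝓘(ℝ, 𝔹) ∞ (F.direction v) w := by
  have h1 : ContMDiffAt (𝓡 n).tangent (𝓡 n).tangent ∞ (tangentChart (M := M) v.incl.1) w :=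
    (contMDiffOn_chart (I := (𝓡 n).tangent)
      (x := (⟨v.incl.1, 0⟩ : TangentBundle (𝓡 n) M))).contMDiffAt
        ((tangentChart (M := M) v.incl.1).open_source.mem_nhds hs)
  have h2 := (F.contDiffAt_directionCoord v hw).contMDiffAt
  exact ContMDiffAt.comp w h2 h1

/-- A map into the indicatrix bundle is smooth if it is smooth as a map into the tangent bundle. -/
theorem contMDiffAt_of_incl {E' H' N : Type*} [NormedAddCommGroup E'] [NormedSpace ℝ E']
    [TopologicalSpace H'] {J : ModelWithCorners ℝ E' H'} [TopologicalSpace N] [ChartedSpace H' N]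
    {f : N → F.IndicatrixBundle} {x : N} (hf : ContMDiffAt J (𝓡 n).tangent ∞ (fun y => (f y).incl) x) :
    ContMDiffAt J 𝓘(ℝ, 𝔹) ∞ f x := by
  rw [contMDiffAt_iff_target]
  refine ⟨F.isInducing_incl.continuousAt_iff.2 hf.continuousAt, ?_⟩
  exact ContMDiffAt.comp (f := fun y => (f y).incl) (g := F.direction (f x)) x
    (F.contMDiffAt_direction (f x) (w := (f x).incl) (F.mem_indicatrixChart_source (f x)).1
      (F.mem_indicatrixChart_source (f x)).2) hf

end FinslerMetric

/-! ### Smoothness of the curvature vector fields. -/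

namespace FinslerMetric

variable {n : ℕ} {M : Type*} [TopologicalSpace M]
  [ChartedSpace (EuclideanSpace ℝ (Fin n)) M] [IsManifold (𝓡 n) ∞ M] (F : FinslerMetric n M)

local notation "𝔼" => EuclideanSpace ℝ (Fin n)
local notation "𝔹" => EuclideanSpace ℝ (Fin n) × EuclideanSpace ℝ (Fin (n - 1))

/-- The coordinates of a point of the indicatrix bundle in the chart of `TM` induced by the
preferred chart at `c`. -/
noncomputable def chartCoord (c : M) (v : F.IndicatrixBundle) : 𝔼 × 𝔼 := tangentChart c v.incl

theorem tangentChart_symm_chartCoord {c : M} {v : F.IndicatrixBundle}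
    (hv : v.incl.1 ∈ (chartAt 𝔼 c).source) : (tangentChart c).symm (F.chartCoord c v) = v.incl :=
  (tangentChart c).left_inv ((mem_tangentChart_source _ _).2 hv)

theorem chartAt_symm_chartCoord_fst {c : M} {v : F.IndicatrixBundle}
    (hv : v.incl.1 ∈ (chartAt 𝔼 c).source) :
    (chartAt 𝔼 c).symm (F.chartCoord c v).1 = v.incl.1 :=
  (chartAt 𝔼 c).left_inv hv

theorem chartCoord_fst_mem_source {c : M} (v : F.IndicatrixBundle)
    (hv : v.incl.1 ∈ (chartAt 𝔼 c).source) {d : M} (hd : v.incl.1 ∈ (chartAt 𝔼 d).source) :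
    (F.chartCoord c v).1 ∈ chartChangeSource c d := by
  refine ⟨(chartAt 𝔼 c).map_source hv, ?_⟩
  rw [F.chartAt_symm_chartCoord_fst hv]
  exact hd

theorem tangentChartChange_chartCoord {c d : M} {v : F.IndicatrixBundle}
    (hv : v.incl.1 ∈ (chartAt 𝔼 c).source) (hd : v.incl.1 ∈ (chartAt 𝔼 d).source) :
    tangentChartChange c d (F.chartCoord c v) = F.chartCoord d v := by
  have h := tangentChart_tangentChart_symm (F.chartCoord_fst_mem_source v hv hd)
  rw [F.tangentChart_symm_chartCoord hv] at h
  exact h.symm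

theorem chartNorm_chartCoord {c : M} {v : F.IndicatrixBundle}
    (hv : v.incl.1 ∈ (chartAt 𝔼 c).source) : F.chartNorm c (F.chartCoord c v) = 1 := by
  rw [chartNorm, F.tangentChart_symm_chartCoord hv]
  exact v.norm_eq

theorem chartNorm_zero (c : M) (x : 𝔼) : F.chartNorm c (x, 0) = 0 := by
  have h := F.chartNorm_smul c x 0 (a := 2) (by norm_num)
  rw [smul_zero] at h
  linarith

theorem chartCoord_mem {c : M} {v : F.IndicatrixBundle} (hv : v.incl.1 ∈ (chartAt 𝔼 c).source) :
    F.chartCoord c v ∈ slitSet (chartAt 𝔼 c).target := by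
  refine ⟨(chartAt 𝔼 c).map_source hv, fun h => ?_⟩
  have h1 := F.chartNorm_chartCoord hv
  have h2 : F.chartCoord c v = ((F.chartCoord c v).1, 0) := Prod.ext rfl h
  rw [h2, F.chartNorm_zero] at h1
  exact zero_ne_one h1

/-- The curvature of two vector fields in the coordinates of the chart at `c`. -/
noncomputable def curvatureCoord (c : M) (X Y : SmoothVectorField (𝓡 n) M) (q : 𝔼 × 𝔼) : 𝔼 :=
  sprayCurvature (F.geodesicVector c) q (X.inChart c q.1) (Y.inChart c q.1)

theorem contDiffOn_sprayCurvature (c : M) {u w : 𝔼 × 𝔼 → 𝔼}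
    (hu : ContDiffOn ℝ ∞ u (slitSet (chartAt 𝔼 c).target))
    (hw : ContDiffOn ℝ ∞ w (slitSet (chartAt 𝔼 c).target)) :
    ContDiffOn ℝ ∞ (fun q => sprayCurvature (F.geodesicVector c) q (u q) (w q))
      (slitSet (chartAt 𝔼 c).target) := by
  have hN := (F.isFinslerEnergy_energy c).contDiffOn_sprayConnection (F.isSpray_geodesicVector c)
  have hdN := hN.fderiv_of_isOpen (m := ∞) (isOpen_slitSet (chartAt 𝔼 c).open_target) (by simp)
  exact ((hdN.clm_apply (hw.prodMk (hN.clm_apply hw).neg)).clm_apply hu).sub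
    ((hdN.clm_apply (hu.prodMk (hN.clm_apply hu).neg)).clm_apply hw)

theorem contDiffOn_curvatureCoord (c : M) (X Y : SmoothVectorField (𝓡 n) M) :
    ContDiffOn ℝ ∞ (F.curvatureCoord c X Y) (slitSet (chartAt 𝔼 c).target) :=
  F.contDiffOn_sprayCurvature c ((X.contDiffOn_inChart c).comp contDiffOn_fst fun _ h => h.1)
    ((Y.contDiffOn_inChart c).comp contDiffOn_fst fun _ h => h.1)

theorem fderiv_tangentChartChange_curvatureCoord {c d : M} (X Y : SmoothVectorField (𝓡 n) M)
    {v : F.IndicatrixBundle}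
    (hv : v.incl.1 ∈ (chartAt 𝔼 c).source) (hd : v.incl.1 ∈ (chartAt 𝔼 d).source) :
    fderiv ℝ (tangentChartChange c d) (F.chartCoord c v) (0, F.curvatureCoord c X Y (F.chartCoord c v)) =
      (0, F.curvatureCoord d X Y (F.chartCoord d v)) := by
  have hs := F.chartCoord_fst_mem_source v hv hd
  have h := F.fderiv_tangentChartChange_sprayCurvature hs (F.chartCoord_mem hv).2
    (X.inChart c (F.chartCoord c v).1) (Y.inChart c (F.chartCoord c v).1)
  rw [X.fderiv_chartChange_inChart hs, Y.fderiv_chartChange_inChart hs,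
    F.tangentChartChange_chartCoord hv hd] at h
  have e : chartChange c d (F.chartCoord c v).1 = (F.chartCoord d v).1 :=
    congrArg Prod.fst (F.tangentChartChange_chartCoord hv hd)
  rw [e] at h
  exact h

theorem curvatureVector_eq (X Y : SmoothVectorField (𝓡 n) M) (v : F.IndicatrixBundle) :
    F.curvatureVector X Y v = fderiv ℝ (F.directionCoord v) (selfCoord v.incl)
      (0, F.curvatureCoord v.incl.1 X Y (F.chartCoord v.incl.1 v)) := by
  rw [curvatureVector, curvatureCoord]
  have e : (F.chartCoord v.incl.1 v).1 = chartAt 𝔼 v.incl.1 v.incl.1 := rfl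
  rw [e, X.inChart_self, Y.inChart_self]
  rfl

/-- The curvature vector in the chart of `TM` at `c`. -/
theorem curvatureVector_eq_fderiv {c : M} (X Y : SmoothVectorField (𝓡 n) M) {v : F.IndicatrixBundle}
    (hv : v.incl.1 ∈ (chartAt 𝔼 c).source) :
    F.curvatureVector X Y v = fderiv ℝ (F.directionCoord v) (selfCoord v.incl)
      (fderiv ℝ (tangentChartChange c v.incl.1) (F.chartCoord c v)
        (0, F.curvatureCoord c X Y (F.chartCoord c v))) := by
  rw [F.fderiv_tangentChartChange_curvatureCoord X Y hv (mem_chart_source _ _)]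
  exact F.curvatureVector_eq X Y v

theorem fderiv_unitCoord_curvatureVector (X Y : SmoothVectorField (𝓡 n) M) (v : F.IndicatrixBundle) :
    fderiv ℝ (F.unitCoord v) (F.directionCoord v (selfCoord v.incl)) (F.curvatureVector X Y v) =
      (0, F.curvatureCoord v.incl.1 X Y (F.chartCoord v.incl.1 v)) := by
  rw [F.curvatureVector_eq]
  exact F.fderiv_unitCoord_fderiv_directionCoord v
    (F.fderiv_chartNorm_sprayCurvature v.incl.1 (F.selfCoord_incl_mem v) _ _)

/-- `curvatureVector` is defined in a chart that moves with the point; by invariance of the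
curvature its components in the fixed chart at `v` are given by one expression, visibly smooth in
the coordinates. -/
theorem trivializationAt_curvatureVector (X Y : SmoothVectorField (𝓡 n) M) (v : F.IndicatrixBundle)
    {w : F.IndicatrixBundle} (hw : w ∈ (F.indicatrixChart v).source) :
    (trivializationAt 𝔹 (TangentSpace 𝓘(ℝ, 𝔹)) v
      (⟨w, F.curvatureVector X Y w⟩ : TangentBundle 𝓘(ℝ, 𝔹) F.IndicatrixBundle)).2 =
    fderiv ℝ (F.directionCoord v) (F.chartCoord v.incl.1 w)
      (0, F.curvatureCoord v.incl.1 X Y (F.chartCoord v.incl.1 w)) := by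
  have hs : w.incl.1 ∈ (chartAt 𝔼 v.incl.1).source := (mem_tangentChart_source _ _).1 hw.1
  have hpos : 0 < (F.coord v (F.chartCoord v.incl.1 w).2).1 := hw.2
  have hc := F.chartCoord_fst_mem_source w (mem_chart_source 𝔼 w.incl.1) hs
  have hq := F.selfCoord_incl_mem w
  have h0 : (F.directionCoord w (selfCoord w.incl)).1 ∈ (chartAt 𝔼 w.incl.1).target := hq.1
  have e1 := F.unitCoord_directionCoord_selfCoord w
  have e2 : tangentChartChange w.incl.1 v.incl.1 (selfCoord w.incl) = F.chartCoord v.incl.1 w :=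
    F.tangentChartChange_chartCoord (mem_chart_source _ _) hs
  have d1 := F.hasFDerivAt_unitCoord w h0
  have d2 := hasFDerivAt_tangentChartChange hc
  have d3 := F.hasFDerivAt_directionCoord v hpos
  rw [← e2] at d3
  have d23 : HasFDerivAt (F.directionCoord v ∘ tangentChartChange w.incl.1 v.incl.1)
      ((fderiv ℝ (F.directionCoord v) (F.chartCoord v.incl.1 w)).comp
        (fderiv ℝ (tangentChartChange w.incl.1 v.incl.1) (selfCoord w.incl))) (selfCoord w.incl) := by
    rw [← e2]
    exact d3.comp _ d2
  rw [← e1] at d23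
  have d := d23.comp _ d1
  rw [e1] at d
  rw [TangentBundle.trivializationAt_apply]
  have hev : ((chartAt 𝔹 v).extend 𝓘(ℝ, 𝔹) ∘ ((chartAt 𝔹 w).extend 𝓘(ℝ, 𝔹)).symm)
      =ᶠ[𝓝 (F.directionCoord w (selfCoord w.incl))]
      ((F.directionCoord v ∘ tangentChartChange w.incl.1 v.incl.1) ∘ F.unitCoord w) := by
    have hU : IsOpen {r : 𝔹 | r.1 ∈ chartChangeSource (n := n) w.incl.1 v.incl.1} :=
      (isOpen_chartChangeSource _ _).preimage continuous_fst
    have hm : F.directionCoord w (selfCoord w.incl) ∈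
      {r : 𝔹 | r.1 ∈ chartChangeSource (n := n) w.incl.1 v.incl.1} := hc
    filter_upwards [hU.mem_nhds hm] with r hr
    have h1 : (((chartAt 𝔹 w).extend 𝓘(ℝ, 𝔹)).symm r).incl =
      (tangentChart w.incl.1).symm (F.unitCoord w r) := F.incl_extChartAt_indicatrix_symm w hr.1
    have h2 : tangentChart v.incl.1 ((tangentChart w.incl.1).symm (F.unitCoord w r)) =
      tangentChartChange w.incl.1 v.incl.1 (F.unitCoord w r) :=
      tangentChart_tangentChart_symm (q := F.unitCoord w r) hr
    exact congrArg (F.directionCoord v) ((congrArg (tangentChart v.incl.1) h1).trans h2)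
  have hd := d.congr_of_eventuallyEq hev
  have h3 : fderivWithin ℝ ((chartAt 𝔹 v).extend 𝓘(ℝ, 𝔹) ∘ ((chartAt 𝔹 w).extend 𝓘(ℝ, 𝔹)).symm)
      (range 𝓘(ℝ, 𝔹)) (F.directionCoord w (selfCoord w.incl)) = _ :=
    (hd.hasFDerivWithinAt (s := range 𝓘(ℝ, 𝔹))).fderivWithin (by
      rw [ModelWithCorners.range_eq_univ]; exact uniqueDiffWithinAt_univ)
  refine (congrArg (fun L : 𝔹 →L[ℝ] 𝔹 => L (F.curvatureVector X Y w)) h3).trans ?_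
  have h4 := F.fderiv_unitCoord_curvatureVector X Y w
  have h5 := F.fderiv_tangentChartChange_curvatureCoord X Y (v := w) (mem_chart_source 𝔼 w.incl.1) hs
  refine (congrArg (fun a => fderiv ℝ (F.directionCoord v) (F.chartCoord v.incl.1 w)
    (fderiv ℝ (tangentChartChange w.incl.1 v.incl.1) (selfCoord w.incl) a)) h4).trans ?_
  exact congrArg _ h5

theorem contMDiffAt_chartCoord {c : M} {v : F.IndicatrixBundle} (hv : v.incl.1 ∈ (chartAt 𝔼 c).source) :
    ContMDiffAt 𝓘(ℝ, 𝔹) 𝓘(ℝ, 𝔼 × 𝔼) ∞ (F.chartCoord c) v := by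
  have h1 : ContMDiffAt (𝓡 n).tangent (𝓡 n).tangent ∞ (tangentChart (M := M) c) v.incl :=
    (contMDiffOn_chart (I := (𝓡 n).tangent)
      (x := (⟨c, 0⟩ : TangentBundle (𝓡 n) M))).contMDiffAt
        ((tangentChart (M := M) c).open_source.mem_nhds ((mem_tangentChart_source _ _).2 hv))
  have h2 := h1.comp v (F.contMDiff_incl v)
  exact h2

/-- The curvature vector field `R(X^h, Y^h)` on the indicatrix bundle. -/
noncomputable def curvatureField (X Y : SmoothVectorField (𝓡 n) M) : F.IndicatrixVectorField where
  toFun := F.curvatureVector X Y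
  contMDiff_toFun v := by
    refine (contMDiffAt_section (IB := 𝓘(ℝ, 𝔹)) (F := 𝔹)
      (E := (TangentSpace 𝓘(ℝ, 𝔹) : F.IndicatrixBundle → Type))
      (s := fun w => F.curvatureVector X Y w) v).2 ?_
    have hsrc := F.mem_indicatrixChart_source v
    have hev : (fun w => (trivializationAt 𝔹 (TangentSpace 𝓘(ℝ, 𝔹)) v
      (⟨w, F.curvatureVector X Y w⟩ : TangentBundle 𝓘(ℝ, 𝔹) F.IndicatrixBundle)).2) =ᶠ[𝓝 v]
        (fun q : 𝔼 × 𝔼 => fderiv ℝ (F.directionCoord v) q (0, F.curvatureCoord v.incl.1 X Y q)) ∘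
          F.chartCoord v.incl.1 := by
      filter_upwards [(F.indicatrixChart v).open_source.mem_nhds hsrc] with w hw
      exact F.trivializationAt_curvatureVector X Y v hw
    refine ContMDiffAt.congr_of_eventuallyEq ?_ hev
    have hs : v.incl.1 ∈ (chartAt 𝔼 v.incl.1).source := mem_chart_source _ _
    have hq := F.chartCoord_mem hs
    have hpos : 0 < (F.coord v (F.chartCoord v.incl.1 v).2).1 := hsrc.2
    have h1 := (F.contDiffAt_directionCoord v hpos).fderiv_right (m := ∞) (by simp)
    have h2 := (F.contDiffOn_curvatureCoord v.incl.1 X Y).contDiffAt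
      ((isOpen_slitSet (chartAt 𝔼 v.incl.1).open_target).mem_nhds hq)
    exact ContMDiffAt.comp v (h1.clm_apply (contDiffAt_const.prodMk h2)).contMDiffAt
      (F.contMDiffAt_chartCoord hs)

theorem isCurvatureField_iff_eq (X Y : SmoothVectorField (𝓡 n) M) (ξ : F.IndicatrixVectorField) :
    F.IsCurvatureField X Y ξ ↔ ξ = F.curvatureField X Y := by
  rw [F.isCurvatureField_iff]
  exact ⟨fun h => ContMDiffSection.ext h, fun h v => by rw [h]; rfl⟩

end FinslerMetric

/-! ### Parallel translation along a family of small curves based at all points. -/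

section Transport

open ContinuousMap unitInterval Asymptotics

universe u

variable {E : Type u} [NormedAddCommGroup E] [NormedSpace ℝ E]

theorem exists_contDiff_bump [FiniteDimensional ℝ E] {K U : Set E} (hK : IsCompact K) (hU : IsOpen U) (hKU : K ⊆ U) :
    ∃ χ : E → ℝ, ContDiff ℝ ∞ χ ∧ HasCompactSupport χ ∧ tsupport χ ⊆ U ∧ ∀ᶠ x in 𝓝ˢ K, χ x = 1 := by
  obtain ⟨L, hL, hKL, hLU⟩ := exists_compact_between hK hU hKU
  obtain ⟨χ, h1, h0, -⟩ := exists_contMDiffMap_one_nhds_of_subset_interior (n := ⊤) 𝓘(ℝ, E)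
    hK.isClosed hKL
  have hs : tsupport χ ⊆ L := closure_minimal (fun x hx => by
    by_contra h; exact hx (h0 x h)) hL.isClosed
  exact ⟨χ, χ.contMDiff.contDiff, hL.of_isClosed_subset (isClosed_tsupport _) hs, hs.trans hLU, h1⟩

variable (E) in
/-- A nonlinear connection on `E × E`, two vector fields on `E` (all of them smooth and compactly
supported) and two functions, which define the curves `s ↦ x + t (a(s) u(x) + b(s) w(x))`. -/
structure LoopData where
  /-- The connection. -/
  N : E × E → E →L[ℝ] E
  /-- The first vector field. -/
  u : E → E
  /-- The second vector field. -/
  w : E → E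
  /-- The coefficient of the first vector field. -/
  a : ℝ → ℝ
  /-- The coefficient of the second vector field. -/
  b : ℝ → ℝ
  contDiff_N : ContDiff ℝ ∞ N
  contDiff_u : ContDiff ℝ ∞ u
  contDiff_w : ContDiff ℝ ∞ w
  contDiff_a : ContDiff ℝ ∞ a
  contDiff_b : ContDiff ℝ ∞ b
  hasCompactSupport_N : HasCompactSupport N
  hasCompactSupport_u : HasCompactSupport u
  hasCompactSupport_w : HasCompactSupport w

namespace LoopData

variable (D : LoopData E)

/-- The displacement from the base point, divided by `t`. -/
def displacement (s : ℝ) (x : E) : E := D.a s • D.u x + D.b s • D.w x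

/-- The velocity divided by `t`. -/
noncomputable def direction (s : ℝ) (x : E) : E := deriv D.a s • D.u x + deriv D.b s • D.w x

/-- The curve with base point `x` and size `t`. -/
def loop (t : ℝ) (x : E) (s : ℝ) : E := x + t • D.displacement s x

/-- The right hand side of the equation of parallel translation, divided by `t`. -/
noncomputable def field (q : ℝ × (ℝ × E × E) × E) : E :=
  -D.N (D.loop q.2.1.1 q.2.1.2.1 q.1, q.2.2) (D.direction q.1 q.2.1.2.1)

/-- The curves run backwards. -/
def reverse : LoopData E where
  N := D.N
  u := D.u
  w := D.w
  a s := D.a (1 - s)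
  b s := D.b (1 - s)
  contDiff_N := D.contDiff_N
  contDiff_u := D.contDiff_u
  contDiff_w := D.contDiff_w
  contDiff_a := D.contDiff_a.comp (contDiff_const.sub contDiff_id)
  contDiff_b := D.contDiff_b.comp (contDiff_const.sub contDiff_id)
  hasCompactSupport_N := D.hasCompactSupport_N
  hasCompactSupport_u := D.hasCompactSupport_u
  hasCompactSupport_w := D.hasCompactSupport_w

theorem reverse_reverse : D.reverse.reverse = D := by
  simp [reverse]

theorem contDiff_displacement : ContDiff ℝ ∞ fun q : ℝ × E => D.displacement q.1 q.2 :=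
  ((D.contDiff_a.comp contDiff_fst).smul (D.contDiff_u.comp contDiff_snd)).add
    ((D.contDiff_b.comp contDiff_fst).smul (D.contDiff_w.comp contDiff_snd))

theorem contDiff_deriv_a : ContDiff ℝ ∞ (deriv D.a) := ContDiff.deriv' (n := ∞) D.contDiff_a

theorem contDiff_deriv_b : ContDiff ℝ ∞ (deriv D.b) := ContDiff.deriv' (n := ∞) D.contDiff_b

theorem contDiff_direction : ContDiff ℝ ∞ fun q : ℝ × E => D.direction q.1 q.2 :=
  ((D.contDiff_deriv_a.comp contDiff_fst).smul (D.contDiff_u.comp contDiff_snd)).add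
    ((D.contDiff_deriv_b.comp contDiff_fst).smul (D.contDiff_w.comp contDiff_snd))

theorem contDiff_loop : ContDiff ℝ ∞ fun q : ℝ × E × ℝ => D.loop q.1 q.2.1 q.2.2 :=
  contDiff_snd.fst.add (contDiff_fst.smul (ContDiff.comp (f := fun q : ℝ × E × ℝ => (q.2.2, q.2.1))
    D.contDiff_displacement (contDiff_snd.snd.prodMk contDiff_snd.fst)))

theorem contDiff_field : ContDiff ℝ ∞ D.field := by
  have h1 : ContDiff ℝ ∞ fun q : ℝ × (ℝ × E × E) × E => D.loop q.2.1.1 q.2.1.2.1 q.1 :=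
    ContDiff.comp (f := fun q : ℝ × (ℝ × E × E) × E => (q.2.1.1, q.2.1.2.1, q.1))
      D.contDiff_loop (contDiff_snd.fst.fst.prodMk (contDiff_snd.fst.snd.fst.prodMk contDiff_fst))
  have h2 : ContDiff ℝ ∞ fun q : ℝ × (ℝ × E × E) × E => D.direction q.1 q.2.1.2.1 :=
    ContDiff.comp (f := fun q : ℝ × (ℝ × E × E) × E => (q.1, q.2.1.2.1))
      D.contDiff_direction (contDiff_fst.prodMk contDiff_snd.fst.snd.fst)
  exact ((D.contDiff_N.comp (h1.prodMk contDiff_snd.snd)).clm_apply h2).neg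

/-- The right hand side of the equation of parallel translation. -/
noncomputable def rhs (q : ℝ × (ℝ × E × E) × E) : E := q.2.1.1 • D.field q

theorem contDiff_rhs : ContDiff ℝ ∞ D.rhs := contDiff_snd.fst.fst.smul D.contDiff_field

theorem hasDerivAt_loop (t : ℝ) (x : E) (s : ℝ) :
    HasDerivAt (D.loop t x) (t • D.direction s x) s := by
  have ha := (D.contDiff_a.differentiable (by simp) s).hasDerivAt
  have hb := (D.contDiff_b.differentiable (by simp) s).hasDerivAt
  exact (((ha.smul_const (D.u x)).add (hb.smul_const (D.w x))).const_smul t).const_add x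

theorem reverse_direction (s : ℝ) (x : E) : D.reverse.direction s x = -D.direction (1 - s) x := by
  have h : ∀ f : ℝ → ℝ, deriv (fun s => f (1 - s)) s = -deriv f (1 - s) := fun f =>
    deriv_comp_const_sub _ _ _
  simp only [direction, reverse, h]
  module

theorem reverse_loop (t : ℝ) (x : E) (s : ℝ) : D.reverse.loop t x s = D.loop t x (1 - s) := rfl

/-- The slot of the initial value is free because the right hand side does not depend on it; the
reversed solution starts at a different vector. -/
theorem reverse_rhs (s : ℝ) (p : ℝ × E × E) (z : E) (y : E) :
    D.reverse.rhs (s, (p.1, p.2.1, y), z) = -D.rhs (1 - s, p, z) := by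
  simp only [rhs, field, reverse_loop, reverse_direction, map_neg, smul_neg, neg_neg]
  rfl

theorem exists_bound {f : ℝ → ℝ} (hf : Continuous f) : ∃ C, 0 ≤ C ∧ ∀ s ∈ I, |f s| ≤ C := by
  obtain ⟨C, hC⟩ := isCompact_Icc.exists_bound_of_continuousOn (s := I) hf.continuousOn
  exact ⟨max C 0, le_max_right _ _, fun s hs => (hC s hs).trans (le_max_left _ _)⟩

theorem exists_bound_smul_add_smul {f g : ℝ → ℝ} (hf : Continuous f) (hg : Continuous g) :
    ∃ C, 0 ≤ C ∧ ∀ s ∈ I, ∀ x, ‖f s • D.u x + g s • D.w x‖ ≤ C := by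
  obtain ⟨A, hA, hA'⟩ := exists_bound hf
  obtain ⟨B, hB, hB'⟩ := exists_bound hg
  obtain ⟨U, hU⟩ := D.hasCompactSupport_u.exists_bound_of_continuous D.contDiff_u.continuous
  obtain ⟨W, hW⟩ := D.hasCompactSupport_w.exists_bound_of_continuous D.contDiff_w.continuous
  have hU0 : 0 ≤ U := (norm_nonneg _).trans (hU 0)
  have hW0 : 0 ≤ W := (norm_nonneg _).trans (hW 0)
  refine ⟨A * U + B * W, by positivity, fun s hs x => (norm_add_le _ _).trans ?_⟩
  rw [norm_smul, norm_smul, Real.norm_eq_abs, Real.norm_eq_abs]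
  exact add_le_add (mul_le_mul (hA' s hs) (hU x) (norm_nonneg _) hA)
    (mul_le_mul (hB' s hs) (hW x) (norm_nonneg _) hB)

/-- Uniform bounds. -/
theorem exists_bounds : ∃ C, 0 < C ∧ ∀ s ∈ I, (∀ x, ‖D.displacement s x‖ ≤ C) ∧
    (∀ p z, ‖D.field (s, p, z)‖ ≤ C) ∧
    ∀ p z z', ‖D.field (s, p, z) - D.field (s, p, z')‖ ≤ C * ‖z - z'‖ := by
  obtain ⟨A, hA, hA'⟩ := D.exists_bound_smul_add_smul D.contDiff_a.continuous D.contDiff_b.continuous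
  obtain ⟨B, hB, hB'⟩ := D.exists_bound_smul_add_smul D.contDiff_deriv_a.continuous
    D.contDiff_deriv_b.continuous
  obtain ⟨K, hK⟩ := D.hasCompactSupport_N.exists_bound_of_continuous D.contDiff_N.continuous
  obtain ⟨L, hL⟩ := ContDiff.lipschitzWith_of_hasCompactSupport D.hasCompactSupport_N D.contDiff_N
    (by simp)
  have hK0 : 0 ≤ K := (norm_nonneg _).trans (hK 0)
  refine ⟨A + K * B + L * B + 1, by positivity, fun s hs => ⟨fun x => ?_, fun p z => ?_, fun p z z' => ?_⟩⟩
  · refine (hA' s hs x).trans ?_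
    have : 0 ≤ K * B + L * B + 1 := by positivity
    linarith
  · have h : ‖D.field (s, p, z)‖ ≤ K * B := by
      rw [field, norm_neg]
      exact (ContinuousLinearMap.le_opNorm _ _).trans (mul_le_mul (hK _) (hB' s hs _) (norm_nonneg _) hK0)
    have : 0 ≤ A + L * B + 1 := by positivity
    linarith
  · have h : ‖D.field (s, p, z) - D.field (s, p, z')‖ ≤ L * B * ‖z - z'‖ := by
      simp only [field]
      rw [neg_sub_neg, ← _root_.sub_apply]
      refine (ContinuousLinearMap.le_opNorm _ _).trans ?_
      have h1 := hL.norm_sub_le (D.loop p.1 p.2.1 s, z') (D.loop p.1 p.2.1 s, z)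
      have h2 : ‖((D.loop p.1 p.2.1 s, z') - (D.loop p.1 p.2.1 s, z) : E × E)‖ = ‖z - z'‖ := by
        simp [Prod.norm_def, norm_sub_rev]
      rw [h2] at h1
      refine (mul_le_mul h1 (hB' s hs _) (norm_nonneg _) (by positivity)).trans (le_of_eq (by ring))
    have h0 : 0 ≤ A + K * B + 1 := by positivity
    nlinarith [norm_nonneg (z - z')]

variable [CompleteSpace E]

/-- `Z (t, x, y)` is the parallel translation of `y` along the curve with base point `x` and size
`t`, for `|t| < ε`. -/
structure IsTransport (ε : ℝ) (Z : ℝ × E × E → C(I, E)) : Prop where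
  contDiffOn : ContDiffOn ℝ ∞ Z {p | |p.1| < ε}
  eq_volterra : ∀ p : ℝ × E × E, |p.1| < ε →
    Z p = const I p.2.2 + volterra (velocity D.rhs D.contDiff_rhs.continuous (p, Z p))
  unique : ∀ p : ℝ × E × E, |p.1| < ε → ∀ γ : C(I, E), γ 0 = p.2.2 →
    (∀ (s : ℝ) (hs : s ∈ I), HasDerivWithinAt (Set.IccExtend zero_le_one γ)
      (D.rhs (s, p, γ ⟨s, hs⟩)) I s) → γ = Z p

/-- The factor t in the equation makes the Lipschitz constant small for small t. Compact supports
make this uniform in (x, y), so one ε serves all base points and all vectors. -/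
theorem exists_isTransport : ∃ ε, 0 < ε ∧ ∃ Z, D.IsTransport ε Z := by
  obtain ⟨C, hC, h⟩ := D.exists_bounds
  -- For |t| < 1/(2C) the right hand side has Lipschitz constant at most |t| C ≤ 1/2.
  refine ⟨1 / (2 * C), by positivity, ?_⟩
  obtain ⟨Z, h1, h2, h3⟩ := exists_contDiffOn_integralCurve D.contDiff_rhs
    (y := fun p : ℝ × E × E => p.2.2) contDiff_snd.snd (U := {p | |p.1| < 1 / (2 * C)})
    (isOpen_lt (by fun_prop) continuous_const) fun p hp s hs z z' => by
      simp only [rhs]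
      rw [← smul_sub, norm_smul, Real.norm_eq_abs]
      have hp' : |p.1| < 1 / (2 * C) := hp
      calc |p.1| * ‖D.field (s, p, z) - D.field (s, p, z')‖
          ≤ 1 / (2 * C) * (C * ‖z - z'‖) :=
            mul_le_mul hp'.le ((h s hs).2.2 p z z') (norm_nonneg _) (by positivity)
        _ = 1 / 2 * ‖z - z'‖ := by field_simp
  exact ⟨Z, h1, h2, h3⟩

namespace IsTransport

variable {D} {ε : ℝ} {Z : ℝ × E × E → C(I, E)}

theorem mono (h : D.IsTransport ε Z) {δ : ℝ} (hδ : δ ≤ ε) : D.IsTransport δ Z where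
  contDiffOn := h.contDiffOn.mono fun _ hp => lt_of_lt_of_le hp hδ
  eq_volterra p hp := h.eq_volterra p (hp.trans_le hδ)
  unique p hp := h.unique p (hp.trans_le hδ)

theorem ode (h : D.IsTransport ε Z) {p : ℝ × E × E} (hp : |p.1| < ε) : Z p 0 = p.2.2 ∧
    ∀ (s : ℝ) (hs : s ∈ I), HasDerivWithinAt (Set.IccExtend zero_le_one (Z p))
      (D.rhs (s, p, Z p ⟨s, hs⟩)) I s :=
  (eq_const_add_volterra_iff (Z p) (velocity D.rhs D.contDiff_rhs.continuous (p, Z p)) p.2.2).1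
    (h.eq_volterra p hp)

/-- Keeps translated vectors close to the initial ones, hence inside the region where the cut off
connection is the true one. -/
theorem norm_sub_le (h : D.IsTransport ε Z) {C : ℝ} (hC : 0 ≤ C)
    (hb : ∀ s ∈ I, ∀ p z, ‖D.field (s, p, z)‖ ≤ C) {p : ℝ × E × E} (hp : |p.1| < ε) (s : I) :
    ‖Z p s - p.2.2‖ ≤ |p.1| * C := by
  have h1 : Z p s - p.2.2 = volterra (velocity D.rhs D.contDiff_rhs.continuous (p, Z p)) s := by
    have := congrArg (fun γ : C(I, E) => γ s - p.2.2) (h.eq_volterra p hp)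
    refine this.trans ?_
    simp
  rw [h1]
  refine (norm_coe_le_norm _ s).trans ((norm_volterra_le _).trans
    ((norm_le _ (by positivity)).2 fun r => ?_))
  rw [velocity_apply]
  change ‖p.1 • D.field (r, p, Z p r)‖ ≤ _
  rw [norm_smul, Real.norm_eq_abs]
  exact mul_le_mul_of_nonneg_left (hb r r.2 p _) (abs_nonneg _)

/-- Parallel translation along curves of size zero is trivial. -/
theorem eq_const (h : D.IsTransport ε Z) {p : ℝ × E × E} (hp : |p.1| < ε)
    (h0 : p.1 = 0 ∨ D.u p.2.1 = 0 ∧ D.w p.2.1 = 0) : Z p = const I p.2.2 := by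
  refine (h.unique p hp (const I p.2.2) rfl fun s hs => ?_).symm
  have e : D.rhs (s, p, p.2.2) = 0 := by
    rcases h0 with h0 | ⟨h1, h2⟩
    · simp [rhs, h0]
    · simp [rhs, field, direction, h1, h2]
  rw [const_apply, e]
  exact hasDerivWithinAt_const s I p.2.2

/-- Parallel translation along the reversed curves. -/
theorem reverse_apply (h : D.IsTransport ε Z) {Z' : ℝ × E × E → C(I, E)}
    (h' : D.reverse.IsTransport ε Z') {t : ℝ} (ht : |t| < ε) (x y : E) :
    Z' (t, x, Z (t, x, y) 1) 1 = y := by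
  have ho := h.ode (p := (t, x, y)) ht
  -- The time reversed solution solves the equation of the reversed loop, and uniqueness identifies
  -- it.
  let γ : C(I, E) := (Z (t, x, y)).comp ⟨fun s => σ s, by fun_prop⟩
  have hγ : γ = Z' (t, x, Z (t, x, y) 1) := by
    refine h'.unique (t, x, Z (t, x, y) 1) ht γ ?_ fun s hs => ?_
    · change Z (t, x, y) (σ 0) = Z (t, x, y) 1
      rw [symm_zero]
    · have hs' : 1 - s ∈ I := (Set.Icc.mem_iff_one_sub_mem).1 hs
      have h1 : HasDerivWithinAt (fun r : ℝ => 1 - r) (-1) I s :=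
        ((hasDerivAt_id s).const_sub 1).hasDerivWithinAt
      have h2 := (ho.2 (1 - s) hs').scomp s h1 fun r hr => (Set.Icc.mem_iff_one_sub_mem).1 hr
      rw [D.reverse_rhs s (t, x, y)]
      have e : γ ⟨s, hs⟩ = Z (t, x, y) ⟨1 - s, hs'⟩ := rfl
      rw [e, ← neg_one_smul ℝ]
      refine h2.congr_of_mem (fun r hr => ?_) hs
      have hr' : 1 - r ∈ I := (Set.Icc.mem_iff_one_sub_mem).1 hr
      simp only [Function.comp_apply]
      rw [Set.IccExtend_of_mem _ _ hr, Set.IccExtend_of_mem _ _ hr']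
      rfl
  rw [← hγ]
  change Z (t, x, y) (σ 1) = y
  rw [symm_one]
  exact ho.1

end IsTransport

end LoopData

end Transport

/-! ### Second order expansion of parallel translation around small loops. -/

section TransportExpansion

open ContinuousMap unitInterval Asymptotics

universe u

variable {E : Type u} [NormedAddCommGroup E] [NormedSpace ℝ E] [CompleteSpace E]

theorem volterra_eq_of_hasDerivAt {g : ℝ → E} {b : C(I, E)} (hg : Continuous g) (h0 : g 0 = 0)
    (h : ∀ s : I, HasDerivAt g (b s) s) (s : I) : volterra b s = g s := by
  let γ : C(I, E) := ⟨fun s => g s, by fun_prop⟩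
  have h1 := (eq_const_add_volterra_iff γ b 0).2 ⟨h0, fun s hs => by
    refine (h ⟨s, hs⟩).hasDerivWithinAt.congr_of_mem (fun r hr => ?_) hs
    rw [Set.IccExtend_of_mem _ _ hr]
    rfl⟩
  have h2 := congrArg (fun γ : C(I, E) => γ s) h1
  have h3 : γ s = volterra b s := by simpa using h2
  exact h3.symm

namespace LoopData

variable (D : LoopData E)

/-- The derivative of the connection in a horizontal direction. -/
noncomputable def horizontalDeriv (q : E × E) : E →L[ℝ] E →L[ℝ] E :=
  (fderiv ℝ D.N q).comp ((ContinuousLinearMap.id ℝ E).prod (-D.N q))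

theorem horizontalDeriv_apply (q : E × E) (v : E) :
    D.horizontalDeriv q v = fderiv ℝ D.N q (v, -D.N q v) := rfl

/-- The velocity divided by t does not depend on t, so only the point at which the connection is
evaluated varies. -/
theorem hasDerivAt_field (s : ℝ) (x y v : E) :
    HasDerivAt (fun τ : ℝ => D.field (s, (τ, x, y), y + τ • v))
      (-(fderiv ℝ D.N (x, y) (D.displacement s x, v)) (D.direction s x)) 0 := by
  have h1 : HasDerivAt (fun τ : ℝ => (D.loop τ x s, y + τ • v)) (D.displacement s x, v) 0 := by
    have e : ∀ c d : E, HasDerivAt (fun τ : ℝ => d + τ • c) c 0 := fun c d => by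
      simpa using ((hasDerivAt_id (0 : ℝ)).smul_const c).const_add d
    exact (e _ _).prodMk (e _ _)
  have h2 : HasFDerivAt D.N (fderiv ℝ D.N (x, y)) (D.loop 0 x s, y + (0 : ℝ) • v) := by
    have e : (D.loop 0 x s, y + (0 : ℝ) • v) = (x, y) := by simp [loop]
    rw [e]
    exact (D.contDiff_N.differentiable (by simp) _).hasFDerivAt
  have h3 : HasDerivAt (fun τ : ℝ => D.N (D.loop τ x s, y + τ • v))
      (fderiv ℝ D.N (x, y) (D.displacement s x, v)) 0 :=
    HasFDerivAt.comp_hasDerivAt (f := fun τ : ℝ => (D.loop τ x s, y + τ • v)) (0 : ℝ) h2 h1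
  have h4 : HasDerivAt (fun τ : ℝ => D.N (D.loop τ x s, y + τ • v) (D.direction s x))
      ((fderiv ℝ D.N (x, y) (D.displacement s x, v)) (D.direction s x)) 0 :=
    ((ContinuousLinearMap.apply ℝ E (D.direction s x)).hasFDerivAt).comp_hasDerivAt (0 : ℝ) h3
  exact h4.neg

theorem fderiv_field (s : ℝ) (x y v : E) :
    fderiv ℝ D.field (s, (0, x, y), y) (0, (1, 0, 0), v) =
      -(fderiv ℝ D.N (x, y) (D.displacement s x, v)) (D.direction s x) := by
  have h1 : HasDerivAt (fun τ : ℝ => ((s, (τ, x, y), y + τ • v) : ℝ × (ℝ × E × E) × E))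
      (0, (1, 0, 0), v) 0 := by
    have e : HasDerivAt (fun τ : ℝ => y + τ • v) v 0 := by
      simpa using ((hasDerivAt_id (0 : ℝ)).smul_const v).const_add y
    exact (hasDerivAt_const _ _).prodMk (((hasDerivAt_id _).prodMk (hasDerivAt_const _ _)).prodMk e)
  have h2 : HasFDerivAt D.field (fderiv ℝ D.field (s, (0, x, y), y)) (s, (0, x, y), y + (0 : ℝ) • v) := by
    rw [zero_smul, add_zero]
    exact (D.contDiff_field.differentiable (by simp) _).hasFDerivAt
  exact (HasFDerivAt.comp_hasDerivAt
    (f := fun τ : ℝ => ((s, (τ, x, y), y + τ • v) : ℝ × (ℝ × E × E) × E)) (0 : ℝ) h2 h1).unique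
    (D.hasDerivAt_field s x y v)

/-- The parallel translation along the closed curves `s ↦ x + t ((s - s²) u(x) + (s² - s³) w(x))` is
the identity up to order one in `t`, and the term of order two is a curvature. -/
theorem IsTransport.isLittleO {D : LoopData E} {ε : ℝ} {Z : ℝ × E × E → C(I, E)} (h : D.IsTransport ε Z)
    (hε : 0 < ε) (ha : D.a = fun s => s - s ^ 2) (hb : D.b = fun s => s ^ 2 - s ^ 3) (x y : E) :
    (fun t : ℝ => Z (t, x, y) 1 - y - (((2 : ℕ).factorial : ℝ)⁻¹ * t ^ 2) • ((1 / 30 : ℝ) •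
      (D.horizontalDeriv (x, y) (D.w x) (D.u x) - D.horizontalDeriv (x, y) (D.u x) (D.w x))))
      =o[𝓝 0] fun t : ℝ => t ^ 2 := by
  have hU : IsOpen {p : ℝ × E × E | |p.1| < ε} := isOpen_lt (by fun_prop) continuous_const
  have h00 : |((0 : ℝ), x, y).1| < ε := by simpa using hε
  have hp : HasDerivAt (fun t : ℝ => (t, x, y)) (1, 0, 0) 0 :=
    (hasDerivAt_id _).prodMk (hasDerivAt_const _ _)
  obtain ⟨γ', hγ⟩ : ∃ γ', HasDerivAt (fun t => Z (t, x, y)) γ' 0 :=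
    ⟨_, (((h.contDiffOn.contDiffAt (hU.mem_nhds h00)).differentiableAt
      (by simp)).hasFDerivAt.comp_hasDerivAt (0 : ℝ) hp)⟩
  obtain ⟨c', hc, hc'⟩ := hasDerivAt_velocity D.contDiff_field hp hγ
  set c : ℝ → C(I, E) := fun t => velocity D.field D.contDiff_field.continuous ((t, x, y), Z (t, x, y))
    with hcd
  have hZ0 : Z (0, x, y) = const I y := h.eq_const h00 (Or.inl rfl)
  have hev : ∀ᶠ t : ℝ in 𝓝 0, Z (t, x, y) = const I y + t • volterra (c t) := by
    filter_upwards [(isOpen_lt continuous_abs continuous_const).mem_nhds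
      (show |(0 : ℝ)| < ε by simpa using hε)] with t ht
    rw [← map_smul]
    exact h.eq_volterra (t, x, y) ht
  have hv := (volterra (E := E)).hasFDerivAt.comp_hasDerivAt (0 : ℝ) hc
  -- Since Z = y + t ∫ c(t), the first derivative of Z at t = 0 is the integral of c(0), and the
  -- second order term of Z only needs the first derivative of c.
  have hγ' : γ' = volterra (c 0) := by
    have h1 := (((hasDerivAt_id (0 : ℝ)).smul hv).const_add (const I y)).congr_of_eventuallyEq hev
    have h2 := hγ.unique h1
    simpa using h2
  have hdisp : ∀ s : ℝ, HasDerivAt (fun s => D.displacement s x) (D.direction s x) s := fun s => by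
    have ha' := (D.contDiff_a.differentiable (by simp) s).hasDerivAt
    have hb' := (D.contDiff_b.differentiable (by simp) s).hasDerivAt
    exact (ha'.smul_const (D.u x)).add (hb'.smul_const (D.w x))
  have hdisp0 : D.displacement 0 x = 0 := by simp [displacement, ha, hb]
  have hdisp1 : D.displacement 1 x = 0 := by simp [displacement, ha, hb]
  -- To first order the translated vector moves by minus the connection applied to the displacement.
  -- This vanishes at s = 1 because the loop closes, so the order one term of the translation is
  -- zero.
  have hc0 : ∀ s : I, volterra (c 0) s = -D.N (x, y) (D.displacement s x) := by
    have hd : ∀ s : ℝ, HasDerivAt (fun s : ℝ => -D.N (x, y) (D.displacement s x))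
        (-D.N (x, y) (D.direction s x)) s := fun s =>
      ((D.N (x, y)).hasFDerivAt.comp_hasDerivAt s (hdisp s)).neg
    refine volterra_eq_of_hasDerivAt (g := fun s : ℝ => -D.N (x, y) (D.displacement s x))
      (continuous_iff_continuousAt.2 fun s => (hd s).continuousAt) (by simp [hdisp0]) fun s => ?_
    have e : c 0 s = -D.N (x, y) (D.direction s x) := by
      rw [hcd]
      simp only [velocity_apply, hZ0, const_apply]
      simp [field, loop]
    rw [e]
    exact hd s
  -- Base point and vector vary together along the horizontal vector over the displacement.
  have hc1 : ∀ s : I, c' s = -D.horizontalDeriv (x, y) (D.displacement s x) (D.direction s x) := fun s => by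
    rw [hc' s, hZ0, hγ', hc0 s]
    exact D.fderiv_field s x y _
  set L := D.horizontalDeriv (x, y) with hL
  set R := L (D.w x) (D.u x) - L (D.u x) (D.w x) with hR
  have hda : ∀ s : ℝ, deriv D.a s = 1 - 2 * s := fun s => by
    rw [ha]
    simp
  have hdb : ∀ s : ℝ, deriv D.b s = 2 * s - 3 * s ^ 2 := fun s => by
    rw [hb]
    simp
  -- The loop polynomials satisfy ∫₀¹ a b' = 1/60 and ∫₀¹ b a' = -1/60, while a a' and b b'
  -- integrate to zero. So only the antisymmetric part survives, multiplied by the signed area 1/60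
  -- of the curve (a, b). Relative to the factor 1/2! of the jet, this is 1/30.
  have hc'1 : volterra c' 1 = (1 / 60 : ℝ) • R := by
    -- The explicit primitive: the coefficients are a²/2, b²/2 and the primitives of a b' and b a'.
    let g : ℝ → E := fun s => -(((s - s ^ 2) ^ 2 / 2) • L (D.u x) (D.u x) +
      ((s ^ 2 - s ^ 3) ^ 2 / 2) • L (D.w x) (D.w x) +
      (2 / 3 * s ^ 3 - 5 / 4 * s ^ 4 + 3 / 5 * s ^ 5) • L (D.u x) (D.w x) +
      (1 / 3 * s ^ 3 - 3 / 4 * s ^ 4 + 2 / 5 * s ^ 5) • L (D.w x) (D.u x))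
    have hg : ∀ s : ℝ, HasDerivAt g (-L (D.displacement s x) (D.direction s x)) s := fun s => by
      have hm : ∀ k : ℕ, HasDerivAt (fun s : ℝ => s ^ k) (k * s ^ (k - 1)) s := fun k => hasDerivAt_pow k s
      have h1 := ((hasDerivAt_id s).sub (hm 2)).pow 2 |>.div_const 2
      have h2 := ((hm 2).sub (hm 3)).pow 2 |>.div_const 2
      have h3 := (((hm 3).const_mul (2 / 3)).sub ((hm 4).const_mul (5 / 4))).add ((hm 5).const_mul (3 / 5))
      have h4 := (((hm 3).const_mul (1 / 3)).sub ((hm 4).const_mul (3 / 4))).add ((hm 5).const_mul (2 / 5))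
      have h5 := ((((h1.smul_const (L (D.u x) (D.u x))).add (h2.smul_const (L (D.w x) (D.w x)))).add
        (h3.smul_const (L (D.u x) (D.w x)))).add (h4.smul_const (L (D.w x) (D.u x)))).neg
      refine h5.congr_deriv ?_
      rw [displacement, direction, hda, hdb, ha, hb]
      simp only [map_add, map_smul, _root_.add_apply, _root_.smul_apply]
      simp only [Pi.sub_apply, id]
      push_cast
      norm_num
      module
    have h1 := volterra_eq_of_hasDerivAt (g := g)
      (continuous_iff_continuousAt.2 fun s => (hg s).continuousAt) (by simp [g])
      (b := c') (fun s => by rw [hc1 s]; exact hg s) 1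
    rw [h1, hR]
    simp only [g, Set.Icc.coe_one]
    norm_num
    module
  have hlo := (hasDerivAt_iff_isLittleO.1 hv)
  have hlo1 : (fun t : ℝ => volterra (c t) 1 - (t * (1 / 60)) • R) =o[𝓝 0] fun t : ℝ => t := by
    have h1 : (fun t : ℝ => volterra (c t) 1 - (t * (1 / 60)) • R) =O[𝓝 0]
        fun t => (volterra (c t) - volterra (c 0) - (t - 0) • volterra c') := by
      refine IsBigO.of_bound 1 (Eventually.of_forall fun t => ?_)
      rw [one_mul]
      refine le_trans (le_of_eq ?_) (norm_coe_le_norm _ (1 : I))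
      have e : volterra (c 0) (1 : I) = 0 := by
        rw [hc0]
        simp [hdisp1]
      simp [e, hc'1, smul_smul]
    refine h1.trans_isLittleO (hlo.congr_right fun t => sub_zero t)
  have h2 : (fun t : ℝ => t • (volterra (c t) 1 - (t * (1 / 60)) • R)) =o[𝓝 0] fun t : ℝ => t ^ 2 := by
    simpa [pow_two] using (isBigO_refl (fun t : ℝ => t) (𝓝 0)).smul_isLittleO hlo1
  refine h2.congr' ?_ EventuallyEq.rfl
  filter_upwards [hev] with t ht
  rw [ht]
  simp only [ContinuousMap.add_apply, const_apply, ContinuousMap.smul_apply, Nat.factorial]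
  push_cast
  module

end LoopData

end TransportExpansion

/-! ### Translation along small loops as a map of the indicatrix bundle. -/

namespace FinslerMetric

variable {n : ℕ} {M : Type*} [TopologicalSpace M]
  [ChartedSpace (EuclideanSpace ℝ (Fin n)) M] [IsManifold (𝓡 n) ∞ M] (F : FinslerMetric n M)

local notation "𝔼" => EuclideanSpace ℝ (Fin n)
local notation "𝔹" => EuclideanSpace ℝ (Fin n) × EuclideanSpace ℝ (Fin (n - 1))

theorem _root_.TangentBundle.mk_snd_eq {w : TangentBundle (𝓡 n) M} {p : M} (h : w.1 = p) :
    (⟨p, (w.2 : 𝔼)⟩ : TangentBundle (𝓡 n) M) = w := by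
  subst h
  rfl

theorem contMDiffAt_tangentChart_symm {c : M} {q : 𝔼 × 𝔼} (hq : q.1 ∈ (chartAt 𝔼 c).target) :
    ContMDiffAt 𝓘(ℝ, 𝔼 × 𝔼) (𝓡 n).tangent ∞
      (fun q : 𝔼 × 𝔼 => ((tangentChart c).symm q : TangentBundle (𝓡 n) M)) q := by
  have h : ContMDiffAt (𝓡 n).tangent (𝓡 n).tangent ∞
      ((tangentChart c).symm : ModelProd 𝔼 𝔼 → TangentBundle (𝓡 n) M) q :=
    (contMDiffOn_chart_symm (I := (𝓡 n).tangent)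
      (x := (⟨c, 0⟩ : TangentBundle (𝓡 n) M))).contMDiffAt
        ((tangentChart (M := M) c).open_target.mem_nhds ((mem_tangentChart_target c q).2 hq))
  exact h

theorem continuous_proj_incl : Continuous fun v : F.IndicatrixBundle => v.incl.1 :=
  (FiberBundle.continuous_proj 𝔼 (TangentSpace (𝓡 n) : M → Type)).comp F.isInducing_incl.continuous

open unitInterval ContinuousMap

/-- Along the closed curves of `D`, which lie in the chart at `c`, the map `Z` is the parallel
translation of unit vectors. -/
structure IsLoopTransport (c : M) (D : LoopData 𝔼) (K : Set 𝔼) (ε : ℝ)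
    (Z : ℝ × 𝔼 × 𝔼 → C(I, 𝔼)) : Prop where
  isTransport : D.IsTransport ε Z
  isCompact : IsCompact K
  subset : K ⊆ (chartAt 𝔼 c).target
  u_eq_zero : ∀ x ∉ K, D.u x = 0
  w_eq_zero : ∀ x ∉ K, D.w x = 0
  loop_mem : ∀ t x, |t| < ε → x ∈ K → ∀ s ∈ I, D.loop t x s ∈ (chartAt 𝔼 c).target
  mem : ∀ t x y, |t| < ε → x ∈ K → F.chartNorm c (x, y) = 1 → ∀ s : I, Z (t, x, y) s ≠ 0 ∧
    D.N (D.loop t x s, Z (t, x, y) s) =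
      sprayConnection (F.geodesicVector c) (D.loop t x s, Z (t, x, y) s)
  displacement_zero : ∀ x, D.displacement 0 x = 0
  displacement_one : ∀ x, D.displacement 1 x = 0

namespace IsLoopTransport

variable {F} {c : M}
  {D : LoopData (EuclideanSpace ℝ (Fin n))} {K : Set (EuclideanSpace ℝ (Fin n))} {ε : ℝ}
  {Z : ℝ × EuclideanSpace ℝ (Fin n) × EuclideanSpace ℝ (Fin n) → C(I, EuclideanSpace ℝ (Fin n))}
  (h : F.IsLoopTransport c D K ε Z)

include h

theorem eq_const_of_notMem {t : ℝ} (ht : |t| < ε) {x : 𝔼} (hx : x ∉ K) (y : 𝔼) :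
    Z (t, x, y) = const I y :=
  h.isTransport.eq_const (p := (t, x, y)) ht (Or.inr ⟨h.u_eq_zero x hx, h.w_eq_zero x hx⟩)

theorem hasDerivWithinAt {t : ℝ} (ht : |t| < ε) {x y : 𝔼} (hx : x ∈ K)
    (hy : F.chartNorm c (x, y) = 1) {s : ℝ} (hs : s ∈ I) :
    HasDerivWithinAt (Set.IccExtend zero_le_one (Z (t, x, y)))
      (-sprayConnection (F.geodesicVector c)
        (D.loop t x s, Set.IccExtend zero_le_one (Z (t, x, y)) s) (t • D.direction s x)) I s := by
  have h1 := (h.isTransport.ode (p := (t, x, y)) ht).2 s hs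
  rw [Set.IccExtend_of_mem _ _ hs, ← (h.mem t x y ht hx hy ⟨s, hs⟩).2]
  refine h1.congr_deriv ?_
  simp [LoopData.rhs, LoopData.field]

/-- The curve (base point, translated vector) is horizontal and horizontal vectors annihilate the
energy, so the energy is constant; at both ends the base point is x. -/
theorem chartNorm_eq {t : ℝ} (ht : |t| < ε) {x y : 𝔼} (hx : x ∈ K)
    (hy : F.chartNorm c (x, y) = 1) : F.chartNorm c (x, Z (t, x, y) 1) = 1 := by
  let f : ℝ → ℝ := fun s => F.energy c (D.loop t x s, Set.IccExtend zero_le_one (Z (t, x, y)) s)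
  have hf : ∀ s ∈ I, HasDerivWithinAt f 0 I s := fun s hs => by
    have hmem : (D.loop t x s, Set.IccExtend zero_le_one (Z (t, x, y)) s) ∈
        slitSet (chartAt 𝔼 c).target := by
      refine ⟨h.loop_mem t x ht hx s hs, ?_⟩
      change Set.IccExtend zero_le_one (Z (t, x, y)) s ≠ 0
      rw [Set.IccExtend_of_mem _ _ hs]
      exact (h.mem t x y ht hx hy ⟨s, hs⟩).1
    have h1 := (D.hasDerivAt_loop t x s).hasDerivWithinAt (s := I) |>.prodMk
      (h.hasDerivWithinAt ht hx hy hs)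
    have h2 := (((F.contDiffOn_energy c).contDiffAt ((isOpen_slitSet
      (chartAt 𝔼 c).open_target).mem_nhds hmem)).differentiableAt (by simp)).hasFDerivAt
    have h3 := HasFDerivAt.comp_hasDerivWithinAt
      (f := fun s => (D.loop t x s, Set.IccExtend zero_le_one (Z (t, x, y)) s)) s h2 h1
    refine h3.congr_deriv ?_
    exact (F.isFinslerEnergy_energy c).fderiv_sprayHorizontal (F.isSpray_geodesicVector c) hmem
      (t • D.direction s x)
  have h0 : (0 : ℝ) ∈ I := ⟨le_rfl, zero_le_one⟩
  have h1 : (1 : ℝ) ∈ I := ⟨zero_le_one, le_rfl⟩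
  have h2 := (convex_Icc (0 : ℝ) 1).norm_image_sub_le_of_norm_hasDerivWithin_le (f := f) (C := 0)
    (fun s hs => hf s hs) (fun s _ => by simp) h0 h1
  rw [zero_mul] at h2
  have h3 : f 1 = f 0 := sub_eq_zero.1 (norm_le_zero_iff.1 h2)
  have e0 : Set.IccExtend zero_le_one (Z (t, x, y)) 0 = y := by
    rw [Set.IccExtend_of_mem _ _ h0]
    exact (h.isTransport.ode (p := (t, x, y)) ht).1
  have e1 : Set.IccExtend zero_le_one (Z (t, x, y)) 1 = Z (t, x, y) 1 := Set.IccExtend_of_mem _ _ h1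
  simp only [f, e0, e1, LoopData.loop, h.displacement_zero, h.displacement_one, smul_zero, add_zero,
    energy, hy] at h3
  have h4 : 0 ≤ F.chartNorm c (x, Z (t, x, y) 1) := F.nonneg' _
  nlinarith

end IsLoopTransport

open Classical in
/-- The image of a unit vector under the transport map `Z` in the chart at `c`. -/
noncomputable def transportVector (c : M) (Z : ℝ × 𝔼 × 𝔼 → C(I, 𝔼)) (t : ℝ) (v : F.IndicatrixBundle) :
    TangentBundle (𝓡 n) M :=
  if v.incl.1 ∈ (chartAt 𝔼 c).source then (tangentChart c).symm
    ((F.chartCoord c v).1, Z (t, F.chartCoord c v) 1) else v.incl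

open Classical in
/-- `transportVector` as a map of the indicatrix bundle. -/
noncomputable def transport (c : M) (Z : ℝ × 𝔼 × 𝔼 → C(I, 𝔼)) (t : ℝ) (v : F.IndicatrixBundle) :
    F.IndicatrixBundle :=
  if h : F (F.transportVector c Z t v) = 1 then ⟨F.transportVector c Z t v, h⟩ else v

theorem transportVector_of_mem {c : M} (Z : ℝ × 𝔼 × 𝔼 → C(I, 𝔼)) (t : ℝ) {v : F.IndicatrixBundle}
    (hv : v.incl.1 ∈ (chartAt 𝔼 c).source) : F.transportVector c Z t v =
      (tangentChart c).symm ((F.chartCoord c v).1, Z (t, F.chartCoord c v) 1) := if_pos hv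

theorem transportVector_of_notMem {c : M} (Z : ℝ × 𝔼 × 𝔼 → C(I, 𝔼)) (t : ℝ) {v : F.IndicatrixBundle}
    (hv : v.incl.1 ∉ (chartAt 𝔼 c).source) : F.transportVector c Z t v = v.incl := if_neg hv

namespace IsLoopTransport

variable {F} {c : M}
  {D : LoopData (EuclideanSpace ℝ (Fin n))} {K : Set (EuclideanSpace ℝ (Fin n))} {ε : ℝ}
  {Z Z' : ℝ × EuclideanSpace ℝ (Fin n) × EuclideanSpace ℝ (Fin n) → C(I, EuclideanSpace ℝ (Fin n))}
  (h : F.IsLoopTransport c D K ε Z)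

include h

theorem transportVector_eq_self {t : ℝ} (ht : |t| < ε) {v : F.IndicatrixBundle}
    (hv : v.incl.1 ∈ (chartAt 𝔼 c).source → (F.chartCoord c v).1 ∉ K) :
    F.transportVector c Z t v = v.incl := by
  by_cases hs : v.incl.1 ∈ (chartAt 𝔼 c).source
  · rw [F.transportVector_of_mem Z t hs]
    have e : Z (t, F.chartCoord c v) = const I (F.chartCoord c v).2 :=
      h.eq_const_of_notMem ht (hv hs) (F.chartCoord c v).2
    rw [e]
    exact F.tangentChart_symm_chartCoord hs
  · exact F.transportVector_of_notMem Z t hs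

theorem norm_transportVector {t : ℝ} (ht : |t| < ε) (v : F.IndicatrixBundle) :
    F (F.transportVector c Z t v) = 1 := by
  by_cases hv : v.incl.1 ∈ (chartAt 𝔼 c).source ∧ (F.chartCoord c v).1 ∈ K
  · rw [F.transportVector_of_mem Z t hv.1]
    exact h.chartNorm_eq ht hv.2 (y := (F.chartCoord c v).2) (F.chartNorm_chartCoord hv.1)
  · rw [h.transportVector_eq_self ht fun hs hK => hv ⟨hs, hK⟩]
    exact v.norm_eq

theorem incl_transport {t : ℝ} (ht : |t| < ε) (v : F.IndicatrixBundle) :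
    (F.transport c Z t v).incl = F.transportVector c Z t v := by
  rw [transport, dif_pos (h.norm_transportVector ht v)]

theorem transport_eq_self {t : ℝ} (ht : |t| < ε) {v : F.IndicatrixBundle}
    (hv : v.incl.1 ∈ (chartAt 𝔼 c).source → (F.chartCoord c v).1 ∉ K) : F.transport c Z t v = v :=
  incl_injective ((h.incl_transport ht v).trans (h.transportVector_eq_self ht hv))

theorem proj_transport {t : ℝ} (ht : |t| < ε) (v : F.IndicatrixBundle) :
    (F.transport c Z t v).incl.1 = v.incl.1 := by
  rw [h.incl_transport ht]
  by_cases hv : v.incl.1 ∈ (chartAt 𝔼 c).source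
  · rw [F.transportVector_of_mem Z t hv]
    exact F.chartAt_symm_chartCoord_fst hv
  · rw [F.transportVector_of_notMem Z t hv]

theorem chartCoord_transport {t : ℝ} (ht : |t| < ε) {v : F.IndicatrixBundle}
    (hv : v.incl.1 ∈ (chartAt 𝔼 c).source) :
    F.chartCoord c (F.transport c Z t v) = ((F.chartCoord c v).1, Z (t, F.chartCoord c v) 1) := by
  rw [chartCoord, h.incl_transport ht, F.transportVector_of_mem Z t hv]
  exact (tangentChart c).right_inv ((mem_tangentChart_target c
    ((F.chartCoord c v).1, Z (t, F.chartCoord c v) 1)).2 (F.chartCoord_mem hv).1)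

theorem transport_transport (h' : F.IsLoopTransport c D.reverse K ε Z') {t : ℝ} (ht : |t| < ε)
    (v : F.IndicatrixBundle) : F.transport c Z' t (F.transport c Z t v) = v := by
  by_cases hv : v.incl.1 ∈ (chartAt 𝔼 c).source
  · refine incl_injective ?_
    have hv' : (F.transport c Z t v).incl.1 ∈ (chartAt 𝔼 c).source := by
      rw [h.proj_transport ht]
      exact hv
    rw [h'.incl_transport ht, F.transportVector_of_mem Z' t hv', h.chartCoord_transport ht hv,
      h.isTransport.reverse_apply h'.isTransport ht]
    exact F.tangentChart_symm_chartCoord hv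
  · have e := h.transport_eq_self ht (v := v) fun hs => absurd hs hv
    rw [e]
    exact h'.transport_eq_self ht fun hs => absurd hs hv

theorem transport_zero (hε : 0 < ε) (v : F.IndicatrixBundle) : F.transport c Z 0 v = v := by
  have h0 : |(0 : ℝ)| < ε := by simpa using hε
  by_cases hv : v.incl.1 ∈ (chartAt 𝔼 c).source
  · refine incl_injective ?_
    have e : Z (0, F.chartCoord c v) = const I (F.chartCoord c v).2 :=
      h.isTransport.eq_const (p := (0, F.chartCoord c v)) h0 (Or.inl rfl)
    rw [h.incl_transport h0, F.transportVector_of_mem Z 0 hv, e]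
    exact F.tangentChart_symm_chartCoord hv
  · exact h.transport_eq_self h0 fun hs => absurd hs hv

end IsLoopTransport

/-- Over the chart domain this is the smoothness of `Z` in all its variables. Elsewhere the map is
locally the identity. -/
theorem IsLoopTransport.contMDiffOn_transport [T2Space M] {F : FinslerMetric n M} {c : M}
    {D : LoopData 𝔼} {K : Set 𝔼} {ε : ℝ} {Z : ℝ × 𝔼 × 𝔼 → C(I, 𝔼)} (h : F.IsLoopTransport c D K ε Z) :
    SmoothOnIoo (E := 𝔹) ε (F.transport c Z) := by
  rintro ⟨t, v⟩ ⟨ht, -⟩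
  refine ContMDiffAt.contMDiffWithinAt ?_
  have ht' : |t| < ε := abs_lt.2 ht
  have hnear : ∀ᶠ z : ℝ × F.IndicatrixBundle in 𝓝 (t, v), |z.1| < ε :=
    (isOpen_lt (by fun_prop) continuous_const).mem_nhds ht'
  refine F.contMDiffAt_of_incl (f := fun z : ℝ × F.IndicatrixBundle => F.transport c Z z.1 z.2) ?_
  by_cases hv : v.incl.1 ∈ (chartAt 𝔼 c).source
  · have hev : (fun z : ℝ × F.IndicatrixBundle => (F.transport c Z z.1 z.2).incl) =ᶠ[𝓝 (t, v)]
        fun z => (tangentChart c).symm ((F.chartCoord c z.2).1, Z (z.1, F.chartCoord c z.2) 1) := by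
      have h1 : ∀ᶠ z : ℝ × F.IndicatrixBundle in 𝓝 (t, v), z.2.incl.1 ∈ (chartAt 𝔼 c).source :=
        (F.continuous_proj_incl.comp continuous_snd).continuousAt.eventually
          ((chartAt 𝔼 c).open_source.mem_nhds hv)
      filter_upwards [hnear, h1] with z hz1 hz2
      rw [h.incl_transport hz1, F.transportVector_of_mem Z _ hz2]
    refine ContMDiffAt.congr_of_eventuallyEq ?_ hev
    have h1 : ContMDiffAt (𝓘(ℝ, ℝ).prod 𝓘(ℝ, 𝔹)) 𝓘(ℝ, 𝔼 × 𝔼) ∞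
        (fun z : ℝ × F.IndicatrixBundle => F.chartCoord c z.2) (t, v) :=
      ContMDiffAt.comp (g := F.chartCoord c) (f := fun z : ℝ × F.IndicatrixBundle => z.2) (t, v)
        (F.contMDiffAt_chartCoord hv) contMDiffAt_snd
    have h2 : ContMDiffAt (𝓘(ℝ, ℝ).prod 𝓘(ℝ, 𝔹)) 𝓘(ℝ, ℝ × 𝔼 × 𝔼) ∞
        (fun z : ℝ × F.IndicatrixBundle => (z.1, F.chartCoord c z.2)) (t, v) :=
      contMDiffAt_fst.prodMk_space h1
    have h3 : ContDiffAt ℝ ∞ (fun p : ℝ × 𝔼 × 𝔼 => (p.2.1, Z p 1)) (t, F.chartCoord c v) := by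
      have hZ : ContDiffAt ℝ ∞ Z (t, F.chartCoord c v) := h.isTransport.contDiffOn.contDiffAt
        ((isOpen_lt (by fun_prop) continuous_const).mem_nhds ht')
      have he : ContDiff ℝ ∞ fun γ : C(I, 𝔼) => γ 1 :=
        (ContinuousMap.evalCLM ℝ (1 : I) : C(I, 𝔼) →L[ℝ] 𝔼).contDiff
      exact contDiffAt_snd.fst.prodMk (he.contDiffAt.comp _ hZ)
    have h4 := ContMDiffAt.comp (t, v) h3.contMDiffAt h2
    exact ContMDiffAt.comp (f := fun z : ℝ × F.IndicatrixBundle =>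
        (((F.chartCoord c z.2).1, Z (z.1, F.chartCoord c z.2) 1) : 𝔼 × 𝔼)) (t, v)
      (contMDiffAt_tangentChart_symm (F.chartCoord_mem hv).1) h4
  -- A compact set in a Hausdorff space is closed, so the complement of the support is a
  -- neighborhood of every point outside the chart domain.
  · have hK : IsClosed ((chartAt 𝔼 c).symm '' K) :=
      (h.isCompact.image_of_continuousOn ((chartAt 𝔼 c).continuousOn_symm.mono h.subset)).isClosed
    have hvK : v.incl.1 ∉ (chartAt 𝔼 c).symm '' K := by
      rintro ⟨x, hx, e⟩
      exact hv (e ▸ (chartAt 𝔼 c).map_target (h.subset hx))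
    have hev : (fun z : ℝ × F.IndicatrixBundle => (F.transport c Z z.1 z.2).incl) =ᶠ[𝓝 (t, v)]
        fun z => z.2.incl := by
      have h1 : ∀ᶠ z : ℝ × F.IndicatrixBundle in 𝓝 (t, v),
          z.2.incl.1 ∈ ((chartAt 𝔼 c).symm '' K)ᶜ :=
        (F.continuous_proj_incl.comp continuous_snd).continuousAt.eventually
          (hK.isOpen_compl.mem_nhds hvK)
      filter_upwards [hnear, h1] with z hz1 hz2
      rw [h.transport_eq_self hz1 fun hs hx => hz2 ⟨_, hx, F.chartAt_symm_chartCoord_fst hs⟩]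
    refine ContMDiffAt.congr_of_eventuallyEq ?_ hev
    exact ContMDiffAt.comp (g := fun w : F.IndicatrixBundle => w.incl)
      (f := fun z : ℝ × F.IndicatrixBundle => z.2) (t, v) (F.contMDiff_incl v) contMDiffAt_snd

end FinslerMetric

/-! ### The translations belong to the fibered holonomy group, with the curvature as leading term.
-/

namespace FinslerMetric

variable {n : ℕ} {M : Type*} [TopologicalSpace M]
  [ChartedSpace (EuclideanSpace ℝ (Fin n)) M] [IsManifold (𝓡 n) ∞ M] (F : FinslerMetric n M)

local notation "𝔼" => EuclideanSpace ℝ (Fin n)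
local notation "𝔹" => EuclideanSpace ℝ (Fin n) × EuclideanSpace ℝ (Fin (n - 1))

/-- The map of the indicatrix at `p` induced by a fiber preserving map. -/
def fiberMap {F : FinslerMetric n M} (f : F.IndicatrixBundle → F.IndicatrixBundle)
    (hf : ∀ v, (f v).incl.1 = v.incl.1) (p : M) (y : F.Indicatrix p) : F.Indicatrix p :=
  ⟨((f ⟨⟨p, y.1⟩, y.2⟩).incl.2 : 𝔼), by
    have h := TangentBundle.mk_snd_eq (hf ⟨⟨p, y.1⟩, y.2⟩)
    exact (congrArg F h).trans (f ⟨⟨p, y.1⟩, y.2⟩).norm_eq⟩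

theorem mk_fiberMap {F : FinslerMetric n M} (f : F.IndicatrixBundle → F.IndicatrixBundle)
    (hf : ∀ v, (f v).incl.1 = v.incl.1) (p : M) (y : F.Indicatrix p) :
    (⟨p, (fiberMap f hf p y).1⟩ : TangentBundle (𝓡 n) M) = (f ⟨⟨p, y.1⟩, y.2⟩).incl :=
  TangentBundle.mk_snd_eq (hf ⟨⟨p, y.1⟩, y.2⟩)

theorem fiberMap_fiberMap {F : FinslerMetric n M} {f g : F.IndicatrixBundle → F.IndicatrixBundle}
    (hf : ∀ v, (f v).incl.1 = v.incl.1) (hg : ∀ v, (g v).incl.1 = v.incl.1)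
    (hgf : ∀ v, g (f v) = v) (p : M) (y : F.Indicatrix p) :
    fiberMap g hg p (fiberMap f hf p y) = y := by
  have h1 : (⟨⟨p, (fiberMap f hf p y).1⟩, (fiberMap f hf p y).2⟩ : F.IndicatrixBundle) =
      f ⟨⟨p, y.1⟩, y.2⟩ := incl_injective (mk_fiberMap f hf p y)
  have h2 := mk_fiberMap g hg p (fiberMap f hf p y)
  rw [h1, hgf] at h2
  exact Subtype.ext (TotalSpace.mk_injective p h2)

/-- The permutation of the indicatrix at `p` induced by a fiber preserving diffeomorphism. -/
noncomputable def fiberPerm {F : FinslerMetric n M} (Φ : F.IndicatrixDiffeo) (hΦ : ∀ v, (Φ v).incl.1 = v.incl.1)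
    (p : M) : Equiv.Perm (F.Indicatrix p) :=
  have hΦ' : ∀ v, (Φ.symm v).incl.1 = v.incl.1 := fun v => by
    rw [← hΦ (Φ.symm v), Φ.apply_symm_apply]
  { toFun := fiberMap Φ hΦ p
    invFun := fiberMap Φ.symm hΦ' p
    left_inv := fiberMap_fiberMap hΦ hΦ' Φ.symm_apply_apply p
    right_inv := fiberMap_fiberMap hΦ' hΦ Φ.apply_symm_apply p }

theorem mk_fiberPerm {F : FinslerMetric n M} (Φ : F.IndicatrixDiffeo)
    (hΦ : ∀ v, (Φ v).incl.1 = v.incl.1) (p : M) (y : F.Indicatrix p) :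
    (⟨p, (fiberPerm Φ hΦ p y).1⟩ : TangentBundle (𝓡 n) M) = (Φ ⟨⟨p, y.1⟩, y.2⟩).incl :=
  mk_fiberMap Φ hΦ p y

open unitInterval ContinuousMap

namespace IsLoopTransport

variable {F} {c : M} {D : LoopData (EuclideanSpace ℝ (Fin n))} {K : Set (EuclideanSpace ℝ (Fin n))}
  {ε : ℝ} {Z Z' : ℝ × EuclideanSpace ℝ (Fin n) × EuclideanSpace ℝ (Fin n) →
    C(I, EuclideanSpace ℝ (Fin n))}

theorem contMDiff_transport [T2Space M] (h : F.IsLoopTransport c D K ε Z) {t : ℝ} (ht : |t| < ε) :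
    ContMDiff 𝓘(ℝ, 𝔹) 𝓘(ℝ, 𝔹) ∞ (F.transport c Z t) := by
  intro v
  have h1 := h.contMDiffOn_transport.contMDiffAt (abs_lt.1 ht) v
  exact ContMDiffAt.comp (g := fun z : ℝ × F.IndicatrixBundle => F.transport c Z z.1 z.2)
    (f := fun w : F.IndicatrixBundle => (t, w)) v h1 (contMDiffAt_const.prodMk contMDiffAt_id)

open Classical in
/-- Parallel translation along the loops of size `t` as a diffeomorphism. -/
noncomputable def diffeo [T2Space M] (h : F.IsLoopTransport c D K ε Z)
    (h' : F.IsLoopTransport c D.reverse K ε Z') (t : ℝ) : F.IndicatrixDiffeo :=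
  if ht : |t| < ε then
    { toFun := F.transport c Z t
      invFun := F.transport c Z' t
      left_inv := h.transport_transport h' ht
      right_inv := h'.transport_transport (D.reverse_reverse.symm ▸ h) ht
      contMDiff_toFun := h.contMDiff_transport ht
      contMDiff_invFun := h'.contMDiff_transport ht }
  else 1

theorem diffeo_apply [T2Space M] (h : F.IsLoopTransport c D K ε Z)
    (h' : F.IsLoopTransport c D.reverse K ε Z') {t : ℝ} (ht : |t| < ε) (v : F.IndicatrixBundle) :
    h.diffeo h' t v = F.transport c Z t v := by
  rw [diffeo, dif_pos ht]
  rfl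

/-- The solution of the cut off equation in the chart is genuinely parallel, because along it the
cut off connection agrees with the Finsler connection. -/
theorem isLoopTranslation [T2Space M] (h : F.IsLoopTransport c D K ε Z) {t : ℝ} (ht : |t| < ε) {p : M}
    (hp : p ∈ (chartAt 𝔼 c).source) (hpK : chartAt 𝔼 c p ∈ K) {g : Equiv.Perm (F.Indicatrix p)}
    (hg : ∀ y : F.Indicatrix p, (⟨p, (g y).1⟩ : TangentBundle (𝓡 n) M) =
      (F.transport c Z t ⟨⟨p, y.1⟩, y.2⟩).incl) : F.IsLoopTranslation p g := by
  set x := chartAt 𝔼 c p with hx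
  have e0 : D.loop t x 0 = x := by simp [LoopData.loop, h.displacement_zero]
  have e1 : D.loop t x 1 = x := by simp [LoopData.loop, h.displacement_one]
  have hxp : (chartAt 𝔼 c).symm x = p := (chartAt 𝔼 c).left_inv hp
  -- The loop is smooth as a whole, so the trivial subdivision 0 < 1 suffices.
  refine ⟨fun s => (chartAt 𝔼 c).symm (D.loop t x s), 1, fun i => i, by simp, by simp, fun i _ => by simp,
    fun i hi => ?_, ?_, ?_, fun y => ?_⟩
  · obtain rfl : i = 0 := by omega
    have hI : Icc (((0 : ℕ) : ℝ)) (((0 + 1 : ℕ) : ℝ)) = I := by simp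
    rw [hI]
    have h1 : ContMDiffOn 𝓘(ℝ, 𝔼) (𝓡 n) ∞ (chartAt 𝔼 c).symm (chartAt 𝔼 c).target :=
      contMDiffOn_chart_symm
    have h2 : ContDiff ℝ ∞ (D.loop t x) :=
      D.contDiff_loop.comp (contDiff_const.prodMk (contDiff_const.prodMk contDiff_id))
    exact h1.comp h2.contMDiff.contMDiffOn fun s hs => h.loop_mem t x ht hpK s hs
  · simp only [e0, hxp]
  · simp only [e1, hxp]
  · set v : F.IndicatrixBundle := ⟨⟨p, y.1⟩, y.2⟩ with hv
    have hvs : v.incl.1 ∈ (chartAt 𝔼 c).source := hp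
    have hvx : (F.chartCoord c v).1 = x := rfl
    set η := (F.chartCoord c v).2 with hη
    have hvη : F.chartNorm c (x, η) = 1 := F.chartNorm_chartCoord hvs
    refine ⟨fun s => ((tangentChart c).symm (D.loop t x s, Set.IccExtend zero_le_one (Z (t, x, η)) s) :
      TangentBundle (𝓡 n) M).2, fun i hi => ?_, ?_, ?_⟩
    · obtain rfl : i = 0 := by omega
      have hI : Icc (((0 : ℕ) : ℝ)) (((0 + 1 : ℕ) : ℝ)) = I := by simp
      simp only [hI]
      refine F.isParallelOn_of_chart (γ := Set.IccExtend zero_le_one (Z (t, x, η)))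
        (ℓ' := fun s => t • D.direction s x) uniqueDiffOn_Icc_zero_one (h.loop_mem t x ht hpK)
        (fun s hs => ?_) (fun s hs => (D.hasDerivAt_loop t x s).hasDerivWithinAt)
        fun s hs => h.hasDerivWithinAt ht hpK hvη hs
      rw [Set.IccExtend_of_mem _ _ hs]
      exact (h.mem t x η ht hpK hvη ⟨s, hs⟩).1
    · have h0 : (D.loop t x 0, Set.IccExtend zero_le_one (Z (t, x, η)) 0) = F.chartCoord c v := by
        refine Prod.ext e0 ?_
        exact (Set.IccExtend_of_mem _ _ ⟨le_rfl, zero_le_one⟩).trans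
          (h.isTransport.ode (p := (t, x, η)) ht).1
      exact (congrArg (tangentChart c).symm h0).trans (F.tangentChart_symm_chartCoord hvs)
    · have h1 : (D.loop t x 1, Set.IccExtend zero_le_one (Z (t, x, η)) 1) =
          ((F.chartCoord c v).1, Z (t, F.chartCoord c v) 1) := by
        refine Prod.ext e1 ?_
        exact Set.IccExtend_of_mem _ _ ⟨zero_le_one, le_rfl⟩
      refine (congrArg (tangentChart c).symm h1).trans ?_
      rw [hg, h.incl_transport ht, F.transportVector_of_mem Z t hvs]

theorem diffeo_mem [T2Space M] (h : F.IsLoopTransport c D K ε Z)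
    (h' : F.IsLoopTransport c D.reverse K ε Z') {t : ℝ} (ht : |t| < ε) :
    h.diffeo h' t ∈ F.fiberedHolonomyGroup := by
  have hΦ : ∀ v, (h.diffeo h' t v).incl.1 = v.incl.1 := fun v => by
    rw [h.diffeo_apply h' ht, h.proj_transport ht]
  refine Subgroup.subset_closure fun p => ?_
  by_cases hp : p ∈ (chartAt 𝔼 c).source ∧ chartAt 𝔼 c p ∈ K
  · refine ⟨fiberPerm _ hΦ p, Subgroup.subset_closure ?_, fun y => (mk_fiberPerm _ hΦ p y).symm⟩
    refine h.isLoopTranslation ht hp.1 hp.2 fun y => ?_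
    rw [mk_fiberPerm, h.diffeo_apply h' ht]
  -- Over points outside the support the diffeomorphism is the identity of the fiber.
  · refine ⟨1, one_mem _, fun y => ?_⟩
    rw [h.diffeo_apply h' ht, h.transport_eq_self ht (v := ⟨⟨p, y.1⟩, y.2⟩)
      fun hs hK => hp ⟨hs, hK⟩]
    rfl

/-- The second order term of the parallel translation along small loops. -/
theorem hasJet [T2Space M] (h : F.IsLoopTransport c D K ε Z)
    (hε : 0 < ε) (ha : D.a = fun s => s - s ^ 2) (hb : D.b = fun s => s ^ 2 - s ^ 3)
    {X Y : SmoothVectorField (𝓡 n) M} (v : F.IndicatrixBundle)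
    (hR : v.incl.1 ∈ (chartAt 𝔼 c).source →
      D.horizontalDeriv (F.chartCoord c v) (D.w (F.chartCoord c v).1) (D.u (F.chartCoord c v).1) -
      D.horizontalDeriv (F.chartCoord c v) (D.u (F.chartCoord c v).1) (D.w (F.chartCoord c v).1) =
      F.curvatureCoord c X Y (F.chartCoord c v))
    (hX : v.incl.1 ∉ (chartAt 𝔼 c).source → F.curvatureVector X Y v = 0) :
    HasJet 2 (localRep v (F.transport c Z)) ((1 / 30 : ℝ) • F.curvatureVector X Y v)
      (extChartAt 𝓘(ℝ, 𝔹) v v) := by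
  have hnear : ∀ᶠ t : ℝ in 𝓝 0, |t| < ε :=
    (isOpen_lt continuous_abs continuous_const).mem_nhds (show |(0 : ℝ)| < ε by simpa using hε)
  have hrep : ∀ t : ℝ, localRep v (F.transport c Z) (t, extChartAt 𝓘(ℝ, 𝔹) v v) =
      extChartAt 𝓘(ℝ, 𝔹) v (F.transport c Z t v) := fun t => by
    rw [localRep, extChartAt_to_inv]
  rw [HasJet]
  by_cases hv : v.incl.1 ∈ (chartAt 𝔼 c).source
  · set q := F.chartCoord c v with hq
    have hR' := hR hv
    have hs := F.chartCoord_fst_mem_source v hv (mem_chart_source 𝔼 v.incl.1)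
    have e2 : tangentChartChange c v.incl.1 q = selfCoord v.incl :=
      F.tangentChartChange_chartCoord hv (mem_chart_source _ _)
    have d1 := hasFDerivAt_tangentChartChange hs
    have d2 := F.hasFDerivAt_directionCoord v (F.coord_selfCoord_pos v)
    -- The expansion is known in the chart at `c`; this map reads it in the chart of the indicatrix
    -- bundle at `v`.
    have d3 : HasFDerivAt (F.directionCoord v ∘ tangentChartChange c v.incl.1)
        ((fderiv ℝ (F.directionCoord v) (selfCoord v.incl)).comp
          (fderiv ℝ (tangentChartChange c v.incl.1) q)) q := by
      rw [← e2] at d2 ⊢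
      exact d2.comp q d1
    have hlo := h.isTransport.isLittleO hε ha hb q.1 q.2
    have hlo' : (fun t : ℝ => (q.1, Z (t, q) 1) - q - (((2 : ℕ).factorial : ℝ)⁻¹ * t ^ 2) •
        ((0 : 𝔼), (1 / 30 : ℝ) • F.curvatureCoord c X Y q)) =o[𝓝 0] fun t : ℝ => t ^ 2 := by
      rw [← hR']
      refine (Asymptotics.IsLittleO.prod_left (Asymptotics.isLittleO_zero _ _) hlo).congr_left
        fun t => ?_
      refine Prod.ext ?_ rfl
      simp
    have hfin := isLittleO_of_hasFDerivAt (by norm_num) d3 hlo'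
    refine hfin.congr' ?_ EventuallyEq.rfl
    filter_upwards [hnear] with t ht
    have e3 : (F.directionCoord v ∘ tangentChartChange c v.incl.1) (q.1, Z (t, q) 1) =
        localRep v (F.transport c Z) (t, extChartAt 𝓘(ℝ, 𝔹) v v) := by
      rw [hrep, F.extChartAt_indicatrix, h.incl_transport ht, F.transportVector_of_mem Z t hv]
      exact congrArg (F.directionCoord v)
        (tangentChart_tangentChart_symm (q := (q.1, Z (t, q) 1)) hs).symm
    have e4 : (F.directionCoord v ∘ tangentChartChange c v.incl.1) q = extChartAt 𝓘(ℝ, 𝔹) v v := by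
      rw [Function.comp_apply, e2]
      exact (F.extChartAt_indicatrix_self v).symm
    have e5 : ((fderiv ℝ (F.directionCoord v) (selfCoord v.incl)).comp
        (fderiv ℝ (tangentChartChange c v.incl.1) q)) (0, (1 / 30 : ℝ) • F.curvatureCoord c X Y q) =
        (1 / 30 : ℝ) • F.curvatureVector X Y v := by
      have e6 : ((0 : 𝔼), (1 / 30 : ℝ) • F.curvatureCoord c X Y q) =
        (1 / 30 : ℝ) • ((0 : 𝔼), F.curvatureCoord c X Y q) := by simp
      rw [e6, map_smul, F.curvatureVector_eq_fderiv X Y hv]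
      rfl
    rw [e3, e4, e5]
  · rw [hX hv]
    refine (Asymptotics.isLittleO_zero _ _).congr' ?_ EventuallyEq.rfl
    filter_upwards [hnear] with t ht
    rw [hrep, h.transport_eq_self ht fun hs => absurd hs hv]
    simp

theorem isTangentOfOrder [T2Space M] (h : F.IsLoopTransport c D K ε Z)
    (h' : F.IsLoopTransport c D.reverse K ε Z')
    (hε : 0 < ε) (ha : D.a = fun s => s - s ^ 2) (hb : D.b = fun s => s ^ 2 - s ^ 3)
    {X Y : SmoothVectorField (𝓡 n) M}
    (hR : ∀ v : F.IndicatrixBundle, v.incl.1 ∈ (chartAt 𝔼 c).source →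
      D.horizontalDeriv (F.chartCoord c v) (D.w (F.chartCoord c v).1) (D.u (F.chartCoord c v).1) -
      D.horizontalDeriv (F.chartCoord c v) (D.u (F.chartCoord c v).1) (D.w (F.chartCoord c v).1) =
      F.curvatureCoord c X Y (F.chartCoord c v))
    (hX : ∀ v : F.IndicatrixBundle, v.incl.1 ∉ (chartAt 𝔼 c).source → F.curvatureVector X Y v = 0) :
    IsTangentOfOrder F.fiberedHolonomyGroup 2 (F.curvatureField X Y) := by
  have h1 : IsTangentOfOrder F.fiberedHolonomyGroup 2
      (fun v => ((1 / 30 : ℝ) • F.curvatureVector X Y v : 𝔹)) := by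
    refine ⟨ε, h.diffeo h', hε, ?_, fun t ht => h.diffeo_mem h' (abs_lt.2 ht), ?_, fun v => ?_⟩
    · refine ContMDiffOn.congr h.contMDiffOn_transport fun z hz => ?_
      exact h.diffeo_apply h' (abs_lt.2 hz.1) z.2
    · refine DFunLike.ext _ _ fun v => ?_
      rw [h.diffeo_apply h' (by simpa using hε), h.transport_zero hε]
      rfl
    · have h2 := h.hasJet hε ha hb v (hR v) (hX v)
      rw [HasJet] at h2 ⊢
      refine h2.congr' ?_ EventuallyEq.rfl
      have hnear : ∀ᶠ t : ℝ in 𝓝 0, |t| < ε :=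
        (isOpen_lt continuous_abs continuous_const).mem_nhds (show |(0 : ℝ)| < ε by simpa using hε)
      filter_upwards [hnear] with t ht
      simp only [localRep]
      rw [h.diffeo_apply h' ht]
  -- The area factor 1/30 of the loops is removed by rescaling the tangent field.
  refine (h1.smul (by norm_num) 30).congr (funext fun v => ?_)
  have h2 : (30 : ℝ) • ((1 / 30 : ℝ) • F.curvatureVector X Y v) = F.curvatureVector X Y v := by
    rw [smul_smul]
    norm_num
  exact h2

end IsLoopTransport

end FinslerMetric

/-! ### Cutoffs, localization and the conclusion. -/

theorem contDiff_smul_of_tsupport_subset {E F : Type*} [NormedAddCommGroup E] [NormedSpace ℝ E]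
    [NormedAddCommGroup F] [NormedSpace ℝ F] {χ : E → ℝ} {f : E → F} {U : Set E} (hU : IsOpen U)
    (hχ : ContDiff ℝ ∞ χ) (hs : tsupport χ ⊆ U) (hf : ContDiffOn ℝ ∞ f U) : ContDiff ℝ ∞ (χ • f) := by
  refine contMDiff_iff_contDiff.1 (contMDiff_of_tsupport fun x hx => ?_)
  have h1 : x ∈ U := hs (tsupport_smul_subset_left χ f hx)
  exact (hχ.contDiffAt.smul (hf.contDiffAt (hU.mem_nhds h1))).contMDiffAt

namespace FinslerMetric

variable {n : ℕ} {M : Type*} [TopologicalSpace M]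
  [ChartedSpace (EuclideanSpace ℝ (Fin n)) M] [IsManifold (𝓡 n) ∞ M] (F : FinslerMetric n M)

local notation "𝔼" => EuclideanSpace ℝ (Fin n)
local notation "𝔹" => EuclideanSpace ℝ (Fin n) × EuclideanSpace ℝ (Fin (n - 1))

/-- Finsler unit vectors over a compact set are obtained by rescaling the Euclidean unit sphere by
the continuous positive function 1/F. The zero section, where the connection need not be smooth, is
avoided. -/
theorem exists_isCompact_unitVectors {c : M} {K : Set 𝔼} (hK : IsCompact K)
    (hKc : K ⊆ (chartAt 𝔼 c).target) : ∃ S : Set (𝔼 × 𝔼), IsCompact S ∧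
      S ⊆ slitSet (chartAt 𝔼 c).target ∧
      ∀ x ∈ K, ∀ y, F.chartNorm c (x, y) = 1 → (x, y) ∈ S := by
  have hsub : ∀ q ∈ K ×ˢ Metric.sphere (0 : 𝔼) 1, q ∈ slitSet (chartAt 𝔼 c).target := fun q hq =>
    ⟨hKc hq.1, fun h0 => by have := hq.2; simp [h0] at this⟩
  refine ⟨(fun q : 𝔼 × 𝔼 => (q.1, (F.chartNorm c q)⁻¹ • q.2)) '' (K ×ˢ Metric.sphere (0 : 𝔼) 1), ?_, ?_, ?_⟩
  · have h1 : ContinuousOn (F.chartNorm c) (K ×ˢ Metric.sphere (0 : 𝔼) 1) :=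
      (F.contDiffOn_chartNorm c).continuousOn.mono hsub
    refine (hK.prod (isCompact_sphere _ _)).image_of_continuousOn ?_
    exact continuousOn_fst.prodMk ((h1.inv₀ fun q hq => (F.chartNorm_pos c (hsub q hq)).ne').smul
      continuousOn_snd)
  · rintro _ ⟨q, hq, rfl⟩
    have h1 := F.chartNorm_pos c (hsub q hq)
    exact ⟨(hsub q hq).1, smul_ne_zero (inv_ne_zero h1.ne') (hsub q hq).2⟩
  · intro x hx y hy
    have hy0 : y ≠ 0 := by
      rintro rfl
      rw [F.chartNorm_zero] at hy
      exact zero_ne_one hy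
    have hn : 0 < ‖y‖ := norm_pos_iff.2 hy0
    refine ⟨(x, ‖y‖⁻¹ • y), ⟨hx, by simp [norm_smul, hn.ne']⟩, ?_⟩
    refine Prod.ext rfl ?_
    simp only
    rw [F.chartNorm_smul c x y (inv_pos.2 hn), hy, mul_one, inv_inv, smul_smul,
      mul_inv_cancel₀ hn.ne', one_smul]

open unitInterval ContinuousMap

theorem IsLoopTransport.mono {F : FinslerMetric n M} {c : M} {D : LoopData 𝔼} {K : Set 𝔼} {ε : ℝ}
    {Z : ℝ × 𝔼 × 𝔼 → C(I, 𝔼)} (h : F.IsLoopTransport c D K ε Z) {δ : ℝ} (hδ : δ ≤ ε) :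
    F.IsLoopTransport c D K δ Z where
  isTransport := h.isTransport.mono hδ
  isCompact := h.isCompact
  subset := h.subset
  u_eq_zero := h.u_eq_zero
  w_eq_zero := h.w_eq_zero
  loop_mem t x ht := h.loop_mem t x (ht.trans_le hδ)
  mem t x y ht := h.mem t x y (ht.trans_le hδ)
  displacement_zero := h.displacement_zero
  displacement_one := h.displacement_one

/-- Loops and translated vectors move by at most |t| C. For small t the loops therefore stay in the
chart and the translated unit vectors in `V`, where the connection has not been modified by the
cutoff. -/
theorem exists_isLoopTransport {c : M} (D : LoopData 𝔼) {K : Set 𝔼} (hK : IsCompact K)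
    (hKc : K ⊆ (chartAt 𝔼 c).target) (hu : ∀ x ∉ K, D.u x = 0) (hw : ∀ x ∉ K, D.w x = 0)
    {S V : Set (𝔼 × 𝔼)} (hS : IsCompact S) (hV : IsOpen V) (hSV : S ⊆ V)
    (hVc : V ⊆ slitSet (chartAt 𝔼 c).target)
    (hKS : ∀ x ∈ K, ∀ y, F.chartNorm c (x, y) = 1 → (x, y) ∈ S)
    (hN : ∀ q ∈ V, D.N q = sprayConnection (F.geodesicVector c) q)
    (h0 : ∀ x, D.displacement 0 x = 0) (h1 : ∀ x, D.displacement 1 x = 0) :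
    ∃ ε, 0 < ε ∧ ∃ Z, F.IsLoopTransport c D K ε Z := by
  obtain ⟨ε, hε, Z, hZ⟩ := D.exists_isTransport
  obtain ⟨C, hC, hb⟩ := D.exists_bounds
  obtain ⟨δ₁, hδ₁, h₁⟩ := hK.exists_thickening_subset_open (chartAt 𝔼 c).open_target hKc
  obtain ⟨δ₂, hδ₂, h₂⟩ := hS.exists_thickening_subset_open hV hSV
  -- `δ₁` bounds the room of `K` inside the chart target, `δ₂` that of the unit vectors inside `V`.
  have hr : 0 < min ε (min δ₁ δ₂ / C) := by positivity
  have hmul : ∀ t : ℝ, |t| < min ε (min δ₁ δ₂ / C) → |t| * C < min δ₁ δ₂ := fun t ht =>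
    (lt_div_iff₀ hC).1 (ht.trans_le (min_le_right _ _))
  have hloop : ∀ t x, |t| < min ε (min δ₁ δ₂ / C) → ∀ s ∈ I, dist (D.loop t x s) x < min δ₁ δ₂ := by
    intro t x ht s hs
    rw [dist_eq_norm, LoopData.loop, add_sub_cancel_left, norm_smul, Real.norm_eq_abs]
    exact (mul_le_mul_of_nonneg_left ((hb s hs).1 x) (abs_nonneg t)).trans_lt (hmul t ht)
  refine ⟨_, hr, Z, hZ.mono (min_le_left _ _), hK, hKc, hu, hw, fun t x ht hx s hs => ?_,
    fun t x y ht hx hy s => ?_, h0, h1⟩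
  · exact h₁ (Metric.mem_thickening_iff.2 ⟨x, hx, (hloop t x ht s hs).trans_le (min_le_left _ _)⟩)
  · have hm : (D.loop t x s, Z (t, x, y) s) ∈ V := by
      refine h₂ (Metric.mem_thickening_iff.2 ⟨(x, y), hKS x hx y hy, ?_⟩)
      rw [Prod.dist_eq]
      refine max_lt ((hloop t x ht s s.2).trans_le (min_le_right _ _)) ?_
      have h3 := hZ.norm_sub_le hC.le (fun s hs => (hb s hs).2.1) (p := (t, x, y))
        (ht.trans_le (min_le_left _ _)) s
      simp only
      rw [dist_eq_norm]
      exact h3.trans_lt ((hmul t ht).trans_le (min_le_right _ _))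
    exact ⟨(hVc hm).2, hN _ hm⟩

theorem sprayCurvature_smul_left (G : 𝔼 × 𝔼 → 𝔼) (q : 𝔼 × 𝔼) (a : ℝ) (u w : 𝔼) :
    sprayCurvature G q (a • u) w = a • sprayCurvature G q u w := by
  have h : sprayHorizontal G q (a • u) = a • sprayHorizontal G q u := by
    simp [sprayHorizontal]
  rw [sprayCurvature, sprayCurvature, h, map_smul, map_smul, _root_.smul_apply, smul_sub]

/-- Tensoriality: the curvature depends only on the value of the field at the base point. This
permits cutting X by a partition of unity and makes the curvature vanish where X does. -/
theorem curvatureVector_smul {X X' Y : SmoothVectorField (𝓡 n) M} {v : F.IndicatrixBundle} {a : ℝ}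
    (h : X' v.incl.1 = a • X v.incl.1) :
    F.curvatureVector X' Y v = a • F.curvatureVector X Y v := by
  have h1 : sprayCurvature (F.geodesicVector v.incl.1) (selfCoord v.incl) (X' v.incl.1) (Y v.incl.1) =
      a • sprayCurvature (F.geodesicVector v.incl.1) (selfCoord v.incl) (X v.incl.1) (Y v.incl.1) :=
    (congrArg (fun u : 𝔼 => sprayCurvature (F.geodesicVector v.incl.1) (selfCoord v.incl) u
      (Y v.incl.1)) h).trans (sprayCurvature_smul_left _ _ _ _ _)
  rw [curvatureVector, curvatureVector, h1, ← map_smul]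
  congr 1
  simp

theorem inChart_eq_zero {c : M} {X : SmoothVectorField (𝓡 n) M} {x : 𝔼}
    (h : X ((chartAt 𝔼 c).symm x) = 0) : X.inChart c x = 0 := by
  have h1 := tangentChart_smul c ((chartAt 𝔼 c).symm x) (X ((chartAt 𝔼 c).symm x)) 0
  rw [zero_smul, zero_smul, ← h] at h1
  exact h1

/-- The curvature vector field of two vector fields, one of which is supported in the domain of a
chart, is tangent to the fibered holonomy group. -/
theorem isTangentOfOrder_curvatureField [T2Space M] {c : M} {X : SmoothVectorField (𝓡 n) M}
    (Y : SmoothVectorField (𝓡 n) M) {K : Set M} (hK : IsCompact K) (hKc : K ⊆ (chartAt 𝔼 c).source)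
    (hX : ∀ p ∉ K, X p = 0) :
    IsTangentOfOrder F.fiberedHolonomyGroup 2 (F.curvatureField X Y) := by
  have hK0 : IsCompact (chartAt 𝔼 c '' K) :=
    hK.image_of_continuousOn ((chartAt 𝔼 c).continuousOn.mono hKc)
  have hK0c : chartAt 𝔼 c '' K ⊆ (chartAt 𝔼 c).target := by
    rintro _ ⟨p, hp, rfl⟩
    exact (chartAt 𝔼 c).map_source (hKc hp)
  -- Two cutoffs: ψ on the base, equal to 1 near the support of X, makes the vector fields compactly
  -- supported; χ on the slit tangent bundle, equal to 1 near the unit vectors over the support of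
  -- ψ, does this for the connection.
  obtain ⟨ψ, hψ, hψc, hψs, hψ1⟩ := exists_contDiff_bump hK0 (chartAt 𝔼 c).open_target hK0c
  obtain ⟨S, hS, hSc, hKS⟩ := F.exists_isCompact_unitVectors hψc hψs
  obtain ⟨χ, hχ, hχc, hχs, hχ1⟩ := exists_contDiff_bump hS (isOpen_slitSet (chartAt 𝔼 c).open_target) hSc
  obtain ⟨V, hV, hSV, hV1⟩ := eventually_nhdsSet_iff_exists.1 hχ1
  have hVc : V ⊆ slitSet (chartAt 𝔼 c).target := fun q hq => hχs (subset_tsupport _ (by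
    rw [Function.mem_support, hV1 q hq]
    exact one_ne_zero))
  have hzero : ∀ (f : 𝔼 → 𝔼), ∀ x ∉ tsupport ψ, (ψ • f) x = 0 := fun f x hx => by
    rw [Pi.smul_apply', image_eq_zero_of_notMem_tsupport hx, zero_smul]
  let D : LoopData 𝔼 :=
    { N := χ • sprayConnection (F.geodesicVector c)
      u := ψ • X.inChart c
      w := ψ • Y.inChart c
      a := fun s => s - s ^ 2
      b := fun s => s ^ 2 - s ^ 3
      contDiff_N := contDiff_smul_of_tsupport_subset (isOpen_slitSet (chartAt 𝔼 c).open_target) hχ hχs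
        ((F.isFinslerEnergy_energy c).contDiffOn_sprayConnection (F.isSpray_geodesicVector c))
      contDiff_u := contDiff_smul_of_tsupport_subset (chartAt 𝔼 c).open_target hψ hψs
        (X.contDiffOn_inChart c)
      contDiff_w := contDiff_smul_of_tsupport_subset (chartAt 𝔼 c).open_target hψ hψs
        (Y.contDiffOn_inChart c)
      contDiff_a := by fun_prop
      contDiff_b := by fun_prop
      hasCompactSupport_N := hχc.smul_right
      hasCompactSupport_u := hψc.smul_right
      hasCompactSupport_w := hψc.smul_right }
  have hN : ∀ q ∈ V, D.N q = sprayConnection (F.geodesicVector c) q := fun q hq => by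
    change χ q • sprayConnection (F.geodesicVector c) q = _
    rw [hV1 q hq, one_smul]
  obtain ⟨ε₁, hε₁, Z, hZ⟩ := F.exists_isLoopTransport D hψc hψs (hzero _) (hzero _) hS hV hSV hVc hKS
    hN (fun x => by simp [LoopData.displacement, D]) (fun x => by simp [LoopData.displacement, D])
  obtain ⟨ε₂, hε₂, Z', hZ'⟩ := F.exists_isLoopTransport D.reverse hψc hψs (hzero _) (hzero _) hS hV hSV
    hVc hKS hN (fun x => by simp [LoopData.displacement, LoopData.reverse, D])
    (fun x => by simp [LoopData.displacement, LoopData.reverse, D])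
  refine (hZ.mono (min_le_left ε₁ ε₂)).isTangentOfOrder (hZ'.mono (min_le_right ε₁ ε₂))
    (lt_min hε₁ hε₂) rfl rfl (fun v hv => ?_) fun v hv => ?_
  · set q := F.chartCoord c v with hq
    have hqc := F.chartCoord_mem hv
    by_cases hvK : v.incl.1 ∈ K
    · have hx1 : ψ q.1 = 1 := hψ1.self_of_nhdsSet _ ⟨_, hvK, rfl⟩
      have hqV : q ∈ V := hSV (hKS q.1 (subset_tsupport _ (by
        rw [Function.mem_support, hx1]
        exact one_ne_zero)) q.2 (F.chartNorm_chartCoord hv))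
      have eu : D.u q.1 = X.inChart c q.1 := by
        change ψ q.1 • X.inChart c q.1 = _
        rw [hx1, one_smul]
      have ew : D.w q.1 = Y.inChart c q.1 := by
        change ψ q.1 • Y.inChart c q.1 = _
        rw [hx1, one_smul]
      have ed : fderiv ℝ D.N q = fderiv ℝ (sprayConnection (F.geodesicVector c)) q :=
        Filter.EventuallyEq.fderiv_eq (by filter_upwards [hV.mem_nhds hqV] with r hr using hN r hr)
      rw [D.horizontalDeriv_apply, D.horizontalDeriv_apply, eu, ew, ed, hN q hqV]
      rfl
    · have hx0 : X.inChart c q.1 = 0 := by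
        refine inChart_eq_zero ?_
        have e := F.chartAt_symm_chartCoord_fst hv
        rw [e]
        exact hX _ hvK
      have eu : D.u q.1 = 0 := by
        change ψ q.1 • X.inChart c q.1 = _
        rw [hx0, smul_zero]
      have e0 : F.curvatureCoord c X Y q = 0 := by
        have h1 := sprayCurvature_smul_left (F.geodesicVector c) q 0 0 (Y.inChart c q.1)
        rw [zero_smul, zero_smul] at h1
        rw [curvatureCoord, hx0, h1]
      rw [eu, e0]
      simp
  · have h1 := F.curvatureVector_smul (X := X) (X' := X) (Y := Y) (v := v) (a := 0)
      ((hX _ fun h => hv (hKc h)).trans (zero_smul ℝ (X v.incl.1)).symm)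
    rwa [zero_smul] at h1

/-- Curvature vector fields are tangent to the fibered holonomy group. -/
theorem curvatureField_mem [T2Space M] [CompactSpace M] (X Y : SmoothVectorField (𝓡 n) M) :
    F.curvatureField X Y ∈ tangentLieSubalgebra F.fiberedHolonomyGroup := by
  -- Cutting X alone is enough: one of the two fields supported in a chart domain suffices for the
  -- local result.
  obtain ⟨ρ, hρ⟩ := SmoothPartitionOfUnity.exists_isSubordinate_chartAt_source (𝓡 n) M
  let X' : M → SmoothVectorField (𝓡 n) M := fun i =>
    ⟨fun p => ρ i p • X p, (ρ i).contMDiff.smul_section X.contMDiff⟩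
  have hX' : ∀ i, F.curvatureField (X' i) Y ∈ tangentLieSubalgebra F.fiberedHolonomyGroup := fun i => by
    rw [mem_tangentLieSubalgebra, isTangentToSubgroup_iff]
    refine ⟨2, by norm_num, F.isTangentOfOrder_curvatureField Y (c := i) (K := tsupport (ρ i))
      (isClosed_tsupport _).isCompact (hρ i) fun p hp => ?_⟩
    change ρ i p • X p = 0
    rw [image_eq_zero_of_notMem_tsupport hp, zero_smul]
  -- By compactness the decomposition of X is a finite sum, as closure under addition requires.
  have hfin : {i | (Function.support (ρ i)).Nonempty}.Finite :=
    ρ.locallyFinite.finite_nonempty_of_compact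
  have hsum : F.curvatureField X Y = ∑ i ∈ hfin.toFinset, F.curvatureField (X' i) Y := by
    refine ContMDiffSection.ext fun v => ?_
    have h1 : (∑ i ∈ hfin.toFinset, F.curvatureField (X' i) Y) v =
        ∑ i ∈ hfin.toFinset, F.curvatureField (X' i) Y v := by
      have h2 := map_sum (ContMDiffSection.coeAddHom 𝓘(ℝ, 𝔹) 𝔹 ∞
        (TangentSpace 𝓘(ℝ, 𝔹) : F.IndicatrixBundle → Type)) (fun i => F.curvatureField (X' i) Y) hfin.toFinset
      exact (congrFun h2 v).trans (Finset.sum_apply _ _ _)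
    rw [h1]
    have h3 : ∀ i, F.curvatureVector (X' i) Y v = ρ i v.incl.1 • F.curvatureVector X Y v :=
      fun i => F.curvatureVector_smul rfl
    have h4 : ∑ i ∈ hfin.toFinset, F.curvatureVector (X' i) Y v = F.curvatureVector X Y v := by
      simp_rw [h3]
      rw [← Finset.sum_smul, ← finsum_eq_sum_of_support_subset, ρ.sum_eq_one (mem_univ _), one_smul]
      intro i hi
      exact hfin.mem_toFinset.2 ⟨_, hi⟩
    exact h4.symm
  rw [hsum]
  exact Submodule.sum_mem (tangentLieSubalgebra F.fiberedHolonomyGroup).toSubmodule fun i _ => hX' i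

end FinslerMetric

theorem mainTheorem4 (n : ℕ) (M : Type*) [TopologicalSpace M]
    [ChartedSpace (EuclideanSpace ℝ (Fin n)) M] [IsManifold (𝓡 n) ∞ M] [T2Space M]
    [CompactSpace M] (F : FinslerMetric n M) :
    (∀ X Y : SmoothVectorField (𝓡 n) M, ∃! ξ : F.IndicatrixVectorField,
      F.IsCurvatureField X Y ξ) ∧
    (∀ ξ ∈ F.curvatureAlgebra, IsTangentToSubgroup F.fiberedHolonomyGroup ξ) ∧
    ∃ hol : LieSubalgebra ℝ F.IndicatrixVectorField,
      (hol : Set F.IndicatrixVectorField) = F.fiberedHolonomyAlgebra ∧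
      F.curvatureAlgebra ≤ hol := by
  -- The tangent fields form a Lie algebra, so it is enough to check the generators.
  have h : F.curvatureAlgebra ≤ tangentLieSubalgebra F.fiberedHolonomyGroup := by
    refine LieSubalgebra.lieSpan_le.2 ?_
    rintro ξ ⟨X, Y, hξ⟩
    rw [(F.isCurvatureField_iff_eq X Y ξ).1 hξ]
    exact F.curvatureField_mem X Y
  refine ⟨fun X Y => ⟨F.curvatureField X Y, (F.isCurvatureField_iff_eq X Y _).2 rfl,
    fun ξ hξ => (F.isCurvatureField_iff_eq X Y ξ).1 hξ⟩,
    fun ξ hξ => mem_tangentLieSubalgebra.1 (h hξ),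
    tangentLieSubalgebra F.fiberedHolonomyGroup, ?_, h⟩
  ext ξ
  exact mem_tangentLieSubalgebra
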